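/- **Theorem (Cheng–Yau type gradient estimate).** Let $n\ge 2$. There are a constant $C_1(n)$, depending only on $n$, and for every $H\ge 0$ a constant $C_2(n,H)$, depending only on $n$ and $H$, such that the following holds. Let $M^n$ be a closed smooth manifold (compact, Hausdorff, without boundary), $S\subset M$ a closed (possibly empty) embedded submanifold of positive codimension, whose components may have different dimensions, and $\Omega:=M\setminus S$. Let $g$ be a uniformly Euclidean metric on $M$ that is smooth away from $S$: $g$ is a symmetric $2$-tensor that is smooth on $\Omega$, and there are a smooth Riemannian metric $\bar g$ on $M$ and $\Lambda>0$ with $\Lambda^{-1}\bar g\le g\le\Lambda\bar g$ on $\Omega$. Let $d_g(x,y)\in[0,\infty]$ be the infimum of the lengths $\int_a^b|\gamma'(t)|_g\,dt$ over all piecewise $C^1$ curves $\gamma:[a,b]\to M$ from $x$ to $y$ whose image meets $S$ in only finitely many points, and let $B(q,\rho)=\{x\in M: d_g(q,x)\le\rho\}$. Let $q\in M$, $r>0$ and $H\ge 0$ be such that $B(q,2r)\subset\Omega$ and $\mathrm{Ric}_g\ge-(n-1)H^2$ on $B(q,2r)$. Let $u$ be a function that is positive on $B(q,2r)$ and of class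 $C^3$ on $\{x: d_g(q,x)<2r\}$, let $K$ be a real function that is differentiable at every value $u(x)$, $x\in B(q,2r)$, and suppose that $\Delta u=K(u)$ on $\{x: d_g(q,x)<2r\}$, where $\Delta$ is the Laplace–Beltrami operator (the trace of the Hessian) of $g$. Then for every $x\in B(q,r)$ $$\frac{|\nabla u(x)|}{u(x)}\le\max\Big\{\sup_{B(q,2r)}\Big(\frac{|K(u)|}{u}\Big)^{1/2},\ (n-1)H+C_1(n)\,r^{-1}+C_2(n,H)\,r^{-1/2}+\sup_{B(q,2r)}\Big[(n-1)\Big|K'(u)-\frac{n+1}{n-1}\frac{K(u)}{u}\Big|\Big]^{1/2}\Big\},$$ where the suprema are taken in $[0,\infty]$. -/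

import Mathlib

open scoped Manifold ContDiff

noncomputable section

namespace SingularMetric

/-! ### Riemannian geometry of a metric tensor in coordinates -/

section Coordinates

variable {n : ℕ}

/-- The partial derivative `∂ᵢ f` at `y`. -/
def partialDeriv (i : Fin n) (f : EuclideanSpace ℝ (Fin n) → ℝ)
    (y : EuclideanSpace ℝ (Fin n)) : ℝ :=
  fderiv ℝ f y (EuclideanSpace.single i 1)

/-- The Christoffel symbol `Γᵏᵢⱼ = ½ ∑ₗ Gᵏˡ (∂ᵢ Gⱼₗ + ∂ⱼ Gᵢₗ - ∂ₗ Gᵢⱼ)`. -/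
def christoffel (G : EuclideanSpace ℝ (Fin n) → Matrix (Fin n) (Fin n) ℝ) (k i j : Fin n)
    (y : EuclideanSpace ℝ (Fin n)) : ℝ :=
  (1 / 2) * ∑ l, (G y)⁻¹ k l *
    (partialDeriv i (fun z => G z j l) y + partialDeriv j (fun z => G z i l) y
      - partialDeriv l (fun z => G z i j) y)

/-- The Ricci tensor
`Rᵢⱼ = ∂ₖ Γᵏᵢⱼ - ∂ⱼ Γᵏᵢₖ + Γᵏₖₗ Γˡᵢⱼ - Γᵏⱼₗ Γˡᵢₖ` (summed over `k` and `l`);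
the round sphere has positive Ricci tensor. -/
def ricciCoord (G : EuclideanSpace ℝ (Fin n) → Matrix (Fin n) (Fin n) ℝ) (i j : Fin n)
    (y : EuclideanSpace ℝ (Fin n)) : ℝ :=
  ∑ k, (partialDeriv k (christoffel G k i j) y - partialDeriv j (christoffel G k i k) y)
    + ∑ k, ∑ l, (christoffel G k k l y * christoffel G l i j y
      - christoffel G k j l y * christoffel G l i k y)

/-- The Laplace-Beltrami operator `Gⁱʲ (∂ᵢ ∂ⱼ f - Γᵏᵢⱼ ∂ₖ f)` (the trace of the Hessian). -/
def laplacianCoord (G : EuclideanSpace ℝ (Fin n) → Matrix (Fin n) (Fin n) ℝ)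
    (f : EuclideanSpace ℝ (Fin n) → ℝ) (y : EuclideanSpace ℝ (Fin n)) : ℝ :=
  ∑ i, ∑ j, (G y)⁻¹ i j *
    (partialDeriv i (partialDeriv j f) y - ∑ k, christoffel G k i j y * partialDeriv k f y)

end Coordinates

/-! ### Uniformly Euclidean metrics on a closed manifold -/

section Manifold

variable {n : ℕ} {M : Type*} [TopologicalSpace M] [ChartedSpace (EuclideanSpace ℝ (Fin n)) M]

/-- `S` is an embedded submanifold of positive codimension: near each of its points, `S` is cut out
in some smooth chart by the vanishing of the coordinates of index at least `k`, with `k < n` (the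
dimension `k` may differ from one component of `S` to another). -/
def IsEmbeddedSubmanifold (n : ℕ) {M : Type*} [TopologicalSpace M]
    [ChartedSpace (EuclideanSpace ℝ (Fin n)) M] (S : Set M) : Prop :=
  ∀ p ∈ S, ∃ k < n, ∃ e ∈ IsManifold.maximalAtlas (𝓡 n) ∞ M, p ∈ e.source ∧
    ∀ x ∈ e.source, (x ∈ S ↔ ∀ i : Fin n, k ≤ (i : ℕ) → e x i = 0)

/-- A field of bilinear forms on the tangent spaces of `M`. -/
abbrev BilinField (n : ℕ) (M : Type*) [TopologicalSpace M]
    [ChartedSpace (EuclideanSpace ℝ (Fin n)) M] : Type _ :=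
  ∀ x : M, TangentSpace (𝓡 n) x →L[ℝ] TangentSpace (𝓡 n) x →L[ℝ] ℝ

/-- `g` is a uniformly Euclidean metric on `M` that is smooth away from `S`: a symmetric
`2`-tensor, smooth on the complement of `S`, and comparable there to a smooth Riemannian metric
`gbar` of the whole of `M`. The values of `g` on `S` (a null set) play no role. -/
structure IsUniformlyEuclidean [IsManifold (𝓡 n) ∞ M] (g : BilinField n M) (S : Set M) :
    Prop where
  symm : ∀ x ∉ S, ∀ v w : TangentSpace (𝓡 n) x, g x v w = g x w v
  smooth : ContMDiffOn (𝓡 n)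
    ((𝓡 n).prod 𝓘(ℝ, EuclideanSpace ℝ (Fin n) →L[ℝ] EuclideanSpace ℝ (Fin n) →L[ℝ] ℝ)) ∞
    (fun x => Bundle.TotalSpace.mk'
      (E := fun x : M => TangentSpace (𝓡 n) x →L[ℝ] TangentSpace (𝓡 n) x →L[ℝ] ℝ)
      (EuclideanSpace ℝ (Fin n) →L[ℝ] EuclideanSpace ℝ (Fin n) →L[ℝ] ℝ) x (g x)) Sᶜ
  comparable : ∃ (gbar : Bundle.ContMDiffRiemannianMetric (𝓡 n) ∞ (EuclideanSpace ℝ (Fin n))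
      (fun x : M => TangentSpace (𝓡 n) x)) (Λ : ℝ), 0 < Λ ∧
    ∀ x ∉ S, ∀ v : TangentSpace (𝓡 n) x,
      Λ⁻¹ * gbar.inner x v v ≤ g x v v ∧ g x v v ≤ Λ * gbar.inner x v v

/-- The curve `γ : [a, b] → M` is piecewise `C¹`. -/
def IsPiecewiseC1 (n : ℕ) {M : Type*} [TopologicalSpace M]
    [ChartedSpace (EuclideanSpace ℝ (Fin n)) M] (γ : ℝ → M) (a b : ℝ) : Prop :=
  ∃ (m : ℕ) (t : Fin (m + 1) → ℝ), Monotone t ∧ t 0 = a ∧ t (Fin.last m) = b ∧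
    ∀ i : Fin m, ContMDiffOn 𝓘(ℝ, ℝ) (𝓡 n) 1 γ (Set.Icc (t i.castSucc) (t i.succ))

/-- The length `∫ₐᵇ |γ'(t)|_g dt`. -/
def curveLength (g : BilinField n M) (γ : ℝ → M) (a b : ℝ) : ENNReal :=
  ∫⁻ t in Set.Icc a b, ENNReal.ofReal (Real.sqrt
    (g (γ t) (mfderivWithin 𝓘(ℝ, ℝ) (𝓡 n) γ (Set.Icc a b) t (1 : ℝ))
      (mfderivWithin 𝓘(ℝ, ℝ) (𝓡 n) γ (Set.Icc a b) t (1 : ℝ))))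

/-- The distance `d_g(x, y)`: the infimum of the lengths of the admissible curves from `x` to `y`,
the piecewise `C¹` curves whose image meets `S` in finitely many points. -/
def dist (g : BilinField n M) (S : Set M) (x y : M) : ENNReal :=
  sInf {L | ∃ (a b : ℝ) (γ : ℝ → M), a ≤ b ∧ IsPiecewiseC1 n γ a b ∧
    (γ '' Set.Icc a b ∩ S).Finite ∧ γ a = x ∧ γ b = y ∧ L = curveLength g γ a b}

/-- The closed ball of radius `r` about `q`. -/
def closedBall (g : BilinField n M) (S : Set M) (q : M) (r : ℝ) : Set M :=
  {x | dist g S q x ≤ ENNReal.ofReal r}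

/-- The open ball of radius `r` about `q`. -/
def openBall (g : BilinField n M) (S : Set M) (q : M) (r : ℝ) : Set M :=
  {x | dist g S q x < ENNReal.ofReal r}

/-- The matrix `gᵢⱼ = g(∂ᵢ, ∂ⱼ)` of `g` in the chart `e`, as a function of the coordinates. -/
def metricInChart (g : BilinField n M) (e : OpenPartialHomeomorph M (EuclideanSpace ℝ (Fin n)))
    (y : EuclideanSpace ℝ (Fin n)) : Matrix (Fin n) (Fin n) ℝ :=
  Matrix.of fun i j => g (e.symm y)
    (mfderiv 𝓘(ℝ, EuclideanSpace ℝ (Fin n)) (𝓡 n) e.symm y (EuclideanSpace.single i (1 : ℝ)))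
    (mfderiv 𝓘(ℝ, EuclideanSpace ℝ (Fin n)) (𝓡 n) e.symm y (EuclideanSpace.single j (1 : ℝ)))

/-- `Δ_g u = f` at the point `x`, read in the smooth charts around `x`; the value of the
Laplace-Beltrami operator does not depend on the chart. -/
def LaplacianEqAt (g : BilinField n M) (u : M → ℝ) (f : ℝ) (x : M) : Prop :=
  ∀ e ∈ IsManifold.maximalAtlas (𝓡 n) ∞ M, x ∈ e.source →
    laplacianCoord (metricInChart g e) (u ∘ e.symm) (e x) = f

/-- `Ric_g ≥ κ g` at the point `x`, read in the smooth charts around `x`; since both sides are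
tensors, the inequality does not depend on the chart. -/
def RicciGeAt (g : BilinField n M) (κ : ℝ) (x : M) : Prop :=
  ∀ e ∈ IsManifold.maximalAtlas (𝓡 n) ∞ M, x ∈ e.source → ∀ v : Fin n → ℝ,
    κ * ∑ i, ∑ j, metricInChart g e (e x) i j * v i * v j
      ≤ ∑ i, ∑ j, ricciCoord (metricInChart g e) i j (e x) * v i * v j

open Classical in
/-- The gradient of `u` at `x`, the vector `w` with `g(w, v) = du(v)` for all `v`
(and `0` if there is none, which does not happen for a positive definite form). -/
def gradient (g : BilinField n M) (u : M → ℝ) (x : M) : TangentSpace (𝓡 n) x :=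
  if h : ∃ w : TangentSpace (𝓡 n) x, ∀ v : TangentSpace (𝓡 n) x,
      g x w v = (show ℝ from mfderiv (𝓡 n) 𝓘(ℝ, ℝ) u x v) then h.choose else 0

/-- The norm `|∇u|_g` at `x`. -/
def gradNorm (g : BilinField n M) (u : M → ℝ) (x : M) : ℝ :=
  Real.sqrt (g x (gradient g u x) (gradient g u x))

/-- Where `g` is positive definite, the gradient is what it should be. -/
theorem gradient_spec (g : BilinField n M) (u : M → ℝ) (x : M)
    (hpos : ∀ v : TangentSpace (𝓡 n) x, v ≠ 0 → 0 < g x v v) (v : TangentSpace (𝓡 n) x) :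
    g x (gradient g u x) v = (show ℝ from mfderiv (𝓡 n) 𝓘(ℝ, ℝ) u x v) := by
  have h : ∃ w : TangentSpace (𝓡 n) x, ∀ v : TangentSpace (𝓡 n) x,
      g x w v = (show ℝ from mfderiv (𝓡 n) 𝓘(ℝ, ℝ) u x v) := by
    let E := EuclideanSpace ℝ (Fin n)
    let B : E →ₗ[ℝ] (E →L[ℝ] ℝ) := (show E →L[ℝ] E →L[ℝ] ℝ from g x).toLinearMap
    have hinj : Function.Injective B := by
      rw [injective_iff_map_eq_zero]
      intro w hw
      by_contra hne
      have h1 := hpos w hne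
      have h2 : g x w w = 0 := congrArg (fun f : E →L[ℝ] ℝ => f w) hw
      exact absurd h2 h1.ne'
    have hdim : Module.finrank ℝ E = Module.finrank ℝ (E →L[ℝ] ℝ) := by
      rw [← LinearEquiv.finrank_eq (LinearMap.toContinuousLinearMap (𝕜 := ℝ) (E := E) (F' := ℝ))]
      exact (Subspace.dual_finrank_eq (K := ℝ) (V := E)).symm
    obtain ⟨w, hw⟩ := (LinearMap.injective_iff_surjective_of_finrank_eq_finrank hdim).1 hinj
      (show E →L[ℝ] ℝ from mfderiv (𝓡 n) 𝓘(ℝ, ℝ) u x)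
    exact ⟨w, fun v => congrArg (fun f : E →L[ℝ] ℝ => f v) hw⟩
  rw [gradient, dif_pos h]
  exact h.choose_spec v

end Manifold

end SingularMetric

end

/-! Put v = log u and f = |∇v|² = (|∇u| / u)². The equation becomes Δv + f = K(u)/u, and the
gradient of its right-hand side is (K'(u) - K(u)/u)∇v. Let t be the Hessian of v in the direction of
∇v/|∇v|. The trace of the Hessian is k - f with k = K(u)/u, so its squared norm is at least t² + (k
- f - t)²/(n-1). Bochner's formula then gives ½Δf ≥ f²/(n-1) - 2(n-2)/(n-1)·t f - ((n-1)H² + |K'(u)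
- (n+1)/(n-1)·K(u)/u|) f. The expansion leaves the squares t² + (k-t)²/(n-1), which are dropped; no
sign of K enters, and the second entry of the maximum is a bound in every case.

Next multiply f by the square of a radial cutoff Z of d_g(q, ·), equal to 1 on B(q, r) and 0 at
distance 3r/2, and look at a maximum point. There the first-order condition controls Z t by √f, and
the second-order condition becomes a quadratic inequality for Z√f, whose solution has the stated
form. Both conditions are read off ray by ray along an orthonormal frame, using a lower barrier for
f (`exists_gradient_barrier`, from `IsMetricOn.bochner` and `sum_second_jet_ge`) and an upper
barrier for the distance. The distance need not be differentiable: a one-sided barrier is enough for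
the maximum principle. This is carried out in `estimate_at_max` and `gradient_estimate`.

The upper barrier is the Laplacian comparison theorem, `exists_distance_barrier`: along a frame F at
x, d_g(q, ·) is at most ρ + s aᵢ + s²/2·(Bᵢ + η), with |a| ≤ 1 and ∑ Bᵢ ≤ n/c + κc. It comes from
the second variation along the last piece, of length c, of a shortest path, but with no geodesics,
exponential map or ordinary differential equations. A closed ball that avoids S is compact: a point
of S is joined to nearby points off S by coordinate segments that meet S only at the end
(`eventually_dist_le`, `isClosed_closedBall`). Compactness gives points at prescribed distances
(`exists_between`), hence equally spaced chains of arbitrarily fine mesh (`exists_chain`,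
`exists_fine_chain`).

Along such a chain a frame is carried by a discrete parallel transport, and each point is moved
along a quadratic approximation of a geodesic, with a factor growing linearly from 0 to 1. The
chords between moved points have lengths governed by `IsMetricOn.second_variation`, uniformly in the
mesh (`IsMetricOn.exists_step_bound`, `exists_discrete_variation`). The range of s does not shrink
with the mesh, so a limit along an ultrafilter gives a clean second-order bound
(`exists_limit_variation`); this is rewritten in normal charts and glued over finitely many steps
(`HasSecondVariation.chain`). -/

noncomputable section

namespace SingularMetric

set_option maxSynthPendingDepth 3
set_option linter.unusedSectionVars false

open Set MeasureTheory Filter Topology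

/-! ### Admissible curves, their lengths and the triangle inequality -/

section Curves

variable {n : ℕ} {M : Type*} [TopologicalSpace M] [ChartedSpace (EuclideanSpace ℝ (Fin n)) M]

/-- The speed `|γ'(t)|_g`. -/
def speed (g : BilinField n M) (γ : ℝ → M) (t : ℝ) : ℝ :=
  Real.sqrt (g (γ t) (mfderiv 𝓘(ℝ, ℝ) (𝓡 n) γ t (1 : ℝ)) (mfderiv 𝓘(ℝ, ℝ) (𝓡 n) γ t (1 : ℝ)))

/-- The end points are a null set, and inside the interval the derivative within it is the ordinary
one. The integrand thus no longer depends on the interval, which makes length local, additive and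
translation invariant. -/
theorem curveLength_eq_Ioo (g : BilinField n M) (γ : ℝ → M) (a b : ℝ) :
    curveLength g γ a b = ∫⁻ t in Ioo a b, ENNReal.ofReal (speed g γ t) := by
  rw [curveLength, ← restrict_Ioo_eq_restrict_Icc]
  apply setLIntegral_congr_fun measurableSet_Ioo (fun t ht => ?_)
  simp only [speed]
  rw [mfderivWithin_of_mem_nhds (Icc_mem_nhds ht.1 ht.2)]

theorem curveLength_congr (g : BilinField n M) {γ γ' : ℝ → M} {a b : ℝ}
    (h : EqOn γ γ' (Icc a b)) : curveLength g γ a b = curveLength g γ' a b := by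
  simp only [curveLength_eq_Ioo]
  apply setLIntegral_congr_fun measurableSet_Ioo (fun t ht => ?_)
  have h1 : γ =ᶠ[𝓝 t] γ' := by
    filter_upwards [Icc_mem_nhds ht.1 ht.2] with s hs using h hs
  have h2 : mfderiv 𝓘(ℝ, ℝ) (𝓡 n) γ t (1 : ℝ) = mfderiv 𝓘(ℝ, ℝ) (𝓡 n) γ' t (1 : ℝ) :=
    congrArg (fun L : ℝ →L[ℝ] EuclideanSpace ℝ (Fin n) => L 1) (h1.mfderiv_eq)
  simp only [speed]
  rw [h2, h1.eq_of_nhds]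

theorem curveLength_add (g : BilinField n M) (γ : ℝ → M) {a b c : ℝ} (h : a ≤ b) (h' : b ≤ c) :
    curveLength g γ a b + curveLength g γ b c = curveLength g γ a c := by
  simp only [curveLength_eq_Ioo, restrict_Ioo_eq_restrict_Icc]
  symm
  have : Icc a c = Icc a b ∪ Ioc b c := (Icc_union_Ioc_eq_Icc h h').symm
  rw [this, lintegral_union measurableSet_Ioc]; swap
  · exact disjoint_iff_forall_ne.mpr (fun a ha b hb ↦ (ha.2.trans_lt hb.1).ne)
  simp [restrict_Ioc_eq_restrict_Icc]

theorem speed_comp_add_const (g : BilinField n M) (γ : ℝ → M) (d t : ℝ) :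
    speed g (fun s => γ (s + d)) t = speed g γ (t + d) := by
  have key : mfderiv 𝓘(ℝ, ℝ) (𝓡 n) (fun s => γ (s + d)) t (1 : ℝ)
      = mfderiv 𝓘(ℝ, ℝ) (𝓡 n) γ (t + d) (1 : ℝ) := by
    have h1 : ∀ (d t : ℝ), HasMFDerivAt 𝓘(ℝ, ℝ) 𝓘(ℝ, ℝ) (fun s : ℝ => s + d) t
        (ContinuousLinearMap.id ℝ ℝ) :=
      fun d t => ((hasFDerivAt_id t).add_const d).hasMFDerivAt
    by_cases hγ : MDifferentiableAt 𝓘(ℝ, ℝ) (𝓡 n) γ (t + d)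
    · have h2 := hγ.hasMFDerivAt.comp t (h1 d t)
      exact congrArg (fun L : ℝ →L[ℝ] EuclideanSpace ℝ (Fin n) => L 1) h2.mfderiv
    · have h3 : ¬ MDifferentiableAt 𝓘(ℝ, ℝ) (𝓡 n) (fun s => γ (s + d)) t := by
        intro h4
        apply hγ
        have h4' : MDifferentiableAt 𝓘(ℝ, ℝ) (𝓡 n) (fun s => γ (s + d)) (t + d + -d) := by
          simpa using h4
        have h5 := h4'.comp (t + d) (h1 (-d) (t + d)).mdifferentiableAt
        simpa [Function.comp_def] using h5
      rw [mfderiv_zero_of_not_mdifferentiableAt hγ, mfderiv_zero_of_not_mdifferentiableAt h3]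
      rfl
  simp only [speed]
  rw [key]

theorem curveLength_comp_add_const (g : BilinField n M) (γ : ℝ → M) (a b d : ℝ) :
    curveLength g (fun s => γ (s + d)) (a - d) (b - d) = curveLength g γ a b := by
  simp only [curveLength_eq_Ioo, speed_comp_add_const]
  have h := (measurePreserving_add_right (volume : Measure ℝ) d).setLIntegral_comp_preimage_emb
    (measurableEmbedding_addRight d) (fun t => ENNReal.ofReal (speed g γ t)) (Ioo a b)
  rw [← h]
  congr 2
  ext x
  simp

theorem contMDiffOn_singleton_real (γ : ℝ → M) (τ : ℝ) :
    ContMDiffOn 𝓘(ℝ, ℝ) (𝓡 n) 1 γ {τ} := by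
  rintro x rfl
  rw [contMDiffWithinAt_iff]
  exact ⟨continuousWithinAt_singleton, by
    simpa [chartAt_self_eq] using contDiffWithinAt_singleton⟩

theorem IsPiecewiseC1.mono {γ : ℝ → M} {a b c d : ℝ} (h : IsPiecewiseC1 n γ a b)
    (hac : a ≤ c) (hcd : c ≤ d) (hdb : d ≤ b) : IsPiecewiseC1 n γ c d := by
  obtain ⟨m, t, ht, h0, hm, hC⟩ := h
  -- Clamping the partition points to [c, d] keeps their number. Pieces outside [c, d] collapse to a
  -- point, where being C¹ is no condition.
  refine ⟨m, fun i => min (max (t i) c) d, ?_, ?_, ?_, ?_⟩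
  · intro i j hij
    exact min_le_min_right _ (max_le_max_right _ (ht hij))
  · simp [h0, hac, hcd]
  · simp [hm, hdb, hcd.trans hdb]
  · intro i
    by_cases h1 : t i.succ ≤ c
    · have h2 : t i.castSucc ≤ c := (ht (Fin.castSucc_le_succ i)).trans h1
      simpa only [h1, h2, max_eq_right, hcd, min_eq_left, Icc_self] using
        contMDiffOn_singleton_real γ c
    by_cases h3 : d ≤ t i.castSucc
    · have h2 : d ≤ t i.succ := h3.trans (ht (Fin.castSucc_le_succ i))
      have h4 : min (max (t i.castSucc) c) d = d := min_eq_right (le_max_of_le_left h3)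
      have h5 : min (max (t i.succ) c) d = d := min_eq_right (le_max_of_le_left h2)
      simpa only [h4, h5, Icc_self] using contMDiffOn_singleton_real γ d
    · apply (hC i).mono
      push Not at h1 h3
      apply Icc_subset_Icc
      · exact le_min (le_max_left _ _) h3.le
      · exact (min_le_left _ _).trans (max_le le_rfl h1.le)

theorem IsPiecewiseC1.refl (γ : ℝ → M) (a : ℝ) : IsPiecewiseC1 n γ a a :=
  ⟨0, fun _ => a, fun _ _ _ => le_rfl, rfl, rfl, fun i => i.elim0⟩

theorem IsPiecewiseC1.congr {γ γ' : ℝ → M} {a b : ℝ} (h : IsPiecewiseC1 n γ a b)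
    (hγ : EqOn γ' γ (Icc a b)) : IsPiecewiseC1 n γ' a b := by
  obtain ⟨m, t, ht, h0, hm, hC⟩ := h
  refine ⟨m, t, ht, h0, hm, fun i => (hC i).congr fun x hx => hγ ?_⟩
  exact Icc_subset_Icc (h0 ▸ ht (Fin.zero_le _)) (hm ▸ ht (Fin.le_last _)) hx

theorem IsPiecewiseC1.comp_add_const {γ : ℝ → M} {a b : ℝ} (h : IsPiecewiseC1 n γ a b) (d : ℝ) :
    IsPiecewiseC1 n (fun s => γ (s + d)) (a - d) (b - d) := by
  obtain ⟨m, t, ht, h0, hm, hC⟩ := h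
  refine ⟨m, fun i => t i - d, fun i j hij => sub_le_sub_right (ht hij) d, by simp [h0],
    by simp [hm], fun i => ?_⟩
  have h1 : ContMDiff 𝓘(ℝ, ℝ) 𝓘(ℝ, ℝ) 1 (fun s : ℝ => s + d) :=
    (contDiff_id.add contDiff_const).contMDiff
  refine (hC i).comp h1.contMDiffOn fun s hs => ?_
  exact ⟨by linarith [hs.1], by linarith [hs.2]⟩

/-- Induction along the pieces of a piecewise `C¹` curve. -/
theorem IsPiecewiseC1.induction {γ : ℝ → M} {a b : ℝ} (h : IsPiecewiseC1 n γ a b)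
    {P : ℝ → ℝ → Prop} (refl : P a a)
    (trans : ∀ s t, a ≤ s → s ≤ t → t ≤ b → P a s → P s t → P a t)
    (piece : ∀ s t, a ≤ s → s ≤ t → t ≤ b → ContMDiffOn 𝓘(ℝ, ℝ) (𝓡 n) 1 γ (Icc s t) → P s t) :
    P a b := by
  obtain ⟨m, t, ht, h0, hm, hC⟩ := h
  have key : ∀ i : Fin (m + 1), P a (t i) := by
    intro i
    induction i using Fin.induction with
    | zero => rw [h0]; exact refl
    | succ i ih =>
      have h1 : a ≤ t i.castSucc := h0 ▸ ht (Fin.zero_le _)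
      have h2 : t i.castSucc ≤ t i.succ := ht (Fin.castSucc_le_succ i)
      have h3 : t i.succ ≤ b := hm ▸ ht (Fin.le_last _)
      exact trans _ _ h1 h2 h3 ih (piece _ _ h1 h2 h3 (hC i))
  exact hm ▸ key (Fin.last m)

/-- Induction along the second curve: each of its pieces appends one partition point to the
subdivision already obtained. -/
theorem IsPiecewiseC1.trans {γ : ℝ → M} {a b c : ℝ} (h : IsPiecewiseC1 n γ a b)
    (h' : IsPiecewiseC1 n γ b c) : IsPiecewiseC1 n γ a c := by
  refine h'.induction (P := fun s t => IsPiecewiseC1 n γ a s → IsPiecewiseC1 n γ a t) id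
    (fun s t _ _ _ h1 h2 h3 => h2 (h1 h3)) ?_ h
  rintro s t hs hst ht hC ⟨m, u, hu, h0, hm, hu'⟩
  refine ⟨m + 1, Fin.snoc u t, ?_, ?_, by simp, ?_⟩
  · rw [Fin.monotone_iff_le_succ]
    intro i
    induction i using Fin.lastCases with
    | last => simp [hm, hst]
    | cast j =>
      rw [Fin.snoc_castSucc, ← Fin.castSucc_succ, Fin.snoc_castSucc]
      exact hu (Fin.castSucc_le_succ j)
  · have : (0 : Fin (m + 1 + 1)) = Fin.castSucc 0 := rfl
    rw [this, Fin.snoc_castSucc, h0]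
  · intro i
    induction i using Fin.lastCases with
    | last => simpa [hm] using hC
    | cast j =>
      rw [Fin.snoc_castSucc, ← Fin.castSucc_succ, Fin.snoc_castSucc]
      exact hu' j

theorem IsPiecewiseC1.continuousOn {γ : ℝ → M} {a b : ℝ} (h : IsPiecewiseC1 n γ a b) :
    ContinuousOn γ (Icc a b) := by
  refine (h.induction (P := fun s t => s ≤ t ∧ ContinuousOn γ (Icc s t)) ?_ ?_ ?_).2
  · simp
  · rintro s t hs hst ht ⟨-, h1⟩ ⟨-, h2⟩
    refine ⟨hs.trans hst, ?_⟩
    rw [← Icc_union_Icc_eq_Icc hs hst]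
    exact h1.union_of_isClosed h2 isClosed_Icc isClosed_Icc
  · intro s t hs hst ht h1
    exact ⟨hst, h1.continuousOn⟩

/-- An admissible curve from `x` to `y`. -/
structure IsAdmissible (n : ℕ) {M : Type*} [TopologicalSpace M]
    [ChartedSpace (EuclideanSpace ℝ (Fin n)) M] (S : Set M) (γ : ℝ → M) (a b : ℝ) : Prop where
  le : a ≤ b
  piecewise : IsPiecewiseC1 n γ a b
  finite : (γ '' Icc a b ∩ S).Finite

variable {g : BilinField n M} {S : Set M}

theorem IsAdmissible.mono {γ : ℝ → M} {a b c d : ℝ} (h : IsAdmissible n S γ a b)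
    (hac : a ≤ c) (hcd : c ≤ d) (hdb : d ≤ b) : IsAdmissible n S γ c d :=
  ⟨hcd, h.piecewise.mono hac hcd hdb, h.finite.subset
    (inter_subset_inter_left _ (image_mono (Icc_subset_Icc hac hdb)))⟩

theorem IsAdmissible.dist_le {γ : ℝ → M} {a b : ℝ} (h : IsAdmissible n S γ a b) :
    dist g S (γ a) (γ b) ≤ curveLength g γ a b :=
  sInf_le ⟨a, b, γ, h.le, h.piecewise, h.finite, rfl, rfl, rfl⟩

theorem exists_isAdmissible_of_dist_lt {x y : M} {L : ENNReal} (h : dist g S x y < L) :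
    ∃ (a b : ℝ) (γ : ℝ → M), IsAdmissible n S γ a b ∧ γ a = x ∧ γ b = y ∧
      curveLength g γ a b < L := by
  obtain ⟨L', ⟨a, b, γ, h1, h2, h3, h4, h5, rfl⟩, hL⟩ := sInf_lt_iff.1 h
  exact ⟨a, b, γ, ⟨h1, h2, h3⟩, h4, h5, hL⟩

theorem dist_self (g : BilinField n M) (S : Set M) (x : M) : dist g S x x = 0 := by
  have h : IsAdmissible n S (fun _ : ℝ => x) 0 0 :=
    ⟨le_rfl, IsPiecewiseC1.refl _ _, ((finite_singleton x).subset (by simp)).inter_of_left _⟩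
  have h2 := h.dist_le (g := g)
  rw [curveLength_eq_Ioo] at h2
  simpa using h2

/-- Nearly shortest curves are concatenated after a shift of the second parameter; the exceptional
points on S remain finite in number. Symmetry of the distance is never established, so the local
estimates below are stated in both orders where both are needed. -/
theorem dist_triangle (g : BilinField n M) (S : Set M) (x y z : M) :
    dist g S x z ≤ dist g S x y + dist g S y z := by
  apply ENNReal.le_of_forall_pos_le_add
  intro ε hε hfin
  have hε' : (0 : ENNReal) < ε / 2 := by simpa using hε.ne'
  have hε2 : ((ε : ENNReal) / 2) ≠ 0 := hε'.ne'
  have hx : dist g S x y ≠ ⊤ := (lt_of_le_of_lt le_self_add hfin).ne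
  have hy : dist g S y z ≠ ⊤ := (lt_of_le_of_lt le_add_self hfin).ne
  obtain ⟨a, b, γ, h, ha, hb, hL⟩ := exists_isAdmissible_of_dist_lt
    (ENNReal.lt_add_right hx hε2)
  obtain ⟨a', b', γ', h', ha', hb', hL'⟩ := exists_isAdmissible_of_dist_lt
    (ENNReal.lt_add_right hy hε2)
  set d := a' - b with hd
  set c := b' - d with hc
  have hbc : b ≤ c := by have := h'.le; linarith
  set δ : ℝ → M := fun t => if t ≤ b then γ t else γ' (t + d) with hδ
  have e1 : EqOn δ γ (Icc a b) := fun t ht => by simp [hδ, ht.2]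
  have e2 : EqOn δ (fun t => γ' (t + d)) (Icc b c) := by
    intro t ht
    rcases ht.1.eq_or_lt with rfl | h3
    · simp [hδ, hd, ha', hb]
    · simp [hδ, not_le.2 h3]
  have hb1 : a' - d = b := by simp [hd]
  have p2 : IsPiecewiseC1 n (fun t => γ' (t + d)) b c := by
    have := h'.piecewise.comp_add_const d
    rwa [hb1] at this
  have hadm : IsAdmissible n S δ a c := by
    refine ⟨h.le.trans hbc, (h.piecewise.congr e1).trans (p2.congr e2), ?_⟩
    refine (h.finite.union h'.finite).subset ?_
    rintro _ ⟨⟨t, ht, rfl⟩, hS⟩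
    by_cases htb : t ≤ b
    · left
      exact ⟨⟨t, ⟨ht.1, htb⟩, (e1 ⟨ht.1, htb⟩).symm⟩, hS⟩
    · right
      have ht' : t ∈ Icc b c := ⟨(not_le.1 htb).le, ht.2⟩
      exact ⟨⟨t + d, ⟨by linarith [ht'.1], by linarith [ht'.2]⟩, (e2 ht').symm⟩, hS⟩
  have hlen : curveLength g δ a c = curveLength g γ a b + curveLength g γ' a' b' := by
    rw [← curveLength_add g δ h.le hbc, curveLength_congr g e1, curveLength_congr g e2,
      ← curveLength_comp_add_const g γ' a' b' d, hb1]
  have hfinal := hadm.dist_le (g := g)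
  rw [e1 ⟨le_rfl, h.le⟩, e2 ⟨hbc, le_rfl⟩, ha] at hfinal
  have hc' : γ' (c + d) = z := by rw [← hb']; congr 1; simp [hc]
  simp only [hc', hlen] at hfinal
  calc dist g S x z ≤ _ := hfinal
    _ ≤ (dist g S x y + ε / 2) + (dist g S y z + ε / 2) := add_le_add hL.le hL'.le
    _ = dist g S x y + dist g S y z + (ε / 2 + ε / 2) := by ring
    _ = _ := by rw [ENNReal.add_halves]

end Curves

/-! ### The metric as a smooth field of bilinear forms in a chart -/

section MetricForm

variable {n : ℕ} {M : Type*} [TopologicalSpace M] [ChartedSpace (EuclideanSpace ℝ (Fin n)) M]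

/-- The differential of the inverse of the chart `e`. -/
def chartDeriv (e : OpenPartialHomeomorph M (EuclideanSpace ℝ (Fin n)))
    (y : EuclideanSpace ℝ (Fin n)) :
    EuclideanSpace ℝ (Fin n) →L[ℝ] TangentSpace (𝓡 n) (e.symm y) :=
  mfderiv 𝓘(ℝ, EuclideanSpace ℝ (Fin n)) (𝓡 n) e.symm y

/-- The metric `g` in the chart `e`, as a field of bilinear forms. -/
def metricForm (g : BilinField n M) (e : OpenPartialHomeomorph M (EuclideanSpace ℝ (Fin n)))
    (y : EuclideanSpace ℝ (Fin n)) :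
    EuclideanSpace ℝ (Fin n) →L[ℝ] EuclideanSpace ℝ (Fin n) →L[ℝ] ℝ :=
  ContinuousLinearMap.bilinearComp
    (show EuclideanSpace ℝ (Fin n) →L[ℝ] EuclideanSpace ℝ (Fin n) →L[ℝ] ℝ from g (e.symm y))
    (show EuclideanSpace ℝ (Fin n) →L[ℝ] EuclideanSpace ℝ (Fin n) from chartDeriv e y)
    (show EuclideanSpace ℝ (Fin n) →L[ℝ] EuclideanSpace ℝ (Fin n) from chartDeriv e y)

theorem metricForm_apply (g : BilinField n M)
    (e : OpenPartialHomeomorph M (EuclideanSpace ℝ (Fin n))) (y a b : EuclideanSpace ℝ (Fin n)) :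
    metricForm g e y a b = g (e.symm y) (chartDeriv e y a) (chartDeriv e y b) := rfl

/-- The bilinear form `(a, b) ↦ aᵢ bⱼ`. -/
def coordForm (i j : Fin n) :
    EuclideanSpace ℝ (Fin n) →L[ℝ] EuclideanSpace ℝ (Fin n) →L[ℝ] ℝ :=
  (EuclideanSpace.proj i : EuclideanSpace ℝ (Fin n) →L[ℝ] ℝ).smulRight
    (EuclideanSpace.proj j : EuclideanSpace ℝ (Fin n) →L[ℝ] ℝ)

@[simp] theorem coordForm_apply (i j : Fin n) (a b : EuclideanSpace ℝ (Fin n)) :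
    coordForm i j a b = a i * b j := by
  simp [coordForm]

theorem sum_single (a : EuclideanSpace ℝ (Fin n)) :
    a = ∑ i, a i • EuclideanSpace.single i (1 : ℝ) := by
  ext j
  simp [Pi.single_apply]

theorem bilin_eq_sum (B : EuclideanSpace ℝ (Fin n) →L[ℝ] EuclideanSpace ℝ (Fin n) →L[ℝ] ℝ) :
    B = ∑ i, ∑ j,
      B (EuclideanSpace.single i 1) (EuclideanSpace.single j 1) • coordForm i j := by
  ext a b
  conv_lhs => rw [sum_single a, sum_single b]
  simp only [map_sum, map_smul, sum_apply, smul_apply,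
    coordForm_apply, smul_eq_mul, Finset.mul_sum]
  rw [Finset.sum_comm]
  refine Finset.sum_congr rfl fun i _ => Finset.sum_congr rfl fun j _ => by ring

/-- A coordinate vector field is the image of a constant section under the tangent map of the
inverse chart, hence a smooth section of the tangent bundle. -/
theorem contMDiffOn_chartDeriv [IsManifold (𝓡 n) ∞ M]
    {e : OpenPartialHomeomorph M (EuclideanSpace ℝ (Fin n))}
    (he : e ∈ IsManifold.maximalAtlas (𝓡 n) ∞ M) (a : EuclideanSpace ℝ (Fin n)) :
    ContMDiffOn 𝓘(ℝ, EuclideanSpace ℝ (Fin n))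
      ((𝓡 n).prod 𝓘(ℝ, EuclideanSpace ℝ (Fin n))) ∞
      (fun y => (⟨e.symm y, chartDeriv e y a⟩ : TangentBundle (𝓡 n) M)) e.target := by
  have h0 := (contMDiffOn_symm_of_mem_maximalAtlas he)
  have h1 := h0.contMDiffOn_tangentMapWithin (m := ∞) (by simp) e.open_target.uniqueMDiffOn
  have h2 : ContMDiff 𝓘(ℝ, EuclideanSpace ℝ (Fin n))
      (𝓘(ℝ, EuclideanSpace ℝ (Fin n)).prod 𝓘(ℝ, EuclideanSpace ℝ (Fin n))) ∞
      (fun y : EuclideanSpace ℝ (Fin n) =>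
        (⟨y, a⟩ : TangentBundle 𝓘(ℝ, EuclideanSpace ℝ (Fin n)) (EuclideanSpace ℝ (Fin n)))) := by
    intro y
    rw [Bundle.contMDiffAt_totalSpace]
    refine ⟨contMDiffAt_id, ?_⟩
    simp only [trivializationAt_model_space_apply]
    exact contMDiffAt_const
  have h3 := h1.comp h2.contMDiffOn (s := e.target) (fun y hy => hy)
  refine h3.congr fun y hy => ?_
  simp only [Function.comp, tangentMapWithin]
  rw [mfderivWithin_of_mem_nhds (e.open_target.mem_nhds hy)]
  rfl

/-- Each coefficient is g applied to two smooth coordinate fields; the form itself is a finite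
combination of the constant forms `coordForm` with these coefficients. -/
theorem contDiffOn_metricForm [IsManifold (𝓡 n) ∞ M] {g : BilinField n M} {U : Set M}
    (hg : ContMDiffOn (𝓡 n)
      ((𝓡 n).prod 𝓘(ℝ, EuclideanSpace ℝ (Fin n) →L[ℝ] EuclideanSpace ℝ (Fin n) →L[ℝ] ℝ)) ∞
      (fun x => Bundle.TotalSpace.mk'
        (E := fun x : M => TangentSpace (𝓡 n) x →L[ℝ] TangentSpace (𝓡 n) x →L[ℝ] ℝ)
        (EuclideanSpace ℝ (Fin n) →L[ℝ] EuclideanSpace ℝ (Fin n) →L[ℝ] ℝ) x (g x)) U)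
    {e : OpenPartialHomeomorph M (EuclideanSpace ℝ (Fin n))}
    (he : e ∈ IsManifold.maximalAtlas (𝓡 n) ∞ M) :
    ContDiffOn ℝ ∞ (metricForm g e) (e.target ∩ e.symm ⁻¹' U) := by
  have key : ∀ a b : EuclideanSpace ℝ (Fin n),
      ContDiffOn ℝ ∞ (fun y => metricForm g e y a b) (e.target ∩ e.symm ⁻¹' U) := by
    intro a b
    rw [← contMDiffOn_iff_contDiffOn]
    have h0 := (contMDiffOn_symm_of_mem_maximalAtlas he).mono
      (inter_subset_left : e.target ∩ e.symm ⁻¹' U ⊆ e.target)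
    have h1 := hg.comp h0 (fun y hy => hy.2)
    have h2 := (contMDiffOn_chartDeriv he a).mono
      (inter_subset_left : e.target ∩ e.symm ⁻¹' U ⊆ e.target)
    have h3 := (contMDiffOn_chartDeriv he b).mono
      (inter_subset_left : e.target ∩ e.symm ⁻¹' U ⊆ e.target)
    have h4 : ContMDiffOn 𝓘(ℝ, EuclideanSpace ℝ (Fin n)) ((𝓡 n).prod 𝓘(ℝ)) ∞
      (fun y ↦ Bundle.TotalSpace.mk' ℝ (E := Bundle.Trivial M ℝ) (e.symm y)
        (g (e.symm y) (chartDeriv e y a) (chartDeriv e y b))) (e.target ∩ e.symm ⁻¹' U) := by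
      apply ContMDiffOn.clm_bundle_apply₂ (F₁ := EuclideanSpace ℝ (Fin n))
        (F₂ := EuclideanSpace ℝ (Fin n))
      · exact h1
      · exact h2
      · exact h3
    intro y hy
    have h5 := h4 y hy
    rw [Bundle.contMDiffWithinAt_totalSpace] at h5
    exact h5.2
  have h6 : metricForm g e = fun y => ∑ i, ∑ j,
      metricForm g e y (EuclideanSpace.single i 1) (EuclideanSpace.single j 1) •
        coordForm i j := by
    ext1 y
    exact bilin_eq_sum _
  rw [h6]
  refine ContDiffOn.sum fun i _ => ContDiffOn.sum fun j _ => ?_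
  exact (key _ _).smul contDiffOn_const

theorem hasMFDerivAt_chart_symm {e : OpenPartialHomeomorph M (EuclideanSpace ℝ (Fin n))}
    (he : e ∈ IsManifold.maximalAtlas (𝓡 n) ∞ M) {y : EuclideanSpace ℝ (Fin n)}
    (hy : y ∈ e.target) :
    HasMFDerivAt 𝓘(ℝ, EuclideanSpace ℝ (Fin n)) (𝓡 n) e.symm y (chartDeriv e y) :=
  ((contMDiffAt_symm_of_mem_maximalAtlas he hy).mdifferentiableAt (by simp)).hasMFDerivAt

theorem chartDeriv_bijective {e : OpenPartialHomeomorph M (EuclideanSpace ℝ (Fin n))}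
    (he : e ∈ IsManifold.maximalAtlas (𝓡 n) ∞ M) {y : EuclideanSpace ℝ (Fin n)}
    (hy : y ∈ e.target) :
    (∀ a, (show EuclideanSpace ℝ (Fin n) from
      mfderiv (𝓡 n) 𝓘(ℝ, EuclideanSpace ℝ (Fin n)) e (e.symm y) (chartDeriv e y a)) = a) ∧
    (∀ v, chartDeriv e y
      (mfderiv (𝓡 n) 𝓘(ℝ, EuclideanSpace ℝ (Fin n)) e (e.symm y) v) = v) := by
  have hx := e.map_target hy
  have h1 := hasMFDerivAt_chart_symm he hy
  have h2 : HasMFDerivAt (𝓡 n) 𝓘(ℝ, EuclideanSpace ℝ (Fin n)) e (e.symm y)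
      (mfderiv (𝓡 n) 𝓘(ℝ, EuclideanSpace ℝ (Fin n)) e (e.symm y)) :=
    ((contMDiffAt_of_mem_maximalAtlas he hx).mdifferentiableAt (by simp)).hasMFDerivAt
  constructor
  · intro a
    have h3 := h2.comp y h1
    have h4 : (e ∘ e.symm) =ᶠ[𝓝 y] id := by
      filter_upwards [e.open_target.mem_nhds hy] with z hz using e.right_inv hz
    have h5 := h3.congr_of_eventuallyEq h4.symm
    have h6 := hasMFDerivAt_unique h5 (hasMFDerivAt_id y)
    exact congrArg (fun L : EuclideanSpace ℝ (Fin n) →L[ℝ] EuclideanSpace ℝ (Fin n) => L a) h6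
  · intro v
    have h1' : HasMFDerivAt 𝓘(ℝ, EuclideanSpace ℝ (Fin n)) (𝓡 n) e.symm (e (e.symm y))
        (show EuclideanSpace ℝ (Fin n) →L[ℝ] EuclideanSpace ℝ (Fin n) from chartDeriv e y) := by
      have : ∀ z, z = y → HasMFDerivAt 𝓘(ℝ, EuclideanSpace ℝ (Fin n)) (𝓡 n) e.symm z
          (show EuclideanSpace ℝ (Fin n) →L[ℝ] EuclideanSpace ℝ (Fin n)
            from chartDeriv e y) := by
        rintro _ rfl
        exact h1
      exact this _ (e.right_inv hy)
    have h3 := h1'.comp (e.symm y) h2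
    have h4 : (e.symm ∘ e) =ᶠ[𝓝 (e.symm y)] id := by
      filter_upwards [e.open_source.mem_nhds hx] with z hz using e.left_inv hz
    have h5 := h3.congr_of_eventuallyEq h4.symm
    have h6 := hasMFDerivAt_unique h5 (hasMFDerivAt_id (e.symm y))
    exact congrArg (fun L : EuclideanSpace ℝ (Fin n) →L[ℝ] EuclideanSpace ℝ (Fin n) => L v) h6

end MetricForm

/-! ### Comparing length with coordinates -/

section ChartEstimates

variable {n : ℕ} {M : Type*} [TopologicalSpace M] [ChartedSpace (EuclideanSpace ℝ (Fin n)) M]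
  {g : BilinField n M} {S : Set M}

theorem speed_chart_symm_comp (g : BilinField n M)
    {e : OpenPartialHomeomorph M (EuclideanSpace ℝ (Fin n))}
    (he : e ∈ IsManifold.maximalAtlas (𝓡 n) ∞ M) {c : ℝ → EuclideanSpace ℝ (Fin n)} {t : ℝ}
    {v : EuclideanSpace ℝ (Fin n)} (hc : HasDerivAt c v t) (ht : c t ∈ e.target) :
    speed g (fun s => e.symm (c s)) t = Real.sqrt (metricForm g e (c t) v v) := by
  have h2 := (hasMFDerivAt_chart_symm he ht).comp t hc.hasFDerivAt.hasMFDerivAt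
  have h3 : mfderiv 𝓘(ℝ, ℝ) (𝓡 n) (fun s => e.symm (c s)) t (1 : ℝ) = chartDeriv e (c t) v := by
    have h4 := congrArg (fun L : ℝ →L[ℝ] EuclideanSpace ℝ (Fin n) => L 1) h2.mfderiv
    refine h4.trans ?_
    change chartDeriv e (c t) ((ContinuousLinearMap.toSpanSingleton ℝ v) (1 : ℝ)) = _
    simp
  simp only [speed]
  rw [h3]
  rfl

theorem speed_eq_sqrt_metricForm (g : BilinField n M)
    {e : OpenPartialHomeomorph M (EuclideanSpace ℝ (Fin n))}
    (he : e ∈ IsManifold.maximalAtlas (𝓡 n) ∞ M) {γ : ℝ → M} {t : ℝ}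
    {v : EuclideanSpace ℝ (Fin n)} (ht : γ t ∈ e.source) (hγ : ContinuousAt γ t)
    (hc : HasDerivAt (fun s => e (γ s)) v t) :
    speed g γ t = Real.sqrt (metricForm g e (e (γ t)) v v) := by
  rw [← speed_chart_symm_comp g he hc (e.map_source ht)]
  have h1 : γ =ᶠ[𝓝 t] fun s => e.symm (e (γ s)) := by
    filter_upwards [hγ.preimage_mem_nhds (e.open_source.mem_nhds ht)] with s hs
    exact (e.left_inv hs).symm
  have h2 : mfderiv 𝓘(ℝ, ℝ) (𝓡 n) γ t (1 : ℝ)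
      = mfderiv 𝓘(ℝ, ℝ) (𝓡 n) (fun s => e.symm (e (γ s))) t (1 : ℝ) :=
    congrArg (fun L : ℝ →L[ℝ] EuclideanSpace ℝ (Fin n) => L 1) (h1.mfderiv_eq)
  simp only [speed]
  rw [h2, ← h1.eq_of_nhds]
  rfl

/-- The straight coordinate segment is itself an admissible curve. The parameters at which it meets
S are finite in number, hence null, so the speed has to be bounded only off S. -/
theorem dist_le_of_segment {e : OpenPartialHomeomorph M (EuclideanSpace ℝ (Fin n))}
    (he : e ∈ IsManifold.maximalAtlas (𝓡 n) ∞ M) {x y : EuclideanSpace ℝ (Fin n)} {C : ℝ}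
    (hC : 0 ≤ C) (hseg : ∀ t ∈ Icc (0 : ℝ) 1, x + t • (y - x) ∈ e.target)
    (hfin : {t ∈ Icc (0 : ℝ) 1 | e.symm (x + t • (y - x)) ∈ S}.Finite)
    (hbound : ∀ t ∈ Icc (0 : ℝ) 1, e.symm (x + t • (y - x)) ∉ S →
      metricForm g e (x + t • (y - x)) (y - x) (y - x) ≤ C ^ 2) :
    dist g S (e.symm x) (e.symm y) ≤ ENNReal.ofReal C := by
  set c : ℝ → EuclideanSpace ℝ (Fin n) := fun t => x + t • (y - x) with hc
  have hadm : IsAdmissible n S (fun t => e.symm (c t)) 0 1 := by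
    refine ⟨zero_le_one, ⟨1, ![0, 1], ?_, rfl, rfl, ?_⟩, ?_⟩
    · rw [Fin.monotone_iff_le_succ]
      intro i
      fin_cases i
      simp
    · intro i
      fin_cases i
      have h1 : ContMDiff 𝓘(ℝ, ℝ) 𝓘(ℝ, EuclideanSpace ℝ (Fin n)) ∞ c := by
        apply ContDiff.contMDiff
        fun_prop
      have h2 := (contMDiffOn_symm_of_mem_maximalAtlas he).comp h1.contMDiffOn
        (s := Icc (0 : ℝ) 1) (fun t ht => hseg t ht)
      exact h2.of_le (by exact_mod_cast le_top)
    · refine (hfin.image (fun t => e.symm (c t))).subset ?_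
      rintro _ ⟨⟨t, ht, rfl⟩, hS⟩
      exact ⟨t, ⟨ht, hS⟩, rfl⟩
  have h1 := hadm.dist_le (g := g)
  have h2 : c 0 = x := by simp [hc]
  have h3 : c 1 = y := by simp [hc]
  simp only [h2, h3] at h1
  refine h1.trans ?_
  rw [curveLength_eq_Ioo]
  have hae : ∀ᵐ t ∂(volume : Measure ℝ), t ∈ Ioo (0 : ℝ) 1 →
      ENNReal.ofReal (speed g (fun t => e.symm (c t)) t) ≤ ENNReal.ofReal C := by
    have h4 : volume {t ∈ Icc (0 : ℝ) 1 | e.symm (x + t • (y - x)) ∈ S} = 0 := hfin.measure_zero _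
    filter_upwards [measure_eq_zero_iff_ae_notMem.1 h4] with t ht ht'
    have ht2 : t ∈ Icc (0 : ℝ) 1 := Ioo_subset_Icc_self ht'
    have h5 : HasDerivAt c (y - x) t := by
      simpa only [one_smul, id] using ((hasDerivAt_id t).smul_const (y - x)).const_add x
    rw [speed_chart_symm_comp g he h5 (hseg t ht2)]
    apply ENNReal.ofReal_le_ofReal
    apply Real.sqrt_le_iff.2 ⟨hC, hbound t ht2 fun hS => ht ⟨ht2, hS⟩⟩
  calc ∫⁻ t in Ioo (0 : ℝ) 1, ENNReal.ofReal (speed g (fun t => e.symm (c t)) t)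
      ≤ ∫⁻ t in Ioo (0 : ℝ) 1, ENNReal.ofReal C := setLIntegral_mono_ae (by fun_prop) hae
    _ = ENNReal.ofReal C := by simp

/-- A calibration argument: a linear function that is κ-Lipschitz for g along the curve changes by
at most κ times the length. Every lower bound for distances comes from a suitable choice of `l`. -/
theorem abs_sub_le_curveLength {e : OpenPartialHomeomorph M (EuclideanSpace ℝ (Fin n))}
    (he : e ∈ IsManifold.maximalAtlas (𝓡 n) ∞ M) {γ : ℝ → M} {a b : ℝ}
    (hγ : IsPiecewiseC1 n γ a b) (hsrc : ∀ t ∈ Icc a b, γ t ∈ e.source)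
    (l : EuclideanSpace ℝ (Fin n) →L[ℝ] ℝ) {κ : ℝ} (hκ : 0 ≤ κ)
    (hl : ∀ t ∈ Ioo a b, ∀ w, |l w| ≤ κ * Real.sqrt (metricForm g e (e (γ t)) w w)) :
    ENNReal.ofReal |l (e (γ b)) - l (e (γ a))| ≤ ENNReal.ofReal κ * curveLength g γ a b := by
  refine hγ.induction (P := fun s t => ENNReal.ofReal |l (e (γ t)) - l (e (γ s))| ≤
    ENNReal.ofReal κ * curveLength g γ s t) (by simp) ?_ ?_
  · intro s t hs hst ht h1 h2
    rw [← curveLength_add g γ hs hst, mul_add]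
    refine le_trans ?_ (add_le_add h1 h2)
    rw [← ENNReal.ofReal_add (abs_nonneg _) (abs_nonneg _)]
    apply ENNReal.ofReal_le_ofReal
    rw [add_comm]
    exact abs_sub_le _ _ _
  · intro s t hs hst ht hC
    have h1 : ContMDiffOn 𝓘(ℝ, ℝ) 𝓘(ℝ, EuclideanSpace ℝ (Fin n)) 1 (fun τ => e (γ τ))
        (Icc s t) :=
      ((contMDiffOn_of_mem_maximalAtlas he).of_le (by exact_mod_cast le_top)).comp hC
        (fun τ hτ => hsrc τ ⟨hs.trans hτ.1, hτ.2.trans ht⟩)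
    have h1' := contMDiffOn_iff_contDiffOn.1 h1
    have h2 : ContDiffOn ℝ 1 (fun τ => l (e (γ τ))) (Icc s t) := l.contDiff.comp_contDiffOn h1'
    have h3 := enorm_sub_le_lintegral_derivWithin_Icc_of_contDiffOn_Icc h2 hst
    rw [Real.enorm_eq_ofReal_abs] at h3
    refine h3.trans ?_
    rw [curveLength_eq_Ioo, ← restrict_Ioo_eq_restrict_Icc,
      ← lintegral_const_mul' _ _ ENNReal.ofReal_ne_top]
    refine setLIntegral_mono' measurableSet_Ioo fun τ hτ => ?_
    have hmem : Icc s t ∈ 𝓝 τ := Icc_mem_nhds hτ.1 hτ.2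
    have h4 : DifferentiableAt ℝ (fun τ => e (γ τ)) τ :=
      (h1'.contDiffAt hmem).differentiableAt (by simp)
    have h5 := h4.hasDerivAt
    have h6 : HasDerivAt (fun τ => l (e (γ τ))) (l (deriv (fun τ => e (γ τ)) τ)) τ :=
      l.hasFDerivAt.comp_hasDerivAt τ h5
    rw [derivWithin_of_mem_nhds hmem, h6.deriv, Real.enorm_eq_ofReal_abs,
      ← ENNReal.ofReal_mul hκ]
    apply ENNReal.ofReal_le_ofReal
    have hτ' : τ ∈ Ioo a b := ⟨hs.trans_lt hτ.1, hτ.2.trans_le ht⟩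
    rw [speed_eq_sqrt_metricForm g he (hsrc τ (Ioo_subset_Icc_self hτ'))
      (hC.continuousOn.continuousAt hmem) h5]
    exact hl τ hτ' _

end ChartEstimates

/-- Euclidean `n`-space. -/
abbrev Euc (n : ℕ) : Type := EuclideanSpace ℝ (Fin n)

/-- Bilinear forms on Euclidean `n`-space. -/
abbrev Form (n : ℕ) : Type := Euc n →L[ℝ] Euc n →L[ℝ] ℝ

/-- A smooth Riemannian metric on an open subset of Euclidean space. -/
structure IsMetricOn {n : ℕ} (G : Euc n → Form n) (U : Set (Euc n)) : Prop where
  isOpen : IsOpen U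
  smooth : ContDiffOn ℝ ∞ G U
  symm : ∀ y ∈ U, ∀ v w, G y v w = G y w v
  pos : ∀ y ∈ U, ∀ v, v ≠ 0 → 0 < G y v v

/-! ### Local bounds for a Riemannian metric on an open set of Euclidean space -/

section IsMetricOn

variable {n : ℕ} {G : Euc n → Form n} {U : Set (Euc n)}

theorem IsMetricOn.contDiffAt (h : IsMetricOn G U) {y : Euc n} (hy : y ∈ U) :
    ContDiffAt ℝ ∞ G y :=
  h.smooth.contDiffAt (h.isOpen.mem_nhds hy)

theorem IsMetricOn.nonneg (h : IsMetricOn G U) {y : Euc n} (hy : y ∈ U) (v : Euc n) :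
    0 ≤ G y v v := by
  by_cases hv : v = 0
  · simp [hv]
  · exact (h.pos y hy v hv).le

theorem IsMetricOn.abs_le_sqrt_mul_sqrt (h : IsMetricOn G U) {y : Euc n} (hy : y ∈ U)
    (v w : Euc n) : |G y v w| ≤ Real.sqrt (G y v v) * Real.sqrt (G y w w) := by
  rw [← Real.sqrt_mul (h.nonneg hy v)]
  apply Real.abs_le_sqrt
  have h1 : ∀ x : ℝ, 0 ≤ G y w w * (x * x) + 2 * G y v w * x + G y v v := by
    intro x
    have h2 := h.nonneg hy (v + x • w)
    simp only [map_add, map_smul, add_apply, smul_apply,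
      smul_eq_mul, h.symm y hy w v] at h2
    nlinarith
  have h3 := discrim_le_zero h1
  simp only [discrim] at h3
  nlinarith

theorem exists_norm_bounds (h : IsMetricOn G U) {p : Euc n} (hp : p ∈ U) :
    ∃ c C : ℝ, 0 < c ∧ 0 < C ∧ ∀ᶠ y in 𝓝 p, ∀ v : Euc n,
      c ^ 2 * ‖v‖ ^ 2 ≤ G y v v ∧ G y v v ≤ C ^ 2 * ‖v‖ ^ 2 := by
  have hcont : ContinuousAt G p := (h.contDiffAt hp).continuousAt
  have hmin : ∃ c : ℝ, 0 < c ∧ ∀ v : Euc n, c * ‖v‖ ^ 2 ≤ G p v v := by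
    -- The unit sphere is empty only in dimension 0, where every vector vanishes.
    rcases (Metric.sphere (0 : Euc n) 1).eq_empty_or_nonempty with hem | hne
    · refine ⟨1, one_pos, fun v => ?_⟩
      have hv : v = 0 := by
        by_contra hv
        have : ‖v‖⁻¹ • v ∈ Metric.sphere (0 : Euc n) 1 := by
          simp [norm_smul, hv]
        simp [hem] at this
      simp [hv]
    · obtain ⟨v0, hv0, hmin⟩ := (isCompact_sphere (0 : Euc n) 1).exists_isMinOn hne
        (f := fun v => G p v v) (by fun_prop)
      have hv0' : ‖v0‖ = 1 := by simpa using hv0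
      have hne0 : v0 ≠ 0 := by rintro rfl; simp at hv0'
      refine ⟨G p v0 v0, h.pos p hp v0 hne0, fun v => ?_⟩
      by_cases hv : v = 0
      · simp [hv]
      have hv1 : ‖v‖⁻¹ • v ∈ Metric.sphere (0 : Euc n) 1 := by simp [norm_smul, hv]
      have h1 : G p v0 v0 ≤ G p (‖v‖⁻¹ • v) (‖v‖⁻¹ • v) := hmin hv1
      simp only [map_smul, smul_apply, smul_eq_mul] at h1
      have h2 : 0 < ‖v‖ := norm_pos_iff.2 hv
      have h3 : G p v v = ‖v‖ ^ 2 * (‖v‖⁻¹ * (‖v‖⁻¹ * G p v v)) := by field_simp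
      rw [h3, mul_comm]
      gcongr
  obtain ⟨c, hc, hcb⟩ := hmin
  refine ⟨Real.sqrt (c / 2), Real.sqrt (‖G p‖ + c / 2), by positivity, by positivity, ?_⟩
  filter_upwards [Metric.tendsto_nhds.1 hcont (c / 2) (by positivity)] with y hy v
  rw [Real.sq_sqrt (by positivity), Real.sq_sqrt (by positivity)]
  have h1 : |(G y - G p) v v| ≤ c / 2 * ‖v‖ ^ 2 := by
    calc |(G y - G p) v v| ≤ ‖G y - G p‖ * ‖v‖ * ‖v‖ := (G y - G p).le_opNorm₂ v v
      _ ≤ c / 2 * ‖v‖ * ‖v‖ := by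
        rw [dist_eq_norm] at hy
        gcongr
      _ = _ := by ring
  have h2 : |G p v v| ≤ ‖G p‖ * ‖v‖ ^ 2 := by
    have := (G p).le_opNorm₂ v v
    rw [Real.norm_eq_abs] at this
    nlinarith
  have h3 : (G y - G p) v v = G y v v - G p v v := rfl
  rw [h3] at h1
  have h4 := hcb v
  have h5 := abs_le.1 h1
  have h6 := le_abs_self (G p v v)
  constructor <;> nlinarith

/-- By continuity two nearby forms differ by at most η c² in norm, and c²‖v‖² is at most the form
itself. The factor is a square because it is later taken out of a square root. -/
theorem eventually_metric_le (h : IsMetricOn G U) {p : Euc n} (hp : p ∈ U) {η : ℝ} (hη : 0 < η) :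
    ∃ R > 0, ∀ x ∈ Metric.ball p R, ∀ y ∈ Metric.ball p R, ∀ v : Euc n,
      G x v v ≤ (1 + η) ^ 2 * G y v v := by
  obtain ⟨c, C, hc, hC, hev⟩ := exists_norm_bounds h hp
  have hcont : ContinuousAt G p := (h.contDiffAt hp).continuousAt
  obtain ⟨R, hR, hball⟩ := Metric.eventually_nhds_iff_ball.1
    (hev.and (Metric.tendsto_nhds.1 hcont (η * c ^ 2 / 2) (by positivity)))
  refine ⟨R, hR, fun x hx y hy v => ?_⟩
  have h1 := (hball y hy).1 v
  have h2 : ‖G x - G y‖ ≤ η * c ^ 2 := by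
    rw [← dist_eq_norm]
    have := dist_triangle_right (G x) (G y) (G p)
    linarith [(hball x hx).2, (hball y hy).2]
  have h3 : |(G x - G y) v v| ≤ η * c ^ 2 * ‖v‖ ^ 2 := by
    calc |(G x - G y) v v| ≤ ‖G x - G y‖ * ‖v‖ * ‖v‖ := (G x - G y).le_opNorm₂ v v
      _ ≤ η * c ^ 2 * ‖v‖ * ‖v‖ := by gcongr
      _ = _ := by ring
  have h4 : (G x - G y) v v = G x v v - G y v v := rfl
  rw [h4] at h3
  have h5 := (abs_le.1 h3).2
  have h6 : 0 ≤ c ^ 2 * ‖v‖ ^ 2 := by positivity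
  nlinarith [mul_nonneg hη.le (h6.trans h1.1), sq_nonneg η, mul_le_mul_of_nonneg_left h1.1 hη.le]

end IsMetricOn

/-! ### Uniformly Euclidean metrics in charts -/

section UniformlyEuclidean

variable {n : ℕ} {M : Type*} [TopologicalSpace M] [ChartedSpace (EuclideanSpace ℝ (Fin n)) M]
  [IsManifold (𝓡 n) ∞ M] {g : BilinField n M} {S : Set M}

/-- The part of the target of a chart which does not meet `S`. -/
def chartDomain (e : OpenPartialHomeomorph M (EuclideanSpace ℝ (Fin n))) (S : Set M) :
    Set (Euc n) :=
  e.target ∩ e.symm ⁻¹' Sᶜ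

theorem IsUniformlyEuclidean.pos (hg : IsUniformlyEuclidean g S) {x : M} (hx : x ∉ S)
    (v : TangentSpace (𝓡 n) x) (hv : v ≠ 0) : 0 < g x v v := by
  obtain ⟨gbar, Λ, hΛ, hb⟩ := hg.comparable
  have h1 := (hb x hx v).1
  have h2 := gbar.pos x v hv
  exact lt_of_lt_of_le (by positivity) h1

theorem chartDeriv_ne_zero {e : OpenPartialHomeomorph M (EuclideanSpace ℝ (Fin n))}
    (he : e ∈ IsManifold.maximalAtlas (𝓡 n) ∞ M) {y : Euc n} (hy : y ∈ e.target) {v : Euc n}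
    (hv : v ≠ 0) : chartDeriv e y v ≠ 0 := by
  intro h
  have h1 := (chartDeriv_bijective he hy).1 v
  rw [h, map_zero] at h1
  exact hv h1.symm

theorem IsUniformlyEuclidean.isMetricOn (hg : IsUniformlyEuclidean g S) (hS : IsClosed S)
    {e : OpenPartialHomeomorph M (EuclideanSpace ℝ (Fin n))}
    (he : e ∈ IsManifold.maximalAtlas (𝓡 n) ∞ M) :
    IsMetricOn (metricForm g e) (chartDomain e S) where
  isOpen := e.symm.isOpen_inter_preimage hS.isOpen_compl
  smooth := contDiffOn_metricForm hg.smooth he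
  symm _ hy _ _ := hg.symm _ hy.2 _ _
  pos _ hy _ hv := hg.pos hy.2 _ (chartDeriv_ne_zero he hy.1 hv)

theorem IsUniformlyEuclidean.exists_upper_bound (hg : IsUniformlyEuclidean g S)
    {e : OpenPartialHomeomorph M (EuclideanSpace ℝ (Fin n))}
    (he : e ∈ IsManifold.maximalAtlas (𝓡 n) ∞ M) {p : Euc n} (hp : p ∈ e.target) :
    ∃ C > 0, ∀ᶠ y in 𝓝 p, y ∈ e.target ∧ (e.symm y ∉ S →
      ∀ v, metricForm g e y v v ≤ C ^ 2 * ‖v‖ ^ 2) := by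
  obtain ⟨gbar, Λ, hΛ, hb⟩ := hg.comparable
  have h0 := (gbar.contMDiff.contMDiffOn (s := univ))
  -- The background metric is itself uniformly Euclidean, with empty singular set and comparison
  -- constant 1, so the local bounds for smooth metrics apply to it even at points of S.
  have hbar : IsUniformlyEuclidean (gbar.inner : BilinField n M) (∅ : Set M) :=
    ⟨fun x _ => gbar.symm x, by simpa using h0, gbar, 1, one_pos, fun x _ v => by simp⟩
  have hp' : p ∈ chartDomain e (∅ : Set M) := ⟨hp, by simp⟩
  obtain ⟨c, C, hc, hC, hev⟩ := exists_norm_bounds (hbar.isMetricOn isClosed_empty he) hp'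
  refine ⟨Real.sqrt Λ * C, by positivity, ?_⟩
  filter_upwards [hev, e.open_target.mem_nhds hp] with y hy hyt
  refine ⟨hyt, fun hyS v => ?_⟩
  rw [mul_pow, Real.sq_sqrt hΛ.le, mul_assoc]
  exact ((hb _ hyS _).2).trans (mul_le_mul_of_nonneg_left (hy v).2 hΛ.le)

end UniformlyEuclidean

/-! ### Continuity of the distance and closedness of balls -/

section LocalDistance

variable {n : ℕ} {M : Type*} [TopologicalSpace M] [ChartedSpace (EuclideanSpace ℝ (Fin n)) M]
  [IsManifold (𝓡 n) ∞ M] {g : BilinField n M} {S : Set M}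

theorem add_smul_sub_mem_ball {p w w' : Euc n} {R t : ℝ} (hw : w ∈ Metric.ball p R)
    (hw' : w' ∈ Metric.ball p R) (ht : t ∈ Icc (0 : ℝ) 1) :
    w + t • (w' - w) ∈ Metric.ball p R :=
  (convex_ball p R).add_smul_sub_mem hw hw' ht

/-- In a chart, the distance is at most the largest speed along the straight segment. -/
theorem dist_symm_le {e : OpenPartialHomeomorph M (EuclideanSpace ℝ (Fin n))}
    (he : e ∈ IsManifold.maximalAtlas (𝓡 n) ∞ M) {w w' : Euc n} {C : ℝ} (hC : 0 ≤ C)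
    (hseg : ∀ t ∈ Icc (0 : ℝ) 1, w + t • (w' - w) ∈ chartDomain e S)
    (hbound : ∀ t ∈ Icc (0 : ℝ) 1,
      metricForm g e (w + t • (w' - w)) (w' - w) (w' - w) ≤ C ^ 2) :
    dist g S (e.symm w) (e.symm w') ≤ ENNReal.ofReal C := by
  refine dist_le_of_segment he hC (fun t ht => (hseg t ht).1) ?_ fun t ht _ => hbound t ht
  convert! Set.finite_empty
  ext t
  simp only [mem_ofPred_eq, mem_empty_iff_false, iff_false, not_and]
  exact fun ht => (hseg t ht).2

theorem exists_dist_symm_le (hg : IsUniformlyEuclidean g S) (hS : IsClosed S)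
    {e : OpenPartialHomeomorph M (EuclideanSpace ℝ (Fin n))}
    (he : e ∈ IsManifold.maximalAtlas (𝓡 n) ∞ M) {p : Euc n} (hp : p ∈ chartDomain e S) :
    ∃ C > 0, ∃ R > 0, ∀ w ∈ Metric.ball p R, ∀ w' ∈ Metric.ball p R,
      dist g S (e.symm w) (e.symm w') ≤ ENNReal.ofReal (C * ‖w' - w‖) := by
  have hm := hg.isMetricOn hS he
  obtain ⟨c, C, hc, hC, hev⟩ := exists_norm_bounds hm hp
  obtain ⟨R, hR, hball⟩ := Metric.eventually_nhds_iff_ball.1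
    (hev.and (hm.isOpen.mem_nhds hp))
  refine ⟨C, hC, R, hR, fun w hw w' hw' => ?_⟩
  refine dist_symm_le he (by positivity)
    (fun t ht => (hball _ (add_smul_sub_mem_ball hw hw' ht)).2) fun t ht => ?_
  rw [mul_pow]
  exact ((hball _ (add_smul_sub_mem_ball hw hw' ht)).1 _).2

theorem eventually_dist_chart_le (hg : IsUniformlyEuclidean g S) (hS : IsClosed S)
    {x : M} (hx : x ∉ S) {ε : ℝ} (hε : 0 < ε) :
    ∀ᶠ y in 𝓝 x, y ∉ S ∧ dist g S x y ≤ ENNReal.ofReal ε ∧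
      dist g S y x ≤ ENNReal.ofReal ε := by
  set e := chartAt (EuclideanSpace ℝ (Fin n)) x with he
  have hxe : x ∈ e.source := mem_chart_source _ x
  have hp : e x ∈ chartDomain e S := ⟨e.map_source hxe, by simpa [e.left_inv hxe] using hx⟩
  obtain ⟨C, hC, R, hR, hball⟩ := exists_dist_symm_le (g := g) hg hS
    (IsManifold.chart_mem_maximalAtlas x) hp
  have h1 : ∀ᶠ y in 𝓝 x, e y ∈ Metric.ball (e x) (min R (ε / C)) :=
    (e.continuousAt hxe).preimage_mem_nhds (Metric.ball_mem_nhds _ (by positivity))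
  filter_upwards [h1, e.open_source.mem_nhds hxe, hS.isOpen_compl.mem_nhds hx] with y hy hys hyS
  have hy1 : e y ∈ Metric.ball (e x) R := Metric.ball_subset_ball (min_le_left _ _) hy
  have hx1 : e x ∈ Metric.ball (e x) R := Metric.mem_ball_self hR
  have hy2 : ‖e y - e x‖ ≤ ε / C := by
    rw [← dist_eq_norm]
    exact (lt_of_lt_of_le hy (min_le_right _ _)).le
  have h3 : C * ‖e y - e x‖ ≤ ε := by
    rw [le_div_iff₀ hC] at hy2
    linarith
  have h4 := hball _ hx1 _ hy1
  have h5 := hball _ hy1 _ hx1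
  rw [e.left_inv hxe, e.left_inv hys] at h4 h5
  rw [norm_sub_rev] at h5
  exact ⟨hyS, h4.trans (ENNReal.ofReal_le_ofReal h3), h5.trans (ENNReal.ofReal_le_ofReal h3)⟩

/-- At x in S take the chart in which S is cut out by the vanishing of some coordinates. If y is off
S, one of these coordinates is nonzero at y and is scaled by 1 - t along the segment from y to x, so
the segment meets S only at x. It is admissible, and its speed is bounded by the background metric.
-/
theorem eventually_dist_le (hg : IsUniformlyEuclidean g S) (hS : IsClosed S)
    (hemb : IsEmbeddedSubmanifold n S) (x : M) {ε : ℝ} (hε : 0 < ε) :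
    ∀ᶠ y in 𝓝 x, y ∉ S → dist g S y x ≤ ENNReal.ofReal ε := by
  by_cases hx : x ∈ S
  · obtain ⟨k, hk, e, he, hxe, hchart⟩ := hemb x hx
    obtain ⟨C, hC, hev⟩ := hg.exists_upper_bound he (e.map_source hxe)
    obtain ⟨R, hR, hball⟩ := Metric.eventually_nhds_iff_ball.1 hev
    have h1 : ∀ᶠ y in 𝓝 x, e y ∈ Metric.ball (e x) (min R (ε / C)) :=
      (e.continuousAt hxe).preimage_mem_nhds (Metric.ball_mem_nhds _ (by positivity))
    filter_upwards [h1, e.open_source.mem_nhds hxe] with y hy hys hyS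
    have hy1 : e y ∈ Metric.ball (e x) R := Metric.ball_subset_ball (min_le_left _ _) hy
    have hx1 : e x ∈ Metric.ball (e x) R := Metric.mem_ball_self hR
    have hy2 : ‖e x - e y‖ ≤ ε / C := by
      rw [← dist_eq_norm, dist_comm]
      exact (lt_of_lt_of_le hy (min_le_right _ _)).le
    have h3 : C * ‖e x - e y‖ ≤ ε := by
      rw [le_div_iff₀ hC] at hy2
      linarith
    have h4 : dist g S (e.symm (e y)) (e.symm (e x)) ≤ ENNReal.ofReal ε := by
      refine dist_le_of_segment he hε.le
        (fun t ht => (hball _ (add_smul_sub_mem_ball hy1 hx1 ht)).1) ?_ ?_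
      · refine (finite_singleton (1 : ℝ)).subset ?_
        rintro t ⟨ht, htS⟩
        have hmem := (hball _ (add_smul_sub_mem_ball hy1 hx1 ht)).1
        have h5 := (hchart _ (e.map_target hmem)).1 htS
        rw [e.right_inv hmem] at h5
        have h6 := (hchart x hxe).1 hx
        have h7 : ¬ ∀ i : Fin n, k ≤ (i : ℕ) → e y i = 0 := fun h => hyS ((hchart y hys).2 h)
        push Not at h7
        obtain ⟨i, hi, hne⟩ := h7
        have h8 := h5 i hi
        have h9 := h6 i hi
        simp only [PiLp.add_apply, PiLp.smul_apply, PiLp.sub_apply, h9, smul_eq_mul] at h8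
        have h10 : e y i * (1 - t) = 0 := by linarith
        have h11 := (mul_eq_zero.1 h10).resolve_left hne
        simp only [mem_singleton_iff]
        linarith
      · intro t ht htS
        have h5 := (hball _ (add_smul_sub_mem_ball hy1 hx1 ht)).2 htS (e x - e y)
        refine h5.trans ?_
        rw [← mul_pow]
        gcongr
    rwa [e.left_inv hxe, e.left_inv hys] at h4
  · filter_upwards [eventually_dist_chart_le hg hS hx hε] with y hy _ using hy.2.2

/-- Points of the ball near x lie off S and are therefore at small distance from x, even when x is
in S; so x cannot be at distance more than R. In a compact manifold this makes the ball compact,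
which takes the place of the Hopf–Rinow theorem. -/
theorem isClosed_closedBall (hg : IsUniformlyEuclidean g S) (hS : IsClosed S)
    (hemb : IsEmbeddedSubmanifold n S) {q : M} {R : ℝ} (hR : 0 ≤ R)
    (hsub : closedBall g S q R ⊆ Sᶜ) :
    IsClosed (closedBall g S q R) := by
  rw [← isOpen_compl_iff, isOpen_iff_mem_nhds]
  intro x hx
  simp only [mem_compl_iff, closedBall, mem_ofPred_eq, not_le] at hx
  obtain ⟨ε, hε, hε2⟩ : ∃ ε : ℝ, 0 < ε ∧ ENNReal.ofReal (R + ε) < dist g S q x := by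
    obtain ⟨c, hc1, hc2⟩ := ENNReal.lt_iff_exists_nnreal_btwn.1 hx
    refine ⟨c - R, ?_, ?_⟩
    · have := (ENNReal.ofReal_lt_iff_lt_toReal hR (by simp)).1 hc1
      simpa using this
    · simpa using hc2
  filter_upwards [eventually_dist_le hg hS hemb x hε] with y hy hyB
  have h1 := hy (hsub hyB)
  refine absurd hε2 (not_lt.2 ?_)
  rw [ENNReal.ofReal_add hR hε.le]
  exact (dist_triangle g S q y x).trans (add_le_add hyB h1)

theorem mem_nhds_of_dist_lt (hg : IsUniformlyEuclidean g S) (hS : IsClosed S)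
    {q x : M} (hx : x ∉ S) {R : ENNReal} (hR : dist g S q x < R) :
    ∀ᶠ y in 𝓝 x, dist g S q y < R := by
  obtain ⟨ε, hε, hε2⟩ := ENNReal.lt_iff_exists_add_pos_lt.1 hR
  filter_upwards [eventually_dist_chart_le hg hS hx (show 0 < (ε : ℝ) by exact_mod_cast hε)]
    with y hy
  refine lt_of_le_of_lt ((dist_triangle g S q x y).trans (add_le_add_right hy.2.1 _)) ?_
  simpa using hε2

theorem continuousAt_dist (hg : IsUniformlyEuclidean g S) (hS : IsClosed S)
    (z : M) {x : M} (hx : x ∉ S) (hfin : dist g S z x ≠ ⊤) :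
    ContinuousAt (fun y => dist g S z y) x := by
  rw [ContinuousAt, ENNReal.tendsto_nhds hfin]
  intro ε hε
  by_cases hε' : ε = ⊤
  · simp [hε']
  filter_upwards [eventually_dist_chart_le hg hS hx (ENNReal.toReal_pos hε.ne' hε')] with y hy
  rw [ENNReal.ofReal_toReal hε'] at hy
  constructor
  · rw [tsub_le_iff_right]
    exact (dist_triangle g S z y x).trans (add_le_add_right hy.2.2 _)
  · exact (dist_triangle g S z x y).trans (add_le_add_right hy.2.1 _)

end LocalDistance

/-! ### Lower bounds for the distance -/

section LowerBound

variable {n : ℕ} {M : Type*} [TopologicalSpace M] [ChartedSpace (EuclideanSpace ℝ (Fin n)) M]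
  [IsManifold (𝓡 n) ∞ M] {g : BilinField n M} {S : Set M}

/-- A curve of small length starting at `x` stays in a coordinate ball about `x`. -/
theorem mem_ball_of_curveLength_lt [T2Space M]
    {e : OpenPartialHomeomorph M (EuclideanSpace ℝ (Fin n))}
    (he : e ∈ IsManifold.maximalAtlas (𝓡 n) ∞ M) {x : M} (hx : x ∈ e.source) {R c : ℝ}
    (hR : 0 < R) (hc : 0 < c) (hsub : Metric.closedBall (e x) R ⊆ e.target)
    (hbound : ∀ y ∈ Metric.ball (e x) R, ∀ v, c ^ 2 * ‖v‖ ^ 2 ≤ metricForm g e y v v)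
    {γ : ℝ → M} {a b : ℝ} (hγ : IsAdmissible n S γ a b) (ha : γ a = x)
    (hlen : curveLength g γ a b < ENNReal.ofReal (c * R)) :
    ∀ t ∈ Icc a b, γ t ∈ e.source ∧ e (γ t) ∈ Metric.ball (e x) R := by
  set W : Set M := e.source ∩ e ⁻¹' Metric.ball (e x) R with hW
  have hWo : IsOpen W := e.isOpen_inter_preimage Metric.isOpen_ball
  by_contra hcon
  push Not at hcon
  obtain ⟨t₁, ht₁, ht₁'⟩ := hcon
  set T : Set ℝ := Icc a b ∩ γ ⁻¹' Wᶜ with hT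
  have hTc : IsClosed T := hγ.piecewise.continuousOn.preimage_isClosed_of_isClosed isClosed_Icc
    hWo.isClosed_compl
  have hTne : T.Nonempty := ⟨t₁, ht₁, fun h => ht₁' h.1 h.2⟩
  have hTcomp : IsCompact T := isCompact_Icc.of_isClosed_subset hTc inter_subset_left
  -- The first time at which the curve leaves the coordinate ball.
  obtain ⟨s, hsT, hs⟩ := hTcomp.exists_isLeast hTne
  have hbefore : ∀ t ∈ Ico a s, γ t ∈ W := by
    intro t ht
    by_contra h
    exact absurd (hs ⟨⟨ht.1, ht.2.le.trans hsT.1.2⟩, h⟩) (not_le.2 ht.2)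
  have has : a < s := by
    rcases hsT.1.1.eq_or_lt with h | h
    · exfalso
      apply hsT.2
      rw [← h]
      refine ⟨by rw [ha]; exact hx, ?_⟩
      simp only [mem_preimage, ha]
      exact Metric.mem_ball_self hR
    · exact h
  -- The image of a compact coordinate ball is closed in a Hausdorff space. The exit point is thus
  -- still in the chart, at coordinate distance exactly R from the centre.
  have hcompact : IsClosed (e.symm '' Metric.closedBall (e x) R) :=
    ((isCompact_closedBall _ _).image_of_continuousOn
      (e.symm.continuousOn.mono hsub)).isClosed
  have hsmem : γ s ∈ e.symm '' Metric.closedBall (e x) R := by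
    have h1 : ContinuousWithinAt γ (Ico a s) s :=
      (hγ.piecewise.continuousOn s hsT.1).mono
        (fun t ht => ⟨ht.1, ht.2.le.trans hsT.1.2⟩)
    have h2 : s ∈ closure (Ico a s) := by
      rw [closure_Ico has.ne]
      exact ⟨has.le, le_rfl⟩
    refine hcompact.closure_subset_iff.2 ?_ (h1.mem_closure h2 (t := e.symm '' Metric.closedBall (e x) R) ?_)
    · exact subset_rfl
    · intro t ht
      have h3 := hbefore t ht
      exact ⟨e (γ t), Metric.ball_subset_closedBall h3.2, e.left_inv h3.1⟩
  obtain ⟨w, hw, hws⟩ := hsmem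
  have hssrc : γ s ∈ e.source := hws ▸ e.map_target (hsub hw)
  have hew : e (γ s) = w := by rw [← hws, e.right_inv (hsub hw)]
  have hnorm : ‖e (γ s) - e x‖ = R := by
    apply le_antisymm
    · rw [hew]; simpa [dist_eq_norm] using hw
    · by_contra h
      apply hsT.2
      refine ⟨hssrc, ?_⟩
      simpa [dist_eq_norm] using h
  have hsrc : ∀ t ∈ Icc a s, γ t ∈ e.source := by
    intro t ht
    rcases ht.2.eq_or_lt with h | h
    · rw [h]; exact hssrc
    · exact (hbefore t ⟨ht.1, h⟩).1
  have hadm := hγ.mono le_rfl has.le hsT.1.2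
  set u : Euc n := R⁻¹ • (e (γ s) - e x) with hu
  have hu1 : ‖u‖ = 1 := by
    rw [hu, norm_smul, hnorm, norm_inv, Real.norm_of_nonneg hR.le, inv_mul_cancel₀ hR.ne']
  -- Calibration by the unit covector pointing at the exit point: reaching it costs length at least
  -- c R, against `hlen`.
  have hl := abs_sub_le_curveLength (g := g) he hadm.piecewise hsrc (innerSL ℝ u)
    (κ := c⁻¹) (by positivity) ?_
  · rw [← map_sub, ha] at hl
    have h5 : innerSL ℝ u (e (γ s) - e x) = R := by
      have : e (γ s) - e x = R • u := by
        rw [hu, smul_smul, mul_inv_cancel₀ hR.ne', one_smul]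
      rw [this]
      simp [hu1]
    rw [h5, abs_of_pos hR] at hl
    have h6 : curveLength g γ a s ≤ curveLength g γ a b := by
      rw [← curveLength_add g γ has.le hsT.1.2]
      exact le_self_add
    have h7 : ENNReal.ofReal R < ENNReal.ofReal R := by
      calc ENNReal.ofReal R ≤ ENNReal.ofReal c⁻¹ * curveLength g γ a s := hl
        _ ≤ ENNReal.ofReal c⁻¹ * curveLength g γ a b := by gcongr
        _ < ENNReal.ofReal c⁻¹ * ENNReal.ofReal (c * R) := by
          apply ENNReal.mul_lt_mul_right _ ENNReal.ofReal_ne_top hlen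
          simpa using hc
        _ = ENNReal.ofReal R := by
          rw [← ENNReal.ofReal_mul (by positivity)]
          congr 1
          field_simp
    exact lt_irrefl _ h7
  · intro t ht w
    have h3 := hbefore t ⟨ht.1.le, ht.2⟩
    have h4 := hbound _ h3.2 w
    rw [innerSL_apply_apply]
    calc |inner ℝ u w| ≤ ‖u‖ * ‖w‖ := abs_real_inner_le_norm u w
      _ = ‖w‖ := by rw [hu1, one_mul]
      _ = c⁻¹ * (c * ‖w‖) := by field_simp
      _ ≤ c⁻¹ * Real.sqrt (metricForm g e (e (γ t)) w w) := by
        gcongr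
        apply Real.le_sqrt_of_sq_le
        rwa [mul_pow]

/-- Up to a factor 1 + η the distance is at least the length of the coordinate difference, measured
in the metric at x, with one radius for all x near the base point. This sharp constant makes the
energies of fine chains asymptotically correct. -/
theorem exists_metric_le_dist [T2Space M] (hg : IsUniformlyEuclidean g S) (hS : IsClosed S)
    {x₀ : M} (hx₀ : x₀ ∉ S) {e : OpenPartialHomeomorph M (EuclideanSpace ℝ (Fin n))}
    (he : e ∈ IsManifold.maximalAtlas (𝓡 n) ∞ M) (hx₀e : x₀ ∈ e.source) {η : ℝ} (hη : 0 < η) :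
    ∃ κ > 0, ∀ᶠ x in 𝓝 x₀, ∀ y, dist g S x y < ENNReal.ofReal κ →
      y ∈ e.source ∧ ‖e y - e x‖ < η ∧
      Real.sqrt (metricForm g e (e x) (e y - e x) (e y - e x))
        ≤ (1 + η) * (dist g S x y).toReal := by
  have hm := hg.isMetricOn hS he
  have hp : e x₀ ∈ chartDomain e S := ⟨e.map_source hx₀e, by simpa [e.left_inv hx₀e] using hx₀⟩
  obtain ⟨c, C, hc, hC, hev⟩ := exists_norm_bounds hm hp
  obtain ⟨R₁, hR₁, hball₁⟩ := Metric.eventually_nhds_iff_ball.1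
    (hev.and (hm.isOpen.mem_nhds hp))
  obtain ⟨R₂, hR₂, hball₂⟩ := eventually_metric_le hm hp hη
  set R := min (min R₁ R₂ / 2) η / 2 with hRdef
  have hR : 0 < R := by positivity
  have hRη : R < η := by
    have := min_le_right (min R₁ R₂ / 2) η
    linarith
  have hR12 : 2 * R ≤ min R₁ R₂ / 2 := by
    have := min_le_left (min R₁ R₂ / 2) η
    linarith
  have hmin : 0 < min R₁ R₂ := by positivity
  refine ⟨c * R, by positivity, ?_⟩
  filter_upwards [(e.continuousAt hx₀e).preimage_mem_nhds (Metric.ball_mem_nhds _ hR),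
    e.open_source.mem_nhds hx₀e] with x hx hxs y hxy
  have hbig : ∀ w ∈ Metric.closedBall (e x) R, w ∈ Metric.ball (e x₀) R₁ ∧
      w ∈ Metric.ball (e x₀) R₂ := by
    intro w hw
    have h1 : Dist.dist w (e x₀) < min R₁ R₂ := by
      have h2 := _root_.dist_triangle w (e x) (e x₀)
      have h3 : Dist.dist w (e x) ≤ R := hw
      have h4 : Dist.dist (e x) (e x₀) < R := hx
      linarith
    exact ⟨lt_of_lt_of_le h1 (min_le_left _ _), lt_of_lt_of_le h1 (min_le_right _ _)⟩
  have key : ∀ L : ENNReal, dist g S x y < L → L ≤ ENNReal.ofReal (c * R) →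
      y ∈ e.source ∧ ‖e y - e x‖ < η ∧
      ENNReal.ofReal (Real.sqrt (metricForm g e (e x) (e y - e x) (e y - e x)))
        ≤ ENNReal.ofReal (1 + η) * L := by
    intro L hL hLR
    obtain ⟨a, b, γ, hγ, ha, hb, hlen⟩ := exists_isAdmissible_of_dist_lt hL
    have hstay := mem_ball_of_curveLength_lt he hxs hR hc
      (fun w hw => (hball₁ w (hbig w hw).1).2.1)
      (fun w hw => fun v => ((hball₁ w (hbig w (Metric.ball_subset_closedBall hw)).1).1 v).1)
      hγ ha (hlen.trans_le hLR)
    have hyb := hstay b ⟨hγ.le, le_rfl⟩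
    rw [hb] at hyb
    have hxx : e x ∈ Metric.closedBall (e x) R := Metric.mem_closedBall_self hR.le
    have hxU : e x ∈ chartDomain e S := (hball₁ _ (hbig _ hxx).1).2
    refine ⟨hyb.1, ?_, ?_⟩
    · rw [← dist_eq_norm]
      exact lt_trans hyb.2 hRη
    set Δ := e y - e x with hΔ
    set N := Real.sqrt (metricForm g e (e x) Δ Δ) with hN
    by_cases hN0 : N = 0
    · rw [hN0]; simp
    have hNpos : 0 < N := lt_of_le_of_ne (Real.sqrt_nonneg _) (Ne.symm hN0)
    have hNsq : N * N = metricForm g e (e x) Δ Δ := Real.mul_self_sqrt (hm.nonneg hxU _)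
    -- The calibrating form is g(Δ, ·) at x. By Cauchy–Schwarz and the comparison of nearby metrics
    -- it is N(1 + η)-Lipschitz along the curve, while it changes by N² in total.
    have hl := abs_sub_le_curveLength (g := g) he hγ.piecewise (fun t ht => (hstay t ht).1)
      (metricForm g e (e x) Δ) (κ := N * (1 + η)) (by positivity) ?_
    · rw [ha, hb, ← map_sub, ← hΔ, ← hNsq, abs_of_nonneg (by positivity)] at hl
      have h8 : ENNReal.ofReal N * ENNReal.ofReal N
          ≤ ENNReal.ofReal N * (ENNReal.ofReal (1 + η) * L) := by
        rw [← ENNReal.ofReal_mul hNpos.le]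
        refine hl.trans ?_
        rw [ENNReal.ofReal_mul hNpos.le, mul_assoc]
        gcongr
      refine (ENNReal.mul_le_mul_iff_right ?_ ENNReal.ofReal_ne_top).1 h8
      simpa using hNpos
    · intro t ht w
      have h9 := hbig _ (Metric.ball_subset_closedBall (hstay t (Ioo_subset_Icc_self ht)).2)
      have h10 := hball₂ _ (hbig _ hxx).2 _ h9.2 w
      calc |metricForm g e (e x) Δ w|
          ≤ N * Real.sqrt (metricForm g e (e x) w w) := hm.abs_le_sqrt_mul_sqrt hxU _ _
        _ ≤ N * ((1 + η) * Real.sqrt (metricForm g e (e (γ t)) w w)) := by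
          gcongr
          rw [← Real.sqrt_sq (show 0 ≤ 1 + η by positivity), ← Real.sqrt_mul (by positivity)]
          exact Real.sqrt_le_sqrt h10
        _ = _ := by ring
  have h1 := key _ hxy le_rfl
  refine ⟨h1.1, h1.2.1, ?_⟩
  have hfin : dist g S x y ≠ ⊤ := (lt_of_lt_of_le hxy le_top).ne
  have h2 : ENNReal.ofReal (Real.sqrt (metricForm g e (e x) (e y - e x) (e y - e x)))
      ≤ ENNReal.ofReal (1 + η) * dist g S x y := by
    have hne : ENNReal.ofReal (1 + η) ≠ 0 := by
      simp only [ne_eq, ENNReal.ofReal_eq_zero, not_le]; positivity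
    rw [mul_comm, ← ENNReal.div_le_iff hne ENNReal.ofReal_ne_top]
    refine le_of_forall_gt_imp_ge_of_dense fun L hL => ?_
    rw [ENNReal.div_le_iff hne ENNReal.ofReal_ne_top, mul_comm]
    rcases le_total L (ENNReal.ofReal (c * R)) with h | h
    · exact (key L hL h).2.2
    · refine (key _ hxy le_rfl).2.2.trans ?_
      gcongr
  have h3 := ENNReal.toReal_mono (ENNReal.mul_ne_top ENNReal.ofReal_ne_top hfin) h2
  rwa [ENNReal.toReal_ofReal (Real.sqrt_nonneg _), ENNReal.toReal_mul,
    ENNReal.toReal_ofReal (by positivity)] at h3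

end LowerBound

/-! ### Points at prescribed distances and equidistant chains -/

section Chains

variable {n : ℕ} {M : Type*} [TopologicalSpace M] [ChartedSpace (EuclideanSpace ℝ (Fin n)) M]
  [IsManifold (𝓡 n) ∞ M] [T2Space M] [CompactSpace M] {g : BilinField n M} {S : Set M}

/-- On a nearly shortest curve from x to y the distance from x takes the value t, by the
intermediate value theorem. These points lie in a compact ball that avoids S, so they accumulate at
a point where the error has disappeared. -/
theorem exists_between (hg : IsUniformlyEuclidean g S) (hS : IsClosed S)
    (hemb : IsEmbeddedSubmanifold n S) {q : M} {R : ℝ} (hR : 0 ≤ R)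
    (hsub : closedBall g S q R ⊆ Sᶜ) {x y : M}
    (hxy : dist g S q x + dist g S x y < ENNReal.ofReal R) {t : ENNReal}
    (ht : t ≤ dist g S x y) :
    ∃ z, dist g S x z = t ∧ dist g S z y + t = dist g S x y := by
  set D := dist g S x y with hD
  have hDfin : D ≠ ⊤ := (lt_of_le_of_lt le_add_self (hxy.trans_le le_top)).ne
  have hqfin : dist g S q x ≠ ⊤ := (lt_of_le_of_lt le_self_add (hxy.trans_le le_top)).ne
  have htfin : t ≠ ⊤ := ne_top_of_le_ne_top hDfin ht
  have step : ∀ ε : ENNReal, 0 < ε → ∃ z ∈ closedBall g S q R, dist g S x z = t ∧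
      dist g S z y + t ≤ D + ε := by
    intro ε hε
    -- The second bound on the length keeps the whole curve inside the closed ball of radius R,
    -- hence off S, where the distance is continuous.
    have hlt : D < min (D + ε) (ENNReal.ofReal R - dist g S q x) := by
      apply lt_min (ENNReal.lt_add_right hDfin hε.ne')
      exact lt_tsub_iff_left.2 hxy
    obtain ⟨a, b, γ, hγ, ha, hb, hlen⟩ := exists_isAdmissible_of_dist_lt hlt
    have hL1 : curveLength g γ a b ≤ D + ε := (hlen.trans_le (min_le_left _ _)).le
    have hL2 : dist g S q x + curveLength g γ a b ≤ ENNReal.ofReal R := by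
      have h1 := (hlen.trans_le (min_le_right _ _)).le
      calc dist g S q x + curveLength g γ a b
          ≤ dist g S q x + (ENNReal.ofReal R - dist g S q x) := add_le_add_right h1 _
        _ = ENNReal.ofReal R := add_tsub_cancel_of_le (le_self_add.trans hxy.le)
    have hLfin : curveLength g γ a b ≠ ⊤ :=
      ne_top_of_le_ne_top ENNReal.ofReal_ne_top (le_add_self.trans hL2)
    have hdx : ∀ τ ∈ Icc a b, dist g S x (γ τ) ≤ curveLength g γ a b := by
      intro τ hτ
      rw [← ha]
      refine (hγ.mono le_rfl hτ.1 hτ.2).dist_le.trans ?_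
      rw [← curveLength_add g γ hτ.1 hτ.2]
      exact le_self_add
    have hball : ∀ τ ∈ Icc a b, γ τ ∈ closedBall g S q R := by
      intro τ hτ
      exact (dist_triangle g S q x _).trans ((add_le_add_right (hdx τ hτ) _).trans hL2)
    have hcont : ContinuousOn (fun τ => dist g S x (γ τ)) (Icc a b) := by
      intro τ hτ
      have h1 := continuousAt_dist hg hS x (hsub (hball τ hτ))
        (ne_top_of_le_ne_top hLfin (hdx τ hτ))
      exact ContinuousAt.comp_continuousWithinAt (f := γ) (g := fun z => dist g S x z) h1
        (hγ.piecewise.continuousOn τ hτ)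
    have hivt := intermediate_value_Icc hγ.le hcont
    simp only [ha, hb, dist_self] at hivt
    obtain ⟨τ, hτ, hτt⟩ := hivt ⟨zero_le, ht⟩
    refine ⟨γ τ, hball τ hτ, hτt, ?_⟩
    have h2 : dist g S (γ τ) y ≤ curveLength g γ τ b := by
      rw [← hb]
      exact (hγ.mono hτ.1 hτ.2 le_rfl).dist_le
    have h3 : t ≤ curveLength g γ a τ := by
      rw [← hτt]
      simpa only [ha] using (hγ.mono le_rfl hτ.1 hτ.2).dist_le (g := g)
    calc dist g S (γ τ) y + t ≤ curveLength g γ τ b + curveLength g γ a τ := add_le_add h2 h3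
      _ = curveLength g γ a b := by rw [add_comm, curveLength_add g γ hτ.1 hτ.2]
      _ ≤ D + ε := hL1
  have hpos : ∀ k : ℕ, (0 : ENNReal) < ((k : ENNReal) + 1)⁻¹ := by
    intro k
    simp only [ENNReal.inv_pos]
    exact ENNReal.add_ne_top.2 ⟨ENNReal.natCast_ne_top k, ENNReal.one_ne_top⟩
  choose z hzB hzx hzy using fun k : ℕ => step _ (hpos k)
  have hcomp : IsCompact (closedBall g S q R) := (isClosed_closedBall hg hS hemb hR hsub).isCompact
  obtain ⟨w, hw, hcl⟩ := hcomp.exists_mapClusterPt (f := atTop) (u := z)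
    (tendsto_principal.2 (Eventually.of_forall hzB))
  have hlim : Tendsto (fun k : ℕ => ((k : ENNReal) + 1)⁻¹) atTop (𝓝 0) := by
    have := (ENNReal.tendsto_inv_nat_nhds_zero).comp (tendsto_add_atTop_nat 1)
    simpa [Function.comp_def] using this
  have happrox : ∀ ε : NNReal, 0 < ε → dist g S x w ≤ t + ε ∧
      dist g S w y + t ≤ D + ε + ε := by
    intro ε hε
    have h1 := eventually_dist_chart_le hg hS (hsub hw) (show 0 < (ε : ℝ) by exact_mod_cast hε)
    have h2 := hcl.frequently h1
    have h3 : ∀ᶠ k : ℕ in atTop, ((k : ENNReal) + 1)⁻¹ ≤ ε :=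
      (hlim.eventually_lt_const (by exact_mod_cast hε)).mono fun _ h => h.le
    obtain ⟨k, hk, hk'⟩ := (h2.and_eventually h3).exists
    simp only [ENNReal.ofReal_coe_nnreal] at hk
    constructor
    · calc dist g S x w ≤ dist g S x (z k) + dist g S (z k) w := dist_triangle _ _ _ _ _
        _ ≤ t + ε := add_le_add (hzx k).le hk.2.2
    · calc dist g S w y + t ≤ dist g S w (z k) + dist g S (z k) y + t :=
          add_le_add_left (dist_triangle _ _ _ _ _) _
        _ = dist g S w (z k) + (dist g S (z k) y + t) := add_assoc _ _ _
        _ ≤ ε + (D + ε) := add_le_add hk.2.1 ((hzy k).trans (add_le_add_right hk' _))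
        _ = _ := by ring
  have hA : dist g S x w ≤ t := ENNReal.le_of_forall_pos_le_add fun ε hε _ => (happrox ε hε).1
  have hB : dist g S w y + t ≤ D := by
    apply ENNReal.le_of_forall_pos_le_add
    intro ε hε _
    have h := (happrox (ε / 2) (by positivity)).2
    rw [add_assoc, ← ENNReal.coe_add, add_halves] at h
    exact h
  have hC : D ≤ dist g S x w + dist g S w y := dist_triangle _ _ _ _ _
  have hwfin : dist g S w y ≠ ⊤ := ne_top_of_le_ne_top hDfin (le_self_add.trans hB)
  -- The triangle inequality through w turns both approximate inequalities into equalities.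
  refine ⟨w, le_antisymm hA ?_, le_antisymm hB ?_⟩
  · have h1 := hB.trans hC
    rw [add_comm (dist g S x w)] at h1
    exact (ENNReal.add_le_add_iff_left hwfin).1 h1
  · rw [add_comm (dist g S w y)]
    exact hC.trans (add_le_add_left hA _)

/-- Equidistant points on a shortest path from `x` to `y`. -/
theorem exists_chain (hg : IsUniformlyEuclidean g S) (hS : IsClosed S)
    (hemb : IsEmbeddedSubmanifold n S) {q : M} {R : ℝ} (hR : 0 ≤ R)
    (hsub : closedBall g S q R ⊆ Sᶜ) {h : ENNReal} {y : M} (m : ℕ) {x : M}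
    (hxy : dist g S q x + dist g S x y < ENNReal.ofReal R)
    (hm : dist g S x y = (m + 1 : ℕ) * h) :
    ∃ p : ℕ → M, p 0 = x ∧ p (m + 1) = y ∧ ∀ k ≤ m, dist g S (p k) (p (k + 1)) = h := by
  induction m generalizing x with
  | zero =>
    refine ⟨fun k => if k = 0 then x else y, by simp, by simp, fun k hk => ?_⟩
    obtain rfl : k = 0 := by omega
    simpa using hm
  | succ m ih =>
    have hh : h ≠ ⊤ := by
      rintro rfl
      rw [hm, ENNReal.mul_top (by simp)] at hxy
      simp at hxy
    have ht : h ≤ dist g S x y := by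
      rw [hm]
      push_cast
      calc h = 1 * h := (one_mul h).symm
        _ ≤ _ := by gcongr; exact le_add_self
    obtain ⟨z, hz1, hz2⟩ := exists_between hg hS hemb hR hsub hxy ht
    have hz3 : dist g S z y = (m + 1 : ℕ) * h := by
      rw [hm] at hz2
      have : ((m + 1 + 1 : ℕ) : ENNReal) * h = (m + 1 : ℕ) * h + h := by push_cast; ring
      rw [this] at hz2
      exact (ENNReal.add_left_inj hh).1 hz2
    -- The sum of the distances from q to the current point and on to y does not increase along the
    -- chain, so the induction stays in the ball.
    have hz4 : dist g S q z + dist g S z y < ENNReal.ofReal R := by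
      refine lt_of_le_of_lt ?_ hxy
      rw [← hz2]
      calc dist g S q z + dist g S z y ≤ (dist g S q x + dist g S x z) + dist g S z y :=
            add_le_add_left (dist_triangle _ _ _ _ _) _
        _ = dist g S q x + (dist g S z y + h) := by rw [hz1]; ring
    obtain ⟨p, hp0, hpm, hp⟩ := ih hz4 hz3
    refine ⟨fun k => if k = 0 then x else p (k - 1), by simp, by simpa using hpm, ?_⟩
    intro k hk
    rcases k with _ | k
    · simp [hp0, hz1]
    · simpa using hp k (by omega)

theorem dist_chain_le {h : ENNReal} {p : ℕ → M} {m : ℕ}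
    (hp : ∀ k < m, dist g S (p k) (p (k + 1)) = h) : ∀ k ≤ m, dist g S (p 0) (p k) ≤ k * h := by
  intro k
  induction k with
  | zero => intro _; simp [dist_self]
  | succ k ih =>
    intro hk
    refine (dist_triangle g S _ (p k) _).trans ?_
    rw [hp k (by omega)]
    push_cast
    rw [add_mul, one_mul]
    exact add_le_add_left (ih (by omega)) _

end Chains

/-! ### Christoffel symbols and the Levi-Civita connection in coordinates -/

section Christoffel

variable {n : ℕ} {G : Euc n → Form n} {U : Set (Euc n)}

/-- The standard basis vector `eᵢ`. -/
abbrev stdVec (i : Fin n) : Euc n := EuclideanSpace.single i (1 : ℝ)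

/-- The matrix of a field of bilinear forms. -/
def matOf (G : Euc n → Form n) (y : Euc n) : Matrix (Fin n) (Fin n) ℝ :=
  Matrix.of fun i j => G y (stdVec i) (stdVec j)

theorem metricInChart_eq_matOf {M : Type*} [TopologicalSpace M]
    [ChartedSpace (EuclideanSpace ℝ (Fin n)) M] (g : BilinField n M)
    (e : OpenPartialHomeomorph M (EuclideanSpace ℝ (Fin n))) :
    metricInChart g e = matOf (metricForm g e) := rfl

theorem form_eq_sum (B : Form n) (a b : Euc n) :
    B a b = ∑ i, ∑ j, B (stdVec i) (stdVec j) * a i * b j := by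
  conv_lhs => rw [bilin_eq_sum B]
  simp [mul_assoc]

theorem partialDeriv_eq {f : Euc n → ℝ} (i : Fin n) (y : Euc n) :
    partialDeriv i f y = fderiv ℝ f y (stdVec i) := rfl

theorem ContDiffAt.partialDeriv {f : Euc n → ℝ} {y : Euc n} (hf : ContDiffAt ℝ ∞ f y)
    (i : Fin n) : ContDiffAt ℝ ∞ (partialDeriv i f) y :=
  (hf.fderiv_right (m := ∞) (by simp)).clm_apply contDiffAt_const

theorem contDiffAt_det {m : ℕ} {k : WithTop ℕ∞} {A : Euc n → Matrix (Fin m) (Fin m) ℝ} {y : Euc n}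
    (hA : ∀ i j, ContDiffAt ℝ k (fun z => A z i j) y) :
    ContDiffAt ℝ k (fun z => (A z).det) y := by
  simp only [Matrix.det_apply']
  refine ContDiffAt.sum fun σ _ => contDiffAt_const.mul ?_
  exact contDiffAt_prod fun i _ => hA _ _

/-- By Cramer's rule the entries of the inverse are polynomials in the entries divided by the
determinant. -/
theorem contDiffAt_inv {m : ℕ} {k : WithTop ℕ∞} {A : Euc n → Matrix (Fin m) (Fin m) ℝ} {y : Euc n}
    (hA : ∀ i j, ContDiffAt ℝ k (fun z => A z i j) y) (hdet : (A y).det ≠ 0) (i j : Fin m) :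
    ContDiffAt ℝ k (fun z => (A z)⁻¹ i j) y := by
  simp only [Matrix.inv_def, Matrix.smul_apply, Ring.inverse_eq_inv', smul_eq_mul,
    Matrix.adjugate_apply]
  refine ((contDiffAt_det hA).inv hdet).mul (contDiffAt_det fun i' j' => ?_)
  by_cases h : i' = j
  · subst h
    simp only [Matrix.updateRow_self]
    exact contDiffAt_const
  · simp only [Matrix.updateRow_ne h]
    exact hA _ _

theorem IsMetricOn.det_ne_zero (h : IsMetricOn G U) {y : Euc n} (hy : y ∈ U) :
    (matOf G y).det ≠ 0 := by
  intro h0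
  obtain ⟨v, hv, hv0⟩ := Matrix.exists_mulVec_eq_zero_iff.2 h0
  set w : Euc n := WithLp.toLp 2 v with hw
  have hw0 : w ≠ 0 := by
    intro h1
    apply hv
    ext i
    have := congrArg (fun z : Euc n => z i) h1
    simpa [hw] using this
  have h1 := h.pos y hy w hw0
  have h2 : G y w w = ∑ i, w i * (matOf G y).mulVec v i := by
    rw [form_eq_sum]
    refine Finset.sum_congr rfl fun i _ => ?_
    simp only [Matrix.mulVec, dotProduct, Finset.mul_sum, matOf, Matrix.of_apply, hw]
    exact Finset.sum_congr rfl fun j _ => by ring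
  rw [h2, hv0] at h1
  simp at h1

theorem IsMetricOn.contDiffAt_entry (h : IsMetricOn G U) {y : Euc n} (hy : y ∈ U) (i j : Fin n) :
    ContDiffAt ℝ ∞ (fun z => matOf G z i j) y :=
  ((h.contDiffAt hy).clm_apply contDiffAt_const).clm_apply contDiffAt_const

theorem IsMetricOn.contDiffAt_christoffel (h : IsMetricOn G U) {y : Euc n} (hy : y ∈ U)
    (k i j : Fin n) : ContDiffAt ℝ ∞ (christoffel (matOf G) k i j) y := by
  have h1 : ∀ i j l, ContDiffAt ℝ ∞ (partialDeriv l fun z => matOf G z i j) y :=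
    fun i j l => ContDiffAt.partialDeriv (h.contDiffAt_entry hy i j) l
  unfold christoffel
  refine contDiffAt_const.mul (ContDiffAt.sum fun l _ => ?_)
  refine ContDiffAt.mul (contDiffAt_inv (fun i j => h.contDiffAt_entry hy i j)
    (h.det_ne_zero hy) _ _) ?_
  exact ((h1 _ _ _).add (h1 _ _ _)).sub (h1 _ _ _)

/-- The vector-valued form `(a, b) ↦ aᵢ bⱼ eₖ`. -/
def coordVecForm (k i j : Fin n) : Euc n →L[ℝ] Euc n →L[ℝ] Euc n :=
  (EuclideanSpace.proj i : Euc n →L[ℝ] ℝ).smulRight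
    ((EuclideanSpace.proj j : Euc n →L[ℝ] ℝ).smulRight (stdVec k))

@[simp] theorem coordVecForm_apply (k i j l : Fin n) (a b : Euc n) :
    coordVecForm k i j a b l = a i * b j * (if l = k then 1 else 0) := by
  simp [coordVecForm]

/-- The Christoffel symbols as a field of vector-valued bilinear forms. -/
def chr (G : Euc n → Form n) (y : Euc n) : Euc n →L[ℝ] Euc n →L[ℝ] Euc n :=
  ∑ k, ∑ i, ∑ j, christoffel (matOf G) k i j y • coordVecForm k i j

theorem chr_apply (G : Euc n → Form n) (y a b : Euc n) (k : Fin n) :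
    chr G y a b k = ∑ i, ∑ j, christoffel (matOf G) k i j y * (a i * b j) := by
  simp [chr, sum_apply, Finset.sum_ite_eq]

theorem IsMetricOn.contDiffAt_chr (h : IsMetricOn G U) {y : Euc n} (hy : y ∈ U) :
    ContDiffAt ℝ ∞ (chr G) y := by
  unfold chr
  refine ContDiffAt.sum fun k _ => ContDiffAt.sum fun i _ => ContDiffAt.sum fun j _ => ?_
  exact (h.contDiffAt_christoffel hy k i j).smul contDiffAt_const

theorem christoffel_symm (h : IsMetricOn G U) {y : Euc n} (hy : y ∈ U) (k i j : Fin n) :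
    christoffel (matOf G) k i j y = christoffel (matOf G) k j i y := by
  unfold christoffel
  have h1 : ∀ l, partialDeriv l (fun z => matOf G z i j) y
      = partialDeriv l (fun z => matOf G z j i) y := by
    intro l
    have : (fun z => matOf G z i j) =ᶠ[𝓝 y] fun z => matOf G z j i := by
      filter_upwards [h.isOpen.mem_nhds hy] with z hz using h.symm z hz _ _
    rw [partialDeriv, partialDeriv, this.fderiv_eq]
  congr 1
  refine Finset.sum_congr rfl fun l _ => ?_
  rw [h1 l]
  ring

theorem IsMetricOn.chr_symm (h : IsMetricOn G U) {y : Euc n} (hy : y ∈ U) (a b : Euc n) :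
    chr G y a b = chr G y b a := by
  ext k
  rw [chr_apply, chr_apply, Finset.sum_comm]
  refine Finset.sum_congr rfl fun i _ => Finset.sum_congr rfl fun j _ => ?_
  rw [christoffel_symm h hy]
  ring

theorem IsMetricOn.fderiv_entry (h : IsMetricOn G U) {y : Euc n} (hy : y ∈ U) (a b c : Euc n) :
    fderiv ℝ (fun z => G z b c) y a = fderiv ℝ G y a b c := by
  have h1 : HasFDerivAt G (fderiv ℝ G y) y :=
    ((h.contDiffAt hy).differentiableAt (by simp)).hasFDerivAt
  have h2 := (h1.clm_apply (hasFDerivAt_const b y)).clm_apply (hasFDerivAt_const c y)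
  rw [h2.fderiv]
  simp

theorem IsMetricOn.fderiv_symm (h : IsMetricOn G U) {y : Euc n} (hy : y ∈ U) (a b c : Euc n) :
    fderiv ℝ G y a b c = fderiv ℝ G y a c b := by
  rw [← h.fderiv_entry hy, ← h.fderiv_entry hy]
  have : (fun z => G z b c) =ᶠ[𝓝 y] fun z => G z c b := by
    filter_upwards [h.isOpen.mem_nhds hy] with z hz using h.symm z hz _ _
  rw [this.fderiv_eq]

/-- The Christoffel symbols are defined by applying the inverse matrix to the Koszul expression;
contracting with the metric undoes this. -/
theorem koszul_std (h : IsMetricOn G U) {y : Euc n} (hy : y ∈ U) (i j l : Fin n) :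
    2 * G y (stdVec l) (chr G y (stdVec i) (stdVec j)) =
      fderiv ℝ G y (stdVec i) (stdVec j) (stdVec l)
      + fderiv ℝ G y (stdVec j) (stdVec i) (stdVec l)
      - fderiv ℝ G y (stdVec l) (stdVec i) (stdVec j) := by
  set T : Fin n → ℝ := fun l => fderiv ℝ G y (stdVec i) (stdVec j) (stdVec l)
      + fderiv ℝ G y (stdVec j) (stdVec i) (stdVec l)
      - fderiv ℝ G y (stdVec l) (stdVec i) (stdVec j) with hT
  have h1 : ∀ k, christoffel (matOf G) k i j y = 1 / 2 * (matOf G y)⁻¹.mulVec T k := by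
    intro k
    simp only [christoffel, Matrix.mulVec, dotProduct, hT, ← h.fderiv_entry hy]
    rfl
  have h2 : ∀ k, chr G y (stdVec i) (stdVec j) k = christoffel (matOf G) k i j y := by
    intro k
    rw [chr_apply]
    simp
  have h3 : G y (stdVec l) (chr G y (stdVec i) (stdVec j))
      = ∑ k, matOf G y l k * christoffel (matOf G) k i j y := by
    conv_lhs => rw [sum_single (chr G y (stdVec i) (stdVec j))]
    simp only [map_sum, map_smul, smul_eq_mul, h2]
    exact Finset.sum_congr rfl fun k _ => mul_comm _ _
  have h4 : (matOf G y).mulVec ((matOf G y)⁻¹.mulVec T) l = T l := by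
    rw [Matrix.mulVec_mulVec, Matrix.mul_nonsing_inv _ (isUnit_iff_ne_zero.2 (h.det_ne_zero hy)),
      Matrix.one_mulVec]
  change _ = T l
  rw [h3, ← h4, Matrix.mulVec, dotProduct, Finset.mul_sum]
  refine Finset.sum_congr rfl fun k _ => ?_
  rw [h1]
  ring

theorem trilin_eq_sum (T : Euc n →L[ℝ] Form n) (a b c : Euc n) :
    T a b c = ∑ i, ∑ j, ∑ l, a i * b j * c l * T (stdVec i) (stdVec j) (stdVec l) := by
  conv_lhs => rw [sum_single a, sum_single b, sum_single c]
  simp only [map_sum, map_smul, sum_apply, smul_apply, smul_eq_mul, Finset.mul_sum]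
  rw [Finset.sum_comm]
  refine (Finset.sum_congr rfl fun i _ => Finset.sum_comm).trans ?_
  rw [Finset.sum_comm]
  refine Finset.sum_congr rfl fun i _ => Finset.sum_congr rfl fun j _ =>
    Finset.sum_congr rfl fun l _ => ?_
  ring

theorem IsMetricOn.koszul (h : IsMetricOn G U) {y : Euc n} (hy : y ∈ U) (a b c : Euc n) :
    2 * G y c (chr G y a b) =
      fderiv ℝ G y a b c + fderiv ℝ G y b a c - fderiv ℝ G y c a b := by
  have key : ∀ a b c : Euc n, G y c (chr G y a b) = ∑ i, ∑ j, ∑ l, a i * b j * c l *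
      G y (stdVec l) (chr G y (stdVec i) (stdVec j)) := by
    intro a b c
    let T : Euc n →L[ℝ] Euc n →L[ℝ] Euc n →L[ℝ] ℝ :=
      (ContinuousLinearMap.compL ℝ (Euc n) (Euc n) (Euc n →L[ℝ] ℝ) (G y).flip).comp (chr G y)
    exact trilin_eq_sum T a b c
  rw [key, trilin_eq_sum _ a b c, trilin_eq_sum _ b a c, trilin_eq_sum _ c a b]
  have e1 : ∀ F : Fin n → Fin n → Fin n → ℝ, ∑ j, ∑ i, ∑ l, F j i l = ∑ i, ∑ j, ∑ l, F j i l :=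
    fun F => Finset.sum_comm
  have e2 : ∀ F : Fin n → Fin n → Fin n → ℝ, ∑ l, ∑ i, ∑ j, F l i j = ∑ i, ∑ j, ∑ l, F l i j := by
    intro F
    rw [Finset.sum_comm]
    exact Finset.sum_congr rfl fun i _ => Finset.sum_comm
  rw [e1 fun j i l => b j * a i * c l * _, e2 fun l i j => c l * a i * b j * _]
  simp only [Finset.mul_sum, ← Finset.sum_add_distrib, ← Finset.sum_sub_distrib]
  refine Finset.sum_congr rfl fun i _ => Finset.sum_congr rfl fun j _ =>
    Finset.sum_congr rfl fun l _ => ?_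
  have := koszul_std h hy i j l
  linear_combination (a i * b j * c l) * this

/-- Metric compatibility of the Levi-Civita connection. -/
theorem IsMetricOn.fderiv_eq (h : IsMetricOn G U) {y : Euc n} (hy : y ∈ U) (a b c : Euc n) :
    fderiv ℝ G y a b c = G y (chr G y a b) c + G y b (chr G y a c) := by
  have h1 := h.koszul hy a b c
  have h2 := h.koszul hy a c b
  rw [h.symm y hy _ c]
  rw [h.fderiv_symm hy a c b] at h2
  linarith [h.fderiv_symm hy c a b, h.fderiv_symm hy b a c]

/-- The curvature `R(a, b) c`. -/
def curv (G : Euc n → Form n) (y a b c : Euc n) : Euc n :=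
  fderiv ℝ (chr G) y a b c - fderiv ℝ (chr G) y b a c
    + chr G y a (chr G y b c) - chr G y b (chr G y a c)

end Christoffel

/-! ### Curvature, its antisymmetry and its trace -/

section Curvature

variable {n : ℕ} {G : Euc n → Form n} {U : Set (Euc n)}

theorem IsMetricOn.hasFDerivAt (h : IsMetricOn G U) {y : Euc n} (hy : y ∈ U) :
    HasFDerivAt G (fderiv ℝ G y) y :=
  ((h.contDiffAt hy).differentiableAt (by simp)).hasFDerivAt

theorem IsMetricOn.hasFDerivAt_fderiv (h : IsMetricOn G U) {y : Euc n} (hy : y ∈ U) :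
    HasFDerivAt (fderiv ℝ G) (fderiv ℝ (fderiv ℝ G) y) y :=
  (((h.contDiffAt hy).fderiv_right (m := ∞) (by simp)).differentiableAt (by simp)).hasFDerivAt

theorem IsMetricOn.hasFDerivAt_chr (h : IsMetricOn G U) {y : Euc n} (hy : y ∈ U) :
    HasFDerivAt (chr G) (fderiv ℝ (chr G) y) y :=
  ((h.contDiffAt_chr hy).differentiableAt (by simp)).hasFDerivAt

theorem IsMetricOn.fderiv_fderiv_eq (h : IsMetricOn G U) {y : Euc n} (hy : y ∈ U)
    (a b c d : Euc n) :
    fderiv ℝ (fderiv ℝ G) y a b c d =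
      fderiv ℝ G y a (chr G y b c) d + G y (fderiv ℝ (chr G) y a b c) d
      + (fderiv ℝ G y a c (chr G y b d) + G y c (fderiv ℝ (chr G) y a b d)) := by
  have h1 := h.hasFDerivAt hy
  have h2 := h.hasFDerivAt_chr hy
  have cst : ∀ v : Euc n, HasFDerivAt (fun _ : Euc n => v) (0 : Euc n →L[ℝ] Euc n) y := fun v => hasFDerivAt_const v y
  have hL := (((h.hasFDerivAt_fderiv hy).clm_apply (cst b)).clm_apply (cst c)).clm_apply (cst d)
  have hR := ((h1.clm_apply ((h2.clm_apply (cst b)).clm_apply (cst c))).clm_apply (cst d)).add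
    ((h1.clm_apply (cst c)).clm_apply ((h2.clm_apply (cst b)).clm_apply (cst d)))
  have heq : (fun z => fderiv ℝ G z b c d) =ᶠ[𝓝 y]
      fun z => G z (chr G z b c) d + G z c (chr G z b d) := by
    filter_upwards [h.isOpen.mem_nhds hy] with z hz using h.fderiv_eq hz b c d
  have h3 := hL.unique (hR.congr_of_eventuallyEq heq)
  have h4 := congrArg (fun L : Euc n →L[ℝ] ℝ => L a) h3
  simp only [add_apply, ContinuousLinearMap.comp_apply, ContinuousLinearMap.flip_apply,
    zero_apply, map_zero, zero_add] at h4
  rw [h4]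
  ring

theorem IsMetricOn.fderiv_fderiv_symm (h : IsMetricOn G U) {y : Euc n} (hy : y ∈ U)
    (a b : Euc n) : fderiv ℝ (fderiv ℝ G) y a b = fderiv ℝ (fderiv ℝ G) y b a :=
  ((h.contDiffAt hy).isSymmSndFDerivAt (by simpa using WithTop.coe_le_coe.2 (le_top : (2 : ℕ∞) ≤ ⊤))).eq a b

/-- The second derivative of G is symmetric in its two directions. Expressed through the connection,
by differentiating metric compatibility twice, the antisymmetric part is exactly the sum of the two
curvature terms. -/
theorem IsMetricOn.curv_antisymm (h : IsMetricOn G U) {y : Euc n} (hy : y ∈ U)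
    (a b c d : Euc n) : G y (curv G y a b c) d = - G y c (curv G y a b d) := by
  have h1 := h.fderiv_fderiv_eq hy a b c d
  have h2 := h.fderiv_fderiv_eq hy b a c d
  rw [h.fderiv_fderiv_symm hy a b, h2] at h1
  simp only [h.fderiv_eq hy] at h1
  simp only [curv, map_add, map_sub, add_apply, sub_apply]
  linarith

theorem fderiv_chr_apply (h : IsMetricOn G U) {y : Euc n} (hy : y ∈ U) (a b c : Euc n)
    (k : Fin n) : fderiv ℝ (chr G) y a b c k =
      fderiv ℝ (fun z => chr G z b c k) y a := by
  have h2 := ((h.hasFDerivAt_chr hy).clm_apply (hasFDerivAt_const b y)).clm_apply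
    (hasFDerivAt_const c y)
  have h3 := (EuclideanSpace.proj k : Euc n →L[ℝ] ℝ).hasFDerivAt.comp y h2
  have h4 : HasFDerivAt (fun z => chr G z b c k) _ y := h3
  rw [h4.fderiv]
  simp

theorem chr_stdVec (G : Euc n → Form n) (y : Euc n) (i j k : Fin n) :
    chr G y (stdVec i) (stdVec j) k = christoffel (matOf G) k i j y := by
  rw [chr_apply]
  simp

theorem chr_stdVec_left (G : Euc n → Form n) (y : Euc n) (i k : Fin n) (v : Euc n) :
    chr G y (stdVec i) v k = ∑ l, christoffel (matOf G) k i l y * v l := by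
  rw [chr_apply]
  simp

/-- Identifies the coordinate formula, in its sign convention, with the trace of `curv` over the
first slot. -/
theorem ricciCoord_eq (h : IsMetricOn G U) {y : Euc n} (hy : y ∈ U) (i j : Fin n) :
    ricciCoord (matOf G) i j y = ∑ k, curv G y (stdVec k) (stdVec j) (stdVec i) k := by
  have h1 : ∀ l k, partialDeriv l (christoffel (matOf G) k i j) y
      = fderiv ℝ (fun z => chr G z (stdVec j) (stdVec i) k) y (stdVec l) := by
    intro l k
    rw [partialDeriv]
    congr 1
    apply Filter.EventuallyEq.fderiv_eq
    filter_upwards [h.isOpen.mem_nhds hy] with z hz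
    rw [chr_stdVec, christoffel_symm h hz]
  have h2 : ∀ l k, partialDeriv l (christoffel (matOf G) k i k) y
      = fderiv ℝ (fun z => chr G z (stdVec k) (stdVec i) k) y (stdVec l) := by
    intro l k
    rw [partialDeriv]
    congr 1
    apply Filter.EventuallyEq.fderiv_eq
    filter_upwards [h.isOpen.mem_nhds hy] with z hz
    rw [chr_stdVec, christoffel_symm h hz]
  have h5 : ∀ k m l j, chr G y (stdVec k) (chr G y (stdVec m) (stdVec l)) j
      = ∑ a, christoffel (matOf G) j k a y * christoffel (matOf G) a l m y := by
    intro k m l j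
    rw [chr_stdVec_left]
    simp only [chr_stdVec, christoffel_symm h hy _ m l]
  simp only [ricciCoord, curv, PiLp.add_apply, PiLp.sub_apply,
    fderiv_chr_apply h hy, h1, h2, h5, Finset.sum_sub_distrib, Finset.sum_add_distrib]
  ring

theorem IsMetricOn.sum_ricciCoord (h : IsMetricOn G U) {y : Euc n} (hy : y ∈ U) (b : Euc n) :
    ∑ i, ∑ j, ricciCoord (matOf G) i j y * b i * b j = ∑ k, curv G y (stdVec k) b b k := by
  have h1 : ∀ k, curv G y (stdVec k) b b k
      = ∑ i, ∑ j, curv G y (stdVec k) (stdVec j) (stdVec i) k * b i * b j := by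
    intro k
    let B : Euc n →L[ℝ] Euc n →L[ℝ] Euc n :=
      fderiv ℝ (chr G) y (stdVec k) - (fderiv ℝ (chr G) y).flip (stdVec k)
        + (ContinuousLinearMap.compL ℝ (Euc n) (Euc n) (Euc n) (chr G y (stdVec k))).comp (chr G y)
        - ((ContinuousLinearMap.compL ℝ (Euc n) (Euc n) (Euc n)).flip
            (chr G y (stdVec k))).comp (chr G y)
    let B' : Form n := (ContinuousLinearMap.compL ℝ (Euc n) (Euc n) ℝ
      (EuclideanSpace.proj k : Euc n →L[ℝ] ℝ)).comp B
    have hB : ∀ v w, B' v w = curv G y (stdVec k) v w k := fun v w => rfl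
    rw [← hB, form_eq_sum, Finset.sum_comm]
    simp only [hB]
    exact Finset.sum_congr rfl fun i _ => Finset.sum_congr rfl fun j _ => by ring
  simp only [h1, ricciCoord_eq h hy, Finset.sum_mul]
  rw [Finset.sum_comm]
  refine (Finset.sum_congr rfl fun j _ => Finset.sum_comm).trans ?_
  rw [Finset.sum_comm]
  refine Finset.sum_congr rfl fun k _ => Finset.sum_comm

/-- A frame which is orthonormal for the bilinear form `B`. -/
def IsOrthoFrame (B : Form n) (E : Fin n → Euc n) : Prop :=
  ∀ i j, B (E i) (E j) = if i = j then 1 else 0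

theorem IsOrthoFrame.eq_sum {B : Form n} {E : Fin n → Euc n} (hE : IsOrthoFrame B E) (v : Euc n) :
    v = ∑ i, B v (E i) • E i := by
  have hli : LinearIndependent ℝ E := by
    rw [Fintype.linearIndependent_iff]
    intro c hc j
    have h1 := congrArg (fun w => B w (E j)) hc
    simpa [sum_apply, hE _ j] using h1
  let b := Module.Basis.mk hli
    (hli.span_eq_top_of_card_eq_finrank' (by simp)).ge
  have hb : ⇑b = E := Module.Basis.coe_mk _ _
  have h1 := b.sum_repr v
  rw [hb] at h1
  have h2 : ∀ j, B v (E j) = b.repr v j := by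
    intro j
    conv_lhs => rw [← h1]
    simp [sum_apply, hE _ j]
  simp only [h2, h1]

theorem IsOrthoFrame.trace {B : Form n} {E : Fin n → Euc n} (hE : IsOrthoFrame B E)
    (L : Euc n →L[ℝ] Euc n) : ∑ i, B (L (E i)) (E i) = ∑ k, L (stdVec k) k := by
  have h1 : ∀ k, L (stdVec k) k = ∑ i, B (stdVec k) (E i) * L (E i) k := by
    intro k
    conv_lhs => rw [hE.eq_sum (stdVec k)]
    simp
  have h2 : ∀ i, B (L (E i)) (E i) = ∑ k, B (stdVec k) (E i) * L (E i) k := by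
    intro i
    conv_lhs => rw [sum_single (L (E i))]
    simp only [map_sum, map_smul, sum_apply, smul_apply, smul_eq_mul]
    exact Finset.sum_congr rfl fun k _ => mul_comm _ _
  simp only [h1, h2]
  exact Finset.sum_comm

/-- The trace may be computed in any orthonormal frame; moving b across by antisymmetry of the
curvature produces the minus sign. This is the form in which Ricci curvature enters both the second
variation and Bochner's formula. -/
theorem IsMetricOn.sum_curv_frame (h : IsMetricOn G U) {y : Euc n} (hy : y ∈ U)
    {E : Fin n → Euc n} (hE : IsOrthoFrame (G y) E) (b : Euc n) :
    ∑ i, G y (curv G y (E i) b (E i)) b =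
      - ∑ i, ∑ j, ricciCoord (matOf G) i j y * b i * b j := by
  let L : Euc n →L[ℝ] Euc n :=
    ((fderiv ℝ (chr G) y).flip b).flip b
      - (fderiv ℝ (chr G) y b).flip b
      + (chr G y).flip (chr G y b b) - (chr G y b).comp ((chr G y).flip b)
  have hL : ∀ v, L v = curv G y v b b := fun v => rfl
  have h1 := hE.trace L
  simp only [hL] at h1
  rw [h.sum_ricciCoord hy, ← h1, ← Finset.sum_neg_distrib]
  refine Finset.sum_congr rfl fun i _ => ?_
  rw [h.curv_antisymm hy, h.symm y hy]

end Curvature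

section ChartChange

variable {n : ℕ} {M : Type*} [TopologicalSpace M] [ChartedSpace (EuclideanSpace ℝ (Fin n)) M]
  [IsManifold (𝓡 n) ∞ M] {g : BilinField n M} {S : Set M}

theorem contDiffAt_chartChange {e ν : OpenPartialHomeomorph M (EuclideanSpace ℝ (Fin n))}
    (he : e ∈ IsManifold.maximalAtlas (𝓡 n) ∞ M) (hν : ν ∈ IsManifold.maximalAtlas (𝓡 n) ∞ M)
    {y : Euc n} (hy : y ∈ ν.target) (hye : ν.symm y ∈ e.source) :
    ContDiffAt ℝ ∞ (fun z => e (ν.symm z)) y := by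
  have h1 := contMDiffAt_symm_of_mem_maximalAtlas hν hy
  have h2 := contMDiffAt_of_mem_maximalAtlas he hye
  exact (h2.comp y h1).contDiffAt

theorem metricForm_chartChange {e ν : OpenPartialHomeomorph M (EuclideanSpace ℝ (Fin n))}
    (he : e ∈ IsManifold.maximalAtlas (𝓡 n) ∞ M) (hν : ν ∈ IsManifold.maximalAtlas (𝓡 n) ∞ M)
    {y : Euc n} (hy : y ∈ ν.target) (hye : ν.symm y ∈ e.source) (a b : Euc n) :
    metricForm g ν y a b = metricForm g e (e (ν.symm y))
      (fderiv ℝ (fun z => e (ν.symm z)) y a) (fderiv ℝ (fun z => e (ν.symm z)) y b) := by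
  have h1 := ((contDiffAt_chartChange he hν hy hye).differentiableAt (by simp)).hasFDerivAt
  have h2 := hasMFDerivAt_chart_symm he (e.map_source hye)
  have h3 := h2.comp y h1.hasMFDerivAt
  have h4 : (e.symm ∘ fun z => e (ν.symm z)) =ᶠ[𝓝 y] ν.symm := by
    filter_upwards [(ν.continuousAt_symm hy).eventually (e.open_source.mem_nhds hye)] with z hz
    exact e.left_inv hz
  have h5 := (h3.congr_of_eventuallyEq h4.symm).mfderiv
  have h6 : ∀ a, chartDeriv ν y a = chartDeriv e (e (ν.symm y))
      (fderiv ℝ (fun z => e (ν.symm z)) y a) := fun a =>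
    congrArg (fun L : Euc n →L[ℝ] Euc n => L a) h5
  rw [metricForm_apply, metricForm_apply, h6, h6]
  congr 2
  exact congrArg _ (e.left_inv hye).symm

end ChartChange

/-! ### Change of coordinates and the covariant Hessian of a map -/

section Pullback

variable {n : ℕ} {G G' : Euc n → Form n} {U U' : Set (Euc n)} {κ : Euc n → Euc n} {y : Euc n}

/-- The covariant second derivative of `κ`. -/
def covHess (G : Euc n → Form n) (κ : Euc n → Euc n) (y a b : Euc n) : Euc n :=
  fderiv ℝ (fderiv ℝ κ) y a b + chr G (κ y) (fderiv ℝ κ y a) (fderiv ℝ κ y b)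

theorem IsMetricOn.covHess_symm (h : IsMetricOn G U) (hy : κ y ∈ U) (hκ : ContDiffAt ℝ ∞ κ y)
    (a b : Euc n) : covHess G κ y a b = covHess G κ y b a := by
  have h1 := (hκ.isSymmSndFDerivAt
    (by simpa using WithTop.coe_le_coe.2 (le_top : (2 : ℕ∞) ≤ ⊤))).eq a b
  rw [covHess, covHess, h1, h.chr_symm hy]

theorem IsMetricOn.fderiv_pullback (h : IsMetricOn G U) (h' : IsMetricOn G' U') (hy : κ y ∈ U)
    (hy' : y ∈ U') (hκ : ContDiffAt ℝ ∞ κ y)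
    (hG : ∀ᶠ z in 𝓝 y, ∀ a b, G' z a b = G (κ z) (fderiv ℝ κ z a) (fderiv ℝ κ z b))
    (c a b : Euc n) : fderiv ℝ G' y c a b =
      G (κ y) (covHess G κ y c a) (fderiv ℝ κ y b)
      + G (κ y) (fderiv ℝ κ y a) (covHess G κ y c b) := by
  have h1 := (h.hasFDerivAt hy).comp y (hκ.differentiableAt (by simp)).hasFDerivAt
  have h2 : HasFDerivAt (fderiv ℝ κ) (fderiv ℝ (fderiv ℝ κ) y) y :=
    ((hκ.fderiv_right (m := ∞) (by simp)).differentiableAt (by simp)).hasFDerivAt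
  have cst : ∀ v : Euc n, HasFDerivAt (fun _ : Euc n => v) (0 : Euc n →L[ℝ] Euc n) y :=
    fun v => hasFDerivAt_const v y
  have hL := ((h'.hasFDerivAt hy').clm_apply (cst a)).clm_apply (cst b)
  have hR := (h1.clm_apply (h2.clm_apply (cst a))).clm_apply (h2.clm_apply (cst b))
  have heq : (fun z => G' z a b) =ᶠ[𝓝 y]
      fun z => (G ∘ κ) z (fderiv ℝ κ z a) (fderiv ℝ κ z b) := by
    filter_upwards [hG] with z hz using hz a b
  have h3 := hL.unique (hR.congr_of_eventuallyEq heq)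
  have h4 := congrArg (fun L : Euc n →L[ℝ] ℝ => L c) h3
  simp only [add_apply, ContinuousLinearMap.comp_apply, ContinuousLinearMap.flip_apply,
    zero_apply, map_zero, zero_add, Function.comp_apply] at h4
  rw [h4, h.fderiv_eq hy]
  simp only [covHess, map_add, add_apply]
  ring

/-- Consider the trilinear form G(D²κ(c, a), dκ b), where D² is the covariant Hessian. It is
symmetric in c, a, and it is antisymmetric in a, b because the pulled-back metric is critical at y.
Such a form vanishes, and dκ is onto, so D²κ = 0: straight lines through y map to geodesics to
second order. -/
theorem IsMetricOn.fderiv_fderiv_of_pullback (h : IsMetricOn G U) (h' : IsMetricOn G' U')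
    (hy : κ y ∈ U) (hy' : y ∈ U') (hκ : ContDiffAt ℝ ∞ κ y)
    (hG : ∀ᶠ z in 𝓝 y, ∀ a b, G' z a b = G (κ z) (fderiv ℝ κ z a) (fderiv ℝ κ z b))
    (h0 : fderiv ℝ G' y = 0) (a b : Euc n) : fderiv ℝ (fderiv ℝ κ) y a b =
      - chr G (κ y) (fderiv ℝ κ y a) (fderiv ℝ κ y b) := by
  have key : ∀ c a b, G (κ y) (covHess G κ y c a) (fderiv ℝ κ y b)
      = - G (κ y) (covHess G κ y c b) (fderiv ℝ κ y a) := by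
    intro c a b
    have h1 := h.fderiv_pullback h' hy hy' hκ hG c a b
    rw [h0, h.symm _ hy (fderiv ℝ κ y a)] at h1
    simp only [zero_apply] at h1
    linarith
  have sy := h.covHess_symm hy hκ
  have h2 : ∀ d, G (κ y) (covHess G κ y a b) (fderiv ℝ κ y d) = 0 := by
    intro d
    have h1 := key a b d
    rw [sy a d, key d a b, sy d b, key b d a, sy b a] at h1
    linarith
  have hinj : Function.Injective (fderiv ℝ κ y).toLinearMap := by
    rw [injective_iff_map_eq_zero]
    intro v hv
    by_contra hne
    have h3 := h'.pos y hy' v hne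
    have hv' : fderiv ℝ κ y v = 0 := hv
    rw [hG.self_of_nhds, hv'] at h3
    simp at h3
  obtain ⟨d, hd⟩ := LinearMap.injective_iff_surjective.1 hinj (covHess G κ y a b)
  have hd' : fderiv ℝ κ y d = covHess G κ y a b := hd
  have h4 : covHess G κ y a b = 0 := by
    by_contra hne
    have h5 := h.pos _ hy _ hne
    have h6 := h2 d
    rw [hd'] at h6
    exact h5.ne' h6
  exact eq_neg_of_add_eq_zero_left h4

theorem exists_isOrthoFrame (B : Form n) (hsymm : ∀ v w, B v w = B w v)
    (hpos : ∀ v, v ≠ 0 → 0 < B v v) : ∃ E, IsOrthoFrame B E := by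
  let B' : LinearMap.BilinForm ℝ (Euc n) :=
    LinearMap.mk₂ ℝ (fun v w => B v w) (by simp) (by simp) (by simp) (by simp)
  obtain ⟨v, hv⟩ := LinearMap.BilinForm.exists_orthogonal_basis (B := B')
    ⟨fun v w => hsymm v w⟩
  have hfin : Module.finrank ℝ (Euc n) = n := by simp
  let w := v.reindex (finCongr hfin)
  have hw : ∀ i j, i ≠ j → B (w i) (w j) = 0 := by
    intro i j hij
    have h1 : (finCongr hfin).symm i ≠ (finCongr hfin).symm j :=
      fun h => hij ((finCongr hfin).symm.injective h)
    simpa [w, B'] using hv h1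
  have hp : ∀ i, 0 < B (w i) (w i) := fun i => hpos _ (w.ne_zero i)
  refine ⟨fun i => (Real.sqrt (B (w i) (w i)))⁻¹ • w i, fun i j => ?_⟩
  simp only [map_smul, smul_apply, smul_eq_mul]
  split_ifs with h
  · subst h
    have h2 := Real.mul_self_sqrt (hp i).le
    have h3 := (Real.sqrt_pos.2 (hp i)).ne'
    field_simp
    nlinarith
  · rw [hw i j h]; simp

/-- The linear map which sends the standard basis to the frame `E`. -/
def frameMap (E : Fin n → Euc n) : Euc n →L[ℝ] Euc n :=
  ∑ i, (EuclideanSpace.proj i : Euc n →L[ℝ] ℝ).smulRight (E i)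

theorem frameMap_apply (E : Fin n → Euc n) (a : Euc n) : frameMap E a = ∑ i, a i • E i := by
  simp [frameMap, sum_apply]

theorem IsOrthoFrame.frameMap_inner {B : Form n} {E : Fin n → Euc n} (hE : IsOrthoFrame B E)
    (a b : Euc n) : B (frameMap E a) (frameMap E b) = inner ℝ a b := by
  simp [frameMap_apply, sum_apply, hE _ _, PiLp.inner_apply, mul_comm]

end Pullback

/-! ### Second-order Taylor expansion along rays -/

section SecondOrder

/-- A function which vanishes to second order at `0` is `o(s ^ 2)`. -/
theorem isLittleO_sq_of_hasDerivAt {F : Type*} [NormedAddCommGroup F] [NormedSpace ℝ F]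
    {f f' : ℝ → F} (hf : ∀ᶠ s in 𝓝 0, HasDerivAt f (f' s) s) (h0 : f 0 = 0) (h0' : f' 0 = 0)
    (hf' : HasDerivAt f' 0 0) : f =o[𝓝 0] fun s => s ^ 2 := by
  rw [Asymptotics.isLittleO_iff]
  intro ε hε
  have h1 := hf'.isLittleO
  simp only [h0', sub_zero, smul_zero] at h1
  obtain ⟨R, hR, hball⟩ := Metric.eventually_nhds_iff_ball.1
    (hf.and (Asymptotics.isLittleO_iff.1 h1 hε))
  filter_upwards [Metric.ball_mem_nhds (0 : ℝ) hR] with s hs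
  rw [mem_ball_zero_iff, Real.norm_eq_abs] at hs
  have hsub : ∀ t ∈ Icc (-|s|) |s|, t ∈ Metric.ball (0 : ℝ) R := by
    intro t ht
    rw [mem_ball_zero_iff, Real.norm_eq_abs]
    exact (abs_le.2 ht).trans_lt hs
  have h2 := (convex_Icc (-|s|) |s|).norm_image_sub_le_of_norm_hasDerivWithin_le (C := ε * |s|)
    (fun t ht => (hball t (hsub t ht)).1.hasDerivWithinAt)
    (fun t ht => ((hball t (hsub t ht)).2).trans
      (mul_le_mul_of_nonneg_left (abs_le.2 ht) hε.le))
    (x := 0) (y := s) ⟨by simp, by simp⟩ ⟨neg_abs_le s, le_abs_self s⟩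
  rw [h0, sub_zero, sub_zero, Real.norm_eq_abs, mul_assoc, ← sq, sq_abs] at h2
  rwa [Real.norm_of_nonneg (sq_nonneg s)]

theorem hasDerivAt_quadratic {F : Type*} [NormedAddCommGroup F] [NormedSpace ℝ F] (c V W : F)
    (s : ℝ) : HasDerivAt (fun s : ℝ => c + s • V + (s ^ 2 / 2) • W) (V + s • W) s := by
  have h1 : HasDerivAt (fun s : ℝ => s • V) V s := by
    simpa using (hasDerivAt_id s).smul_const V
  have h2 : HasDerivAt (fun s : ℝ => s ^ 2 / 2) s s := by
    have h := ((hasDerivAt_id s).pow 2).div_const 2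
    simpa using h
  exact (h1.const_add c).add (h2.smul_const W)

/-- The second-order Taylor expansion along a ray. -/
theorem isLittleO_taylor_two {F F' : Type*} [NormedAddCommGroup F] [NormedSpace ℝ F]
    [NormedAddCommGroup F'] [NormedSpace ℝ F'] {κ : F → F'} (hκ : ContDiffAt ℝ ∞ κ 0) (v : F) :
    (fun s : ℝ => κ (s • v) - (κ 0 + s • fderiv ℝ κ 0 v
      + (s ^ 2 / 2) • fderiv ℝ (fderiv ℝ κ) 0 v v)) =o[𝓝 0] fun s => s ^ 2 := by
  have hray : ∀ s : ℝ, HasDerivAt (fun s : ℝ => s • v) v s := fun s => by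
    simpa using (hasDerivAt_id s).smul_const v
  have hray0 : Tendsto (fun s : ℝ => s • v) (𝓝 0) (𝓝 0) := by
    simpa using (hray 0).continuousAt.tendsto
  have hev : ∀ᶠ z in 𝓝 (0 : F), DifferentiableAt ℝ κ z :=
    ((hκ.of_le (m := 1) (by exact_mod_cast le_top)).eventually (by simp)).mono
      fun z hz => hz.differentiableAt (by simp)
  refine isLittleO_sq_of_hasDerivAt (f' := fun s => fderiv ℝ κ (s • v) v
    - (fderiv ℝ κ 0 v + s • fderiv ℝ (fderiv ℝ κ) 0 v v)) ?_ (by simp) (by simp) ?_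
  · filter_upwards [hray0.eventually hev] with s hs
    exact (hs.hasFDerivAt.comp_hasDerivAt s (hray s)).sub (hasDerivAt_quadratic _ _ _ s)
  · have h1 : HasFDerivAt (fderiv ℝ κ) (fderiv ℝ (fderiv ℝ κ) 0) ((0 : ℝ) • v) := by
      rw [zero_smul]
      exact ((hκ.fderiv_right (m := ∞) (by simp)).differentiableAt (by simp)).hasFDerivAt
    have h5 : HasDerivAt (fun s : ℝ => fderiv ℝ κ (s • v)) (fderiv ℝ (fderiv ℝ κ) 0 v) 0 :=
      h1.comp_hasDerivAt (0 : ℝ) (hray 0)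
    have h2 : HasDerivAt (fun s : ℝ => fderiv ℝ κ (s • v) v)
        (fderiv ℝ (fderiv ℝ κ) 0 v v) 0 := by
      simpa using h5.clm_apply (hasDerivAt_const (0 : ℝ) v)
    have h4 : HasDerivAt (fun s : ℝ => s • fderiv ℝ (fderiv ℝ κ) 0 v v)
        (fderiv ℝ (fderiv ℝ κ) 0 v v) 0 := by
      simpa using (hasDerivAt_id (0 : ℝ)).smul_const (fderiv ℝ (fderiv ℝ κ) 0 v v)
    have h3 := h2.sub (h4.const_add (fderiv ℝ κ 0 v))
    exact (h3.congr_deriv (sub_self _))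

end SecondOrder

/-! ### The quadratic model of the exponential map -/

section NormalMap

variable {n : ℕ} {G : Euc n → Form n} {U : Set (Euc n)}

/-- The quadratic approximation of the geodesic through `p` with velocity `V` at time `s`. -/
def quadGeodesic (G : Euc n → Form n) (p V : Euc n) (s : ℝ) : Euc n :=
  p + s • V - (s ^ 2 / 2) • chr G p V V

/-- The quadratic approximation of the exponential map composed with the linear map `A`. -/
def normalMap (G : Euc n → Form n) (p : Euc n) (A : Euc n →L[ℝ] Euc n) (y : Euc n) : Euc n :=
  p + A y - (1 / 2 : ℝ) • chr G p (A y) (A y)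

theorem contDiff_normalMap (p : Euc n) (A : Euc n →L[ℝ] Euc n) :
    ContDiff ℝ ∞ (normalMap G p A) := by
  have h1 : ContDiff ℝ ∞ fun y => A y := A.contDiff
  have h2 : ContDiff ℝ ∞ fun y => chr G p (A y) (A y) :=
    ((chr G p).contDiff.comp h1).clm_apply h1
  exact (contDiff_const.add h1).sub (h2.const_smul (1 / 2 : ℝ))

theorem IsMetricOn.fderiv_normalMap (h : IsMetricOn G U) {p : Euc n} (hp : p ∈ U)
    (A : Euc n →L[ℝ] Euc n) (y a : Euc n) :
    fderiv ℝ (normalMap G p A) y a = A a - chr G p (A y) (A a) := by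
  have h1 : HasFDerivAt (fun y => A y) A y := A.hasFDerivAt
  have h2 := (((chr G p).hasFDerivAt (x := A y)).comp y h1).clm_apply h1
  have h3 := ((hasFDerivAt_const p y).add h1).sub (h2.const_smul (1 / 2 : ℝ))
  have h4 : HasFDerivAt (normalMap G p A) _ y := h3
  rw [h4.fderiv]
  simp only [add_apply, sub_apply, smul_apply, zero_add,
    ContinuousLinearMap.comp_apply, ContinuousLinearMap.flip_apply, Function.comp_apply]
  rw [h.chr_symm hp (A a) (A y), ← two_smul ℝ (chr G p (A y) (A a)), smul_smul]
  norm_num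

theorem IsMetricOn.fderiv_fderiv_normalMap (h : IsMetricOn G U) {p : Euc n} (hp : p ∈ U)
    (A : Euc n →L[ℝ] Euc n) (y a b : Euc n) :
    fderiv ℝ (fderiv ℝ (normalMap G p A)) y a b = - chr G p (A a) (A b) := by
  have h0 : DifferentiableAt ℝ (fderiv ℝ (normalMap G p A)) y :=
    ((contDiff_normalMap p A).fderiv_right (m := ∞) (by simp)).differentiable (by simp) y
  have h1 := h0.hasFDerivAt.clm_apply (hasFDerivAt_const b y)
  have h2 : HasFDerivAt (fun y => A y) A y := A.hasFDerivAt
  have h3 := (hasFDerivAt_const (A b) y).sub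
    ((((chr G p).hasFDerivAt (x := A y)).comp y h2).clm_apply (hasFDerivAt_const (A b) y))
  have h4 : (fun y => fderiv ℝ (normalMap G p A) y b) = fun y => A b - chr G p (A y) (A b) :=
    funext fun y => h.fderiv_normalMap hp A y b
  rw [h4] at h1
  have h5 := congrArg (fun L : Euc n →L[ℝ] Euc n => L a) (h1.unique h3)
  simpa using h5

end NormalMap

/-! ### Charts that are Euclidean to first order -/

section NormalChart

variable {n : ℕ} {M : Type*} [TopologicalSpace M] [ChartedSpace (EuclideanSpace ℝ (Fin n)) M]
  [IsManifold (𝓡 n) ∞ M] {g : BilinField n M} {S : Set M}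

theorem mem_maximalAtlas_trans {e : OpenPartialHomeomorph M (EuclideanSpace ℝ (Fin n))}
    (he : e ∈ IsManifold.maximalAtlas (𝓡 n) ∞ M) {φ : OpenPartialHomeomorph (Euc n) (Euc n)}
    (hφ : ContDiffOn ℝ ∞ φ φ.source) (hφ' : ContDiffOn ℝ ∞ φ.symm φ.target) :
    e ≫ₕ φ ∈ IsManifold.maximalAtlas (𝓡 n) ∞ M := by
  have hg : φ ∈ contDiffGroupoid ∞ (𝓡 n) := by
    rw [contDiffGroupoid, mem_groupoid_of_pregroupoid]
    constructor
    · simpa [contDiffPregroupoid] using hφ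
    · simpa [contDiffPregroupoid] using hφ'
  rw [IsManifold.mem_maximalAtlas_iff, mem_maximalAtlas_iff]
  intro e' he'
  obtain ⟨h1, h2⟩ := mem_maximalAtlas_iff.1 (IsManifold.mem_maximalAtlas_iff.1 he) e' he'
  constructor
  · have h3 := (contDiffGroupoid ∞ (𝓡 n)).trans ((contDiffGroupoid ∞ (𝓡 n)).symm hg) h1
    rwa [OpenPartialHomeomorph.trans_symm_eq_symm_trans_symm, OpenPartialHomeomorph.trans_assoc]
  · rw [← OpenPartialHomeomorph.trans_assoc]
    exact (contDiffGroupoid ∞ (𝓡 n)).trans h2 hg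

/-- A smooth chart centred at `x` in which the metric is Euclidean to first order at `x`. -/
structure IsNormalChart (g : BilinField n M) (x : M)
    (ν : OpenPartialHomeomorph M (EuclideanSpace ℝ (Fin n))) : Prop where
  mem : ν ∈ IsManifold.maximalAtlas (𝓡 n) ∞ M
  mem_source : x ∈ ν.source
  map_eq : ν x = 0
  inner : ∀ a b, metricForm g ν 0 a b = inner ℝ a b
  fderiv_eq : fderiv ℝ (metricForm g ν) 0 = 0

theorem IsNormalChart.zero_mem {x : M}
    {ν : OpenPartialHomeomorph M (EuclideanSpace ℝ (Fin n))} (h : IsNormalChart g x ν) :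
    (0 : Euc n) ∈ ν.target := h.map_eq ▸ ν.map_source h.mem_source

theorem IsNormalChart.symm_zero {x : M}
    {ν : OpenPartialHomeomorph M (EuclideanSpace ℝ (Fin n))} (h : IsNormalChart g x ν) :
    ν.symm (0 : Euc n) = x := h.map_eq ▸ ν.left_inv h.mem_source

theorem exists_localDiffeo {τ : Euc n → Euc n} (hτ : ContDiff ℝ ∞ τ) {y : Euc n}
    {A : Euc n ≃L[ℝ] Euc n} (hA : fderiv ℝ τ y = A) :
    ∃ φ : OpenPartialHomeomorph (Euc n) (Euc n), y ∈ φ.source ∧ (∀ z, φ z = τ z) ∧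
      ContDiffOn ℝ ∞ φ φ.source ∧ ContDiffOn ℝ ∞ φ.symm φ.target := by
  have h1 : HasFDerivAt τ (A : Euc n →L[ℝ] Euc n) y := by
    rw [← hA]; exact (hτ.differentiable (by simp) y).hasFDerivAt
  let ψ := hτ.contDiffAt.toOpenPartialHomeomorph τ h1 (by simp)
  have hψ : ∀ z, ψ z = τ z := fun z => rfl
  have hy : y ∈ ψ.source := hτ.contDiffAt.mem_toOpenPartialHomeomorph_source h1 (by simp)
  -- Restriction to the open set where the derivative is invertible makes the inverse smooth on the
  -- whole target, not only at the image of y.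
  let O : Set (Euc n) := (fderiv ℝ τ) ⁻¹' (Set.range ((↑) : (Euc n ≃L[ℝ] Euc n) → _))
  have hO : IsOpen O := (ContinuousLinearEquiv.isOpen).preimage
    (hτ.continuous_fderiv (by simp))
  refine ⟨ψ.restrOpen O hO, ⟨hy, ⟨A, hA.symm⟩⟩, hψ, hτ.contDiffOn, ?_⟩
  intro z hz
  have hz' : (ψ.restrOpen O hO).symm z ∈ (ψ.restrOpen O hO).source :=
    (ψ.restrOpen O hO).map_target hz
  obtain ⟨B, hB⟩ := hz'.2
  apply ContDiffAt.contDiffWithinAt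
  refine (ψ.restrOpen O hO).contDiffAt_symm hz (f₀' := B) ?_ hτ.contDiffAt
  rw [hB]
  exact (hτ.differentiable (by simp) _).hasFDerivAt

/-- The chart at x is followed by the inverse of `normalMap`. Its linear part is an orthonormal
frame, so the metric at 0 is Euclidean; its quadratic part cancels the Christoffel term, so the
covariant Hessian vanishes at 0 and with it the first derivative of the metric. -/
theorem exists_isNormalChart (hg : IsUniformlyEuclidean g S) (hS : IsClosed S) {x : M}
    (hx : x ∉ S) : ∃ ν, IsNormalChart g x ν := by
  set e := chartAt (EuclideanSpace ℝ (Fin n)) x with he_def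
  have he : e ∈ IsManifold.maximalAtlas (𝓡 n) ∞ M := IsManifold.chart_mem_maximalAtlas x
  have hxe : x ∈ e.source := mem_chart_source _ x
  have hm := hg.isMetricOn hS he
  set p := e x with hp_def
  have hxp : e.symm p = x := e.left_inv hxe
  have hp : p ∈ chartDomain e S := ⟨e.map_source hxe, by
    change e.symm p ∈ Sᶜ; rw [hxp]; exact hx⟩
  obtain ⟨E, hE⟩ := exists_isOrthoFrame _ (hm.symm p hp) (hm.pos p hp)
  have hinj : LinearMap.ker (frameMap E).toLinearMap = ⊥ := by
    rw [LinearMap.ker_eq_bot']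
    intro v hv
    have hv' : frameMap E v = 0 := hv
    have h1 := hE.frameMap_inner v v
    rw [hv'] at h1
    simpa using h1.symm
  let A : Euc n ≃L[ℝ] Euc n :=
    (LinearEquiv.ofInjectiveEndo _ (LinearMap.ker_eq_bot.1 hinj)).toContinuousLinearEquiv
  have hA : (A : Euc n →L[ℝ] Euc n) = frameMap E := by ext; rfl
  set τ := normalMap (metricForm g e) p (frameMap E) with hτ_def
  have hτ : ContDiff ℝ ∞ τ := contDiff_normalMap _ _
  have hτ0 : τ 0 = p := by simp [hτ_def, normalMap]
  have hd0 : fderiv ℝ τ 0 = frameMap E := by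
    ext1 a
    rw [hm.fderiv_normalMap hp]
    simp
  obtain ⟨φ, h0φ, hφ, hφ1, hφ2⟩ := exists_localDiffeo hτ (hd0.trans hA.symm)
  have hν := mem_maximalAtlas_trans he (φ := φ.symm) (by simpa using hφ2) (by simpa using hφ1)
  have hx0 : φ.symm p = 0 := by
    rw [← hτ0, ← hφ]
    exact φ.left_inv h0φ
  have hpφ : p ∈ φ.target := by
    rw [← hτ0, ← hφ]; exact φ.map_source h0φ
  have hxs : x ∈ (e ≫ₕ φ.symm).source := by
    rw [OpenPartialHomeomorph.trans_source]
    exact ⟨hxe, hpφ⟩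
  set ν := e ≫ₕ φ.symm with hν_def
  have hνx : ν x = 0 := hx0
  have h0t : (0 : Euc n) ∈ ν.target := hνx ▸ ν.map_source hxs
  have hs0 : ν.symm 0 = x := hνx ▸ ν.left_inv hxs
  have hm' := hg.isMetricOn hS hν
  have h0' : (0 : Euc n) ∈ chartDomain ν S := ⟨h0t, by
    change ν.symm 0 ∈ Sᶜ; rw [hs0]; exact hx⟩
  have hνs : ∀ z ∈ ν.target, ν.symm z ∈ e.source ∧ e (ν.symm z) = τ z := by
    intro z hz
    have h1 := (ν.map_target hz)
    rw [hν_def, OpenPartialHomeomorph.trans_source] at h1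
    refine ⟨h1.1, ?_⟩
    have h2 : ν.symm z = e.symm (φ z) := rfl
    rw [← hφ, h2]
    rw [OpenPartialHomeomorph.trans_target] at hz
    exact e.right_inv hz.2
  have hchange : ∀ z ∈ ν.target, ∀ a b, metricForm g ν z a b
      = metricForm g e (τ z) (fderiv ℝ τ z a) (fderiv ℝ τ z b) := by
    intro z hz a b
    have h1 : (fun z => e (ν.symm z)) =ᶠ[𝓝 z] τ := by
      filter_upwards [ν.open_target.mem_nhds hz] with w hw using (hνs w hw).2
    rw [metricForm_chartChange he hν hz (hνs z hz).1, h1.fderiv_eq, (hνs z hz).2]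
  refine ⟨ν, hν, hxs, hνx, fun a b => ?_, ?_⟩
  · rw [hchange 0 h0t, hτ0, hd0, hE.frameMap_inner]
  · have hp' : τ 0 ∈ chartDomain e S := by rw [hτ0]; exact hp
    have hc : ∀ a b, covHess (metricForm g e) τ 0 a b = 0 := by
      intro a b
      rw [covHess, hm.fderiv_fderiv_normalMap hp, hd0, hτ0]
      simp
    ext c a b
    rw [hm.fderiv_pullback hm' hp' h0' hτ.contDiffAt
      (by filter_upwards [ν.open_target.mem_nhds h0t] with z hz using hchange z hz), hc, hc]
    simp

theorem IsNormalChart.zero_mem_chartDomain {x : M} (hx : x ∉ S)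
    {ν : OpenPartialHomeomorph M (EuclideanSpace ℝ (Fin n))} (h : IsNormalChart g x ν) :
    (0 : Euc n) ∈ chartDomain ν S :=
  ⟨h.zero_mem, by change ν.symm 0 ∈ Sᶜ; rw [h.symm_zero]; exact hx⟩

/-- In a chart, the rays of a normal chart are quadratic geodesics to second order. -/
theorem IsNormalChart.isLittleO (hg : IsUniformlyEuclidean g S) (hS : IsClosed S) {x : M}
    (hx : x ∉ S) {ν e : OpenPartialHomeomorph M (EuclideanSpace ℝ (Fin n))}
    (h : IsNormalChart g x ν) (he : e ∈ IsManifold.maximalAtlas (𝓡 n) ∞ M)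
    (hxe : x ∈ e.source) (v : Euc n) :
    (fun s : ℝ => e (ν.symm (s • v)) - quadGeodesic (metricForm g e) (e x)
      (fderiv ℝ (fun z => e (ν.symm z)) 0 v) s) =o[𝓝 0] fun s => s ^ 2 := by
  set κ : Euc n → Euc n := fun z => e (ν.symm z) with hκ_def
  have hm := hg.isMetricOn hS he
  have hκ0 : κ 0 = e x := congrArg e h.symm_zero
  have hxe' : ν.symm (0 : Euc n) ∈ e.source := by rw [h.symm_zero]; exact hxe
  have hx0 : κ 0 ∈ chartDomain e S := by
    rw [hκ0]
    exact ⟨e.map_source hxe, by change e.symm (e x) ∈ Sᶜ; rw [e.left_inv hxe]; exact hx⟩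
  have hnear : ∀ᶠ z in 𝓝 (0 : Euc n), z ∈ ν.target ∧ ν.symm z ∈ e.source :=
    (Filter.eventually_of_mem (ν.open_target.mem_nhds h.zero_mem) fun _ hz => hz).and
      ((ν.continuousAt_symm h.zero_mem).eventually (e.open_source.mem_nhds hxe'))
  have hcd : ContDiffAt ℝ ∞ κ 0 := contDiffAt_chartChange he h.mem h.zero_mem hxe'
  have hD := hm.fderiv_fderiv_of_pullback (hg.isMetricOn hS h.mem) hx0
    (h.zero_mem_chartDomain hx) hcd (by
      filter_upwards [hnear] with z hz a b using metricForm_chartChange he h.mem hz.1 hz.2 a b)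
    h.fderiv_eq v v
  rw [hκ0] at hD
  have h1 := isLittleO_taylor_two hcd v
  rw [hD, hκ0] at h1
  refine h1.congr_left fun s => ?_
  rw [quadGeodesic, smul_neg, ← sub_eq_add_neg]

end NormalChart

/-! ### Expansions that are uniform over compact sets of parameters -/

section UniformExpansion

variable {W F : Type*} [NormedAddCommGroup W] [NormedSpace ℝ W] [NormedAddCommGroup F]
  [NormedSpace ℝ F]

/-- Strict differentiability at (z, 0) gives a first-order expansion in h that is uniform for
parameters near z, with the derivative D frozen at z. -/
theorem eventually_expansion {f : W × ℝ → F} {z : W} (hf : ContDiffAt ℝ 1 f (z, 0)) {D : F}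
    (hD : HasDerivAt (fun h : ℝ => f (z, h)) D 0) {ε : ℝ} (hε : 0 < ε) :
    ∀ᶠ q : ℝ × W in 𝓝 (0, z), ‖f (q.2, q.1) - f (q.2, 0) - q.1 • D‖ ≤ ε * |q.1| := by
  have h1 := hf.hasStrictFDerivAt (by simp)
  have hpair : HasDerivAt (fun h : ℝ => (z, h)) ((0 : W), (1 : ℝ)) 0 :=
    (hasDerivAt_const (0 : ℝ) z).prodMk (hasDerivAt_id 0)
  have h2 : fderiv ℝ f (z, 0) (0, 1) = D :=
    (h1.hasFDerivAt.comp_hasDerivAt (0 : ℝ) hpair).unique hD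
  have h3 := h1.isLittleO.def hε
  have ht : Tendsto (fun q : ℝ × W => ((q.2, q.1), (q.2, (0 : ℝ)))) (𝓝 (0, z))
      (𝓝 ((z, (0 : ℝ)), (z, (0 : ℝ)))) := by
    have : Continuous (fun q : ℝ × W => ((q.2, q.1), (q.2, (0 : ℝ)))) := by fun_prop
    exact this.tendsto (0, z)
  filter_upwards [ht.eventually h3] with q hq
  have h4 : ((q.2, q.1) : W × ℝ) - (q.2, 0) = q.1 • ((0 : W), (1 : ℝ)) := by
    ext <;> simp
  simp only [h4, map_smul, h2] at hq
  refine hq.trans_eq ?_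
  rw [norm_smul, Prod.norm_mk]
  simp

theorem hasDerivAt_partial_right {f : W × ℝ → F} {w : W} {s : ℝ}
    (hf : DifferentiableAt ℝ f (w, s)) :
    HasDerivAt (fun t : ℝ => f (w, t)) (fderiv ℝ f (w, s) (0, 1)) s :=
  hf.hasFDerivAt.comp_hasDerivAt s ((hasDerivAt_const s w).prodMk (hasDerivAt_id s))

/-- A uniform second-order Taylor estimate. -/
theorem exists_uniform_taylor_two {q : W × ℝ → ℝ} {K : Set W} (hK : IsCompact K)
    (hq : ∀ w ∈ K, ContDiffAt ℝ ∞ q (w, 0)) {A B : W → ℝ}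
    (hAB : ∀ w ∈ K, ∃ f₁ : ℝ → ℝ, (∀ᶠ s in 𝓝 0, HasDerivAt (fun t => q (w, t)) (f₁ s) s) ∧
      f₁ 0 = A w ∧ HasDerivAt f₁ (2 * B w) 0) {η : ℝ} (hη : 0 < η) :
    ∃ s₀ > 0, ∀ s : ℝ, |s| ≤ s₀ → ∀ w ∈ K, q (w, s) ≤ q (w, 0) + s * A w + s ^ 2 * (B w + η) := by
  set g₁ : W × ℝ → ℝ := fun z => fderiv ℝ q z (0, 1) with hg₁
  set g₂ : W × ℝ → ℝ := fun z => fderiv ℝ g₁ z (0, 1) with hg₂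
  have c1 : ∀ w ∈ K, ContDiffAt ℝ ∞ g₁ (w, 0) := fun w hw =>
    ((hq w hw).fderiv_right (m := ∞) (by simp)).clm_apply contDiffAt_const
  have c2 : ∀ w ∈ K, ContDiffAt ℝ ∞ g₂ (w, 0) := fun w hw =>
    ((c1 w hw).fderiv_right (m := ∞) (by simp)).clm_apply contDiffAt_const
  have hdiff : ∀ f : W × ℝ → ℝ, ∀ w, ContDiffAt ℝ ∞ f (w, 0) →
      ∀ᶠ z in 𝓝 (w, (0 : ℝ)), DifferentiableAt ℝ f z := fun f w hf =>
    ((hf.of_le (m := 1) (by exact_mod_cast le_top)).eventually (by simp)).mono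
      fun z hz => hz.differentiableAt (by simp)
  -- The uniformity comes from here: the second derivative in s is within η of its value at s = 0,
  -- simultaneously for all w in K.
  have hev : ∀ᶠ s : ℝ in 𝓝 0, ∀ w ∈ K, DifferentiableAt ℝ q (w, s) ∧
      DifferentiableAt ℝ g₁ (w, s) ∧ |g₂ (w, s) - g₂ (w, 0)| ≤ η := by
    apply hK.eventually_forall_of_forall_eventually
    intro w hw
    have ht : Tendsto (fun z : ℝ × W => (z.2, z.1)) (𝓝 (0, w)) (𝓝 (w, 0)) :=
      continuous_swap.tendsto (0, w)
    have ht0 : Tendsto (fun z : ℝ × W => (z.2, (0 : ℝ))) (𝓝 (0, w)) (𝓝 (w, 0)) := by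
      have : Continuous (fun z : ℝ × W => (z.2, (0 : ℝ))) := by fun_prop
      exact this.tendsto (0, w)
    have hc := Metric.tendsto_nhds.1 (c2 w hw).continuousAt (η / 2) (by positivity)
    filter_upwards [ht.eventually (hdiff q w (hq w hw)), ht.eventually (hdiff g₁ w (c1 w hw)),
      ht.eventually hc, ht0.eventually hc] with z h1 h2 h3 h4
    refine ⟨h1, h2, ?_⟩
    rw [Real.dist_eq] at h3 h4
    rw [abs_le]
    rw [abs_lt] at h3 h4
    constructor <;> linarith [h3.1, h3.2, h4.1, h4.2]
  obtain ⟨R, hR, hball⟩ := Metric.eventually_nhds_iff_ball.1 hev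
  refine ⟨R / 2, by positivity, fun s hs w hw => ?_⟩
  have hin : ∀ t : ℝ, |t| ≤ |s| → t ∈ Metric.ball (0 : ℝ) R := fun t ht => by
    rw [mem_ball_zero_iff, Real.norm_eq_abs]; linarith
  have d1 : ∀ t : ℝ, |t| ≤ |s| → HasDerivAt (fun t => q (w, t)) (g₁ (w, t)) t := fun t ht =>
    hasDerivAt_partial_right (hball t (hin t ht) w hw).1
  have d2 : ∀ t : ℝ, |t| ≤ |s| → HasDerivAt (fun t => g₁ (w, t)) (g₂ (w, t)) t := fun t ht =>
    hasDerivAt_partial_right (hball t (hin t ht) w hw).2.1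
  obtain ⟨f₁, hf₁, hA, hB⟩ := hAB w hw
  have e1 : (fun t => g₁ (w, t)) =ᶠ[𝓝 0] f₁ := by
    filter_upwards [hf₁, Metric.ball_mem_nhds (0 : ℝ) hR] with t ht ht'
    exact (hasDerivAt_partial_right (hball t ht' w hw).1).unique ht
  have hA' : g₁ (w, 0) = A w := e1.self_of_nhds.trans hA
  have hB' : g₂ (w, 0) = 2 * B w :=
    (d2 0 (by simp)).unique (hB.congr_of_eventuallyEq e1)
  have hmem : ∀ t ∈ Icc (-|s|) |s|, |t| ≤ |s| := fun t ht => abs_le.2 ht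
  have h0mem : (0 : ℝ) ∈ Icc (-|s|) |s| := ⟨by simp, by simp⟩
  -- The mean value inequality is applied twice, first to the derivative and then to the function;
  -- the errors η and η|s| yield η s².
  have r1 : ∀ t : ℝ, |t| ≤ |s| → |g₁ (w, t) - A w - 2 * B w * t| ≤ η * |s| := by
    intro t ht
    have h := (convex_Icc (-|s|) |s|).norm_image_sub_le_of_norm_hasDerivWithin_le
      (f := fun t => g₁ (w, t) - 2 * B w * t) (f' := fun t => g₂ (w, t) - 2 * B w * 1) (C := η)
      (fun t ht => ((d2 t (hmem t ht)).sub
        ((hasDerivAt_id t).const_mul (2 * B w))).hasDerivWithinAt)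
      (fun t ht => by
        rw [mul_one, ← hB']; exact (hball t (hin t (hmem t ht)) w hw).2.2)
      h0mem (y := t) (abs_le.1 ht)
    simp only [hA', Real.norm_eq_abs, mul_zero, sub_zero] at h
    rw [sub_right_comm]
    exact h.trans (mul_le_mul_of_nonneg_left ht hη.le)
  have h := (convex_Icc (-|s|) |s|).norm_image_sub_le_of_norm_hasDerivWithin_le
      (f := fun t => q (w, t) - A w * t - B w * t ^ 2)
      (f' := fun t => g₁ (w, t) - A w - 2 * B w * t) (C := η * |s|)
      (fun t ht => by
        have h1 : HasDerivAt (fun t : ℝ => A w * t) (A w) t := by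
          simpa using (hasDerivAt_id t).const_mul (A w)
        have h2 : HasDerivAt (fun t : ℝ => B w * t ^ 2) (2 * B w * t) t := by
          have := ((hasDerivAt_id t).pow 2).const_mul (B w)
          exact this.congr_deriv (by simp; ring)
        exact (((d1 t (hmem t ht)).sub h1).sub h2).hasDerivWithinAt)
      (fun t ht => r1 t (hmem t ht)) h0mem (y := s) ⟨neg_abs_le s, le_abs_self s⟩
  simp only [Real.norm_eq_abs, mul_zero, sub_zero] at h
  rw [mul_assoc, abs_mul_abs_self] at h
  have := (abs_le.1 h).2
  nlinarith

/-- If `g ≤ c` on the part of a compact set where `f ≤ 0`, then `g` is almost at most `c` where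
`f` is almost nonpositive. -/
theorem exists_forall_le_add_of_compact {X : Type*} [TopologicalSpace X] {K : Set X}
    (hK : IsCompact K) {f g : X → ℝ} (hf : ContinuousOn f K) (hg : ContinuousOn g K) {c : ℝ}
    (h : ∀ x ∈ K, f x ≤ 0 → g x ≤ c) {η : ℝ} (hη : 0 < η) :
    ∃ ε > 0, ∀ x ∈ K, f x ≤ ε → g x ≤ c + η := by
  rcases (K ∩ g ⁻¹' Ici (c + η)).eq_empty_or_nonempty with he | hne
  · refine ⟨1, one_pos, fun x hx _ => ?_⟩
    by_contra hlt
    have : x ∈ K ∩ g ⁻¹' Ici (c + η) := ⟨hx, (not_le.1 hlt).le⟩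
    rw [he] at this
    exact this
  · by_contra hcon
    push Not at hcon
    have hex : ∀ m : ℕ, ∃ x ∈ K, f x ≤ 1 / ((m : ℝ) + 1) ∧ c + η < g x := fun m =>
      hcon _ (by positivity)
    choose x hxK hxf hxg using hex
    obtain ⟨x₀, hx₀, hcl⟩ := hK.exists_mapClusterPt (u := x) (f := atTop)
      (Filter.tendsto_principal.2 (Filter.Eventually.of_forall hxK))
    have hle : (Filter.map x atTop) ≤ 𝓟 K :=
      Filter.tendsto_principal.2 (Filter.Eventually.of_forall hxK)
    have hcl' : ClusterPt x₀ (Filter.map x atTop) := hcl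
    have : (𝓝 x₀ ⊓ Filter.map x atTop).NeBot := hcl'
    have hN : 𝓝 x₀ ⊓ Filter.map x atTop ≤ 𝓝[K] x₀ := inf_le_inf_left _ hle
    have h1 : f x₀ ≤ 0 := by
      have t1 : Tendsto f (𝓝 x₀ ⊓ Filter.map x atTop) (𝓝 (f x₀)) := (hf x₀ hx₀).mono_left hN
      refine le_of_forall_pos_le_add fun ε hε => ?_
      refine le_of_tendsto t1 ?_
      apply Filter.Eventually.filter_mono inf_le_right
      rw [Filter.eventually_map]
      filter_upwards [(tendsto_one_div_add_atTop_nhds_zero_nat).eventually (gt_mem_nhds hε)]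
        with m hm
      linarith [hxf m]
    have h2 : c + η ≤ g x₀ := by
      have t1 : Tendsto g (𝓝 x₀ ⊓ Filter.map x atTop) (𝓝 (g x₀)) := (hg x₀ hx₀).mono_left hN
      refine ge_of_tendsto t1 ?_
      apply Filter.Eventually.filter_mono inf_le_right
      rw [Filter.eventually_map]
      exact Filter.Eventually.of_forall fun m => (hxg m).le
    linarith [h x₀ hx₀ h1]

end UniformExpansion

/-! ### Chords of a family of curves -/

section ChordEstimate

variable {n : ℕ} {G : Euc n → Form n} {U : Set (Euc n)}
variable {W : Type*} [NormedAddCommGroup W] [NormedSpace ℝ W]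

/-- The chords of a family of curves are controlled by the initial velocities. -/
theorem IsMetricOn.eventually_chord_le (hG : IsMetricOn G U) {f : W × ℝ → Euc n} {D : W → Euc n}
    {z : W} (hf : ContDiffAt ℝ 1 f (z, 0)) (hD : ContinuousAt D z)
    (hfD : HasDerivAt (fun h : ℝ => f (z, h)) (D z) 0) (hz : f (z, 0) ∈ U) {ε : ℝ} (hε : 0 < ε) :
    ∀ᶠ q : ℝ × W in 𝓝 (0, z), ∀ t ∈ Icc (0 : ℝ) 1,
      f (q.2, 0) + t • (f (q.2, q.1) - f (q.2, 0)) ∈ U ∧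
      G (f (q.2, 0) + t • (f (q.2, q.1) - f (q.2, 0))) (f (q.2, q.1) - f (q.2, 0))
        (f (q.2, q.1) - f (q.2, 0)) ≤ q.1 ^ 2 * (G (f (q.2, 0)) (D q.2) (D q.2) + ε) := by
  have hGc : ContinuousAt G (f (z, 0)) := (hG.contDiffAt hz).continuousAt
  have hΨ : ContinuousAt (fun y : Euc n × Euc n => G y.1 y.2 y.2) (f (z, 0), D z) := by
    have h1 : ContinuousAt (fun y : Euc n × Euc n => G y.1) (f (z, 0), D z) :=
      ContinuousAt.comp (f := Prod.fst) hGc continuousAt_fst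
    exact (h1.clm_apply continuousAt_snd).clm_apply continuousAt_snd
  have hU : ∀ᶠ y : Euc n × Euc n in 𝓝 (f (z, 0), D z), y.1 ∈ U :=
    continuousAt_fst.eventually (hG.isOpen.mem_nhds hz)
  obtain ⟨R, hR, hball⟩ := Metric.eventually_nhds_iff_ball.1
    (hU.and (Metric.tendsto_nhds.1 hΨ (ε / 2) (by positivity)))
  have ht : Tendsto (fun q : ℝ × W => (q.2, q.1)) (𝓝 (0, z)) (𝓝 (z, 0)) :=
    continuous_swap.tendsto (0, z)
  have ht0 : Tendsto (fun q : ℝ × W => (q.2, (0 : ℝ))) (𝓝 (0, z)) (𝓝 (z, 0)) := by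
    have : Continuous (fun q : ℝ × W => (q.2, (0 : ℝ))) := by fun_prop
    exact this.tendsto (0, z)
  have hfc := Metric.tendsto_nhds.1 hf.continuousAt R hR
  have hDc : Tendsto (fun q : ℝ × W => D q.2) (𝓝 (0, z)) (𝓝 (D z)) :=
    hD.tendsto.comp (continuous_snd.tendsto ((0 : ℝ), z))
  filter_upwards [eventually_expansion hf hfD (ε := R / 2) (by positivity), ht.eventually hfc,
    ht0.eventually hfc, Metric.tendsto_nhds.1 hDc R hR] with q h1 h2 h3 h4 t ht
  have hmem : f (q.2, 0) + t • (f (q.2, q.1) - f (q.2, 0)) ∈ Metric.ball (f (z, 0)) R :=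
    add_smul_sub_mem_ball h3 h2 ht
  set y := f (q.2, 0) + t • (f (q.2, q.1) - f (q.2, 0)) with hy
  have hy0 : (y, D z) ∈ Metric.ball (f (z, 0), D z) R := by
    rw [Metric.mem_ball, Prod.dist_eq, max_lt_iff]
    exact ⟨hmem, by simpa using hR⟩
  refine ⟨(hball _ hy0).1, ?_⟩
  by_cases hq : q.1 = 0
  · simp [hq]
  -- The difference quotient w and the nearby velocity D q.2 are both close to D z, so the energies
  -- at (y, w) and at (f(q.2, 0), D q.2) each differ by less than ε/2 from that at (f(z, 0), D z).
  set w := q.1⁻¹ • (f (q.2, q.1) - f (q.2, 0)) with hw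
  have hw1 : f (q.2, q.1) - f (q.2, 0) = q.1 • w := by rw [hw, smul_inv_smul₀ hq]
  rw [hw1, ← smul_sub, norm_smul, Real.norm_eq_abs, mul_comm] at h1
  have hwD : ‖w - D z‖ ≤ R / 2 := le_of_mul_le_mul_right h1 (abs_pos.2 hq)
  have hyw : (y, w) ∈ Metric.ball (f (z, 0), D z) R := by
    rw [Metric.mem_ball, Prod.dist_eq, max_lt_iff]
    refine ⟨hmem, ?_⟩
    change Dist.dist w (D z) < R
    rw [dist_eq_norm]; linarith
  have hfD' : (f (q.2, 0), D q.2) ∈ Metric.ball (f (z, 0), D z) R := by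
    rw [Metric.mem_ball, Prod.dist_eq, max_lt_iff]
    exact ⟨h3, h4⟩
  have e1 := (hball _ hyw).2
  have e2 := (hball _ hfD').2
  rw [Real.dist_eq, abs_lt] at e1 e2
  rw [hw1]
  simp only [map_smul, smul_apply, smul_eq_mul]
  rw [← mul_assoc, ← sq]
  apply mul_le_mul_of_nonneg_left _ (sq_nonneg _)
  linarith [e1.2, e2.1]

end ChordEstimate

/-! ### The second variation of energy for quadratic geodesics -/

section Variation

variable {n : ℕ} {G : Euc n → Form n} {U : Set (Euc n)}
variable {W : Type*} [NormedAddCommGroup W] [NormedSpace ℝ W]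

theorem IsMetricOn.contDiffAt_chr_apply (h : IsMetricOn G U) {P A B : W → Euc n} {w : W}
    (hP : ContDiffAt ℝ ∞ P w) (hA : ContDiffAt ℝ ∞ A w) (hB : ContDiffAt ℝ ∞ B w)
    (hw : P w ∈ U) : ContDiffAt ℝ ∞ (fun z => chr G (P z) (A z) (B z)) w :=
  (((h.contDiffAt_chr hw).comp w hP).clm_apply hA).clm_apply hB

theorem IsMetricOn.contDiffAt_quadGeodesic (h : IsMetricOn G U) {P A : W → Euc n} {σ : W → ℝ}
    {w : W} (hP : ContDiffAt ℝ ∞ P w) (hA : ContDiffAt ℝ ∞ A w) (hσ : ContDiffAt ℝ ∞ σ w)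
    (hw : P w ∈ U) : ContDiffAt ℝ ∞ (fun z => quadGeodesic G (P z) (A z) (σ z)) w :=
  (hP.add (hσ.smul hA)).sub (((hσ.pow 2).div_const 2).smul (h.contDiffAt_chr_apply hP hA hA hw))

theorem IsMetricOn.fderiv_chr_symm (h : IsMetricOn G U) {y : Euc n} (hy : y ∈ U) (a b c : Euc n) :
    fderiv ℝ (chr G) y a b c = fderiv ℝ (chr G) y a c b := by
  have h1 := ((h.hasFDerivAt_chr hy).clm_apply (hasFDerivAt_const b y)).clm_apply
    (hasFDerivAt_const c y)
  have h2 := ((h.hasFDerivAt_chr hy).clm_apply (hasFDerivAt_const c y)).clm_apply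
    (hasFDerivAt_const b y)
  have heq : (fun z => chr G z b c) =ᶠ[𝓝 y] fun z => chr G z c b := by
    filter_upwards [h.isOpen.mem_nhds hy] with z hz using h.chr_symm hz b c
  have h3 := congrArg (fun L : Euc n →L[ℝ] Euc n => L a)
    (h1.unique (h2.congr_of_eventuallyEq heq))
  simpa using h3

theorem hasDerivAt_add_smul_sub {F : Type*} [NormedAddCommGroup F] [NormedSpace ℝ F]
    {P V : ℝ → F} {Γ : ℝ → F →L[ℝ] F →L[ℝ] F} {P' V' : F} {Γ' : F →L[ℝ] F →L[ℝ] F} {t : ℝ}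
    (hP : HasDerivAt P P' t) (hV : HasDerivAt V V' t) (hΓ : HasDerivAt Γ Γ' t) (s : ℝ) :
    HasDerivAt (fun h => P h + s • V h - (s ^ 2 / 2) • Γ h (V h) (V h))
      (P' + s • V' - (s ^ 2 / 2) • (Γ' (V t) (V t) + Γ t V' (V t) + Γ t (V t) V')) t := by
  have h6 := (hΓ.clm_apply hV).clm_apply hV
  have h7 := (hP.add (hV.const_smul s)).sub (h6.const_smul (s ^ 2 / 2))
  refine h7.congr_deriv ?_
  simp only [add_apply]

/-- The first-order transport of `V` along the segment from `p` to `p + h • b`, with covariant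
derivative `Y`. -/
def stepVec (G : Euc n → Form n) (p V Y b : Euc n) (h : ℝ) : Euc n :=
  V + h • (Y - chr G p b V) - h ^ 2 • chr G p b Y

/-- The velocity at `h = 0` of `h ↦ quadGeodesic G (p + h • b) (stepVec G p V Y b h) s`. -/
def variationField (G : Euc n → Form n) (p V Y b : Euc n) (s : ℝ) : Euc n :=
  b + s • (Y - chr G p b V) + (s ^ 2 / 2) •
    (-(fderiv ℝ (chr G) p b V V + (2 : ℝ) • chr G p (Y - chr G p b V) V))

theorem IsMetricOn.hasDerivAt_quadGeodesic_comp (hG : IsMetricOn G U) {P V : ℝ → Euc n}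
    {P' V' : Euc n} {t : ℝ} (ht : P t ∈ U) (hP : HasDerivAt P P' t) (hV : HasDerivAt V V' t)
    (s : ℝ) : HasDerivAt (fun h => quadGeodesic G (P h) (V h) s)
      (P' + s • V' - (s ^ 2 / 2) • (fderiv ℝ (chr G) (P t) P' (V t) (V t)
        + chr G (P t) V' (V t) + chr G (P t) (V t) V')) t :=
  hasDerivAt_add_smul_sub hP hV ((hG.hasFDerivAt_chr ht).comp_hasDerivAt t hP) s

theorem IsMetricOn.hasDerivAt_step (hG : IsMetricOn G U) {p : Euc n} (hp : p ∈ U)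
    (V Y b : Euc n) (s : ℝ) :
    HasDerivAt (fun h : ℝ => quadGeodesic G (p + h • b) (stepVec G p V Y b h) s)
      (variationField G p V Y b s) 0 := by
  have hP : HasDerivAt (fun h : ℝ => p + h • b) b 0 :=
    (((hasDerivAt_id (0 : ℝ)).smul_const b).const_add p).congr_deriv (one_smul _ _)
  have hV : HasDerivAt (stepVec G p V Y b) (Y - chr G p b V) 0 := by
    have h1 := (hasDerivAt_quadratic V (Y - chr G p b V) (-(2 : ℝ) • chr G p b Y) 0)
    refine (h1.congr_deriv (by simp)).congr_of_eventuallyEq (Filter.Eventually.of_forall fun t => ?_)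
    simp only [stepVec, smul_smul, sub_eq_add_neg, ← neg_smul]
    congr 2
    ring
  have hp0 : p + (0 : ℝ) • b = p := by rw [zero_smul, add_zero]
  have hV0 : stepVec G p V Y b 0 = V := by simp [stepVec]
  have hpU : p + (0 : ℝ) • b ∈ U := by rw [hp0]; exact hp
  refine (hG.hasDerivAt_quadGeodesic_comp hpU hP hV s).congr_deriv ?_
  rw [hV0, hp0, hG.chr_symm hp V (Y - chr G p b V), variationField]
  module

theorem hasDerivAt_quadGeodesic (p V : Euc n) (s : ℝ) :
    HasDerivAt (quadGeodesic G p V) (V + s • -chr G p V V) s := by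
  have h := hasDerivAt_quadratic p V (-chr G p V V) s
  refine h.congr_of_eventuallyEq (Filter.Eventually.of_forall fun t => ?_)
  simp [quadGeodesic, sub_eq_add_neg]

/-- The product rule along a curve, with the derivative of the metric absorbed into covariant
derivatives of the two fields. -/
theorem IsMetricOn.hasDerivAt_form (hG : IsMetricOn G U) {N X Y : ℝ → Euc n} {N' X' Y' : Euc n}
    {s : ℝ} (hs : N s ∈ U) (hN : HasDerivAt N N' s) (hX : HasDerivAt X X' s)
    (hY : HasDerivAt Y Y' s) : HasDerivAt (fun t => G (N t) (X t) (Y t))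
      (G (N s) (X' + chr G (N s) N' (X s)) (Y s)
        + G (N s) (X s) (Y' + chr G (N s) N' (Y s))) s := by
  have h1 : HasDerivAt (fun t => G (N t)) (fderiv ℝ G (N s) N') s :=
    (hG.hasFDerivAt hs).comp_hasDerivAt s hN
  refine ((h1.clm_apply hX).clm_apply hY).congr_deriv ?_
  simp only [add_apply, map_add]
  rw [hG.fderiv_eq hs]
  ring

/-- The second variation of energy in the direction of `Y`. -/
theorem IsMetricOn.second_variation (hG : IsMetricOn G U) {p : Euc n} (hp : p ∈ U)
    (V Y b : Euc n) : ∃ f₁ : ℝ → ℝ,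
      (∀ᶠ s in 𝓝 0, HasDerivAt (fun t => G (quadGeodesic G p V t) (variationField G p V Y b t)
        (variationField G p V Y b t)) (f₁ s) s) ∧ f₁ 0 = 2 * G p Y b ∧
      HasDerivAt f₁ (2 * (G p Y Y + G p (curv G p V b V) b)) 0 := by
  set N := quadGeodesic G p V with hN
  set X := variationField G p V Y b with hX
  set W := -(fderiv ℝ (chr G) p b V V + (2 : ℝ) • chr G p (Y - chr G p b V) V) with hW
  set N' : ℝ → Euc n := fun s => V + s • -chr G p V V with hN'
  set X' : ℝ → Euc n := fun s => (Y - chr G p b V) + s • W with hX'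
  have hNs : ∀ s, HasDerivAt N (N' s) s := fun s => hasDerivAt_quadGeodesic p V s
  have hXs : ∀ s, HasDerivAt X (X' s) s := fun s => hasDerivAt_quadratic b _ W s
  have hN0 : N 0 = p := by simp [hN, quadGeodesic]
  have hX0 : X 0 = b := by simp [hX, variationField]
  have hN'0 : N' 0 = V := by simp [hN']
  have hX'0 : X' 0 = Y - chr G p b V := by simp [hX']
  have hN0U : N 0 ∈ U := by rw [hN0]; exact hp
  have hNU : ∀ᶠ s in 𝓝 0, N s ∈ U := (hNs 0).continuousAt.eventually (hG.isOpen.mem_nhds hN0U)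
  -- Z is the covariant derivative of the variation field X along N; `variationField` is arranged so
  -- that Z takes the prescribed value Y at 0.
  set Z : ℝ → Euc n := fun s => X' s + chr G (N s) (N' s) (X s) with hZ
  have hZ0 : Z 0 = Y := by
    simp only [hZ, hN0, hX0, hN'0, hX'0, hG.chr_symm hp V b, sub_add_cancel]
  have hN'd : HasDerivAt N' (-chr G p V V) 0 := by
    exact (((hasDerivAt_id (0 : ℝ)).smul_const (-chr G p V V)).const_add V).congr_deriv
      (one_smul _ _)
  have hX'd : HasDerivAt X' W 0 := by
    exact (((hasDerivAt_id (0 : ℝ)).smul_const W).const_add (Y - chr G p b V)).congr_deriv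
      (one_smul _ _)
  have hΓ : HasDerivAt (fun s => chr G (N s)) (fderiv ℝ (chr G) p V) 0 := by
    have h1 := (hG.hasFDerivAt_chr hN0U).comp_hasDerivAt (0 : ℝ) (hNs 0)
    rw [hN0, hN'0] at h1
    exact h1
  have hZd : HasDerivAt Z (W + (fderiv ℝ (chr G) p V V b + chr G p (-chr G p V V) b
      + chr G p V (Y - chr G p b V))) 0 := by
    have h1 := hX'd.add ((hΓ.clm_apply hN'd).clm_apply (hXs 0))
    refine h1.congr_deriv ?_
    simp only [add_apply, hN0, hX0, hN'0, hX'0]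
  refine ⟨fun s => 2 * G (N s) (Z s) (X s), ?_, ?_, ?_⟩
  · filter_upwards [hNU] with s hs
    refine (hG.hasDerivAt_form hs (hNs s) (hXs s) (hXs s)).congr_deriv ?_
    rw [hG.symm _ hs (X s)]
    ring
  · simp only [hN0, hZ0, hX0]
  -- N has acceleration -Γ(V, V), so it is a geodesic to the order that matters at s = 0. The
  -- covariant derivative of Z is then pure curvature, as in the Jacobi equation.
  · refine ((hG.hasDerivAt_form hN0U (hNs 0) hZd (hXs 0)).const_mul 2).congr_deriv ?_
    have e1 : X' 0 + chr G (N 0) (N' 0) (X 0) = Y := hZ0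
    rw [e1, hN0, hZ0, hX0, hN'0, add_comm]
    congr 3
    simp only [curv, hW, map_sub, map_neg, map_add, map_smul, sub_apply, neg_apply]
    rw [hG.fderiv_chr_symm hp V b V, hG.chr_symm hp V Y, hG.chr_symm hp (chr G p V V) b,
      hG.chr_symm hp (chr G p b V) V]
    module

end Variation

/-! ### One step of a discrete variation, uniformly on compact sets -/

section StepBound

variable {n : ℕ} {G : Euc n → Form n} {U : Set (Euc n)}
variable {W : Type*} [NormedAddCommGroup W] [NormedSpace ℝ W]

theorem IsMetricOn.contDiffAt_form (hG : IsMetricOn G U) {P A B : W → Euc n} {w : W}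
    (hP : ContDiffAt ℝ ∞ P w) (hA : ContDiffAt ℝ ∞ A w) (hB : ContDiffAt ℝ ∞ B w)
    (hw : P w ∈ U) : ContDiffAt ℝ ∞ (fun z => G (P z) (A z) (B z)) w :=
  (((hG.contDiffAt hw).comp w hP).clm_apply hA).clm_apply hB

theorem IsMetricOn.contDiffAt_fderiv_chr (hG : IsMetricOn G U) {P A B C : W → Euc n} {w : W}
    (hP : ContDiffAt ℝ ∞ P w) (hA : ContDiffAt ℝ ∞ A w) (hB : ContDiffAt ℝ ∞ B w)
    (hC : ContDiffAt ℝ ∞ C w) (hw : P w ∈ U) :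
    ContDiffAt ℝ ∞ (fun z => fderiv ℝ (chr G) (P z) (A z) (B z) (C z)) w :=
  (((((hG.contDiffAt_chr hw).fderiv_right (m := ∞) (by simp)).comp w hP).clm_apply hA).clm_apply
    hB).clm_apply hC

theorem IsMetricOn.contDiffAt_stepVec (hG : IsMetricOn G U) {P V Y B : W → Euc n} {σ : W → ℝ}
    {w : W} (hP : ContDiffAt ℝ ∞ P w) (hV : ContDiffAt ℝ ∞ V w) (hY : ContDiffAt ℝ ∞ Y w)
    (hB : ContDiffAt ℝ ∞ B w) (hσ : ContDiffAt ℝ ∞ σ w) (hw : P w ∈ U) :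
    ContDiffAt ℝ ∞ (fun z => stepVec G (P z) (V z) (Y z) (B z) (σ z)) w :=
  (hV.add (hσ.smul (hY.sub (hG.contDiffAt_chr_apply hP hB hV hw)))).sub
    ((hσ.pow 2).smul (hG.contDiffAt_chr_apply hP hB hY hw))

theorem IsMetricOn.contDiffAt_variationField (hG : IsMetricOn G U) {P V Y B : W → Euc n}
    {σ : W → ℝ} {w : W} (hP : ContDiffAt ℝ ∞ P w) (hV : ContDiffAt ℝ ∞ V w)
    (hY : ContDiffAt ℝ ∞ Y w) (hB : ContDiffAt ℝ ∞ B w) (hσ : ContDiffAt ℝ ∞ σ w)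
    (hw : P w ∈ U) :
    ContDiffAt ℝ ∞ (fun z => variationField G (P z) (V z) (Y z) (B z) (σ z)) w := by
  have h1 := hY.sub (hG.contDiffAt_chr_apply hP hB hV hw)
  have h2 := (hG.contDiffAt_fderiv_chr hP hB hV hV hw).add
    ((hG.contDiffAt_chr_apply hP h1 hV hw).const_smul (2 : ℝ))
  exact (hB.add (hσ.smul h1)).add (((hσ.pow 2).div_const 2).smul h2.neg)

/-- The parameters of one step of a discrete variation: a point, the variation vector, its
covariant derivative and the velocity. -/
abbrev VarParam (n : ℕ) : Type := Euc n × Euc n × Euc n × Euc n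

/-- The starting point of a step. -/
def varPoint (G : Euc n → Form n) (z : VarParam n × ℝ) : Euc n :=
  quadGeodesic G z.1.1 z.1.2.1 z.2

/-- The velocity of a step. -/
def varVel (G : Euc n → Form n) (z : VarParam n × ℝ) : Euc n :=
  variationField G z.1.1 z.1.2.1 z.1.2.2.1 z.1.2.2.2 z.2

/-- The end point of a step of size `z.2`. -/
def varStep (G : Euc n → Form n) (z : (VarParam n × ℝ) × ℝ) : Euc n :=
  quadGeodesic G (z.1.1.1 + z.2 • z.1.1.2.2.2)
    (stepVec G z.1.1.1 z.1.1.2.1 z.1.1.2.2.1 z.1.1.2.2.2 z.2) z.1.2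

theorem varStep_zero (z : VarParam n × ℝ) : varStep G (z, 0) = varPoint G z := by
  simp [varStep, varPoint, stepVec]

theorem varPoint_zero (w : VarParam n) : varPoint G (w, 0) = w.1 := by
  simp [varPoint, quadGeodesic]

theorem varVel_zero (w : VarParam n) : varVel G (w, 0) = w.2.2.2 := by
  simp [varVel, variationField]

theorem IsMetricOn.contDiffAt_varPoint (hG : IsMetricOn G U) {z : VarParam n × ℝ}
    (hz : z.1.1 ∈ U) : ContDiffAt ℝ ∞ (varPoint G) z :=
  hG.contDiffAt_quadGeodesic (P := fun z : VarParam n × ℝ => z.1.1) (A := fun z => z.1.2.1)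
    (σ := fun z => z.2) (by fun_prop) (by fun_prop) (by fun_prop) hz

theorem IsMetricOn.contDiffAt_varVel (hG : IsMetricOn G U) {z : VarParam n × ℝ}
    (hz : z.1.1 ∈ U) : ContDiffAt ℝ ∞ (varVel G) z :=
  hG.contDiffAt_variationField (P := fun z : VarParam n × ℝ => z.1.1) (V := fun z => z.1.2.1)
    (Y := fun z => z.1.2.2.1) (B := fun z => z.1.2.2.2) (σ := fun z => z.2)
    (by fun_prop) (by fun_prop) (by fun_prop) (by fun_prop) (by fun_prop) hz

theorem IsMetricOn.contDiffAt_varStep (hG : IsMetricOn G U) {z : VarParam n × ℝ}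
    (hz : z.1.1 ∈ U) : ContDiffAt ℝ ∞ (varStep G) (z, 0) := by
  refine hG.contDiffAt_quadGeodesic
    (P := fun z : (VarParam n × ℝ) × ℝ => z.1.1.1 + z.2 • z.1.1.2.2.2)
    (A := fun z => stepVec G z.1.1.1 z.1.1.2.1 z.1.1.2.2.1 z.1.1.2.2.2 z.2)
    (σ := fun z => z.1.2) (by fun_prop) ?_ (by fun_prop) (by simpa using hz)
  exact hG.contDiffAt_stepVec (P := fun z : (VarParam n × ℝ) × ℝ => z.1.1.1)
    (V := fun z => z.1.1.2.1) (Y := fun z => z.1.1.2.2.1) (B := fun z => z.1.1.2.2.2)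
    (σ := fun z => z.2) (by fun_prop) (by fun_prop) (by fun_prop) (by fun_prop)
    (by fun_prop) hz

theorem IsMetricOn.exists_varPoint_taylor (hG : IsMetricOn G U) {K : Set (VarParam n)}
    (hK : IsCompact K) (hKU : ∀ w ∈ K, w.1 ∈ U) {η : ℝ} (hη : 0 < η) : ∃ s₀ > 0, ∀ s : ℝ,
      |s| ≤ s₀ → ∀ w ∈ K, varPoint G (w, s) ∈ U ∧
        G (varPoint G (w, s)) (varVel G (w, s)) (varVel G (w, s)) ≤
          G w.1 w.2.2.2 w.2.2.2 + s * (2 * G w.1 w.2.2.1 w.2.2.2)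
            + s ^ 2 * (G w.1 w.2.2.1 w.2.2.1
              + G w.1 (curv G w.1 w.2.1 w.2.2.2 w.2.1) w.2.2.2 + η) := by
  have hq : ∀ w ∈ K, ContDiffAt ℝ ∞ (fun z : VarParam n × ℝ =>
      G (varPoint G z) (varVel G z) (varVel G z)) (w, 0) := by
    intro w hw
    have h1 : varPoint G (w, 0) ∈ U := by rw [varPoint_zero]; exact hKU w hw
    have h2 := hG.contDiffAt_varPoint (z := (w, 0)) (hKU w hw)
    have h3 := hG.contDiffAt_varVel (z := (w, 0)) (hKU w hw)
    exact hG.contDiffAt_form h2 h3 h3 h1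
  have hsv : ∀ w ∈ K, ∃ f₁ : ℝ → ℝ,
      (∀ᶠ s in 𝓝 0, HasDerivAt (fun t => G (varPoint G (w, t)) (varVel G (w, t))
        (varVel G (w, t))) (f₁ s) s) ∧ f₁ 0 = 2 * G w.1 w.2.2.1 w.2.2.2 ∧
      HasDerivAt f₁ (2 * (G w.1 w.2.2.1 w.2.2.1
        + G w.1 (curv G w.1 w.2.1 w.2.2.2 w.2.1) w.2.2.2)) 0 :=
    fun w hw => hG.second_variation (hKU w hw) w.2.1 w.2.2.1 w.2.2.2
  obtain ⟨s₁, hs₁, htaylor⟩ := exists_uniform_taylor_two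
    (q := fun z => G (varPoint G z) (varVel G z) (varVel G z))
    (A := fun w => 2 * G w.1 w.2.2.1 w.2.2.2)
    (B := fun w => G w.1 w.2.2.1 w.2.2.1 + G w.1 (curv G w.1 w.2.1 w.2.2.2 w.2.1) w.2.2.2) hK
    hq hsv hη
  have hNU : ∀ᶠ s : ℝ in 𝓝 0, ∀ w ∈ K, varPoint G (w, s) ∈ U := by
    apply hK.eventually_forall_of_forall_eventually
    intro w hw
    have ht : Tendsto (fun z : ℝ × VarParam n => (z.2, z.1)) (𝓝 (0, w))
        (𝓝 (w, 0)) := continuous_swap.tendsto (0, w)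
    have h1 : varPoint G (w, 0) ∈ U := by rw [varPoint_zero]; exact hKU w hw
    exact ht.eventually ((hG.contDiffAt_varPoint (z := (w, 0))
      (hKU w hw)).continuousAt.eventually (hG.isOpen.mem_nhds h1))
  obtain ⟨s₂, hs₂, hball⟩ := Metric.eventually_nhds_iff_ball.1 hNU
  refine ⟨min s₁ (s₂ / 2), by positivity, fun s hs w hw => ⟨hball s ?_ w hw, ?_⟩⟩
  · rw [mem_ball_zero_iff, Real.norm_eq_abs]
    have := hs.trans (min_le_right s₁ (s₂ / 2))
    linarith
  · have h3 := htaylor s (hs.trans (min_le_left _ _)) w hw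
    rwa [varPoint_zero, varVel_zero] at h3

/-- The length of one step of a discrete variation, to second order in the parameter `s` of the
variation and uniformly to first order in the step size `h`. -/
theorem IsMetricOn.exists_step_bound (hG : IsMetricOn G U) {K : Set (Euc n)} (hK : IsCompact K)
    (hKU : K ⊆ U) (R : ℝ) {η : ℝ} (hη : 0 < η) : ∃ s₀ > 0, ∀ η' > 0, ∃ h₁ > 0, ∀ h : ℝ,
      0 ≤ h → h ≤ h₁ → ∀ s : ℝ, |s| ≤ s₀ → ∀ p ∈ K, ∀ V Y b : Euc n, ‖V‖ ≤ R → ‖Y‖ ≤ R →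
      ‖b‖ ≤ R → ∀ c₀ c₁ : Euc n, c₀ = quadGeodesic G p V s →
      c₁ = quadGeodesic G (p + h • b) (stepVec G p V Y b h) s → ∀ t ∈ Icc (0 : ℝ) 1,
      c₀ + t • (c₁ - c₀) ∈ U ∧ G (c₀ + t • (c₁ - c₀)) (c₁ - c₀) (c₁ - c₀) ≤
        h ^ 2 * (G p b b + s * (2 * G p Y b)
          + s ^ 2 * (G p Y Y + G p (curv G p V b V) b + η) + η') := by
  have hKWc : IsCompact (K ×ˢ Metric.closedBall 0 R ×ˢ Metric.closedBall 0 R ×ˢ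
      Metric.closedBall 0 R : Set (VarParam n)) :=
    hK.prod ((isCompact_closedBall _ _).prod
      ((isCompact_closedBall _ _).prod (isCompact_closedBall _ _)))
  obtain ⟨s₀, hs₀, htaylor⟩ := hG.exists_varPoint_taylor hKWc (fun w hw => hKU hw.1) hη
  -- The order of the quantifiers is essential: s₀ depends only on η, so η' and the step size can
  -- tend to 0 while the range of s stays fixed.
  refine ⟨s₀, hs₀, fun η' hη' => ?_⟩
  have hev := (hKWc.prod (isCompact_Icc (a := -s₀) (b := s₀))).eventually_forall_of_forall_eventually
    (x₀ := (0 : ℝ)) (P := fun h z => ∀ t ∈ Icc (0 : ℝ) 1,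
      varStep G (z, 0) + t • (varStep G (z, h) - varStep G (z, 0)) ∈ U ∧
      G (varStep G (z, 0) + t • (varStep G (z, h) - varStep G (z, 0)))
        (varStep G (z, h) - varStep G (z, 0)) (varStep G (z, h) - varStep G (z, 0)) ≤
        h ^ 2 * (G (varStep G (z, 0)) (varVel G z) (varVel G z) + η'))
    fun z hz => hG.eventually_chord_le (f := varStep G) (D := varVel G)
      ((hG.contDiffAt_varStep (hKU hz.1.1)).of_le (by exact_mod_cast le_top))
      (hG.contDiffAt_varVel (hKU hz.1.1)).continuousAt
      (hG.hasDerivAt_step (hKU hz.1.1) z.1.2.1 z.1.2.2.1 z.1.2.2.2 z.2)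
      (by rw [varStep_zero]; exact (htaylor z.2 (abs_le.2 hz.2) z.1 hz.1).1) hη'
  obtain ⟨h₂, hh₂, hhball⟩ := Metric.eventually_nhds_iff_ball.1 hev
  refine ⟨h₂ / 2, by positivity, fun h hh hh1 s hs p hp V Y b hV hY hb c₀ c₁ hc₀ hc₁ t ht => ?_⟩
  have hw : ((p, V, Y, b) : VarParam n) ∈ (K ×ˢ Metric.closedBall 0 R ×ˢ Metric.closedBall 0 R ×ˢ
      Metric.closedBall 0 R : Set (VarParam n)) :=
    ⟨hp, by simpa using hV, by simpa using hY, by simpa using hb⟩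
  have hhb : h ∈ Metric.ball (0 : ℝ) h₂ := by
    rw [mem_ball_zero_iff, Real.norm_of_nonneg hh]; linarith
  have key := hhball h hhb ((p, V, Y, b), s) ⟨hw, abs_le.1 hs⟩ t ht
  have e0 : varStep G (((p, V, Y, b), s), 0) = c₀ := (varStep_zero _).trans hc₀.symm
  have e1 : varStep G (((p, V, Y, b), s), h) = c₁ := hc₁.symm
  have e2 : varPoint G ((p, V, Y, b), s) = c₀ := hc₀.symm
  simp only [e0, e1] at key
  refine ⟨key.1, key.2.trans ?_⟩
  apply mul_le_mul_of_nonneg_left _ (sq_nonneg h)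
  have h3 := (htaylor s hs _ hw).2
  rw [e2] at h3
  exact add_le_add_left h3 η'

end StepBound

/-! ### Discrete parallel transport -/

section Transport

variable {n : ℕ} {G : Euc n → Form n} {U : Set (Euc n)}

theorem IsMetricOn.exists_norm_le_sqrt (hG : IsMetricOn G U) {K : Set (Euc n)} (hK : IsCompact K)
    (hKU : K ⊆ U) : ∃ R > 0, ∀ p ∈ K, ∀ v, ‖v‖ ≤ R * Real.sqrt (G p v v) := by
  refine hK.induction_on (p := fun A => ∃ R > 0, ∀ p ∈ A, ∀ v, ‖v‖ ≤ R * Real.sqrt (G p v v))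
    ⟨1, one_pos, fun p hp => hp.elim⟩ (fun s t hst ⟨R, hR, h⟩ => ⟨R, hR, fun p hp => h p (hst hp)⟩)
    ?_ ?_
  · rintro s t ⟨R, hR, h⟩ ⟨R', hR', h'⟩
    refine ⟨max R R', lt_max_of_lt_left hR, fun p hp v => ?_⟩
    rcases hp with hp | hp
    · exact (h p hp v).trans (mul_le_mul_of_nonneg_right (le_max_left _ _) (Real.sqrt_nonneg _))
    · exact (h' p hp v).trans (mul_le_mul_of_nonneg_right (le_max_right _ _) (Real.sqrt_nonneg _))
  · intro p hp
    obtain ⟨c, C, hc, hC, hev⟩ := exists_norm_bounds hG (hKU hp)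
    refine ⟨_, mem_nhdsWithin_of_mem_nhds hev, c⁻¹, by positivity, fun y hy v => ?_⟩
    rw [inv_mul_eq_div, le_div_iff₀ hc, mul_comm]
    apply Real.le_sqrt_of_sq_le
    rw [mul_pow]
    exact (hy v).1

/-- By metric compatibility the inner product of two vectors moved by the first-order transport has
zero derivative at h = 0, so its change is o(h), uniformly on compact sets. -/
theorem IsMetricOn.exists_drift_bound (hG : IsMetricOn G U) {K : Set (Euc n)} (hK : IsCompact K)
    (hKU : K ⊆ U) (R : ℝ) {ε : ℝ} (hε : 0 < ε) : ∃ h₁ > 0, ∀ h : ℝ, 0 ≤ h → h ≤ h₁ →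
      ∀ p ∈ K, ∀ v w b : Euc n, ‖v‖ ≤ R → ‖w‖ ≤ R → ‖b‖ ≤ R →
      |G (p + h • b) (v - h • chr G p b v) (w - h • chr G p b w) - G p v w| ≤ ε * h := by
  have hKWc : IsCompact (K ×ˢ Metric.closedBall 0 R ×ˢ Metric.closedBall 0 R ×ˢ
      Metric.closedBall 0 R : Set (VarParam n)) :=
    hK.prod ((isCompact_closedBall _ _).prod
      ((isCompact_closedBall _ _).prod (isCompact_closedBall _ _)))
  have hev := hKWc.eventually_forall_of_forall_eventually (x₀ := (0 : ℝ))
    (P := fun h z => |G (z.1 + h • z.2.2.2) (z.2.1 - h • chr G z.1 z.2.2.2 z.2.1)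
      (z.2.2.1 - h • chr G z.1 z.2.2.2 z.2.2.1) - G z.1 z.2.1 z.2.2.1| ≤ ε * |h|) (by
    intro z hz
    have hzU : z.1 ∈ U := hKU hz.1
    have hz0 : z.1 + (0 : ℝ) • z.2.2.2 ∈ U := by simpa using hzU
    have c1 : ContDiffAt ℝ ∞ (fun q : VarParam n × ℝ => q.1.1 + q.2 • q.1.2.2.2) (z, 0) := by
      fun_prop
    have c2 : ContDiffAt ℝ ∞ (fun q : VarParam n × ℝ =>
        q.1.2.1 - q.2 • chr G q.1.1 q.1.2.2.2 q.1.2.1) (z, 0) := by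
      have d0 := hG.contDiffAt_chr_apply (P := fun q : VarParam n × ℝ => q.1.1)
        (A := fun q => q.1.2.2.2) (B := fun q => q.1.2.1) (w := (z, 0))
        (by fun_prop) (by fun_prop) (by fun_prop) hzU
      have d1 : ContDiffAt ℝ ∞ (fun q : VarParam n × ℝ => q.2) (z, 0) := by fun_prop
      have d2 : ContDiffAt ℝ ∞ (fun q : VarParam n × ℝ => q.1.2.1) (z, 0) := by fun_prop
      exact d2.sub (d1.smul d0)
    have c3 : ContDiffAt ℝ ∞ (fun q : VarParam n × ℝ =>
        q.1.2.2.1 - q.2 • chr G q.1.1 q.1.2.2.2 q.1.2.2.1) (z, 0) := by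
      have d0 := hG.contDiffAt_chr_apply (P := fun q : VarParam n × ℝ => q.1.1)
        (A := fun q => q.1.2.2.2) (B := fun q => q.1.2.2.1) (w := (z, 0))
        (by fun_prop) (by fun_prop) (by fun_prop) hzU
      have d1 : ContDiffAt ℝ ∞ (fun q : VarParam n × ℝ => q.2) (z, 0) := by fun_prop
      have d2 : ContDiffAt ℝ ∞ (fun q : VarParam n × ℝ => q.1.2.2.1) (z, 0) := by fun_prop
      exact d2.sub (d1.smul d0)
    have c4 := hG.contDiffAt_form c1 c2 c3 hz0
    have hvec : ∀ v : Euc n, HasDerivAt (fun h : ℝ => v - h • chr G z.1 z.2.2.2 v)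
        (-chr G z.1 z.2.2.2 v) 0 := fun v =>
      (((hasDerivAt_id (0 : ℝ)).smul_const (chr G z.1 z.2.2.2 v)).const_sub v).congr_deriv
        (by simp)
    have hP : HasDerivAt (fun h : ℝ => z.1 + h • z.2.2.2) z.2.2.2 0 :=
      (((hasDerivAt_id (0 : ℝ)).smul_const z.2.2.2).const_add z.1).congr_deriv (one_smul _ _)
    have hd := (hG.hasDerivAt_form (N := fun h : ℝ => z.1 + h • z.2.2.2) hz0 hP
      (hvec z.2.1) (hvec z.2.2.1)).congr_deriv (g' := 0) (by simp)
    have := eventually_expansion (c4.of_le (m := 1) (by exact_mod_cast le_top)) hd hε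
    filter_upwards [this] with q hq
    simpa using hq)
  obtain ⟨h₂, hh₂, hball⟩ := Metric.eventually_nhds_iff_ball.1 hev
  refine ⟨h₂ / 2, by positivity, fun h hh hh1 p hp v w b hv hw hb => ?_⟩
  have hhb : h ∈ Metric.ball (0 : ℝ) h₂ := by
    rw [mem_ball_zero_iff, Real.norm_of_nonneg hh]; linarith
  have := hball h hhb (p, v, w, b)
    ⟨hp, by simpa using hv, by simpa using hw, by simpa using hb⟩
  rwa [abs_of_nonneg hh] at this

/-- The discrete parallel transport along the sequence of points `x`. -/
def transport (G : Euc n → Form n) (x : ℕ → Euc n) (v : Euc n) : ℕ → Euc n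
  | 0 => v
  | k + 1 => transport G x v k - chr G (x k) (x (k + 1) - x k) (transport G x v k)

/-- Each step costs at most ε h in orthonormality, and m h ≤ 1, so the total error is at most ε
however many steps there are. -/
theorem IsMetricOn.exists_transport_bound (hG : IsMetricOn G U) {K : Set (Euc n)}
    (hK : IsCompact K) (hKU : K ⊆ U) {ε : ℝ} (hε : 0 < ε) : ∃ h₁ > 0, ∀ h : ℝ, 0 < h → h ≤ h₁ →
      ∀ (m : ℕ) (x : ℕ → Euc n), m * h ≤ 1 → (∀ k ≤ m, x k ∈ K) →
      (∀ k < m, G (x k) (x (k + 1) - x k) (x (k + 1) - x k) ≤ 4 * h ^ 2) →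
      ∀ E, IsOrthoFrame (G (x 0)) E → ∀ k ≤ m, ∀ i j,
        |G (x k) (transport G x (E i) k) (transport G x (E j) k) - if i = j then 1 else 0| ≤ ε := by
  -- With ε ≤ 1 the transported vectors have squared length at most 2 and so remain in the compact
  -- set on which the drift bound holds.
  wlog hε1 : ε ≤ 1 generalizing ε
  · obtain ⟨h₁, hh₁, H⟩ := this one_pos le_rfl
    exact ⟨h₁, hh₁, fun h h1 h2 m x h3 h4 h5 E hE k hk i j =>
      (H h h1 h2 m x h3 h4 h5 E hE k hk i j).trans (not_le.1 hε1).le⟩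
  obtain ⟨R, hR, hnorm⟩ := hG.exists_norm_le_sqrt hK hKU
  obtain ⟨h₁, hh₁, hdrift⟩ := hG.exists_drift_bound hK hKU (R * 2) hε
  refine ⟨h₁, hh₁, fun h hh0 hh m x hm hxK hstep E hE k hk i j => ?_⟩
  have key : ∀ k ≤ m, ∀ i j, |G (x k) (transport G x (E i) k) (transport G x (E j) k)
      - if i = j then 1 else 0| ≤ ε * (k * h) := by
    intro k
    induction k with
    | zero => intro _ i j; simp [transport, hE i j]
    | succ k ih =>
      intro hk i j
      have ihk := ih (by omega)
      have hkK := hxK k (by omega)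
      have hkh : (k : ℝ) * h ≤ 1 := by
        have : (k : ℝ) ≤ m := by exact_mod_cast (by omega : k ≤ m)
        exact (mul_le_mul_of_nonneg_right this hh0.le).trans hm
      have hnE : ∀ i, ‖transport G x (E i) k‖ ≤ R * 2 := by
        intro i
        refine (hnorm _ hkK _).trans (mul_le_mul_of_nonneg_left ?_ hR.le)
        rw [Real.sqrt_le_left (by norm_num)]
        have h1 := (abs_le.1 (ihk i i)).2
        simp only [if_true] at h1
        nlinarith
      obtain ⟨b, hb⟩ : ∃ b, b = h⁻¹ • (x (k + 1) - x k) := ⟨_, rfl⟩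
      have hhb : h • b = x (k + 1) - x k := by rw [hb, smul_inv_smul₀ hh0.ne']
      have hnb : ‖b‖ ≤ R * 2 := by
        refine (hnorm _ hkK _).trans (mul_le_mul_of_nonneg_left ?_ hR.le)
        rw [Real.sqrt_le_left (by norm_num), hb]
        simp only [map_smul, smul_apply, smul_eq_mul]
        rw [← mul_assoc, ← mul_inv, ← sq, inv_mul_le_iff₀ (by positivity)]
        linarith [hstep k (by omega)]
      have h1 := hdrift h hh0.le hh (x k) hkK _ _ b (hnE i) (hnE j) hnb
      have h2 : ∀ v, h • chr G (x k) b v = chr G (x k) (x (k + 1) - x k) v := by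
        intro v
        rw [← hhb, map_smul, smul_apply]
      rw [h2, h2, hhb, add_sub_cancel] at h1
      have h3 := ihk i j
      change |G (x (k + 1)) (_ - _) (_ - _) - _| ≤ _
      push_cast
      refine (abs_sub_le _ (G (x k) (transport G x (E i) k) (transport G x (E j) k)) _).trans ?_
      linarith
  refine (key k hk i j).trans ?_
  have : (k : ℝ) * h ≤ 1 := by
    have : (k : ℝ) ≤ m := by exact_mod_cast hk
    exact (mul_le_mul_of_nonneg_right this hh0.le).trans hm
  nlinarith

/-- Curvature and Bessel bounds for frames which are almost orthonormal. -/
theorem IsMetricOn.exists_frame_bound (hG : IsMetricOn G U) {K : Set (Euc n)}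
    (hK : IsCompact K) (hKU : K ⊆ U) {κ : ℝ} (hκ : 0 ≤ κ)
    (hric : ∀ p ∈ K, ∀ b : Euc n,
      -κ * G p b b ≤ ∑ i, ∑ j, ricciCoord (matOf G) i j p * b i * b j)
    {η : ℝ} (hη : 0 < η) : ∃ ε > 0, ∀ p ∈ K, ∀ (E : Fin n → Euc n) (b : Euc n),
      (∀ i j, |G p (E i) (E j) - if i = j then 1 else 0| ≤ ε) → G p b b ≤ 1 + ε →
      ∑ i, G p (curv G p (E i) b (E i)) b ≤ κ + η ∧ ∑ i, G p (E i) b ^ 2 ≤ 1 + η := by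
  obtain ⟨R, hR, hnorm⟩ := hG.exists_norm_le_sqrt hK hKU
  set X : Set (Euc n × (Fin n → Euc n) × Euc n) :=
    K ×ˢ Metric.closedBall 0 (R * 2) ×ˢ Metric.closedBall 0 (R * 2) with hX
  have hXc : IsCompact X :=
    hK.prod ((isCompact_closedBall _ _).prod (isCompact_closedBall _ _))
  have cform : ∀ A B : Euc n × (Fin n → Euc n) × Euc n → Euc n, Continuous A → Continuous B →
      ContinuousOn (fun z => G z.1 (A z) (B z)) X := by
    intro A B hA hB z hz
    have h1 : ContinuousAt (fun z : Euc n × (Fin n → Euc n) × Euc n => G z.1) z :=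
      ContinuousAt.comp (f := Prod.fst) (hG.contDiffAt (hKU hz.1)).continuousAt continuousAt_fst
    exact ((h1.clm_apply hA.continuousAt).clm_apply hB.continuousAt).continuousWithinAt
  have hf : ContinuousOn (fun z : Euc n × (Fin n → Euc n) × Euc n =>
      max (∑ i, ∑ j, |G z.1 (z.2.1 i) (z.2.1 j) - if i = j then 1 else 0|)
        (G z.1 z.2.2 z.2.2 - 1)) X := by
    refine fun z hz => Filter.Tendsto.max ?_ ?_
    · revert z hz
      refine continuousOn_finsetSum _ fun i _ => continuousOn_finsetSum _ fun j _ => ?_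
      exact ((cform _ _ (by fun_prop) (by fun_prop)).sub continuousOn_const).abs
    · exact ((cform _ _ (by fun_prop) (by fun_prop)).sub continuousOn_const) z hz
  have hg : ContinuousOn (fun z : Euc n × (Fin n → Euc n) × Euc n =>
      max (∑ i, G z.1 (curv G z.1 (z.2.1 i) z.2.2 (z.2.1 i)) z.2.2 - κ)
        (∑ i, G z.1 (z.2.1 i) z.2.2 ^ 2 - 1)) X := by
    refine fun z hz => Filter.Tendsto.max ?_ ?_
    · revert z hz
      refine ContinuousOn.sub (continuousOn_finsetSum _ fun i _ => ?_) continuousOn_const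
      intro z hz
      have hzU : z.1 ∈ U := hKU hz.1
      have a1 : ContDiffAt ℝ ∞ (fun z : Euc n × (Fin n → Euc n) × Euc n => z.1) z := by fun_prop
      have a2 : ContDiffAt ℝ ∞ (fun z : Euc n × (Fin n → Euc n) × Euc n => z.2.1 i) z := by
        fun_prop
      have a3 : ContDiffAt ℝ ∞ (fun z : Euc n × (Fin n → Euc n) × Euc n => z.2.2) z := by
        fun_prop
      have a4 := (((hG.contDiffAt_fderiv_chr a1 a2 a3 a2 hzU).sub
        (hG.contDiffAt_fderiv_chr a1 a3 a2 a2 hzU)).add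
        (hG.contDiffAt_chr_apply a1 a2 (hG.contDiffAt_chr_apply a1 a3 a2 hzU) hzU)).sub
        (hG.contDiffAt_chr_apply a1 a3 (hG.contDiffAt_chr_apply a1 a2 a2 hzU) hzU)
      exact (hG.contDiffAt_form a1 a4 a3 hzU).continuousAt.continuousWithinAt
    · revert z hz
      refine ContinuousOn.sub (continuousOn_finsetSum _ fun i _ => ?_) continuousOn_const
      exact (cform _ _ (by fun_prop) (by fun_prop)).pow 2
  -- For an exactly orthonormal frame and G(b, b) ≤ 1 the two bounds hold without error, by the
  -- Ricci hypothesis and Parseval's identity; compactness extends them to nearby frames.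
  obtain ⟨ε, hε, H⟩ := exists_forall_le_add_of_compact hXc hf hg (c := 0) (by
    intro z hz hz0
    obtain ⟨h1, h2⟩ := max_le_iff.1 hz0
    have hzU : z.1 ∈ U := hKU hz.1
    have hE : IsOrthoFrame (G z.1) z.2.1 := by
      intro i j
      have h3 := (Finset.sum_eq_zero_iff_of_nonneg (fun i _ =>
        Finset.sum_nonneg fun j _ => abs_nonneg _)).1
        (le_antisymm h1 (Finset.sum_nonneg fun i _ => Finset.sum_nonneg fun j _ => abs_nonneg _))
        i (Finset.mem_univ i)
      have h4 := (Finset.sum_eq_zero_iff_of_nonneg (fun j _ => abs_nonneg _)).1 h3 j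
        (Finset.mem_univ j)
      exact sub_eq_zero.1 (abs_eq_zero.1 h4)
    apply max_le
    · rw [hG.sum_curv_frame hzU hE]
      have := hric z.1 hz.1 z.2.2
      nlinarith
    · have h3 : G z.1 z.2.2 z.2.2 = ∑ i, G z.1 (z.2.1 i) z.2.2 ^ 2 := by
        refine (congrArg (fun w => G z.1 w z.2.2) (hE.eq_sum z.2.2)).trans ?_
        simp only [map_sum, map_smul, sum_apply, smul_apply, smul_eq_mul]
        refine Finset.sum_congr rfl fun i _ => ?_
        rw [sq, hG.symm _ hzU z.2.2]
      linarith) hη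
  -- The deviation from orthonormality is a sum of n² entries, each within this tolerance.
  refine ⟨min (ε / (n ^ 2 + 1)) 1, by positivity, fun p hp E b hE hb => ?_⟩
  have hε1 : min (ε / ((n : ℝ) ^ 2 + 1)) 1 ≤ 1 := min_le_right _ _
  have hε2 : (n ^ 2 + 1) * min (ε / ((n : ℝ) ^ 2 + 1)) 1 ≤ ε := by
    rw [← le_div_iff₀' (by positivity)]
    exact min_le_left _ _
  set ε' := min (ε / ((n : ℝ) ^ 2 + 1)) 1 with hε'
  have hε'0 : 0 < ε' := by positivity
  have hn : ∀ v, G p v v ≤ 4 → ‖v‖ ≤ R * 2 := by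
    intro v hv
    refine (hnorm _ hp _).trans (mul_le_mul_of_nonneg_left ?_ hR.le)
    rw [Real.sqrt_le_left (by norm_num)]
    linarith
  have hmem : (p, E, b) ∈ X := by
    refine ⟨hp, ?_, ?_⟩
    · rw [mem_closedBall_zero_iff, pi_norm_le_iff_of_nonneg (by positivity)]
      intro i
      apply hn
      have := (abs_le.1 (hE i i)).2
      simp only [if_true] at this
      linarith
    · rw [mem_closedBall_zero_iff]
      exact hn _ (by linarith)
  have h1 := H _ hmem (by
    apply max_le
    · calc _ ≤ ∑ i : Fin n, ∑ j : Fin n, ε' :=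
            Finset.sum_le_sum fun i _ => Finset.sum_le_sum fun j _ => hE i j
        _ = n ^ 2 * ε' := by simp; ring
        _ ≤ ε := by nlinarith
    · have : (0 : ℝ) ≤ (n : ℝ) ^ 2 := by positivity
      change G p b b - 1 ≤ ε
      nlinarith)
  obtain ⟨h2, h3⟩ := max_le_iff.1 h1
  change ∑ i, G p (curv G p (E i) b (E i)) b - κ ≤ 0 + η at h2
  change ∑ i, G p (E i) b ^ 2 - 1 ≤ 0 + η at h3
  constructor <;> linarith

end Transport

/-! ### First and second variations along a chain -/

section DiscreteVariation

variable {n : ℕ} {G : Euc n → Form n} {U : Set (Euc n)}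

/-- The velocity of the `k`-th step, of duration `h`, of a sequence of points. -/
def stepVel (x : ℕ → Euc n) (h : ℝ) (k : ℕ) : Euc n := h⁻¹ • (x (k + 1) - x k)

theorem smul_stepVel (x : ℕ → Euc n) {h : ℝ} (hh : h ≠ 0) (k : ℕ) :
    h • stepVel x h k = x (k + 1) - x k := smul_inv_smul₀ hh _

theorem form_stepVel_le {x : ℕ → Euc n} {h : ℝ} (hh : 0 < h) {k : ℕ} {B : Form n} {c : ℝ}
    (hB : B (x (k + 1) - x k) (x (k + 1) - x k) ≤ c * h ^ 2) :
    B (stepVel x h k) (stepVel x h k) ≤ c := by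
  simp only [stepVel, map_smul, smul_apply, smul_eq_mul]
  rw [← mul_assoc, ← mul_inv, ← sq, inv_mul_le_iff₀ (by positivity), mul_comm]
  exact hB

/-- The first variation of the length of the discrete variation along the transported vector `v`
multiplied by a function of slope `l`. -/
def varFirst (G : Euc n → Form n) (x : ℕ → Euc n) (h l : ℝ) (v : Euc n) (m : ℕ) : ℝ :=
  ∑ k ∈ Finset.range m, h * (l * G (x k) (transport G x v k) (stepVel x h k))

/-- The second variation of the length of the discrete variation along the transported vector `v`
multiplied by a function of slope `l` and initial value `c`. -/
def varSecond (G : Euc n → Form n) (x : ℕ → Euc n) (h l c : ℝ) (v : Euc n) (m : ℕ) : ℝ :=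
  ∑ k ∈ Finset.range m, h * (l ^ 2 * G (x k) (transport G x v k) (transport G x v k)
    + (c + k * h * l) ^ 2 * G (x k)
      (curv G (x k) (transport G x v k) (stepVel x h k) (transport G x v k)) (stepVel x h k))

theorem curv_smul_smul (y v b : Euc n) (c : ℝ) :
    curv G y (c • v) b (c • v) = c ^ 2 • curv G y v b v := by
  simp only [curv, map_smul, smul_apply, smul_smul, smul_add, smul_sub, ← sq]

/-- The quadratic term in `stepVec` is there for this exact identity: (c + hl)(E - hΓ(b, E))
contains -h²lΓ(b, E). The end point of one varied step is thus precisely the starting point of the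
next. -/
theorem stepVec_transport (x : ℕ → Euc n) {h : ℝ} (hh : h ≠ 0) (v : Euc n) (c l : ℝ) (k : ℕ) :
    stepVec G (x k) (c • transport G x v k) (l • transport G x v k) (stepVel x h k) h =
      (c + h * l) • transport G x v (k + 1) := by
  rw [transport, ← smul_stepVel x hh, stepVec]
  simp only [map_smul, smul_apply]
  module

theorem norm_transport_le {K : Set (Euc n)} {R : ℝ} (hR : 0 < R)
    (hnorm : ∀ p ∈ K, ∀ v, ‖v‖ ≤ R * Real.sqrt (G p v v)) {p v : Euc n} (hp : p ∈ K)
    (hv : G p v v ≤ 4) : ‖v‖ ≤ R * 2 := by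
  refine (hnorm _ hp _).trans (mul_le_mul_of_nonneg_left ?_ hR.le)
  rw [Real.sqrt_le_left (by norm_num)]
  linarith

theorem form_self_le_four {B : Form n} {E : Fin n → Euc n} {ε : ℝ} (hε : ε ≤ 1)
    (h : ∀ i j, |B (E i) (E j) - if i = j then 1 else 0| ≤ ε) (i : Fin n) : B (E i) (E i) ≤ 4 := by
  have := (abs_le.1 (h i i)).2
  simp only [if_true] at this
  linarith

/-- The bounds on the first and second variations, and on the transported frame. -/
theorem IsMetricOn.exists_variation_bounds (hG : IsMetricOn G U) {K : Set (Euc n)}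
    (hK : IsCompact K) (hKU : K ⊆ U) {κ : ℝ} (hκ : 0 ≤ κ)
    (hric : ∀ p ∈ K, ∀ b : Euc n,
      -κ * G p b b ≤ ∑ i, ∑ j, ricciCoord (matOf G) i j p * b i * b j)
    {l : ℝ} (hl : 0 ≤ l) : ∃ C : ℝ, ∀ η : ℝ, 0 < η → ∃ h₁ > 0, ∃ ε > 0, ∀ h : ℝ, 0 < h → h ≤ h₁ →
      ∀ (m : ℕ) (x : ℕ → Euc n) (c : ℝ), 0 ≤ c → c + m * h * l ≤ 1 → m * h ≤ 1 →
      (∀ k ≤ m, x k ∈ K) →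
      (∀ k < m, G (x k) (x (k + 1) - x k) (x (k + 1) - x k) ≤ (1 + ε) * h ^ 2) →
      ∀ E, IsOrthoFrame (G (x 0)) E →
      (∀ i j, |G (x m) (transport G x (E i) m) (transport G x (E j) m)
        - if i = j then 1 else 0| ≤ η) ∧
      (∀ i, ‖transport G x (E i) m‖ ≤ C) ∧
      ‖(WithLp.toLp 2 fun i => varFirst G x h l (E i) m : Euc n)‖ ≤ m * h * l * (1 + η) ∧
      ∑ i, varSecond G x h l c (E i) m ≤ m * h * (n * l ^ 2 + κ + η) ∧
      ∀ i, |varSecond G x h l c (E i) m| ≤ C := by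
  obtain ⟨R, hR, hnorm⟩ := hG.exists_norm_le_sqrt hK hKU
  have hcpt : IsCompact (K ×ˢ Metric.closedBall (0 : Euc n) (R * 2) ×ˢ
      Metric.closedBall (0 : Euc n) (R * 2)) :=
    hK.prod ((isCompact_closedBall _ _).prod (isCompact_closedBall _ _))
  have hcont : ContinuousOn (fun z : Euc n × Euc n × Euc n =>
      G z.1 (curv G z.1 z.2.1 z.2.2 z.2.1) z.2.2) (K ×ˢ Metric.closedBall (0 : Euc n) (R * 2) ×ˢ
      Metric.closedBall (0 : Euc n) (R * 2)) := by
    intro z hz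
    have hzU : z.1 ∈ U := hKU hz.1
    have a1 : ContDiffAt ℝ ∞ (fun z : Euc n × Euc n × Euc n => z.1) z := by fun_prop
    have a2 : ContDiffAt ℝ ∞ (fun z : Euc n × Euc n × Euc n => z.2.1) z := by fun_prop
    have a3 : ContDiffAt ℝ ∞ (fun z : Euc n × Euc n × Euc n => z.2.2) z := by fun_prop
    have a4 := (((hG.contDiffAt_fderiv_chr a1 a2 a3 a2 hzU).sub
      (hG.contDiffAt_fderiv_chr a1 a3 a2 a2 hzU)).add
      (hG.contDiffAt_chr_apply a1 a2 (hG.contDiffAt_chr_apply a1 a3 a2 hzU) hzU)).sub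
      (hG.contDiffAt_chr_apply a1 a3 (hG.contDiffAt_chr_apply a1 a2 a2 hzU) hzU)
    exact (hG.contDiffAt_form a1 a4 a3 hzU).continuousAt.continuousWithinAt
  obtain ⟨D, hD⟩ := hcpt.exists_bound_of_continuousOn hcont
  -- This bound does not depend on η or on the number of steps, which later provides compactness
  -- when the mesh tends to 0.
  refine ⟨max (R * 2) (l ^ 2 * 4 + |D|), fun η hη => ?_⟩
  -- The error η₀ enters once through the curvature and n l² times through the squared lengths of
  -- the frame, which totals (1 + n l²)η₀ = η.
  obtain ⟨ε₁, hε₁, hframe⟩ := hG.exists_frame_bound hK hKU hκ hric (η := η / (1 + n * l ^ 2))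
    (by positivity)
  set η₀ := η / (1 + n * l ^ 2) with hη₀
  have hη₀' : (1 + n * l ^ 2) * η₀ = η := by rw [hη₀]; field_simp
  have hη₀0 : 0 < η₀ := by positivity
  have hnl : 0 ≤ (n : ℝ) * l ^ 2 := by positivity
  have hη₀η : η₀ ≤ η := by nlinarith
  set ε := min (min ε₁ η₀) 1 with hε
  have hε0 : 0 < ε := by positivity
  have hεε₁ : ε ≤ ε₁ := (min_le_left _ _).trans (min_le_left _ _)
  have hεη : ε ≤ η₀ := (min_le_left _ _).trans (min_le_right _ _)
  have hε1 : ε ≤ 1 := min_le_right _ _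
  obtain ⟨h₁, hh₁, htrans⟩ := hG.exists_transport_bound hK hKU hε0
  refine ⟨h₁, hh₁, ε, hε0, fun h hh0 hh m x c hc hcm hm hxK hstep E hE => ?_⟩
  have htr := htrans h hh0 hh m x hm hxK
    (fun k hk => (hstep k hk).trans (by nlinarith [sq_nonneg h])) E hE
  have hb : ∀ k < m, G (x k) (stepVel x h k) (stepVel x h k) ≤ 1 + ε := fun k hk =>
    form_stepVel_le hh0 (hstep k hk)
  have hck : ∀ k < m, 0 ≤ c + k * h * l ∧ c + k * h * l ≤ 1 := by
    intro k hk
    refine ⟨by positivity, le_trans ?_ hcm⟩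
    have : (k : ℝ) ≤ m := by exact_mod_cast hk.le
    gcongr
  have hfr : ∀ k < m, _ := fun k hk => hframe (x k) (hxK k hk.le)
    (fun i => transport G x (E i) k) (stepVel x h k)
    (fun i j => (htr k hk.le i j).trans hεε₁) ((hb k hk).trans (by linarith))
  have hEn : ∀ k ≤ m, ∀ i, ‖transport G x (E i) k‖ ≤ R * 2 := fun k hk i =>
    norm_transport_le hR hnorm (hxK k hk) (form_self_le_four hε1 (htr k hk) i)
  refine ⟨fun i j => (htr m le_rfl i j).trans (hεη.trans hη₀η),
    fun i => (hEn m le_rfl i).trans (le_max_left _ _), ?_, ?_, ?_⟩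
  -- Treating the n first variations as one vector allows Bessel's inequality to be used step by
  -- step, without a loss depending on the dimension.
  · have h1 : (WithLp.toLp 2 fun i => varFirst G x h l (E i) m : Euc n) =
        ∑ k ∈ Finset.range m, (h * l) • (WithLp.toLp 2 fun i =>
          G (x k) (transport G x (E i) k) (stepVel x h k) : Euc n) := by
      ext i
      simp [varFirst, mul_assoc]
    rw [h1]
    refine (norm_sum_le _ _).trans ?_
    have h2 : ∀ k ∈ Finset.range m, ‖(h * l) • (WithLp.toLp 2 fun i =>
          G (x k) (transport G x (E i) k) (stepVel x h k) : Euc n)‖ ≤ h * l * (1 + η) := by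
      intro k hk
      rw [norm_smul, Real.norm_of_nonneg (by positivity)]
      apply mul_le_mul_of_nonneg_left _ (by positivity)
      rw [EuclideanSpace.norm_eq, Real.sqrt_le_left (by positivity)]
      simp only [Real.norm_eq_abs, sq_abs]
      nlinarith [(hfr k (Finset.mem_range.1 hk)).2]
    refine (Finset.sum_le_sum h2).trans_eq ?_
    simp; ring
  · simp only [varSecond]
    rw [Finset.sum_comm]
    have h2 : ∀ k ∈ Finset.range m, ∑ i, h * (l ^ 2 * G (x k) (transport G x (E i) k)
        (transport G x (E i) k) + (c + k * h * l) ^ 2 * G (x k)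
        (curv G (x k) (transport G x (E i) k) (stepVel x h k) (transport G x (E i) k))
        (stepVel x h k)) ≤ h * (n * l ^ 2 + κ + η) := by
      intro k hk
      have hk' := Finset.mem_range.1 hk
      rw [← Finset.mul_sum, Finset.sum_add_distrib, ← Finset.mul_sum, ← Finset.mul_sum]
      apply mul_le_mul_of_nonneg_left _ hh0.le
      have h3 : ∑ i, G (x k) (transport G x (E i) k) (transport G x (E i) k) ≤ n * (1 + η₀) := by
        calc _ ≤ ∑ i : Fin n, (1 + η₀) := Finset.sum_le_sum fun i _ => by
              have := (abs_le.1 (htr k hk'.le i i)).2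
              simp only [if_true] at this
              linarith
          _ = n * (1 + η₀) := by simp; ring
      have h4 := (hfr k hk').1
      obtain ⟨h5, h6⟩ := hck k hk'
      have h7 : (c + k * h * l) ^ 2 ≤ 1 := by nlinarith
      have h8 : (c + k * h * l) ^ 2 * ∑ i, G (x k) (curv G (x k) (transport G x (E i) k)
          (stepVel x h k) (transport G x (E i) k)) (stepVel x h k) ≤ κ + η₀ :=
        (mul_le_mul_of_nonneg_left h4 (sq_nonneg _)).trans
          (mul_le_of_le_one_left (by positivity) h7)
      nlinarith [mul_le_mul_of_nonneg_left h3 (sq_nonneg l)]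
    refine (Finset.sum_le_sum h2).trans_eq ?_
    simp; ring
  · intro i
    refine le_trans ?_ (le_max_right _ _)
    have h2 : ∀ k ∈ Finset.range m, |h * (l ^ 2 * G (x k) (transport G x (E i) k)
        (transport G x (E i) k) + (c + k * h * l) ^ 2 * G (x k)
        (curv G (x k) (transport G x (E i) k) (stepVel x h k) (transport G x (E i) k))
        (stepVel x h k))| ≤ h * (l ^ 2 * 4 + |D|) := by
      intro k hk
      have hk' := Finset.mem_range.1 hk
      rw [abs_mul, abs_of_pos hh0]
      apply mul_le_mul_of_nonneg_left _ hh0.le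
      refine (abs_add_le _ _).trans (add_le_add ?_ ?_)
      · rw [abs_mul, abs_of_nonneg (sq_nonneg l),
          abs_of_nonneg (hG.nonneg (hKU (hxK k hk'.le)) _)]
        exact mul_le_mul_of_nonneg_left (form_self_le_four hε1 (htr k hk'.le) i) (sq_nonneg l)
      · obtain ⟨h5, h6⟩ := hck k hk'
        rw [abs_mul, abs_of_nonneg (sq_nonneg (c + k * h * l))]
        have h7 : (c + k * h * l) ^ 2 ≤ 1 := by nlinarith
        refine (mul_le_of_le_one_left (abs_nonneg _) h7).trans ?_
        have h8 := hD (x k, transport G x (E i) k, stepVel x h k) ⟨hxK k hk'.le,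
          mem_closedBall_zero_iff.2 (hEn k hk'.le i), mem_closedBall_zero_iff.2
          (norm_transport_le hR hnorm (hxK k hk'.le) ((hb k hk').trans (by linarith)))⟩
        exact h8.trans (le_abs_self D)
    refine (Finset.abs_sum_le_sum_abs _ _).trans ((Finset.sum_le_sum h2).trans ?_)
    simp only [Finset.sum_const, Finset.card_range, nsmul_eq_mul]
    rw [← mul_assoc]
    exact mul_le_of_le_one_left (by positivity) hm

end DiscreteVariation

/-! ### Distances between the ends of a varied chain -/

section DiscreteLength

variable {n : ℕ} {M : Type*} [TopologicalSpace M] [ChartedSpace (EuclideanSpace ℝ (Fin n)) M]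
  [IsManifold (𝓡 n) ∞ M] {g : BilinField n M} {S : Set M}

/-- The square root is linearised by √X ≤ (1 + X)/2, so energies of steps can be summed in place of
lengths. This discards the tangential part of the variation and is why n, not n - 1, appears in the
comparison estimate. -/
theorem dist_symm_le_of_sq_mul (hg : IsUniformlyEuclidean g S) (hS : IsClosed S)
    {e : OpenPartialHomeomorph M (EuclideanSpace ℝ (Fin n))}
    (he : e ∈ IsManifold.maximalAtlas (𝓡 n) ∞ M) {c₀ c₁ : Euc n} {h X : ℝ} (hh : 0 < h)
    (key : ∀ t ∈ Icc (0 : ℝ) 1, c₀ + t • (c₁ - c₀) ∈ chartDomain e S ∧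
      metricForm g e (c₀ + t • (c₁ - c₀)) (c₁ - c₀) (c₁ - c₀) ≤ h ^ 2 * X) :
    0 ≤ h * ((1 + X) / 2) ∧
      dist g S (e.symm c₀) (e.symm c₁) ≤ ENNReal.ofReal (h * ((1 + X) / 2)) := by
  have hX0 : 0 ≤ X := by
    have h1 := key 0 ⟨le_rfl, zero_le_one⟩
    have h2 := ((hg.isMetricOn hS he).nonneg h1.1 _).trans h1.2
    exact nonneg_of_mul_nonneg_right h2 (by positivity)
  have hℓ0 : 0 ≤ h * ((1 + X) / 2) := by positivity
  refine ⟨hℓ0, dist_symm_le he hℓ0 (fun t ht => (key t ht).1) fun t ht => (key t ht).2.trans ?_⟩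
  rw [mul_pow]
  apply mul_le_mul_of_nonneg_left _ (sq_nonneg h)
  nlinarith [sq_nonneg (X - 1)]

theorem dist_le_sum {pt : ℕ → M} {ℓ : ℕ → ℝ} {m : ℕ}
    (one : ∀ k < m, 0 ≤ ℓ k ∧ dist g S (pt k) (pt (k + 1)) ≤ ENNReal.ofReal (ℓ k)) :
    ∀ j ≤ m, dist g S (pt 0) (pt j) ≤ ENNReal.ofReal (∑ k ∈ Finset.range j, ℓ k) := by
  intro j
  induction j with
  | zero => intro _; simp [dist_self]
  | succ j ih =>
    intro hj
    have hpos : 0 ≤ ∑ k ∈ Finset.range j, ℓ k := Finset.sum_nonneg fun k hk =>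
      (one k (by have := Finset.mem_range.1 hk; omega)).1
    rw [Finset.sum_range_succ, ENNReal.ofReal_add hpos (one j (by omega)).1]
    exact (dist_triangle g S _ (pt j) _).trans (add_le_add (ih (by omega)) (one j (by omega)).2)

theorem exists_discrete_variation (hg : IsUniformlyEuclidean g S) (hS : IsClosed S)
    {e : OpenPartialHomeomorph M (EuclideanSpace ℝ (Fin n))}
    (he : e ∈ IsManifold.maximalAtlas (𝓡 n) ∞ M) {K : Set (Euc n)} (hK : IsCompact K)
    (hKU : K ⊆ chartDomain e S) {l : ℝ} (hl : 0 ≤ l) {η : ℝ} (hη : 0 < η) :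
    ∃ s₀ > 0, ∀ η' : ℝ, 0 < η' → ∃ h₁ > 0, ∃ ε > 0, ∀ h : ℝ, 0 < h → h ≤ h₁ →
      ∀ (m : ℕ) (x : ℕ → Euc n) (c : ℝ), 0 ≤ c → c + m * h * l ≤ 1 → m * h ≤ 1 →
      (∀ k ≤ m, x k ∈ K) →
      (∀ k < m, metricForm g e (x k) (x (k + 1) - x k) (x (k + 1) - x k) ≤ (1 + ε) * h ^ 2) →
      ∀ E, IsOrthoFrame (metricForm g e (x 0)) E → ∀ s : ℝ, |s| ≤ s₀ → ∀ i,
        dist g S (e.symm (quadGeodesic (metricForm g e) (x 0) (c • E i) s))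
          (e.symm (quadGeodesic (metricForm g e) (x m)
            ((c + m * h * l) • transport (metricForm g e) x (E i) m) s)) ≤
        ENNReal.ofReal (m * h * (1 + η') + s * varFirst (metricForm g e) x h l (E i) m
          + s ^ 2 / 2 * (varSecond (metricForm g e) x h l c (E i) m + m * h * η)) := by
  have hG := hg.isMetricOn hS he
  obtain ⟨R, hR, hnorm⟩ := hG.exists_norm_le_sqrt hK hKU
  -- This radius covers the direction (c + khl)E, with factor at most 1, its covariant derivative
  -- lE, and the velocity of the chain.
  obtain ⟨s₀, hs₀, hstepb⟩ := hG.exists_step_bound hK hKU (R * 2 * (1 + l)) hη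
  refine ⟨s₀, hs₀, fun η' hη' => ?_⟩
  obtain ⟨h₁, hh₁, hb1⟩ := hstepb η' hη'
  obtain ⟨h₂, hh₂, htrans⟩ := hG.exists_transport_bound hK hKU one_pos
  refine ⟨min h₁ h₂, by positivity, min η' 1, by positivity, ?_⟩
  intro h hh0 hh m x c hc hcm hm hxK hst E hE s hs i
  have hst4 : ∀ k < m, metricForm g e (x k) (x (k + 1) - x k) (x (k + 1) - x k) ≤ 4 * h ^ 2 := fun k hk =>
    (hst k hk).trans (by nlinarith [sq_nonneg h, min_le_right η' 1])
  have htr := htrans h hh0 (hh.trans (min_le_right _ _)) m x hm hxK hst4 E hE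
  have hEn : ∀ k ≤ m, ∀ i, ‖transport (metricForm g e) x (E i) k‖ ≤ R * 2 := fun k hk i =>
    norm_transport_le hR hnorm (hxK k hk) (form_self_le_four le_rfl (htr k hk) i)
  have one : ∀ k < m, ∃ ℓ : ℝ, ℓ ≤ h * (1 + η') + s * (h * (l * metricForm g e (x k)
      (transport (metricForm g e) x (E i) k) (stepVel x h k))) + s ^ 2 / 2 * (h * (l ^ 2 *
      metricForm g e (x k) (transport (metricForm g e) x (E i) k)
        (transport (metricForm g e) x (E i) k)
      + (c + k * h * l) ^ 2 * metricForm g e (x k) (curv (metricForm g e) (x k)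
        (transport (metricForm g e) x (E i) k) (stepVel x h k)
        (transport (metricForm g e) x (E i) k)) (stepVel x h k)) + h * η) ∧ 0 ≤ ℓ ∧
      dist g S (e.symm (quadGeodesic (metricForm g e) (x k)
        ((c + k * h * l) • transport (metricForm g e) x (E i) k) s))
        (e.symm (quadGeodesic (metricForm g e) (x (k + 1))
        ((c + (k + 1 : ℕ) * h * l) • transport (metricForm g e) x (E i) (k + 1)) s))
        ≤ ENNReal.ofReal ℓ := by
    intro k hk
    have hck : 0 ≤ c + k * h * l ∧ c + k * h * l ≤ 1 := by
      refine ⟨by positivity, le_trans ?_ hcm⟩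
      have : (k : ℝ) ≤ m := by exact_mod_cast hk.le
      gcongr
    have hbn : ‖stepVel x h k‖ ≤ R * 2 :=
      norm_transport_le hR hnorm (hxK k hk.le) (form_stepVel_le hh0 (hst4 k hk))
    have hR2 : R * 2 ≤ R * 2 * (1 + l) := by nlinarith
    have key := hb1 h hh0.le (hh.trans (min_le_left _ _)) s hs (x k) (hxK k hk.le)
      ((c + k * h * l) • transport (metricForm g e) x (E i) k)
      (l • transport (metricForm g e) x (E i) k) (stepVel x h k)
      (by
        rw [norm_smul, Real.norm_of_nonneg hck.1]
        exact (mul_le_of_le_one_left (norm_nonneg _) hck.2).trans ((hEn k hk.le i).trans hR2))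
      (by
        rw [norm_smul, Real.norm_of_nonneg hl]
        nlinarith [mul_le_mul_of_nonneg_left (hEn k hk.le i) hl])
      (hbn.trans hR2) _ _ rfl rfl
    rw [smul_stepVel x hh0.ne', add_sub_cancel, stepVec_transport x hh0.ne', curv_smul_smul] at key
    have hcc : c + (k : ℝ) * h * l + h * l = c + ((k + 1 : ℕ) : ℝ) * h * l := by push_cast; ring
    rw [hcc] at key
    refine ⟨_, ?_, dist_symm_le_of_sq_mul hg hS he hh0 key⟩
    have h1 : metricForm g e (x k) (stepVel x h k) (stepVel x h k) ≤ 1 + η' :=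
      form_stepVel_le hh0 ((hst k hk).trans (by nlinarith [sq_nonneg h, min_le_left η' 1]))
    simp only [map_smul, smul_apply, smul_eq_mul]
    have h2 := mul_le_mul_of_nonneg_left h1 hh0.le
    linarith
  have hone : ∀ k, ∃ ℓ : ℝ, k < m → _ := fun k =>
    if hk : k < m then (one k hk).imp fun ℓ hℓ _ => hℓ else ⟨0, fun h => absurd h hk⟩
  choose ℓ hℓ using hone
  have hfin := dist_le_sum (pt := fun k => e.symm (quadGeodesic (metricForm g e) (x k)
    ((c + k * h * l) • transport (metricForm g e) x (E i) k) s)) (fun k hk => (hℓ k hk).2) m le_rfl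
  simp only [Nat.cast_zero, zero_mul, add_zero, transport] at hfin
  refine hfin.trans (ENNReal.ofReal_le_ofReal ?_)
  refine (Finset.sum_le_sum fun k hk => (hℓ k (Finset.mem_range.1 hk)).1).trans_eq ?_
  simp only [Finset.sum_add_distrib, ← Finset.mul_sum, varFirst, varSecond]
  simp only [Finset.sum_const, Finset.card_range, nsmul_eq_mul]
  ring

end DiscreteLength

/-! ### Fine chains inside a chart -/

section FineChain

variable {n : ℕ} {M : Type*} [TopologicalSpace M] [ChartedSpace (EuclideanSpace ℝ (Fin n)) M]
  [IsManifold (𝓡 n) ∞ M] [T2Space M] {g : BilinField n M} {S : Set M}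

theorem exists_uniform_metric_le_dist (hg : IsUniformlyEuclidean g S) (hS : IsClosed S)
    {e : OpenPartialHomeomorph M (EuclideanSpace ℝ (Fin n))}
    (he : e ∈ IsManifold.maximalAtlas (𝓡 n) ∞ M) {K : Set (Euc n)} (hK : IsCompact K)
    (hKU : K ⊆ chartDomain e S) {η : ℝ} (hη : 0 < η) : ∃ κ > 0, ∀ y ∈ K, ∀ z,
      dist g S (e.symm y) z < ENNReal.ofReal κ → z ∈ e.source ∧ ‖e z - y‖ < η ∧
      Real.sqrt (metricForm g e y (e z - y) (e z - y))
        ≤ (1 + η) * (dist g S (e.symm y) z).toReal := by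
  refine hK.induction_on (p := fun A => ∃ κ > 0, ∀ y ∈ A, ∀ z,
      dist g S (e.symm y) z < ENNReal.ofReal κ → z ∈ e.source ∧ ‖e z - y‖ < η ∧
      Real.sqrt (metricForm g e y (e z - y) (e z - y))
        ≤ (1 + η) * (dist g S (e.symm y) z).toReal) ⟨1, one_pos, fun p hp => hp.elim⟩
    (fun s t hst ⟨κ, hκ, h⟩ => ⟨κ, hκ, fun p hp => h p (hst hp)⟩) ?_ ?_
  · rintro s t ⟨κ, hκ, h⟩ ⟨κ', hκ', h'⟩
    refine ⟨min κ κ', by positivity, fun y hy z hz => ?_⟩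
    rcases hy with hy | hy
    · exact h y hy z (hz.trans_le (ENNReal.ofReal_le_ofReal (min_le_left _ _)))
    · exact h' y hy z (hz.trans_le (ENNReal.ofReal_le_ofReal (min_le_right _ _)))
  · intro y hy
    have hyU := hKU hy
    obtain ⟨κ, hκ, hev⟩ := exists_metric_le_dist hg hS (x₀ := e.symm y) hyU.2 he
      (e.map_target hyU.1) hη
    have h1 := ((e.continuousAt_symm hyU.1).eventually hev)
    have h2 : ∀ᶠ z in 𝓝 y, z ∈ e.target :=
      Filter.eventually_of_mem (e.open_target.mem_nhds hyU.1) fun _ hz => hz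
    refine ⟨_, mem_nhdsWithin_of_mem_nhds (h1.and h2), κ, hκ, fun w hw z hz => ?_⟩
    have h3 := hw.1 z hz
    rwa [e.right_inv hw.2] at h3

variable [CompactSpace M]

/-- The substitute for a minimising geodesic: for each m, a chain of m + 1 equal steps with fixed
ends, lying in one compact set. By the sharp lower bound for the distance, its coordinate steps have
almost the squared length of an exactly minimising chain once the mesh is small. -/
theorem exists_fine_chain (hg : IsUniformlyEuclidean g S) (hS : IsClosed S)
    (hemb : IsEmbeddedSubmanifold n S) {q : M} {R : ℝ} (hR : 0 ≤ R)
    (hsub : closedBall g S q R ⊆ Sᶜ) {e : OpenPartialHomeomorph M (EuclideanSpace ℝ (Fin n))}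
    (he : e ∈ IsManifold.maximalAtlas (𝓡 n) ∞ M) {K : Set (Euc n)} (hK : IsCompact K)
    (hKU : K ⊆ chartDomain e S) {x y : M} {κ δ : ℝ}
    (hnear : ∀ z, dist g S x z < ENNReal.ofReal κ → z ∈ e.source ∧ e z ∈ K) (hδ : 0 < δ)
    (hδκ : δ < κ) (hxy : dist g S x y = ENNReal.ofReal δ)
    (hq : dist g S q x + dist g S x y < ENNReal.ofReal R) :
    ∃ X : ℕ → ℕ → Euc n, (∀ m, X m 0 = e x ∧ X m (m + 1) = e y ∧ ∀ k ≤ m + 1, X m k ∈ K) ∧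
      ∀ ε > 0, ∀ᶠ m : ℕ in atTop, ∀ k < m + 1,
        metricForm g e (X m k) (X m (k + 1) - X m k) (X m (k + 1) - X m k)
          ≤ (1 + ε) * (δ / (m + 1 : ℕ)) ^ 2 := by
  have hch : ∀ m : ℕ, ∃ p : ℕ → M, p 0 = x ∧ p (m + 1) = y ∧
      ∀ k ≤ m, dist g S (p k) (p (k + 1)) = ENNReal.ofReal (δ / (m + 1 : ℕ)) := by
    intro m
    refine exists_chain hg hS hemb hR hsub m hq ?_
    rw [hxy, ← ENNReal.ofReal_natCast, ← ENNReal.ofReal_mul (by positivity)]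
    congr 1
    field_simp
  choose p hp0 hp1 hp using hch
  have hmem : ∀ m, ∀ k ≤ m + 1, p m k ∈ e.source ∧ e (p m k) ∈ K := by
    intro m k hk
    refine hnear _ (lt_of_le_of_lt ?_ ((ENNReal.ofReal_lt_ofReal_iff (hδ.trans hδκ)).2 hδκ))
    have h1 := dist_chain_le (m := m + 1) (fun k hk => hp m k (by omega)) k hk
    rw [hp0] at h1
    refine h1.trans ?_
    rw [← ENNReal.ofReal_natCast, ← ENNReal.ofReal_mul (by positivity)]
    apply ENNReal.ofReal_le_ofReal
    have : (k : ℝ) ≤ (m + 1 : ℕ) := by exact_mod_cast hk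
    rw [mul_div_assoc', div_le_iff₀ (by positivity), mul_comm]
    gcongr
  refine ⟨fun m k => e (p m k), fun m => ⟨congrArg e (hp0 m), congrArg e (hp1 m), fun k hk => (hmem m k hk).2⟩,
    fun ε hε => ?_⟩
  -- With ε' ≤ 1 one has (1 + ε')² ≤ 1 + 3ε' ≤ 1 + ε.
  set ε' := min (ε / 3) 1 with hε'
  have hε'0 : 0 < ε' := by positivity
  have hε'ε : (1 + ε') ^ 2 ≤ 1 + ε := by
    nlinarith [min_le_left (ε / 3) 1, min_le_right (ε / 3) 1]
  obtain ⟨κ', hκ', hm⟩ := exists_uniform_metric_le_dist hg hS he hK hKU hε'0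
  have hlim : Tendsto (fun m : ℕ => δ / ((m + 1 : ℕ) : ℝ)) atTop (𝓝 0) :=
    (tendsto_const_div_atTop_nhds_zero_nat δ).comp (tendsto_add_atTop_nat 1)
  filter_upwards [hlim.eventually (gt_mem_nhds hκ')] with m hmκ k hk
  have h1 := hmem m k (by omega)
  have h2 := hp m k (by omega)
  have h3 := hm _ h1.2 (p m (k + 1)) (by
    rw [e.left_inv h1.1, h2]
    exact (ENNReal.ofReal_lt_ofReal_iff hκ').2 hmκ)
  rw [e.left_inv h1.1, h2, ENNReal.toReal_ofReal (by positivity)] at h3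
  have h4 := (Real.sqrt_le_left (by positivity)).1 h3.2.2
  refine h4.trans ?_
  rw [mul_pow]
  gcongr

end FineChain

/-! ### Passage to the limit of vanishing mesh -/

section Limit

variable {n : ℕ} {M : Type*} [TopologicalSpace M] [ChartedSpace (EuclideanSpace ℝ (Fin n)) M]
  [IsManifold (𝓡 n) ∞ M] {g : BilinField n M} {S : Set M}

theorem le_ofReal_of_forall_pos {d : ENNReal} {t : ℝ}
    (h : ∀ ε > 0, d ≤ ENNReal.ofReal (t + ε)) : d ≤ ENNReal.ofReal t := by
  refine ENNReal.le_of_forall_pos_le_add fun ε hε _ => ?_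
  refine (h ε (by exact_mod_cast hε)).trans (ENNReal.ofReal_add_le.trans ?_)
  simp

/-- The transported frames and the first and second variations are bounded independently of the
mesh, so they have a limit. In the limit the frame is exactly orthonormal and the zeroth-order error
η' is gone; only the second-order error η remains, with s₀ chosen in advance. -/
theorem exists_limit_variation (hg : IsUniformlyEuclidean g S) (hS : IsClosed S)
    {e : OpenPartialHomeomorph M (EuclideanSpace ℝ (Fin n))}
    (he : e ∈ IsManifold.maximalAtlas (𝓡 n) ∞ M) {K : Set (Euc n)} (hK : IsCompact K)
    (hKU : K ⊆ chartDomain e S) {κ : ℝ} (hκ : 0 ≤ κ)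
    (hric : ∀ p ∈ K, ∀ b : Euc n, -κ * metricForm g e p b b ≤
      ∑ i, ∑ j, ricciCoord (matOf (metricForm g e)) i j p * b i * b j)
    {l c δ : ℝ} (hl : 0 ≤ l) (hc : 0 ≤ c) (hδ : 0 < δ) (hδ1 : δ ≤ 1) (hcl : c + δ * l ≤ 1)
    {p p' : Euc n} (X : ℕ → ℕ → Euc n)
    (hX : ∀ m, X m 0 = p ∧ X m (m + 1) = p' ∧ ∀ k ≤ m + 1, X m k ∈ K)
    (hXε : ∀ ε > 0, ∀ᶠ m : ℕ in atTop, ∀ k < m + 1,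
        metricForm g e (X m k) (X m (k + 1) - X m k) (X m (k + 1) - X m k)
          ≤ (1 + ε) * (δ / (m + 1 : ℕ)) ^ 2)
    {E : Fin n → Euc n} (hE : IsOrthoFrame (metricForm g e p) E) :
    ∃ (E' : Fin n → Euc n) (a : Euc n) (B : Fin n → ℝ), IsOrthoFrame (metricForm g e p') E' ∧
      ‖a‖ ≤ δ * l ∧ ∑ i, B i ≤ δ * (n * l ^ 2 + κ) ∧
      ∀ η > 0, ∃ s₀ > 0, ∀ s : ℝ, |s| ≤ s₀ → ∀ i,
        dist g S (e.symm (quadGeodesic (metricForm g e) p (c • E i) s))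
          (e.symm (quadGeodesic (metricForm g e) p' ((c + δ * l) • E' i) s))
        ≤ ENNReal.ofReal (δ + s * a i + s ^ 2 / 2 * (B i + η)) := by
  have hG := hg.isMetricOn hS he
  have hp'K : p' ∈ K := by
    have h1 := (hX 0).2.2 1 le_rfl
    rwa [(hX 0).2.1] at h1
  have hp'U := hKU hp'K
  set h : ℕ → ℝ := fun m => δ / (m + 1 : ℕ) with hh
  have hh0 : ∀ m, 0 < h m := fun m => by positivity
  have hmh : ∀ m, ((m + 1 : ℕ) : ℝ) * h m = δ := fun m => by
    simp only [hh]; field_simp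
  have hlim : Tendsto h atTop (𝓝 0) :=
    (tendsto_const_div_atTop_nhds_zero_nat δ).comp (tendsto_add_atTop_nat 1)
  have hhle : ∀ h₁ > 0, ∀ᶠ m in atTop, h m ≤ h₁ := fun h₁ hh₁ =>
    (hlim.eventually (gt_mem_nhds hh₁)).mono fun m hm => hm.le
  obtain ⟨C, hC⟩ := hG.exists_variation_bounds hK hKU hκ hric hl
  set E' : ℕ → Fin n → Euc n := fun m i => transport (metricForm g e) (X m) (E i) (m + 1) with hE'
  set a : ℕ → Euc n := fun m =>
    WithLp.toLp 2 fun i => varFirst (metricForm g e) (X m) (h m) l (E i) (m + 1) with ha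
  set B : ℕ → Fin n → ℝ := fun m i =>
    varSecond (metricForm g e) (X m) (h m) l c (E i) (m + 1) with hB
  have hbounds : ∀ η > 0, ∀ᶠ m in atTop,
      (∀ i j, |metricForm g e p' (E' m i) (E' m j) - if i = j then 1 else 0| ≤ η) ∧
      (∀ i, ‖E' m i‖ ≤ C) ∧ ‖a m‖ ≤ δ * l * (1 + η) ∧
      ∑ i, B m i ≤ δ * (n * l ^ 2 + κ + η) ∧ ∀ i, |B m i| ≤ C := by
    intro η hη
    obtain ⟨h₁, hh₁, ε, hε, H⟩ := hC η hη
    filter_upwards [hhle h₁ hh₁, hXε ε hε] with m hm hmε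
    have h2 := H (h m) (hh0 m) hm (m + 1) (X m) c hc (by rw [hmh]; exact hcl)
      (by rw [hmh]; exact hδ1) (hX m).2.2 hmε E (by rw [(hX m).1]; exact hE)
    rwa [(hX m).2.1, hmh] at h2
  have hdist : ∀ η > 0, ∃ s₀ > 0, ∀ η' > 0, ∀ᶠ m in atTop, ∀ s : ℝ, |s| ≤ s₀ → ∀ i,
      dist g S (e.symm (quadGeodesic (metricForm g e) p (c • E i) s))
        (e.symm (quadGeodesic (metricForm g e) p' ((c + δ * l) • E' m i) s)) ≤
      ENNReal.ofReal (δ * (1 + η') + s * a m i + s ^ 2 / 2 * (B m i + δ * η)) := by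
    intro η hη
    obtain ⟨s₀, hs₀, H⟩ := exists_discrete_variation hg hS he hK hKU hl hη
    refine ⟨s₀, hs₀, fun η' hη' => ?_⟩
    obtain ⟨h₁, hh₁, ε, hε, H'⟩ := H η' hη'
    filter_upwards [hhle h₁ hh₁, hXε ε hε] with m hm hmε s hs i
    have h2 := H' (h m) (hh0 m) hm (m + 1) (X m) c hc (by rw [hmh]; exact hcl)
      (by rw [hmh]; exact hδ1) (hX m).2.2 hmε E (by rw [(hX m).1]; exact hE) s hs i
    rwa [(hX m).2.1, hmh, (hX m).1] at h2
  -- Along an ultrafilter all the bounded sequences converge at once, without successive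
  -- subsequences.
  set 𝓕 : Ultrafilter ℕ := Ultrafilter.of atTop with h𝓕
  have h𝓕le : (𝓕 : Filter ℕ) ≤ atTop := Ultrafilter.of_le atTop
  have hcpt : IsCompact (Metric.closedBall (0 : Fin n → Euc n) |C| ×ˢ
      Metric.closedBall (0 : Euc n) (δ * l * 2) ×ˢ Metric.closedBall (0 : Fin n → ℝ) |C|) :=
    (isCompact_closedBall _ _).prod ((isCompact_closedBall _ _).prod (isCompact_closedBall _ _))
  have hin : ∀ᶠ m in (𝓕 : Filter ℕ), (E' m, a m, B m) ∈
      (Metric.closedBall (0 : Fin n → Euc n) |C| ×ˢ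
      Metric.closedBall (0 : Euc n) (δ * l * 2) ×ˢ Metric.closedBall (0 : Fin n → ℝ) |C|) := by
    filter_upwards [h𝓕le (hbounds 1 one_pos)] with m hm
    refine ⟨?_, ?_, ?_⟩
    · rw [mem_closedBall_zero_iff, pi_norm_le_iff_of_nonneg (abs_nonneg _)]
      exact fun i => (hm.2.1 i).trans (le_abs_self C)
    · rw [mem_closedBall_zero_iff]
      linarith [hm.2.2.1]
    · rw [mem_closedBall_zero_iff, pi_norm_le_iff_of_nonneg (abs_nonneg _)]
      exact fun i => (hm.2.2.2.2 i).trans (le_abs_self C)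
  obtain ⟨⟨E₀, a₀, B₀⟩, -, hlimit⟩ := hcpt.ultrafilter_le_nhds
    (𝓕.map fun m => (E' m, a m, B m)) (by
      rw [Ultrafilter.coe_map]; exact Filter.tendsto_principal.2 hin)
  have hlimit' : Tendsto (fun m => (E' m, a m, B m)) 𝓕 (𝓝 (E₀, a₀, B₀)) := hlimit
  have tE : ∀ i, Tendsto (fun m => E' m i) 𝓕 (𝓝 (E₀ i)) := fun i =>
    (((continuous_apply i).comp continuous_fst).tendsto (E₀, a₀, B₀)).comp hlimit'
  have ta : Tendsto a 𝓕 (𝓝 a₀) :=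
    ((continuous_fst.comp continuous_snd).tendsto (E₀, a₀, B₀)).comp hlimit'
  have tai : ∀ i, Tendsto (fun m => a m i) 𝓕 (𝓝 (a₀ i)) := fun i =>
    ((EuclideanSpace.proj i : Euc n →L[ℝ] ℝ).continuous.tendsto a₀).comp ta
  have tB : ∀ i, Tendsto (fun m => B m i) 𝓕 (𝓝 (B₀ i)) := fun i =>
    (((continuous_apply i).comp (continuous_snd.comp continuous_snd)).tendsto
      (E₀, a₀, B₀)).comp hlimit'
  refine ⟨E₀, a₀, B₀, fun i j => ?_, ?_, ?_, fun η hη => ?_⟩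
  · have h1 : Tendsto (fun m => |metricForm g e p' (E' m i) (E' m j) - if i = j then 1 else 0|) 𝓕
        (𝓝 |metricForm g e p' (E₀ i) (E₀ j) - if i = j then 1 else 0|) :=
      ((((metricForm g e p').continuous₂.tendsto (E₀ i, E₀ j)).comp
        ((tE i).prodMk_nhds (tE j))).sub tendsto_const_nhds).abs
    have h2 : |metricForm g e p' (E₀ i) (E₀ j) - if i = j then 1 else 0| ≤ 0 :=
      le_of_forall_pos_le_add fun η hη => by
        rw [zero_add]
        exact le_of_tendsto h1 (h𝓕le ((hbounds η hη).mono fun m hm => hm.1 i j))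
    exact sub_eq_zero.1 (abs_eq_zero.1 (le_antisymm h2 (abs_nonneg _)))
  · have h1 : ∀ η > 0, ‖a₀‖ ≤ δ * l * (1 + η) := fun η hη =>
      le_of_tendsto ta.norm (h𝓕le ((hbounds η hη).mono fun m hm => hm.2.2.1))
    refine le_of_forall_pos_le_add fun η hη => (h1 (η / (δ * l + 1)) (by positivity)).trans ?_
    have h3 : 0 ≤ δ * l := by positivity
    rw [mul_add, mul_one, add_le_add_iff_left, mul_div_assoc', div_le_iff₀ (by positivity)]
    nlinarith
  · have h0 : Tendsto (fun m => ∑ i, B m i) 𝓕 (𝓝 (∑ i, B₀ i)) :=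
      tendsto_finsetSum _ fun i _ => tB i
    have h1 : ∀ η > 0, ∑ i, B₀ i ≤ δ * (n * l ^ 2 + κ + η) := fun η hη =>
      le_of_tendsto h0 (h𝓕le ((hbounds η hη).mono fun m hm => hm.2.2.2.1))
    refine le_of_forall_pos_le_add fun η hη => (h1 η hη).trans ?_
    nlinarith
  · obtain ⟨s₁, hs₁, H⟩ := hdist η hη
    have hUev : ∀ᶠ s : ℝ in 𝓝 0, ∀ i,
        quadGeodesic (metricForm g e) p' ((c + δ * l) • E₀ i) s ∈ chartDomain e S := by
      rw [Filter.eventually_all]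
      intro i
      refine (hasDerivAt_quadGeodesic p' _ 0).continuousAt.eventually (hG.isOpen.mem_nhds ?_)
      simpa [quadGeodesic] using hp'U
    -- `ENNReal.ofReal` is additive only on nonnegative numbers, so the bound has to stay positive
    -- for small s.
    have hpev : ∀ᶠ s : ℝ in 𝓝 0, ∀ i, 0 < δ + s * a₀ i + s ^ 2 / 2 * (B₀ i + δ * η) := by
      rw [Filter.eventually_all]
      intro i
      have h1 : Continuous fun s : ℝ => δ + s * a₀ i + s ^ 2 / 2 * (B₀ i + δ * η) := by fun_prop
      exact h1.continuousAt.eventually (lt_mem_nhds (by simpa using hδ))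
    obtain ⟨s₂, hs₂, hball⟩ := Metric.eventually_nhds_iff_ball.1 (hUev.and hpev)
    refine ⟨min s₁ (s₂ / 2), by positivity, fun s hs i => ?_⟩
    have hsball : s ∈ Metric.ball (0 : ℝ) s₂ := by
      rw [mem_ball_zero_iff, Real.norm_eq_abs]
      have := hs.trans (min_le_right s₁ (s₂ / 2))
      linarith
    have hwU := (hball s hsball).1 i
    have hpos := (hball s hsball).2 i
    -- The end point built from the limit frame is reached from that of the m-th frame by a short
    -- segment, whose length tends to 0.
    obtain ⟨L, hL, ρ, hρ, hLip⟩ := exists_dist_symm_le hg hS he hwU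
    have tw : Tendsto (fun m => quadGeodesic (metricForm g e) p' ((c + δ * l) • E' m i) s) 𝓕
        (𝓝 (quadGeodesic (metricForm g e) p' ((c + δ * l) • E₀ i) s)) := by
      have t1 := (tE i).const_smul (c + δ * l)
      have t2 := ((chr (metricForm g e) p').continuous₂.tendsto
        ((c + δ * l) • E₀ i, (c + δ * l) • E₀ i)).comp (t1.prodMk_nhds t1)
      exact (tendsto_const_nhds.add (t1.const_smul s)).sub (t2.const_smul (s ^ 2 / 2))
    apply le_ofReal_of_forall_pos
    intro ε hε
    have t0 : Tendsto (fun m => δ * (1 + ε / 2) + s * a m i + s ^ 2 / 2 * (B m i + δ * η)) 𝓕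
        (𝓝 (δ * (1 + ε / 2) + s * a₀ i + s ^ 2 / 2 * (B₀ i + δ * η))) :=
      (tendsto_const_nhds.add ((tai i).const_mul s)).add
        (((tB i).add_const (δ * η)).const_mul (s ^ 2 / 2))
    have tR : Tendsto (fun m => δ * (1 + ε / 2) + s * a m i + s ^ 2 / 2 * (B m i + δ * η)
        + L * ‖quadGeodesic (metricForm g e) p' ((c + δ * l) • E₀ i) s
          - quadGeodesic (metricForm g e) p' ((c + δ * l) • E' m i) s‖) 𝓕
        (𝓝 (δ * (1 + ε / 2) + s * a₀ i + s ^ 2 / 2 * (B₀ i + δ * η) + L * ‖(0 : Euc n)‖)) := by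
      refine t0.add (Tendsto.const_mul L ?_)
      have := (tendsto_const_nhds (x := quadGeodesic (metricForm g e) p'
        ((c + δ * l) • E₀ i) s)).sub tw
      rw [sub_self] at this
      exact this.norm
    have hlt : δ * (1 + ε / 2) + s * a₀ i + s ^ 2 / 2 * (B₀ i + δ * η) + L * ‖(0 : Euc n)‖
        < δ + s * a₀ i + s ^ 2 / 2 * (B₀ i + η) + ε := by
      rw [norm_zero]
      nlinarith [mul_le_mul_of_nonneg_left hδ1 hε.le,
        mul_nonneg (sq_nonneg s) (mul_nonneg (sub_nonneg.2 hδ1) hη.le)]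
    have hev1 := Filter.Eventually.filter_mono h𝓕le (H (ε / 2) (by positivity))
    have hlt0 : 0 < δ * (1 + ε / 2) + s * a₀ i + s ^ 2 / 2 * (B₀ i + δ * η) := by nlinarith
    obtain ⟨m, hm1, hm2, hm3, hm4⟩ := (hev1.and ((tR.eventually (gt_mem_nhds hlt)).and
      ((tw.eventually (Metric.ball_mem_nhds _ hρ)).and
        (t0.eventually (lt_mem_nhds hlt0))))).exists
    have d1 := hm1 s (hs.trans (min_le_left _ _)) i
    have d2 := hLip _ hm3 _ (Metric.mem_ball_self hρ)
    refine (dist_triangle g S _ _ _).trans ((add_le_add d1 d2).trans ?_)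
    rw [← ENNReal.ofReal_add hm4.le (by positivity)]
    exact ENNReal.ofReal_le_ofReal hm2.le

end Limit

/-! ### Rays of normal charts against quadratic geodesics -/

section Rays

variable {n : ℕ} {M : Type*} [TopologicalSpace M] [ChartedSpace (EuclideanSpace ℝ (Fin n)) M]
  [IsManifold (𝓡 n) ∞ M] {g : BilinField n M} {S : Set M}

/-- The rays of a normal chart and the quadratic geodesics of another chart agree to second
order. -/
theorem IsNormalChart.eventually_dist_le (hg : IsUniformlyEuclidean g S) (hS : IsClosed S) {x : M}
    (hx : x ∉ S) {ν e : OpenPartialHomeomorph M (EuclideanSpace ℝ (Fin n))}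
    (h : IsNormalChart g x ν) (he : e ∈ IsManifold.maximalAtlas (𝓡 n) ∞ M)
    (hxe : x ∈ e.source) (v : Euc n) {η : ℝ} (hη : 0 < η) : ∀ᶠ s : ℝ in 𝓝 0,
      dist g S (ν.symm (s • v)) (e.symm (quadGeodesic (metricForm g e) (e x)
        (fderiv ℝ (fun z => e (ν.symm z)) 0 v) s)) ≤ ENNReal.ofReal (η * s ^ 2) ∧
      dist g S (e.symm (quadGeodesic (metricForm g e) (e x)
        (fderiv ℝ (fun z => e (ν.symm z)) 0 v) s)) (ν.symm (s • v))
          ≤ ENNReal.ofReal (η * s ^ 2) := by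
  have hp : e x ∈ chartDomain e S := ⟨e.map_source hxe, by
    change e.symm (e x) ∈ Sᶜ; rw [e.left_inv hxe]; exact hx⟩
  obtain ⟨C, hC, R, hR, hball⟩ := exists_dist_symm_le hg hS he hp
  have h1 := (h.isLittleO hg hS hx he hxe v).def (c := η / C) (by positivity)
  set V := fderiv ℝ (fun z => e (ν.symm z)) 0 v with hV
  have h2 : ∀ᶠ s : ℝ in 𝓝 0, quadGeodesic (metricForm g e) (e x) V s ∈ Metric.ball (e x) R := by
    refine (hasDerivAt_quadGeodesic (e x) V 0).continuousAt.eventually (Metric.isOpen_ball.mem_nhds ?_)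
    simpa [quadGeodesic] using hR
  have hray0 : Tendsto (fun s : ℝ => s • v) (𝓝 0) (𝓝 0) := by
    have : Continuous fun s : ℝ => s • v := by fun_prop
    simpa using this.tendsto 0
  have hxe' : ν.symm (0 : Euc n) ∈ e.source := by rw [h.symm_zero]; exact hxe
  have hc : ContinuousAt (fun z => e (ν.symm z)) 0 :=
    (contDiffAt_chartChange he h.mem h.zero_mem hxe').continuousAt
  have h3 : ∀ᶠ z in 𝓝 (0 : Euc n), ν.symm z ∈ e.source ∧ e (ν.symm z) ∈ Metric.ball (e x) R := by
    refine ((ν.continuousAt_symm h.zero_mem).eventually (e.open_source.mem_nhds hxe')).and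
      (hc.eventually (Metric.isOpen_ball.mem_nhds ?_))
    change e (ν.symm 0) ∈ _
    rw [h.symm_zero]
    exact Metric.mem_ball_self hR
  filter_upwards [h1, h2, hray0.eventually h3] with s hs1 hs2 hs3
  have h4 : C * ‖e (ν.symm (s • v)) - quadGeodesic (metricForm g e) (e x) V s‖ ≤ η * s ^ 2 := by
    rw [Real.norm_of_nonneg (sq_nonneg s)] at hs1
    calc _ ≤ C * (η / C * s ^ 2) := mul_le_mul_of_nonneg_left hs1 hC.le
      _ = η * s ^ 2 := by field_simp
  have h5 := hball _ hs3.2 _ hs2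
  have h6 := hball _ hs2 _ hs3.2
  rw [e.left_inv hs3.1] at h5 h6
  rw [norm_sub_rev] at h5
  exact ⟨h5.trans (ENNReal.ofReal_le_ofReal h4), h6.trans (ENNReal.ofReal_le_ofReal h4)⟩

theorem IsNormalChart.metricForm_zero {x : M}
    {ν e : OpenPartialHomeomorph M (EuclideanSpace ℝ (Fin n))}
    (h : IsNormalChart g x ν) (he : e ∈ IsManifold.maximalAtlas (𝓡 n) ∞ M)
    (hxe : x ∈ e.source) (a b : Euc n) : metricForm g ν 0 a b = metricForm g e (e x)
      (fderiv ℝ (fun z => e (ν.symm z)) 0 a) (fderiv ℝ (fun z => e (ν.symm z)) 0 b) := by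
  have hxe' : ν.symm (0 : Euc n) ∈ e.source := by rw [h.symm_zero]; exact hxe
  have h1 := metricForm_chartChange (g := g) he h.mem h.zero_mem hxe' a b
  rwa [h.symm_zero] at h1

theorem IsNormalChart.surjective {x : M}
    {ν e : OpenPartialHomeomorph M (EuclideanSpace ℝ (Fin n))}
    (h : IsNormalChart g x ν) (he : e ∈ IsManifold.maximalAtlas (𝓡 n) ∞ M)
    (hxe : x ∈ e.source) : Function.Surjective (fderiv ℝ (fun z => e (ν.symm z)) 0) := by
  have hinj : Function.Injective (fderiv ℝ (fun z => e (ν.symm z)) 0).toLinearMap := by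
    rw [injective_iff_map_eq_zero]
    intro v hv
    have hv' : fderiv ℝ (fun z => e (ν.symm z)) 0 v = 0 := hv
    have h1 := h.metricForm_zero he hxe v v
    rw [hv', h.inner] at h1
    simpa using h1
  exact LinearMap.injective_iff_surjective.1 hinj

theorem RicciGeAt.form_le {κ : ℝ} {x : M} (h : RicciGeAt g κ x)
    {e : OpenPartialHomeomorph M (EuclideanSpace ℝ (Fin n))}
    (he : e ∈ IsManifold.maximalAtlas (𝓡 n) ∞ M) (hxe : x ∈ e.source) (b : Euc n) :
    κ * metricForm g e (e x) b b ≤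
      ∑ i, ∑ j, ricciCoord (matOf (metricForm g e)) i j (e x) * b i * b j := by
  have h1 := h e he hxe (fun i => b i)
  rw [form_eq_sum (metricForm g e (e x)) b b]
  exact h1

end Rays

/-! ### The second variation in normal charts -/

section Step

variable {n : ℕ} {M : Type*} [TopologicalSpace M] [ChartedSpace (EuclideanSpace ℝ (Fin n)) M]
  [IsManifold (𝓡 n) ∞ M] [T2Space M] [CompactSpace M] {g : BilinField n M} {S : Set M}

/-- The conclusion of the second variation argument from `x` to `y`, at distance `δ`: any frame at
`x` can be transported to `y`, so that the distances between the rays spanned by the frames, with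
a factor which grows from `c` with slope `l`, are controlled to second order. -/
def HasSecondVariation (g : BilinField n M) (S : Set M) (κ l : ℝ) (x y : M) (δ : ℝ) : Prop :=
  ∀ c : ℝ, 0 ≤ c → c + δ * l ≤ 1 → ∀ ν ν' : OpenPartialHomeomorph M (EuclideanSpace ℝ (Fin n)),
    IsNormalChart g x ν → IsNormalChart g y ν' → ∀ F, IsOrthoFrame (metricForm g ν 0) F →
    ∃ (F' : Fin n → Euc n) (a : Euc n) (B : Fin n → ℝ), IsOrthoFrame (metricForm g ν' 0) F' ∧
      ‖a‖ ≤ δ * l ∧ ∑ i, B i ≤ δ * (n * l ^ 2 + κ) ∧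
      ∀ η > 0, ∀ᶠ s : ℝ in 𝓝 0, ∀ i,
        dist g S (ν.symm (s • c • F i)) (ν'.symm (s • (c + δ * l) • F' i))
          ≤ ENNReal.ofReal (δ + s * a i + s ^ 2 / 2 * (B i + η))

/-- The limit variation lives in one chart around x₀. Rays of normal charts at x and y agree with
its quadratic geodesics up to o(s²), and the frames correspond under the differentials of the
coordinate changes. The range of δ is the same for all x near x₀. -/
theorem eventually_hasSecondVariation (hg : IsUniformlyEuclidean g S) (hS : IsClosed S)
    (hemb : IsEmbeddedSubmanifold n S) {q : M} {R : ℝ} (hR : 0 ≤ R)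
    (hsub : closedBall g S q R ⊆ Sᶜ) {κ : ℝ} (hκ : 0 ≤ κ)
    (hric : ∀ x ∈ closedBall g S q R, RicciGeAt g (-κ) x) {l : ℝ} (hl : 0 ≤ l) {x₀ : M}
    (hx₀ : dist g S q x₀ < ENNReal.ofReal R) :
    ∃ d > 0, ∀ᶠ x in 𝓝 x₀, ∀ y δ, 0 < δ → δ < d → dist g S x y = ENNReal.ofReal δ →
      dist g S q x + dist g S x y < ENNReal.ofReal R → HasSecondVariation g S κ l x y δ := by
  have hx₀S : x₀ ∉ S := hsub hx₀.le
  set e := chartAt (EuclideanSpace ℝ (Fin n)) x₀ with he_def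
  have he : e ∈ IsManifold.maximalAtlas (𝓡 n) ∞ M := IsManifold.chart_mem_maximalAtlas x₀
  have hx₀e : x₀ ∈ e.source := mem_chart_source _ x₀
  have hG := hg.isMetricOn hS he
  have hp : e x₀ ∈ chartDomain e S := ⟨e.map_source hx₀e, by
    change e.symm (e x₀) ∈ Sᶜ; rw [e.left_inv hx₀e]; exact hx₀S⟩
  have hev : ∀ᶠ y in 𝓝 (e x₀), y ∈ chartDomain e S ∧
      dist g S q (e.symm y) < ENNReal.ofReal R := by
    refine (Filter.eventually_of_mem (hG.isOpen.mem_nhds hp) fun _ h => h).and ?_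
    have h1 := e.continuousAt_symm hp.1
    rw [ContinuousAt, e.left_inv hx₀e] at h1
    exact h1.eventually (mem_nhds_of_dist_lt hg hS hx₀S hx₀)
  obtain ⟨ρ, hρ, hball⟩ := Metric.eventually_nhds_iff_ball.1 hev
  set K : Set (Euc n) := Metric.closedBall (e x₀) (ρ / 2) with hK
  have hKball : K ⊆ Metric.ball (e x₀) ρ := Metric.closedBall_subset_ball (by linarith)
  have hKc : IsCompact K := isCompact_closedBall _ _
  have hKU : K ⊆ chartDomain e S := fun y hy => (hball y (hKball hy)).1
  have hricK : ∀ p ∈ K, ∀ b : Euc n, -κ * metricForm g e p b b ≤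
      ∑ i, ∑ j, ricciCoord (matOf (metricForm g e)) i j p * b i * b j := by
    intro p hpK b
    have h1 := (hball p (hKball hpK))
    have h2 := (hric (e.symm p) h1.2.le).form_le he (e.map_target h1.1.1) b
    rwa [e.right_inv h1.1.1] at h2
  -- Points near x stay within ρ/4 of e x, and e x is within ρ/4 of e x₀, so both lie in the ball K
  -- of radius ρ/2.
  obtain ⟨d, hd, hmet⟩ := exists_metric_le_dist hg hS hx₀S he hx₀e (η := ρ / 4) (by positivity)
  have hnear : ∀ᶠ x in 𝓝 x₀, x ∈ e.source ∧ e x ∈ Metric.ball (e x₀) (ρ / 4) :=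
    (Filter.eventually_of_mem (e.open_source.mem_nhds hx₀e) fun _ h => h).and ((e.continuousAt hx₀e).eventually
      (Metric.ball_mem_nhds _ (by positivity)))
  refine ⟨min d 1, by positivity, ?_⟩
  filter_upwards [hmet, hnear] with x hx1 hx2 y δ hδ hδd hxy hq c hc hcl ν ν' hν hν' F hF
  have hxR : dist g S q x < ENNReal.ofReal R := lt_of_le_of_lt le_self_add hq
  have hyR : dist g S q y < ENNReal.ofReal R := (dist_triangle g S q x y).trans_lt hq
  have hxS : x ∉ S := hsub hxR.le
  have hyS : y ∉ S := hsub hyR.le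
  have hδ1 : δ ≤ 1 := (hδd.trans_le (min_le_right _ _)).le
  have hδ2 : δ < d := hδd.trans_le (min_le_left _ _)
  have hdK : ∀ z, dist g S x z < ENNReal.ofReal d → z ∈ e.source ∧ e z ∈ K := by
    intro z hz
    obtain ⟨h1, h2, -⟩ := hx1 z hz
    refine ⟨h1, ?_⟩
    rw [hK, Metric.mem_closedBall, dist_eq_norm]
    have h3 := hx2.2
    rw [Metric.mem_ball, dist_eq_norm] at h3
    calc _ = ‖(e z - e x) + (e x - e x₀)‖ := by rw [sub_add_sub_cancel]
      _ ≤ _ := (norm_add_le _ _).trans (by linarith)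
  have hye : y ∈ e.source := (hdK y (by
    rw [hxy]; exact (ENNReal.ofReal_lt_ofReal_iff (hδ.trans hδ2)).2 hδ2)).1
  obtain ⟨X, hX, hXε⟩ := exists_fine_chain hg hS hemb hR hsub he hKc hKU hdK hδ hδ2 hxy hq
  set A := fderiv ℝ (fun z => e (ν.symm z)) 0 with hA
  set A' := fderiv ℝ (fun z => e (ν'.symm z)) 0 with hA'
  have hE : IsOrthoFrame (metricForm g e (e x)) (fun i => A (F i)) := fun i j => by
    rw [← hν.metricForm_zero he hx2.1, hF i j]
  obtain ⟨E', a, B, hE', ha, hB, hdist⟩ := exists_limit_variation hg hS he hKc hKU hκ hricK hl hc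
    hδ hδ1 hcl X hX hXε hE
  choose F' hF' using fun i => hν'.surjective he hye (E' i)
  refine ⟨F', a, B, fun i j => ?_, ha, hB, fun η hη => ?_⟩
  · rw [hν'.metricForm_zero he hye, hF', hF', hE' i j]
  · obtain ⟨s₀, hs₀, hs⟩ := hdist (η / 2) (by positivity)
    have h1 : ∀ᶠ s : ℝ in 𝓝 0, |s| ≤ s₀ := by
      have : Tendsto (fun s : ℝ => |s|) (𝓝 0) (𝓝 0) := by
        simpa using (continuous_abs.tendsto (0 : ℝ))
      exact (this.eventually (gt_mem_nhds hs₀)).mono fun s hs => hs.le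
    have h2 : ∀ᶠ s : ℝ in 𝓝 0, ∀ i, 0 ≤ δ + s * a i + s ^ 2 / 2 * (B i + η / 2) := by
      rw [Filter.eventually_all]
      intro i
      have h1 : Continuous fun s : ℝ => δ + s * a i + s ^ 2 / 2 * (B i + η / 2) := by fun_prop
      exact (h1.continuousAt.eventually (lt_mem_nhds (by simpa using hδ))).mono fun s hs => hs.le
    -- The two changes of rays cost η s²/8 each and the variation costs (s²/2)(η/2); together this
    -- is (s²/2)η.
    have h3 : ∀ᶠ s : ℝ in 𝓝 0, ∀ i, _ := Filter.eventually_all.2 fun i =>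
      hν.eventually_dist_le hg hS hxS he hx2.1 (c • F i) (show 0 < η / 8 by positivity)
    have h4 : ∀ᶠ s : ℝ in 𝓝 0, ∀ i, _ := Filter.eventually_all.2 fun i =>
      hν'.eventually_dist_le hg hS hyS he hye ((c + δ * l) • F' i) (show 0 < η / 8 by positivity)
    filter_upwards [h1, h2, h3, h4] with s hs1 hs2 hs3 hs4 i
    have d1 := (hs3 i).1
    have d2 := hs s hs1 i
    have d3 := (hs4 i).2
    rw [map_smul, hF'] at d3
    rw [map_smul] at d1
    refine (dist_triangle g S _ _ _).trans ((add_le_add d1 ((dist_triangle g S _ _ _).trans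
      (add_le_add d2 d3))).trans ?_)
    rw [← ENNReal.ofReal_add (hs2 i) (by positivity), ← ENNReal.ofReal_add (by positivity)
      (add_nonneg (hs2 i) (by positivity))]
    apply ENNReal.ofReal_le_ofReal
    nlinarith

theorem exists_uniform_secondVariation (hg : IsUniformlyEuclidean g S) (hS : IsClosed S)
    (hemb : IsEmbeddedSubmanifold n S) {q : M} {R : ℝ} (hR : 0 ≤ R)
    (hsub : closedBall g S q R ⊆ Sᶜ) {κ : ℝ} (hκ : 0 ≤ κ)
    (hric : ∀ x ∈ closedBall g S q R, RicciGeAt g (-κ) x) {l : ℝ} (hl : 0 ≤ l) {K : Set M}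
    (hK : IsCompact K) (hKR : ∀ x ∈ K, dist g S q x < ENNReal.ofReal R) :
    ∃ d > 0, ∀ x ∈ K, ∀ y δ, 0 < δ → δ < d → dist g S x y = ENNReal.ofReal δ →
      dist g S q x + dist g S x y < ENNReal.ofReal R → HasSecondVariation g S κ l x y δ := by
  refine hK.induction_on (p := fun A => ∃ d > 0, ∀ x ∈ A, ∀ y δ, 0 < δ → δ < d →
      dist g S x y = ENNReal.ofReal δ → dist g S q x + dist g S x y < ENNReal.ofReal R →
      HasSecondVariation g S κ l x y δ) ⟨1, one_pos, fun p hp => hp.elim⟩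
    (fun s t hst ⟨d, hd, h⟩ => ⟨d, hd, fun p hp => h p (hst hp)⟩) ?_ ?_
  · rintro s t ⟨d, hd, h⟩ ⟨d', hd', h'⟩
    refine ⟨min d d', by positivity, fun x hx y δ hδ hδd => ?_⟩
    rcases hx with hx | hx
    · exact h x hx y δ hδ (hδd.trans_le (min_le_left _ _))
    · exact h' x hx y δ hδ (hδd.trans_le (min_le_right _ _))
  · intro x hx
    obtain ⟨d, hd, hev⟩ := eventually_hasSecondVariation hg hS hemb hR hsub hκ hric hl (hKR x hx)
    exact ⟨_, mem_nhdsWithin_of_mem_nhds hev, d, hd, fun y hy => hy⟩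

end Step

/-! ### Laplacian comparison for the distance function -/

section Comparison

variable {n : ℕ} {M : Type*} [TopologicalSpace M] [ChartedSpace (EuclideanSpace ℝ (Fin n)) M]
  [IsManifold (𝓡 n) ∞ M] [T2Space M] [CompactSpace M] {g : BilinField n M} {S : Set M}

theorem closedBall_mono {q : M} {R R' : ℝ} (h : R ≤ R') :
    closedBall g S q R ⊆ closedBall g S q R' := fun _ hx =>
  le_trans hx (ENNReal.ofReal_le_ofReal h)

/-- The final frame and factor of one step are the initial ones of the next, so the triangle
inequality adds the first and second variations. The factor starts from 0, which keeps the first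
point of the chain fixed. -/
theorem HasSecondVariation.chain (hg : IsUniformlyEuclidean g S) (hS : IsClosed S) {κ l δ : ℝ}
    (hl : 0 ≤ l) (hδ : 0 < δ) {p : ℕ → M} {N : ℕ} (hp : ∀ k ≤ N + 1, p k ∉ S)
    (hN : (N + 1 : ℕ) * δ * l ≤ 1)
    (hstep : ∀ k ≤ N, HasSecondVariation g S κ l (p k) (p (k + 1)) δ) :
    ∀ k ≤ N, ∀ ν, IsNormalChart g (p (k + 1)) ν → ∃ (F : Fin n → Euc n) (a : Euc n)
      (B : Fin n → ℝ), IsOrthoFrame (metricForm g ν 0) F ∧ ‖a‖ ≤ (k + 1 : ℕ) * δ * l ∧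
      ∑ i, B i ≤ (k + 1 : ℕ) * δ * (n * l ^ 2 + κ) ∧ ∀ η > 0, ∀ᶠ s : ℝ in 𝓝 0, ∀ i,
        dist g S (p 0) (ν.symm (s • ((k + 1 : ℕ) * δ * l) • F i))
          ≤ ENNReal.ofReal ((k + 1 : ℕ) * δ + s * a i + s ^ 2 / 2 * (B i + η)) := by
  intro k
  induction k with
  | zero =>
    intro _ ν hν
    obtain ⟨ν₀, hν₀⟩ := exists_isNormalChart hg hS (hp 0 (by omega))
    have hG := hg.isMetricOn hS hν₀.mem
    have h0 := hν₀.zero_mem_chartDomain (hp 0 (by omega))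
    obtain ⟨E, hE⟩ := exists_isOrthoFrame _ (hG.symm 0 h0) (hG.pos 0 h0)
    have hc1 : 0 + δ * l ≤ 1 := by
      refine le_trans ?_ hN
      have h1 : (1 : ℝ) ≤ (N + 1 : ℕ) := by exact_mod_cast Nat.succ_pos N
      have h2 : 0 ≤ δ * l := by positivity
      nlinarith
    obtain ⟨F, a, B, hF, ha, hB, hd⟩ := hstep 0 (by omega) 0 le_rfl hc1 ν₀ ν hν₀ hν E hE
    refine ⟨F, a, B, hF, by simpa using ha, by simpa using hB, fun η hη => ?_⟩
    filter_upwards [hd η hη] with s hs i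
    have h1 := hs i
    rw [zero_smul, smul_zero, hν₀.symm_zero] at h1
    simpa using h1
  | succ k ih =>
    intro hk ν hν
    obtain ⟨ν₀, hν₀⟩ := exists_isNormalChart hg hS (hp (k + 1) (by omega))
    obtain ⟨F₀, a₀, B₀, hF₀, ha₀, hB₀, hd₀⟩ := ih (by omega) ν₀ hν₀
    have hc1 : (k + 1 : ℕ) * δ * l + δ * l ≤ 1 := by
      refine le_trans ?_ hN
      have h1 : ((k + 1 : ℕ) : ℝ) + 1 ≤ (N + 1 : ℕ) := by exact_mod_cast (by omega)
      have h2 : 0 ≤ δ * l := by positivity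
      nlinarith
    obtain ⟨F, a, B, hF, ha, hB, hd⟩ := hstep (k + 1) hk _ (by positivity) hc1 ν₀ ν hν₀ hν F₀ hF₀
    have hcast : ((k + 1 + 1 : ℕ) : ℝ) = (k + 1 : ℕ) + 1 := by push_cast; ring
    have hcast' : ((k + 1 + 1 : ℕ) : ℝ) * δ * l = (k + 1 : ℕ) * δ * l + δ * l := by
      rw [hcast]; ring
    refine ⟨F, a₀ + a, fun i => B₀ i + B i, hF, ?_, ?_, fun η hη => ?_⟩
    · rw [hcast']
      exact (norm_add_le _ _).trans (add_le_add ha₀ ha)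
    · rw [Finset.sum_add_distrib, hcast]
      linarith
    · have h2 : ∀ᶠ s : ℝ in 𝓝 0, ∀ i,
          0 ≤ (k + 1 : ℕ) * δ + s * a₀ i + s ^ 2 / 2 * (B₀ i + η / 2) ∧
          0 ≤ δ + s * a i + s ^ 2 / 2 * (B i + η / 2) := by
        rw [Filter.eventually_all]
        intro i
        have h1 : Continuous fun s : ℝ =>
          (k + 1 : ℕ) * δ + s * a₀ i + s ^ 2 / 2 * (B₀ i + η / 2) := by fun_prop
        have h3 : Continuous fun s : ℝ => δ + s * a i + s ^ 2 / 2 * (B i + η / 2) := by fun_prop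
        have h4 : 0 < ((k + 1 : ℕ) : ℝ) * δ := by positivity
        exact ((h1.continuousAt.eventually (lt_mem_nhds (by simpa using h4))).and
          (h3.continuousAt.eventually (lt_mem_nhds (by simpa using hδ)))).mono
          fun s hs => ⟨hs.1.le, hs.2.le⟩
      filter_upwards [h2, hd₀ (η / 2) (by positivity), hd (η / 2) (by positivity)]
        with s hs1 hs2 hs3 i
      rw [hcast']
      refine (dist_triangle g S _ _ _).trans ((add_le_add (hs2 i) (hs3 i)).trans ?_)
      rw [← ENNReal.ofReal_add (hs1 i).1 (hs1 i).2, hcast]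
      apply ENNReal.ofReal_le_ofReal
      rw [PiLp.add_apply]
      apply le_of_eq
      ring

/-- An upper barrier for the distance function from `q`, which bounds its Hessian from above in the
sense of the Laplacian comparison theorem. -/
theorem exists_distance_barrier (hg : IsUniformlyEuclidean g S) (hS : IsClosed S)
    (hemb : IsEmbeddedSubmanifold n S) {q : M} {R : ℝ} (hR : 0 ≤ R)
    (hsub : closedBall g S q R ⊆ Sᶜ) {κ : ℝ} (hκ : 0 ≤ κ)
    (hric : ∀ x ∈ closedBall g S q R, RicciGeAt g (-κ) x) {x : M} {ρ c : ℝ}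
    (hx : dist g S q x = ENNReal.ofReal ρ) (hρR : ρ < R) (hc : 0 < c) (hcρ : c ≤ ρ)
    {ν : OpenPartialHomeomorph M (EuclideanSpace ℝ (Fin n))} (hν : IsNormalChart g x ν) :
    ∃ (F : Fin n → Euc n) (a : Euc n) (B : Fin n → ℝ), IsOrthoFrame (metricForm g ν 0) F ∧
      ‖a‖ ≤ 1 ∧ ∑ i, B i ≤ n / c + κ * c ∧ ∀ η > 0, ∀ᶠ s : ℝ in 𝓝 0, ∀ i,
        dist g S q (ν.symm (s • F i)) ≤ ENNReal.ofReal (ρ + s * a i + s ^ 2 / 2 * (B i + η)) := by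
  have hρ : 0 < ρ := hc.trans_le hcρ
  have hR0 : 0 < R := hρ.trans hρR
  have hqx : dist g S q q + dist g S q x < ENNReal.ofReal R := by
    rw [dist_self, zero_add, hx]
    exact (ENNReal.ofReal_lt_ofReal_iff hR0).2 hρR
  -- Only the last part of a shortest path from q, of length c, is varied. With slope 1/c the factor
  -- grows from 0 at z to 1 at x, and c(n/c² + κ) = n/c + κc.
  obtain ⟨z, hz1, hz2⟩ := exists_between hg hS hemb hR hsub hqx (t := ENNReal.ofReal (ρ - c))
    (by rw [hx]; exact ENNReal.ofReal_le_ofReal (by linarith))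
  have hzx : dist g S z x = ENNReal.ofReal c := by
    have h1 : ENNReal.ofReal ρ = ENNReal.ofReal c + ENNReal.ofReal (ρ - c) := by
      rw [← ENNReal.ofReal_add hc.le (by linarith)]
      congr 1
      ring
    rw [hx, h1] at hz2
    exact (ENNReal.add_left_inj ENNReal.ofReal_ne_top).1 hz2
  have hl : (0 : ℝ) ≤ 1 / c := by positivity
  have hKcl : IsClosed (closedBall g S q ρ) :=
    isClosed_closedBall hg hS hemb hρ.le ((closedBall_mono hρR.le).trans hsub)
  obtain ⟨d, hd, hvar⟩ := exists_uniform_secondVariation hg hS hemb hR hsub hκ hric hl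
    hKcl.isCompact (fun y hy => lt_of_le_of_lt hy ((ENNReal.ofReal_lt_ofReal_iff hR0).2 hρR))
  -- Enough steps for each to be shorter than the uniform range d of the second variation.
  obtain ⟨N, hN⟩ := exists_nat_gt (c / d)
  set δ : ℝ := c / (N + 1 : ℕ) with hδ_def
  have hδ : 0 < δ := by positivity
  have hNδ : ((N + 1 : ℕ) : ℝ) * δ = c := by rw [hδ_def]; field_simp
  have hδd : δ < d := by
    rw [hδ_def, div_lt_iff₀ (by positivity)]
    rw [div_lt_iff₀ hd] at hN
    push_cast
    nlinarith
  obtain ⟨p, hp0, hp1, hp⟩ := exists_chain hg hS hemb hR hsub (h := ENNReal.ofReal δ) N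
    (x := z) (y := x) (by
      rw [hz1, hzx, ← ENNReal.ofReal_add (by linarith) hc.le]
      exact (ENNReal.ofReal_lt_ofReal_iff hR0).2 (by linarith)) (by
      rw [hzx, ← ENNReal.ofReal_natCast, ← ENNReal.ofReal_mul (by positivity), hNδ])
  have hpq : ∀ k ≤ N + 1, dist g S q (p k) ≤ ENNReal.ofReal (ρ - c + k * δ) := by
    intro k hk
    have h1 := dist_chain_le (m := N + 1) (fun k hk => hp k (by omega)) k hk
    rw [hp0] at h1
    rw [ENNReal.ofReal_add (by linarith) (by positivity), ENNReal.ofReal_mul (by positivity),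
      ENNReal.ofReal_natCast]
    exact (dist_triangle g S q z _).trans (add_le_add hz1.le h1)
  have hkδ : ∀ k ≤ N + 1, ρ - c + k * δ ≤ ρ := by
    intro k hk
    have : (k : ℝ) ≤ (N + 1 : ℕ) := by exact_mod_cast hk
    nlinarith
  have hpK : ∀ k ≤ N + 1, p k ∈ closedBall g S q ρ := fun k hk =>
    (hpq k hk).trans (ENNReal.ofReal_le_ofReal (hkδ k hk))
  have hstep : ∀ k ≤ N, HasSecondVariation g S κ (1 / c) (p k) (p (k + 1)) δ := by
    intro k hk
    refine hvar (p k) (hpK k (by omega)) _ δ hδ hδd (hp k hk) ?_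
    rw [hp k hk]
    refine (add_le_add (hpq k (by omega)) le_rfl).trans_lt ?_
    rw [← ENNReal.ofReal_add (add_nonneg (by linarith) (by positivity)) hδ.le]
    refine (ENNReal.ofReal_lt_ofReal_iff hR0).2 ?_
    have := hkδ (k + 1) (by omega)
    push_cast at this
    linarith
  have hν' : IsNormalChart g (p (N + 1)) ν := by rw [hp1]; exact hν
  have hone : c * (1 / c) = 1 := by field_simp
  obtain ⟨F, a, B, hF, ha, hB, hdist⟩ := HasSecondVariation.chain hg hS hl hδ (p := p) (N := N)
    (fun k hk => hsub (closedBall_mono hρR.le (hpK k hk))) (by rw [hNδ, hone]) hstep N le_rfl ν hν'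
  rw [hNδ, hone] at ha
  rw [hNδ] at hB
  refine ⟨F, a, B, hF, ha, hB.trans_eq (by field_simp), fun η hη => ?_⟩
  have h2 : ∀ᶠ s : ℝ in 𝓝 0, ∀ i, 0 ≤ c + s * a i + s ^ 2 / 2 * (B i + η) := by
    rw [Filter.eventually_all]
    intro i
    have h1 : Continuous fun s : ℝ => c + s * a i + s ^ 2 / 2 * (B i + η) := by fun_prop
    exact (h1.continuousAt.eventually (lt_mem_nhds (by simpa using hc))).mono fun s hs => hs.le
  filter_upwards [hdist η hη, h2] with s hs hs2 i
  have h3 := hs i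
  rw [hNδ, hone, one_smul, hp0] at h3
  refine (dist_triangle g S q z _).trans ((add_le_add hz1.le h3).trans ?_)
  rw [← ENNReal.ofReal_add (by linarith) (hs2 i)]
  exact ENNReal.ofReal_le_ofReal (by linarith)

end Comparison

/-! ### Bochner's formula at the centre of a normal chart -/

section Bochner

variable {n : ℕ} {G : Euc n → Form n} {U : Set (Euc n)}

/-- By the Koszul formula, a vanishing first derivative of the metric makes the Christoffel vector
orthogonal to everything. -/
theorem IsMetricOn.chr_eq_zero (hG : IsMetricOn G U) {y : Euc n} (hy : y ∈ U)
    (hD : fderiv ℝ G y = 0) : chr G y = 0 := by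
  have h1 : ∀ i j, chr G y (stdVec i) (stdVec j) = 0 := by
    intro i j
    by_contra hne
    have h2 := hG.pos y hy _ hne
    have h3 : ∀ l, G y (stdVec l) (chr G y (stdVec i) (stdVec j)) = 0 := by
      intro l
      have h4 := hG.koszul hy (stdVec i) (stdVec j) (stdVec l)
      rw [hD] at h4
      simpa using h4
    have h5 : G y (chr G y (stdVec i) (stdVec j)) (chr G y (stdVec i) (stdVec j)) = 0 := by
      conv_lhs => enter [1, 2]; rw [sum_single (chr G y (stdVec i) (stdVec j))]
      simp only [map_sum, map_smul, sum_apply, smul_apply, smul_eq_mul, h3, mul_zero,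
        Finset.sum_const_zero]
    exact h2.ne' h5
  ext1 a
  ext1 c
  rw [sum_single a, sum_single c]
  simp only [map_sum, map_smul, sum_apply, smul_apply, h1, smul_zero, Finset.sum_const_zero,
    zero_apply]

theorem isOrthoFrame_stdVec {B : Form n} (hB : ∀ a b, B a b = inner ℝ a b) :
    IsOrthoFrame B (fun i => stdVec i) := fun i j => by
  rw [hB]
  simp [EuclideanSpace.inner_single_left]

theorem matOf_eq_one {B : Euc n → Form n} {y : Euc n} (hB : ∀ a b, B y a b = inner ℝ a b) :
    matOf B y = 1 := by
  ext i j
  change B y (stdVec i) (stdVec j) = _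
  rw [isOrthoFrame_stdVec hB i j, Matrix.one_apply]

/-- At the centre of normal coordinates the inverse metric is critical. -/
theorem IsMetricOn.hasFDerivAt_inv_entry (hG : IsMetricOn G U) {y : Euc n} (hy : y ∈ U)
    (hB : ∀ a b, G y a b = inner ℝ a b) (hD : fderiv ℝ G y = 0) (i j : Fin n) :
    HasFDerivAt (fun z => (matOf G z)⁻¹ i j) (0 : Euc n →L[ℝ] ℝ) y := by
  have hinv : ∀ i j, DifferentiableAt ℝ (fun z => (matOf G z)⁻¹ i j) y := fun i j =>
    (contDiffAt_inv (fun i j => hG.contDiffAt_entry hy i j) (hG.det_ne_zero hy) i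
      j).differentiableAt (by simp)
  have hent : ∀ i j, HasFDerivAt (fun z => matOf G z i j) (0 : Euc n →L[ℝ] ℝ) y := by
    intro i j
    have h1 := ((hG.hasFDerivAt hy).clm_apply (hasFDerivAt_const (stdVec i) y)).clm_apply
      (hasFDerivAt_const (stdVec j) y)
    refine h1.congr_fderiv ?_
    rw [hD]
    ext v
    simp
  have h2 : ∀ᶠ z in 𝓝 y, ∑ k, (matOf G z)⁻¹ i k * matOf G z k j = (1 : Matrix _ _ ℝ) i j := by
    filter_upwards [hG.isOpen.mem_nhds hy] with z hz
    rw [← Matrix.mul_apply, Matrix.nonsing_inv_mul _ (isUnit_iff_ne_zero.2 (hG.det_ne_zero hz))]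
  have h3 : HasFDerivAt (fun z => ∑ k, (matOf G z)⁻¹ i k * matOf G z k j) _ y :=
    HasFDerivAt.fun_sum fun k _ => (hinv i k).hasFDerivAt.mul (hent k j)
  have h4 := h3.unique ((hasFDerivAt_const ((1 : Matrix (Fin n) (Fin n) ℝ) i j)
    y).congr_of_eventuallyEq h2)
  have h5 : fderiv ℝ (fun z => (matOf G z)⁻¹ i j) y = 0 := by
    rw [← h4, matOf_eq_one hB]
    ext v
    simp [Matrix.one_apply]
  rw [← h5]
  exact (hinv i j).hasFDerivAt

/-- The contraction of a bilinear form with the inverse metric. -/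
def invTrace (G : Euc n → Form n) (y : Euc n) (A : Fin n → Fin n → ℝ) : ℝ :=
  ∑ i, ∑ j, (matOf G y)⁻¹ i j * A i j

theorem IsMetricOn.hasFDerivAt_invTrace (hG : IsMetricOn G U) {y : Euc n} (hy : y ∈ U)
    (hB : ∀ a b, G y a b = inner ℝ a b) (hD : fderiv ℝ G y = 0)
    {A : Fin n → Fin n → Euc n → ℝ} {A' : Fin n → Fin n → Euc n →L[ℝ] ℝ}
    (hA : ∀ i j, HasFDerivAt (A i j) (A' i j) y) :
    HasFDerivAt (fun z => invTrace G z fun i j => A i j z) (∑ k, A' k k) y := by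
  have h1 : HasFDerivAt (fun z => invTrace G z fun i j => A i j z) _ y :=
    HasFDerivAt.fun_sum fun i _ => HasFDerivAt.fun_sum fun j _ =>
      (hG.hasFDerivAt_inv_entry hy hB hD i j).mul (hA i j)
  refine h1.congr_fderiv ?_
  rw [matOf_eq_one hB]
  ext v
  simp [sum_apply, Matrix.one_apply]

theorem invTrace_eq {y : Euc n} (hB : ∀ a b, G y a b = inner ℝ a b) (A : Fin n → Fin n → ℝ) :
    invTrace G y A = ∑ k, A k k := by
  rw [invTrace, matOf_eq_one hB]
  simp [Matrix.one_apply]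

theorem fderiv_three_symm {v : Euc n → ℝ} {y : Euc n} (hv : ContDiffAt ℝ 3 v y) (a b c : Euc n) :
    fderiv ℝ (fderiv ℝ (fderiv ℝ v)) y a b c = fderiv ℝ (fderiv ℝ (fderiv ℝ v)) y a c b ∧
    fderiv ℝ (fderiv ℝ (fderiv ℝ v)) y a b c = fderiv ℝ (fderiv ℝ (fderiv ℝ v)) y b a c := by
  have h1 : ContDiffAt ℝ 2 (fderiv ℝ v) y := hv.fderiv_right (by norm_num)
  have h2 : ContDiffAt ℝ 1 (fderiv ℝ (fderiv ℝ v)) y := h1.fderiv_right (by norm_num)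
  constructor
  · have h3 := (h2.differentiableAt (by simp)).hasFDerivAt
    have h4 := (h3.clm_apply (hasFDerivAt_const b y)).clm_apply (hasFDerivAt_const c y)
    have h5 := (h3.clm_apply (hasFDerivAt_const c y)).clm_apply (hasFDerivAt_const b y)
    have h6 : (fun z => fderiv ℝ (fderiv ℝ v) z b c) =ᶠ[𝓝 y]
        fun z => fderiv ℝ (fderiv ℝ v) z c b := by
      have h7 := hv.eventually (by simp)
      filter_upwards [h7] with z hz
      exact ((hz.of_le (m := 2) (by norm_num)).isSymmSndFDerivAt (by simp)).eq b c
    have h8 := congrArg (fun L : Euc n →L[ℝ] ℝ => L a)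
      (h4.unique (h5.congr_of_eventuallyEq h6))
    simpa using h8
  · exact congrArg (fun L : Euc n →L[ℝ] ℝ => L c) ((h1.isSymmSndFDerivAt (by simp)).eq a b)

/-- Bochner's formula at the centre of normal coordinates, for a solution of
`Δ v + |∇ v| ^ 2 = k`. -/
theorem IsMetricOn.bochner (hG : IsMetricOn G U) (h0 : (0 : Euc n) ∈ U)
    (hB : ∀ a b, G 0 a b = inner ℝ a b) (hD : fderiv ℝ G 0 = 0) {v : Euc n → ℝ}
    (hv : ContDiffAt ℝ 3 v 0) {b : Euc n} (hb : ∀ a, fderiv ℝ v 0 a = inner ℝ b a) {k : Euc n → ℝ}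
    {c : ℝ} (hpde : ∀ᶠ y in 𝓝 0, invTrace G y (fun i j =>
      fderiv ℝ (fderiv ℝ v) y (stdVec i) (stdVec j)
        + fderiv ℝ v y (stdVec i) * fderiv ℝ v y (stdVec j)
        - fderiv ℝ v y (chr G y (stdVec i) (stdVec j))) = k y)
    (hk : HasFDerivAt k (c • fderiv ℝ v 0) 0) :
    ∑ i, fderiv ℝ (fderiv ℝ v) 0 (stdVec i) (stdVec i) = k 0 - ‖b‖ ^ 2 ∧
    ∑ i, (2 * fderiv ℝ (fderiv ℝ (fderiv ℝ v)) 0 (stdVec i) (stdVec i) b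
      - fderiv ℝ (fderiv ℝ G) 0 (stdVec i) (stdVec i) b b) =
    2 * (c * ‖b‖ ^ 2 - 2 * fderiv ℝ (fderiv ℝ v) 0 b b)
      + 2 * ∑ i, ∑ j, ricciCoord (matOf G) i j 0 * b i * b j := by
  have hΓ := hG.chr_eq_zero h0 hD
  have hbi : ∀ i, fderiv ℝ v 0 (stdVec i) = b i := fun i => by
    rw [hb]; simp [EuclideanSpace.inner_single_right]
  have hnorm : ‖b‖ ^ 2 = ∑ i, b i * b i := by
    rw [EuclideanSpace.norm_sq_eq]
    simp [sq]
  constructor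
  · have h1 := hpde.self_of_nhds
    rw [invTrace_eq hB, hΓ] at h1
    simp only [zero_apply, map_zero, sub_zero, Finset.sum_add_distrib, hbi] at h1
    rw [hnorm]
    linarith
  have c1 : ContDiffAt ℝ 2 (fderiv ℝ v) 0 := hv.fderiv_right (by norm_num)
  have c2 : ContDiffAt ℝ 1 (fderiv ℝ (fderiv ℝ v)) 0 := c1.fderiv_right (by norm_num)
  have d1 := (c1.differentiableAt (by simp)).hasFDerivAt
  have d2 := (c2.differentiableAt (by simp)).hasFDerivAt
  have dΓ := hG.hasFDerivAt_chr h0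
  have cst : ∀ v : Euc n, HasFDerivAt (fun _ : Euc n => v) (0 : Euc n →L[ℝ] Euc n) 0 :=
    fun v => hasFDerivAt_const v 0
  have hA : ∀ i j, HasFDerivAt (fun y => fderiv ℝ (fderiv ℝ v) y (stdVec i) (stdVec j)
        + fderiv ℝ v y (stdVec i) * fderiv ℝ v y (stdVec j)
        - fderiv ℝ v y (chr G y (stdVec i) (stdVec j))) _ 0 := fun i j =>
    ((((d2.clm_apply (cst (stdVec i))).clm_apply (cst (stdVec j))).add
      ((d1.clm_apply (cst (stdVec i))).mul (d1.clm_apply (cst (stdVec j))))).sub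
      (d1.clm_apply ((dΓ.clm_apply (cst (stdVec i))).clm_apply (cst (stdVec j)))))
  -- Differentiate the equation at 0. The inverse metric is critical there, so it contributes
  -- nothing and the contraction becomes an ordinary trace; the direction b = ∇v is inserted next.
  have h1 := (hG.hasFDerivAt_invTrace h0 hB hD hA).unique (hk.congr_of_eventuallyEq hpde)
  have h2 := congrArg (fun L : Euc n →L[ℝ] ℝ => L b) h1
  simp only [sum_apply, add_apply, sub_apply, smul_apply, ContinuousLinearMap.comp_apply,
    ContinuousLinearMap.flip_apply, zero_apply, map_zero, zero_add, add_zero, hΓ, hbi,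
    smul_eq_mul, hb, inner_zero_right, Finset.sum_const_zero, real_inner_self_eq_norm_sq, Finset.sum_add_distrib,
    Finset.sum_sub_distrib] at h2
  have h3 : ∑ i, b i * fderiv ℝ (fderiv ℝ v) 0 b (stdVec i) = fderiv ℝ (fderiv ℝ v) 0 b b := by
    conv_rhs => enter [2]; rw [sum_single b]
    simp only [map_sum, map_smul, smul_eq_mul]
  -- The third derivatives of v commute, while the second derivatives of G and the first derivatives
  -- of Γ combine into the trace of the curvature, which is the Ricci term.
  have h4 := hG.sum_curv_frame h0 (isOrthoFrame_stdVec hB) b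
  have h5 : ∀ i, G 0 (curv G 0 (stdVec i) b (stdVec i)) b =
      inner ℝ (fderiv ℝ (chr G) 0 (stdVec i) (stdVec i) b) b
        - inner ℝ b (fderiv ℝ (chr G) 0 b (stdVec i) (stdVec i)) := by
    intro i
    rw [hB, curv, hΓ, hG.fderiv_chr_symm h0 (stdVec i) b]
    simp only [zero_apply, add_zero, sub_zero, inner_sub_left]
    rw [real_inner_comm b (fderiv ℝ (chr G) 0 b (stdVec i) (stdVec i))]
  have h6 : ∀ i, fderiv ℝ (fderiv ℝ G) 0 (stdVec i) (stdVec i) b b =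
      2 * inner ℝ (fderiv ℝ (chr G) 0 (stdVec i) (stdVec i) b) b := by
    intro i
    rw [hG.fderiv_fderiv_eq h0, hD]
    simp only [zero_apply, zero_add, hB]
    rw [real_inner_comm _ b]
    ring
  have h7 : ∀ i, fderiv ℝ (fderiv ℝ (fderiv ℝ v)) 0 (stdVec i) (stdVec i) b =
      fderiv ℝ (fderiv ℝ (fderiv ℝ v)) 0 b (stdVec i) (stdVec i) := by
    intro i
    rw [(fderiv_three_symm hv (stdVec i) (stdVec i) b).1, (fderiv_three_symm hv _ b _).2]
  simp only [h5, Finset.sum_sub_distrib] at h4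
  simp only [h6, h7, Finset.sum_sub_distrib, ← Finset.mul_sum]
  have h8 : ∑ i, fderiv ℝ (fderiv ℝ v) 0 b (stdVec i) * b i = fderiv ℝ (fderiv ℝ v) 0 b b := by
    rw [← h3]
    exact Finset.sum_congr rfl fun i _ => mul_comm _ _
  linarith

end Bochner

/-! ### The equation for the logarithm of the solution -/

section Logarithm

variable {n : ℕ} {G : Euc n → Form n} {U : Set (Euc n)}

theorem laplacianCoord_eq_invTrace (G : Euc n → Form n) {w : Euc n → ℝ} {y : Euc n}
    (hw : ContDiffAt ℝ 2 w y) : laplacianCoord (matOf G) w y = invTrace G y fun i j =>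
      fderiv ℝ (fderiv ℝ w) y (stdVec i) (stdVec j)
        - fderiv ℝ w y (chr G y (stdVec i) (stdVec j)) := by
  have h1 : ContDiffAt ℝ 1 (fderiv ℝ w) y := hw.fderiv_right (by norm_num)
  have h2 := (h1.differentiableAt (by simp)).hasFDerivAt
  have h3 : ∀ i j, partialDeriv i (partialDeriv j w) y =
      fderiv ℝ (fderiv ℝ w) y (stdVec i) (stdVec j) := by
    intro i j
    have h4 := h2.clm_apply (hasFDerivAt_const (stdVec j) y)
    have h5 : fderiv ℝ (partialDeriv j w) y = _ := h4.fderiv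
    rw [partialDeriv_eq, h5]
    simp
  have h6 : ∀ i j, ∑ k, christoffel (matOf G) k i j y * partialDeriv k w y =
      fderiv ℝ w y (chr G y (stdVec i) (stdVec j)) := by
    intro i j
    conv_rhs => enter [2]; rw [sum_single (chr G y (stdVec i) (stdVec j))]
    simp only [map_sum, map_smul, smul_eq_mul, chr_stdVec, partialDeriv_eq]
  simp only [laplacianCoord, invTrace, h3, h6]

theorem ContDiffAt.hasFDerivAt_of_log {w : Euc n → ℝ} {y : Euc n} (hw : ContDiffAt ℝ 1 w y)
    (hpos : 0 < w y) :
    HasFDerivAt w (w y • fderiv ℝ (fun z => Real.log (w z)) y) y := by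
  have h1 := (hw.differentiableAt (by simp)).hasFDerivAt
  have h2 := h1.log hpos.ne'
  rw [h2.fderiv, smul_smul, mul_inv_cancel₀ hpos.ne', one_smul]
  exact h1

theorem fderiv_fderiv_of_log {w : Euc n → ℝ} {y : Euc n} (hw : ContDiffAt ℝ 2 w y)
    (hpos : 0 < w y) (a b : Euc n) :
    fderiv ℝ (fderiv ℝ w) y a b = w y * (fderiv ℝ (fderiv ℝ fun z => Real.log (w z)) y a b
      + fderiv ℝ (fun z => Real.log (w z)) y a * fderiv ℝ (fun z => Real.log (w z)) y b) := by
  have hv : ContDiffAt ℝ 2 (fun z => Real.log (w z)) y := hw.log hpos.ne'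
  have hv1 : ContDiffAt ℝ 1 (fderiv ℝ fun z => Real.log (w z)) y := hv.fderiv_right (by norm_num)
  have h1 : fderiv ℝ w =ᶠ[𝓝 y] fun z => w z • fderiv ℝ (fun z => Real.log (w z)) z := by
    filter_upwards [hw.eventually (by simp), hw.continuousAt.eventually_const_lt hpos] with z hz hz'
    exact (ContDiffAt.hasFDerivAt_of_log (hz.of_le (by norm_num)) hz').fderiv
  have h2 : HasFDerivAt (fun z => w z • fderiv ℝ (fun z => Real.log (w z)) z) _ y :=
    (ContDiffAt.hasFDerivAt_of_log (hw.of_le (by norm_num)) hpos).smul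
      (hv1.differentiableAt (by simp)).hasFDerivAt
  rw [h1.fderiv_eq, h2.fderiv]
  simp
  ring

/-- The equation `Δ w = f` in terms of `log w`. -/
theorem laplacianCoord_log (G : Euc n → Form n) {w : Euc n → ℝ} {y : Euc n}
    (hw : ContDiffAt ℝ 2 w y) (hpos : 0 < w y) :
    invTrace G y (fun i j => fderiv ℝ (fderiv ℝ fun z => Real.log (w z)) y (stdVec i) (stdVec j)
        + fderiv ℝ (fun z => Real.log (w z)) y (stdVec i)
          * fderiv ℝ (fun z => Real.log (w z)) y (stdVec j)
        - fderiv ℝ (fun z => Real.log (w z)) y (chr G y (stdVec i) (stdVec j)))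
      = laplacianCoord (matOf G) w y / w y := by
  rw [laplacianCoord_eq_invTrace G hw, invTrace, invTrace, Finset.sum_div]
  refine Finset.sum_congr rfl fun i _ => ?_
  rw [Finset.sum_div]
  refine Finset.sum_congr rfl fun j _ => ?_
  rw [fderiv_fderiv_of_log hw hpos,
    (ContDiffAt.hasFDerivAt_of_log (hw.of_le (by norm_num)) hpos).fderiv]
  simp only [smul_apply, smul_eq_mul]
  field_simp

/-- The gradient of K(u)/u is a multiple of ∇ log u, as Bochner's formula above requires of the
right-hand side; the multiple is K'(u) - K(u)/u. -/
theorem hasFDerivAt_div_of_log {w : Euc n → ℝ} {y : Euc n} (hw : ContDiffAt ℝ 1 w y)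
    (hpos : 0 < w y) {K : ℝ → ℝ} (hK : DifferentiableAt ℝ K (w y)) :
    HasFDerivAt (fun z => K (w z) / w z)
      ((deriv K (w y) - K (w y) / w y) • fderiv ℝ (fun z => Real.log (w z)) y) y := by
  have h1 := ContDiffAt.hasFDerivAt_of_log hw hpos
  have h2 : HasFDerivAt (fun z => K (w z)) _ y := hK.hasDerivAt.comp_hasFDerivAt y h1
  have h3 : HasFDerivAt (fun z => (w z)⁻¹) _ y := (hasDerivAt_inv hpos.ne').comp_hasFDerivAt y h1
  have h4 := h2.mul h3
  refine (h4.congr_fderiv ?_).congr_of_eventuallyEq (Eventually.of_forall fun z => ?_)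
  · ext a
    simp
    field_simp
    ring
  · simp [div_eq_mul_inv]

end Logarithm

/-! ### Two-jets and the maximum principle in one variable -/

section TwoJet

/-- `φ` has the value `c`, the first derivative `a` and the second derivative `b` at `0`. -/
def HasTwoJet (φ : ℝ → ℝ) (c a b : ℝ) : Prop :=
  φ 0 = c ∧ ∃ φ' : ℝ → ℝ, (∀ᶠ s in 𝓝 0, HasDerivAt φ (φ' s) s) ∧ φ' 0 = a ∧ HasDerivAt φ' b 0

theorem HasTwoJet.mul {φ ψ : ℝ → ℝ} {c a b c' a' b' : ℝ} (h : HasTwoJet φ c a b)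
    (h' : HasTwoJet ψ c' a' b') :
    HasTwoJet (fun s => φ s * ψ s) (c * c') (a * c' + c * a') (b * c' + 2 * (a * a') + c * b') := by
  obtain ⟨h0, φ', h1, h2, h3⟩ := h
  obtain ⟨k0, ψ', k1, k2, k3⟩ := h'
  refine ⟨by simp only [h0, k0], fun s => φ' s * ψ s + φ s * ψ' s, ?_, by simp only [h0, k0, h2, k2], ?_⟩
  · filter_upwards [h1, k1] with s hs ks
    exact hs.mul ks
  · have e1 := h3.mul k1.self_of_nhds
    have e2 := h1.self_of_nhds.mul k3
    refine (e1.add e2).congr_deriv ?_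
    rw [h0, k0, h2, k2]
    ring

theorem hasTwoJet_quadratic (c a b : ℝ) :
    HasTwoJet (fun s => c + s * a + s ^ 2 / 2 * b) c a b := by
  refine ⟨by simp, fun s => a + s * b, Eventually.of_forall fun s => ?_, by simp, ?_⟩
  · have h1 := (((hasDerivAt_id s).mul_const a).const_add c).add
      ((((hasDerivAt_id s).pow 2).div_const 2).mul_const b)
    refine h1.congr_deriv ?_
    simp
  · simpa using (((hasDerivAt_id (0 : ℝ)).mul_const b).const_add a)

/-- A positive second derivative would make 0 a strict contradiction: a local minimum as well as a
local maximum, so φ would be locally constant. -/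
theorem HasTwoJet.second_nonpos {φ : ℝ → ℝ} {c a b : ℝ} (h : HasTwoJet φ c a b)
    (hmax : ∀ᶠ s in 𝓝 0, φ s ≤ c) : a = 0 ∧ b ≤ 0 := by
  obtain ⟨h0, φ', h1, h2, h3⟩ := h
  have hm : IsLocalMax φ 0 := by
    filter_upwards [hmax] with s hs
    rw [h0]; exact hs
  have ha : a = 0 := by
    rw [← h2]; exact hm.hasDerivAt_eq_zero h1.self_of_nhds
  refine ⟨ha, ?_⟩
  by_contra! hb
  have hd : deriv φ =ᶠ[𝓝 0] φ' := h1.mono fun s hs => hs.deriv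
  have hd2 : deriv (deriv φ) 0 = b := by rw [hd.deriv_eq, h3.deriv]
  have hmin : IsLocalMin φ 0 := isLocalMin_of_deriv_deriv_pos (by rw [hd2]; exact hb)
    (by rw [hd.self_of_nhds, h2, ha]) h1.self_of_nhds.continuousAt
  have hconst : φ =ᶠ[𝓝 0] fun _ => φ 0 := by
    filter_upwards [hm, hmin] with s hs hs'
    exact le_antisymm hs hs'
  have h5 : deriv φ =ᶠ[𝓝 0] fun _ => 0 := by
    filter_upwards [hconst.eventuallyEq_nhds] with s hs
    rw [hs.deriv_eq]; simp
  have h6 := h5.deriv_eq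
  rw [hd2] at h6
  simp at h6
  exact hb.ne' h6

end TwoJet

/-! ### Lower barriers for the squared gradient, and trace inequalities -/

section LowerBarrier

variable {n : ℕ} {G : Euc n → Form n} {U : Set (Euc n)}

/-- The expression 2 dv(X) - G(X, X) never exceeds |∇v|², with equality for X = ∇v. Evaluated on a
field X that is affine along the ray it is a lower barrier involving G but not its inverse. -/
theorem hasTwoJet_lower_barrier {E : Type*} [NormedAddCommGroup E] [NormedSpace ℝ E]
    {L L' : ℝ → E →L[ℝ] ℝ} {L'' : E →L[ℝ] ℝ} {Q Q' : ℝ → E →L[ℝ] E →L[ℝ] ℝ}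
    {Q'' : E →L[ℝ] E →L[ℝ] ℝ}
    (hL : ∀ᶠ s in 𝓝 0, HasDerivAt L (L' s) s) (hL' : HasDerivAt L' L'' 0)
    (hQ : ∀ᶠ s in 𝓝 0, HasDerivAt Q (Q' s) s) (hQ' : HasDerivAt Q' Q'' 0) (hQ0 : Q' 0 = 0)
    (b h : E) :
    HasTwoJet (fun s => 2 * L s (b + s • h) - Q s (b + s • h) (b + s • h))
      (2 * L 0 b - Q 0 b b)
      (2 * (L' 0 b + L 0 h) - (Q 0 h b + Q 0 b h))
      (2 * (L'' b + 2 * L' 0 h) - (Q'' b b + 2 * Q 0 h h)) := by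
  have hX : ∀ s : ℝ, HasDerivAt (fun s : ℝ => b + s • h) h s := fun s => by
    simpa using ((hasDerivAt_id s).smul_const h).const_add b
  have hh : ∀ s : ℝ, HasDerivAt (fun _ : ℝ => h) 0 s := fun s => hasDerivAt_const s h
  refine ⟨by simp, fun s => 2 * (L' s (b + s • h) + L s h)
    - ((Q' s (b + s • h) + Q s h) (b + s • h) + Q s (b + s • h) h), ?_, ?_, ?_⟩
  · filter_upwards [hL, hQ] with s hs ks
    exact ((hs.clm_apply (hX s)).const_mul 2).sub ((ks.clm_apply (hX s)).clm_apply (hX s))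
  · simp [hQ0]
  · have e1 := hL.self_of_nhds
    have e2 := hQ.self_of_nhds
    have e3 := ((hL'.clm_apply (hX 0)).add (e1.clm_apply (hh 0))).const_mul 2
    have e4 := (((hQ'.clm_apply (hX 0)).add (e2.clm_apply (hh 0))).clm_apply (hX 0)).add
      ((e2.clm_apply (hX 0)).clm_apply (hh 0))
    refine (e3.sub e4).congr_deriv ?_
    simp [hQ0]
    ring

theorem IsOrthoFrame.trace_form {B : Form n} (hB : ∀ a b, B a b = inner ℝ a b)
    {E : Fin n → Euc n} (hE : IsOrthoFrame B E) (T : Form n) :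
    ∑ i, T (E i) (E i) = ∑ i, T (stdVec i) (stdVec i) := by
  let L : Euc n →L[ℝ] Euc n := ∑ j, (T.flip (stdVec j)).smulRight (stdVec j)
  have hL : ∀ a c, B (L a) c = T a c := by
    intro a c
    conv_rhs => enter [2]; rw [sum_single c]
    simp [L, hB, sum_apply, EuclideanSpace.inner_single_left, mul_comm]
  have h1 := hE.trace L
  have h2 := (isOrthoFrame_stdVec hB).trace L
  rw [← h2] at h1
  simpa only [hL] using h1

theorem IsOrthoFrame.norm_sq {B : Form n} (hB : ∀ a b, B a b = inner ℝ a b)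
    {E : Fin n → Euc n} (hE : IsOrthoFrame B E) (a : Euc n) :
    ∑ i, (inner ℝ a (E i)) ^ 2 = ‖a‖ ^ 2 := by
  have h1 := congrArg (fun z => inner ℝ a z) (hE.eq_sum a)
  simp only [inner_sum, inner_smul_right, hB, real_inner_self_eq_norm_sq] at h1
  rw [h1]
  exact Finset.sum_congr rfl fun i _ => by ring

/-- A lower bound for the norm of a symmetric matrix in terms of its trace and of the value of
the quadratic form at one unit vector. -/
theorem sum_sq_ge (hn : 2 ≤ n) {h : Fin n → Fin n → ℝ} {e : Fin n → ℝ} (he : ∑ i, e i ^ 2 = 1)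
    {P T : ℝ} (hP : ∑ i, ∑ j, h i j * e i * e j = P) (hT : ∑ i, h i i = T) :
    P ^ 2 + (T - P) ^ 2 / (n - 1) ≤ ∑ i, ∑ j, h i j ^ 2 := by
  have hn1 : (0 : ℝ) < n - 1 := by
    have : (2 : ℝ) ≤ n := by exact_mod_cast hn
    linarith
  -- The bound is nonnegativity of the squared norm of h - (P - μ)e ⊗ e - μI, where μ is the average
  -- of h over the complement of e.
  set μ : ℝ := (T - P) / (n - 1) with hμ
  have h0 : 0 ≤ ∑ i, ∑ j, (h i j - (P - μ) * (e i * e j) - μ * (if i = j then 1 else 0)) ^ 2 :=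
    Finset.sum_nonneg fun i _ => Finset.sum_nonneg fun j _ => sq_nonneg _
  have h1 : ∀ i j, (h i j - (P - μ) * (e i * e j) - μ * (if i = j then 1 else 0)) ^ 2 =
      h i j ^ 2 + (P - μ) ^ 2 * (e i ^ 2 * e j ^ 2) + μ ^ 2 * (if i = j then 1 else 0)
      - 2 * (P - μ) * (h i j * e i * e j) - 2 * μ * (if i = j then h i j else 0)
      + 2 * (P - μ) * μ * (if i = j then e i * e j else 0) := by
    intro i j
    split_ifs <;> ring
  simp only [h1, Finset.sum_add_distrib, Finset.sum_sub_distrib, ← Finset.mul_sum,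
    Finset.sum_ite_eq, Finset.mem_univ, if_true, he, hP, hT, ← sq] at h0
  simp only [mul_one, Finset.sum_const, Finset.card_univ, Fintype.card_fin, nsmul_eq_mul, he] at h0
  have h2 : (T - P) ^ 2 / (n - 1) = μ ^ 2 * (n - 1) := by rw [hμ]; field_simp
  have h3 : T = P + μ * (n - 1) := by rw [hμ]; field_simp; ring
  rw [h2]
  rw [h3] at h0
  linarith

end LowerBarrier

/-! ### The gradient in a chart -/

section Gradient

variable {n : ℕ} {M : Type*} [TopologicalSpace M] [ChartedSpace (EuclideanSpace ℝ (Fin n)) M]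
  [IsManifold (𝓡 n) ∞ M] {g : BilinField n M} {S : Set M} {u : M → ℝ}
  {e : OpenPartialHomeomorph M (EuclideanSpace ℝ (Fin n))}

theorem fderiv_comp_chart_symm (he : e ∈ IsManifold.maximalAtlas (𝓡 n) ∞ M) {y : Euc n}
    (hy : y ∈ e.target) (hu : MDifferentiableAt (𝓡 n) 𝓘(ℝ, ℝ) u (e.symm y)) (a : Euc n) :
    fderiv ℝ (fun z => u (e.symm z)) y a =
      (show ℝ from mfderiv (𝓡 n) 𝓘(ℝ, ℝ) u (e.symm y) (chartDeriv e y a)) := by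
  have h1 := hu.hasMFDerivAt.comp y (hasMFDerivAt_chart_symm he hy)
  rw [← mfderiv_eq_fderiv]
  exact congrArg (fun L : Euc n →L[ℝ] ℝ => L a) h1.mfderiv

theorem contDiffAt_comp_chart_symm (he : e ∈ IsManifold.maximalAtlas (𝓡 n) ∞ M) {y : Euc n}
    (hy : y ∈ e.target) {k : ℕ} (hu : ContMDiffAt (𝓡 n) 𝓘(ℝ, ℝ) k u (e.symm y)) :
    ContDiffAt ℝ k (fun z => u (e.symm z)) y :=
by
  have h1 : ContMDiffAt 𝓘(ℝ, EuclideanSpace ℝ (Fin n)) (𝓡 n) k e.symm y :=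
    (contMDiffAt_symm_of_mem_maximalAtlas he hy).of_le (by exact_mod_cast le_top)
  exact contMDiffAt_iff_contDiffAt.1 (hu.comp y h1)

/-- Expansion of |∇u - a|² ≥ 0. -/
theorem gradient_sq_ge (hg : IsUniformlyEuclidean g S)
    (he : e ∈ IsManifold.maximalAtlas (𝓡 n) ∞ M) {y : Euc n} (hy : y ∈ chartDomain e S)
    (hu : MDifferentiableAt (𝓡 n) 𝓘(ℝ, ℝ) u (e.symm y)) (a : Euc n) :
    2 * fderiv ℝ (fun z => u (e.symm z)) y a - metricForm g e y a a
      ≤ gradNorm g u (e.symm y) ^ 2 := by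
  have hpos := hg.pos (x := e.symm y) hy.2
  have h1 := fun v => gradient_spec g u (e.symm y) hpos v
  have h2 : 0 ≤ g (e.symm y) (gradient g u (e.symm y)) (gradient g u (e.symm y)) := by
    by_cases h : gradient g u (e.symm y) = 0
    · rw [h]; simp
    · exact (hpos _ h).le
  rw [gradNorm, Real.sq_sqrt h2, fderiv_comp_chart_symm he hy.1 hu, ← h1, metricForm_apply]
  have h3 : 0 ≤ g (e.symm y) (gradient g u (e.symm y) - chartDeriv e y a)
      (gradient g u (e.symm y) - chartDeriv e y a) := by
    by_cases h : gradient g u (e.symm y) - chartDeriv e y a = 0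
    · rw [h]; simp
    · exact (hpos _ h).le
  have h4 := hg.symm _ hy.2 (gradient g u (e.symm y)) (chartDeriv e y a)
  simp only [map_sub, sub_apply] at h3
  linarith

theorem exists_gradient_coord (hg : IsUniformlyEuclidean g S)
    (he : e ∈ IsManifold.maximalAtlas (𝓡 n) ∞ M) {y : Euc n} (hy : y ∈ chartDomain e S)
    (hu : MDifferentiableAt (𝓡 n) 𝓘(ℝ, ℝ) u (e.symm y)) :
    ∃ a : Euc n, (∀ b, metricForm g e y a b = fderiv ℝ (fun z => u (e.symm z)) y b) ∧
      gradNorm g u (e.symm y) ^ 2 = metricForm g e y a a := by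
  have hpos := hg.pos (x := e.symm y) hy.2
  obtain ⟨a, ha⟩ : ∃ a, chartDeriv e y a = gradient g u (e.symm y) :=
    ⟨_, (chartDeriv_bijective he hy.1).2 _⟩
  have h2 : 0 ≤ g (e.symm y) (gradient g u (e.symm y)) (gradient g u (e.symm y)) := by
    by_cases h : gradient g u (e.symm y) = 0
    · rw [h]; simp
    · exact (hpos _ h).le
  refine ⟨a, fun b => ?_, ?_⟩
  · rw [fderiv_comp_chart_symm he hy.1 hu, metricForm_apply, ha]
    exact gradient_spec g u (e.symm y) hpos _
  · rw [gradNorm, Real.sq_sqrt h2, metricForm_apply, ha]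

theorem gradNorm_sq_eq_invTrace (hg : IsUniformlyEuclidean g S) (hS : IsClosed S)
    (he : e ∈ IsManifold.maximalAtlas (𝓡 n) ∞ M) {y : Euc n} (hy : y ∈ chartDomain e S)
    (hu : MDifferentiableAt (𝓡 n) 𝓘(ℝ, ℝ) u (e.symm y)) :
    gradNorm g u (e.symm y) ^ 2 = invTrace (metricForm g e) y fun i j =>
      fderiv ℝ (fun z => u (e.symm z)) y (stdVec i)
        * fderiv ℝ (fun z => u (e.symm z)) y (stdVec j) := by
  obtain ⟨a, ha, h⟩ := exists_gradient_coord hg he hy hu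
  have hG := hg.isMetricOn hS he
  have h1 : ∀ i, ∑ j, (matOf (metricForm g e) y)⁻¹ i j
      * fderiv ℝ (fun z => u (e.symm z)) y (stdVec j) = a i := by
    intro i
    have h2 : ∀ j, fderiv ℝ (fun z => u (e.symm z)) y (stdVec j) =
        ∑ k, matOf (metricForm g e) y j k * a k := by
      intro j
      rw [← ha, hG.symm y hy]
      conv_lhs => enter [2]; rw [sum_single a]
      simp only [map_sum, map_smul, smul_eq_mul]
      exact Finset.sum_congr rfl fun k _ => mul_comm _ _
    have h3 := congrFun (congrArg (fun A => Matrix.mulVec A (fun k => a k))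
      (Matrix.nonsing_inv_mul _ (isUnit_iff_ne_zero.2 (hG.det_ne_zero hy)))) i
    rw [← Matrix.mulVec_mulVec, Matrix.one_mulVec] at h3
    simp only [h2]
    exact h3
  rw [h, ha, invTrace]
  conv_lhs => rw [sum_single a]
  simp only [map_sum, map_smul, smul_eq_mul, ← h1, Finset.sum_mul]
  refine Finset.sum_congr rfl fun i _ => Finset.sum_congr rfl fun j _ => by ring

theorem continuousAt_gradNorm (hg : IsUniformlyEuclidean g S) (hS : IsClosed S) {x : M}
    (hx : x ∉ S) (hu : ContMDiffAt (𝓡 n) 𝓘(ℝ, ℝ) (2 : ℕ) u x) :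
    ContinuousAt (gradNorm g u) x := by
  set e := chartAt (EuclideanSpace ℝ (Fin n)) x with he_def
  have he : e ∈ IsManifold.maximalAtlas (𝓡 n) ∞ M := IsManifold.chart_mem_maximalAtlas x
  have hxe : x ∈ e.source := mem_chart_source _ x
  have hG := hg.isMetricOn hS he
  have hex : e.symm (e x) = x := e.left_inv hxe
  have hy : e x ∈ chartDomain e S := ⟨e.map_source hxe, by
    change e.symm (e x) ∈ Sᶜ; rw [hex]; exact hx⟩
  have hw : ContDiffAt ℝ (2 : ℕ) (fun z => u (e.symm z)) (e x) :=
    contDiffAt_comp_chart_symm he hy.1 (by rw [hex]; exact hu)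
  have hw1 : ContDiffAt ℝ 1 (fderiv ℝ fun z => u (e.symm z)) (e x) :=
    hw.fderiv_right (by norm_num)
  have h1 : ContinuousAt (fun y => invTrace (metricForm g e) y fun i j =>
      fderiv ℝ (fun z => u (e.symm z)) y (stdVec i)
        * fderiv ℝ (fun z => u (e.symm z)) y (stdVec j)) (e x) := by
    refine tendsto_finsetSum _ fun i _ => tendsto_finsetSum _ fun j _ => ?_
    have h2 := (contDiffAt_inv (fun i j => hG.contDiffAt_entry hy i j) (hG.det_ne_zero hy) i
      j).continuousAt
    have h3 : ∀ k, ContinuousAt (fun y => fderiv ℝ (fun z => u (e.symm z)) y (stdVec k)) (e x) :=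
      fun k => hw1.continuousAt.clm_apply continuousAt_const
    exact h2.mul ((h3 i).mul (h3 j))
  have h4 : ContinuousAt (fun z => Real.sqrt (invTrace (metricForm g e) (e z) fun i j =>
      fderiv ℝ (fun z => u (e.symm z)) (e z) (stdVec i)
        * fderiv ℝ (fun z => u (e.symm z)) (e z) (stdVec j))) x :=
    (h1.comp (f := e) (e.continuousAt hxe)).sqrt
  refine h4.congr ?_
  have hnhds : ∀ᶠ z in 𝓝 x, ContMDiffAt (𝓡 n) 𝓘(ℝ, ℝ) (2 : ℕ) u z :=
    contMDiffAt_iff_contMDiffAt_nhds (by simp) |>.1 hu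
  filter_upwards [hnhds, hS.isOpen_compl.mem_nhds hx, e.open_source.mem_nhds hxe] with z hz hzS hze
  have hez : e.symm (e z) = z := e.left_inv hze
  have hyz : e z ∈ chartDomain e S := ⟨e.map_source hze, by
    change e.symm (e z) ∈ Sᶜ; rw [hez]; exact hzS⟩
  have h5 := gradNorm_sq_eq_invTrace hg hS he hyz
    (by rw [hez]; exact hz.mdifferentiableAt (by simp))
  rw [hez] at h5
  rw [← h5]
  exact Real.sqrt_sq (Real.sqrt_nonneg _)

end Gradient

/-! ### The algebra of the Bochner argument -/

section Core

theorem hasDerivAt_ray {E V : Type*} [NormedAddCommGroup E] [NormedSpace ℝ E]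
    [NormedAddCommGroup V] [NormedSpace ℝ V] {f : E → V} (hf : ContDiffAt ℝ 2 f 0) (e : E) :
    (∀ᶠ s : ℝ in 𝓝 0, HasDerivAt (fun s : ℝ => f (s • e)) (fderiv ℝ f (s • e) e) s) ∧
    HasDerivAt (fun s : ℝ => fderiv ℝ f (s • e) e) (fderiv ℝ (fderiv ℝ f) 0 e e) 0 := by
  have hray : ∀ s : ℝ, HasDerivAt (fun s : ℝ => s • e) e s := fun s => by
    simpa using (hasDerivAt_id s).smul_const e
  have hray0 : Tendsto (fun s : ℝ => s • e) (𝓝 0) (𝓝 0) := by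
    simpa using (hray 0).continuousAt.tendsto
  have hf1 : ContDiffAt ℝ 1 (fderiv ℝ f) 0 := hf.fderiv_right (by norm_num)
  constructor
  · filter_upwards [hray0.eventually (hf.eventually (by simp))] with s hs
    exact (hs.differentiableAt (by simp)).hasFDerivAt.comp_hasDerivAt s (hray s)
  · have h1 : HasFDerivAt (fderiv ℝ f) (fderiv ℝ (fderiv ℝ f) 0) ((0 : ℝ) • e) := by
      rw [zero_smul]
      exact (hf1.differentiableAt (by simp)).hasFDerivAt
    have h2 : HasDerivAt (fun s : ℝ => fderiv ℝ f (s • e)) (fderiv ℝ (fderiv ℝ f) 0 e) 0 :=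
      h1.comp_hasDerivAt 0 (hray 0)
    simpa using h2.clm_apply (hasDerivAt_const 0 e)

variable {n : ℕ} {G : Euc n → Form n} {U : Set (Euc n)}

theorem IsOrthoFrame.trace_comp {B : Form n} (hB : ∀ a b, B a b = inner ℝ a b)
    {E : Fin n → Euc n} (hE : IsOrthoFrame B E) {V : Type*} [NormedAddCommGroup V]
    [NormedSpace ℝ V] (A : Euc n →L[ℝ] Euc n →L[ℝ] V) (l : V →L[ℝ] ℝ) :
    ∑ i, l (A (E i) (E i)) = ∑ i, l (A (stdVec i) (stdVec i)) :=
  hE.trace_form hB ((ContinuousLinearMap.compL ℝ (Euc n) V ℝ l).comp A)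

/-- The vector field dual to a bilinear form. -/
def sharp (T : Form n) : Euc n →L[ℝ] Euc n :=
  ∑ j, (T.flip (stdVec j)).smulRight (stdVec j)

theorem inner_sharp (T : Form n) (a c : Euc n) : inner ℝ (sharp T a) c = T a c := by
  conv_rhs => enter [2]; rw [sum_single c]
  simp [sharp, sum_apply, EuclideanSpace.inner_single_left, sum_inner, inner_smul_left, mul_comm]

theorem sharp_apply (T : Form n) (a : Euc n) (j : Fin n) : sharp T a j = T a (stdVec j) := by
  rw [← inner_sharp]
  simp [EuclideanSpace.inner_single_right]

/-- The algebraic part of the Bochner argument: the sum of the second derivatives of the lower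
barrier of `‖∇ v‖ ^ 2` along an orthonormal frame. -/
theorem sum_second_jet_ge (hn : 2 ≤ n) {T : Form n} {b : Euc n} (hb : b ≠ 0)
    {F : Fin n → Euc n} {B : Form n} (hB : ∀ a b, B a b = inner ℝ a b) (hF : IsOrthoFrame B F)
    (hT : ∀ a c, T a c = T c a) {m k c κ ric : ℝ}
    (htr : ∑ i, T (stdVec i) (stdVec i) = k - ‖b‖ ^ 2)
    (hm : m = 2 * (c * ‖b‖ ^ 2 - 2 * T b b) + 2 * ric) (hric : κ * ‖b‖ ^ 2 ≤ ric) :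
    ∃ t : ℝ, t ^ 2 * ‖b‖ ^ 2 ≤ (∑ i, (2 * T (F i) b) ^ 2) / 4 ∧
      (‖b‖ ^ 2) ^ 2 / (n - 1) - 2 * (n - 2) / (n - 1) * (t * ‖b‖ ^ 2)
        + (κ - |c - 2 / (n - 1) * k|) * ‖b‖ ^ 2
      ≤ (m + 2 * ∑ i, ‖sharp T (F i)‖ ^ 2) / 2 := by
  have hn1 : (0 : ℝ) < n - 1 := by
    have : (2 : ℝ) ≤ n := by exact_mod_cast hn
    linarith
  have hb0 : 0 < ‖b‖ := norm_pos_iff.2 hb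
  have hnb : ∑ i, b i ^ 2 = ‖b‖ ^ 2 := by
    rw [EuclideanSpace.norm_sq_eq]
    simp
  -- The Hessian of v in the unit direction of ∇v. Half the gradient of f is the Hessian applied to
  -- b, so Cauchy–Schwarz bounds t by it.
  refine ⟨T b b / ‖b‖ ^ 2, ?_, ?_⟩
  · have h1 := hF.norm_sq hB (sharp T b)
    simp only [inner_sharp] at h1
    have h2 : ∑ i, (2 * T (F i) b) ^ 2 = 4 * ‖sharp T b‖ ^ 2 := by
      rw [← h1, Finset.mul_sum]
      exact Finset.sum_congr rfl fun i _ => by rw [hT (F i) b]; ring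
    have h3 := abs_real_inner_le_norm (sharp T b) b
    rw [inner_sharp] at h3
    rw [h2, div_pow, div_mul_eq_mul_div, div_le_iff₀ (by positivity)]
    have h4 := pow_le_pow_left₀ (abs_nonneg (T b b)) h3 2
    rw [sq_abs] at h4
    have h5 : 4 * ‖sharp T b‖ ^ 2 / 4 * (‖b‖ ^ 2) ^ 2 = (‖sharp T b‖ * ‖b‖) ^ 2 * ‖b‖ ^ 2 := by
      ring
    rw [h5]
    exact mul_le_mul_of_nonneg_right h4 (by positivity)
  · set t := T b b / ‖b‖ ^ 2 with ht
    have htb : T b b = t * ‖b‖ ^ 2 := by rw [ht]; field_simp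
    have h1 : ∑ i, ‖sharp T (F i)‖ ^ 2 = ∑ i, ∑ j, T (stdVec i) (stdVec j) ^ 2 := by
      have h2 := hF.trace_form hB ((innerSL ℝ : Form n).bilinearComp (sharp T) (sharp T))
      simp only [ContinuousLinearMap.bilinearComp_apply, innerSL_apply_apply,
        real_inner_self_eq_norm_sq] at h2
      rw [h2]
      refine Finset.sum_congr rfl fun i _ => ?_
      rw [EuclideanSpace.norm_sq_eq]
      simp [sharp_apply]
    have h2 : ∑ i, (b i / ‖b‖) ^ 2 = 1 := by
      simp only [div_pow, ← Finset.sum_div, hnb]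
      exact div_self (by positivity)
    have h3 : ∑ i, ∑ j, T (stdVec i) (stdVec j) * (b i / ‖b‖) * (b j / ‖b‖) = t := by
      rw [ht, form_eq_sum T b b, Finset.sum_div]
      refine Finset.sum_congr rfl fun i _ => ?_
      rw [Finset.sum_div]
      refine Finset.sum_congr rfl fun j _ => ?_
      field_simp
    have h4 := sum_sq_ge hn h2 h3 htr
    rw [h1, hm, htb]
    set f := ‖b‖ ^ 2 with hf
    have hf0 : 0 ≤ f := by positivity
    -- The two sides differ by t² + (k - t)²/(n - 1), which is dropped; no condition on k is needed.
    have h5 : t ^ 2 + (k - f - t) ^ 2 / (n - 1) ≥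
        f ^ 2 / (n - 1) - 2 / (n - 1) * k * f + 2 / (n - 1) * (t * f) := by
      have h6 : t ^ 2 + (k - f - t) ^ 2 / (n - 1) - (f ^ 2 / (n - 1) - 2 / (n - 1) * k * f
          + 2 / (n - 1) * (t * f)) = t ^ 2 + (k - t) ^ 2 / (n - 1) := by
        field_simp
        ring
      have h7 : 0 ≤ t ^ 2 + (k - t) ^ 2 / (n - 1) := by positivity
      linarith
    have h8 : (c - 2 / (n - 1) * k) * f ≥ -|c - 2 / (n - 1) * k| * f :=
      mul_le_mul_of_nonneg_right (neg_abs_le _) hf0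
    have h9 : 2 * ((n : ℝ) - 2) / (n - 1) * (t * f) = 2 * (t * f) - 2 / (n - 1) * (t * f) := by
      field_simp
      ring
    rw [h9]
    nlinarith

end Core

/-! ### The lower barrier for (|∇u|/u)² -/

section Barrier

variable {n : ℕ} {M : Type*} [TopologicalSpace M] [ChartedSpace (EuclideanSpace ℝ (Fin n)) M]
  [IsManifold (𝓡 n) ∞ M] {g : BilinField n M} {S : Set M} {u : M → ℝ} {K : ℝ → ℝ} {x : M}
  {ν : OpenPartialHomeomorph M (EuclideanSpace ℝ (Fin n))} {κ : ℝ}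

/-- A lower barrier of `(|∇ u| / u) ^ 2` with the differential inequality that follows from
Bochner's formula. -/
theorem exists_gradient_barrier (hn : 2 ≤ n) (hg : IsUniformlyEuclidean g S) (hS : IsClosed S)
    (hx : x ∉ S) (hu : ContMDiffAt (𝓡 n) 𝓘(ℝ, ℝ) (3 : ℕ) u x) (hpos : 0 < u x)
    (hK : DifferentiableAt ℝ K (u x)) (hlap : ∀ᶠ z in 𝓝 x, LaplacianEqAt g u (K (u z)) z)
    (hric : RicciGeAt g κ x) (hν : IsNormalChart g x ν) {F : Fin n → Euc n}
    (hF : IsOrthoFrame (metricForm g ν 0) F) {f : ℝ} (hf : f = (gradNorm g u x / u x) ^ 2)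
    (hf0 : f ≠ 0) :
    ∃ (φ : Fin n → ℝ → ℝ) (p q : Fin n → ℝ) (t : ℝ),
      (∀ i, HasTwoJet (φ i) f (p i) (q i)) ∧
      (∀ i, ∀ᶠ s in 𝓝 0, φ i s ≤
        (gradNorm g u (ν.symm (s • F i)) / u (ν.symm (s • F i))) ^ 2) ∧
      t ^ 2 * f ≤ (∑ i, p i ^ 2) / 4 ∧
      f ^ 2 / (n - 1) - 2 * (n - 2) / (n - 1) * (t * f)
        + (κ - |deriv K (u x) - (n + 1) / (n - 1) * (K (u x) / u x)|) * f ≤ (∑ i, q i) / 2 := by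
  have hn1 : (0 : ℝ) < n - 1 := by
    have : (2 : ℝ) ≤ n := by exact_mod_cast hn
    linarith
  have hG := hg.isMetricOn hS hν.mem
  have h0 := hν.zero_mem_chartDomain hx
  set G := metricForm g ν with hGdef
  set w : Euc n → ℝ := fun z => u (ν.symm z) with hw_def
  set v : Euc n → ℝ := fun z => Real.log (w z) with hv_def
  have hw0 : w 0 = u x := by rw [hw_def]; simp only [hν.symm_zero]
  have hwpos : 0 < w 0 := by rw [hw0]; exact hpos
  have hw : ContDiffAt ℝ 3 w 0 := contDiffAt_comp_chart_symm hν.mem h0.1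
    (by rw [hν.symm_zero]; exact hu)
  have hv : ContDiffAt ℝ 3 v 0 := hw.log hwpos.ne'
  have hsymm : Tendsto ν.symm (𝓝 0) (𝓝 x) := by
    have := (ν.symm.continuousAt (x := (0 : Euc n)) h0.1).tendsto
    rwa [hν.symm_zero] at this
  have hu1 : ∀ᶠ z in 𝓝 x, ContMDiffAt (𝓡 n) 𝓘(ℝ, ℝ) (3 : ℕ) u z :=
    contMDiffAt_iff_contMDiffAt_nhds (by simp) |>.1 hu
  have hnear : ∀ᶠ y in 𝓝 (0 : Euc n), y ∈ chartDomain ν S ∧ 0 < w y ∧ ContDiffAt ℝ 3 w y ∧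
      MDifferentiableAt (𝓡 n) 𝓘(ℝ, ℝ) u (ν.symm y) ∧
      LaplacianEqAt g u (K (u (ν.symm y))) (ν.symm y) := by
    filter_upwards [hG.isOpen.mem_nhds h0, hw.continuousAt.eventually_const_lt hwpos,
      hw.eventually (by simp), hsymm.eventually hu1, hsymm.eventually hlap] with y h1 h2 h3 h4 h5
    exact ⟨h1, h2, h3, h4.mdifferentiableAt (by simp), h5⟩
  obtain ⟨a, ha, hfa⟩ := exists_gradient_coord (u := u) hg hν.mem h0
    hnear.self_of_nhds.2.2.2.1
  have hDw := ContDiffAt.hasFDerivAt_of_log (hw.of_le (by norm_num)) hwpos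
  set b : Euc n := (w 0)⁻¹ • a with hb_def
  have hb : ∀ c, fderiv ℝ v 0 c = inner ℝ b c := by
    intro c
    have h1 := ha c
    have h2 : fderiv ℝ (fun z => u (ν.symm z)) 0 = _ := hDw.fderiv
    rw [h2, hν.inner, smul_apply, smul_eq_mul] at h1
    rw [hb_def, inner_smul_left, h1]
    change _ = (w 0)⁻¹ * (w 0 * fderiv ℝ v 0 c)
    field_simp
  have hbf : ‖b‖ ^ 2 = f := by
    rw [hν.inner, real_inner_self_eq_norm_sq, hν.symm_zero] at hfa
    rw [hb_def, norm_smul, mul_pow, hf, div_pow, hfa, hw0, norm_inv, Real.norm_eq_abs,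
      inv_pow, sq_abs]
    field_simp
  have hb0 : b ≠ 0 := by
    rintro h
    rw [h] at hbf
    exact hf0 (by rw [← hbf]; simp)
  have hpde : ∀ᶠ y in 𝓝 0, invTrace G y (fun i j =>
      fderiv ℝ (fderiv ℝ v) y (stdVec i) (stdVec j)
        + fderiv ℝ v y (stdVec i) * fderiv ℝ v y (stdVec j)
        - fderiv ℝ v y (chr G y (stdVec i) (stdVec j))) = K (w y) / w y := by
    filter_upwards [hnear] with y hy
    have h1 := laplacianCoord_log G (hy.2.2.1.of_le (by norm_num)) hy.2.1
    rw [h1]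
    have h2 := hy.2.2.2.2 ν hν.mem (ν.map_target hy.1.1)
    rw [ν.right_inv hy.1.1, metricInChart_eq_matOf] at h2
    congr 1
  have hk := hasFDerivAt_div_of_log (hw.of_le (by norm_num)) hwpos
    (K := K) (by rw [hw0]; exact hK)
  obtain ⟨htr, hboch⟩ := hG.bochner h0 hν.inner hν.fderiv_eq hv hb hpde hk
  set T : Form n := fderiv ℝ (fderiv ℝ v) 0 with hT_def
  have hTsymm : ∀ a c, T a c = T c a := fun a c =>
    ((hv.of_le (m := 2) (by norm_num)).isSymmSndFDerivAt (by simp)).eq a c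
  have hricb : κ * ‖b‖ ^ 2 ≤ ∑ i, ∑ j, ricciCoord (matOf G) i j 0 * b i * b j := by
    have h1 := hric.form_le hν.mem hν.mem_source b
    rw [hν.map_eq, hν.inner, real_inner_self_eq_norm_sq] at h1
    exact h1
  obtain ⟨t, ht1, ht2⟩ := sum_second_jet_ge hn hb0 hν.inner hF hTsymm htr hboch hricb
  have hv1 : ContDiffAt ℝ 2 (fderiv ℝ v) 0 := hv.fderiv_right (by norm_num)
  have hG2 : ContDiffAt ℝ 2 G 0 := (hG.contDiffAt h0).of_le
    (by simpa using WithTop.coe_le_coe.2 (le_top : (2 : ℕ∞) ≤ ⊤))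
  -- The slope `sharp T (F i)` is the derivative of ∇v along the ray, so the affine field is the
  -- first-order Taylor polynomial of the gradient and the barrier has the full second derivative.
  have hjet := fun i => hasTwoJet_lower_barrier (hasDerivAt_ray hv1 (F i)).1
    (hasDerivAt_ray hv1 (F i)).2 (hasDerivAt_ray hG2 (F i)).1 (hasDerivAt_ray hG2 (F i)).2
    (by rw [zero_smul, hν.fderiv_eq]; rfl) b (sharp T (F i))
  simp only [zero_smul] at hjet
  refine ⟨fun i s => 2 * fderiv ℝ v (s • F i) (b + s • sharp T (F i))
    - G (s • F i) (b + s • sharp T (F i)) (b + s • sharp T (F i)), fun i => 2 * T (F i) b,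
    fun i => 2 * fderiv ℝ (fderiv ℝ (fderiv ℝ v)) 0 (F i) (F i) b
      - fderiv ℝ (fderiv ℝ G) 0 (F i) (F i) b b + 2 * ‖sharp T (F i)‖ ^ 2, t, fun i => ?_,
    fun i => ?_, ?_, ?_⟩
  · have h1 := hjet i
    have e1 : 2 * fderiv ℝ v 0 b - G 0 b b = f := by
      rw [hb, hν.inner, real_inner_self_eq_norm_sq, hbf]; ring
    have e2 : 2 * (T (F i) b + fderiv ℝ v 0 (sharp T (F i)))
        - (G 0 (sharp T (F i)) b + G 0 b (sharp T (F i))) = 2 * T (F i) b := by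
      rw [hb, hν.inner, hν.inner, real_inner_comm b]; ring
    have e3 : T (F i) (sharp T (F i)) = ‖sharp T (F i)‖ ^ 2 := by
      rw [← inner_sharp, real_inner_self_eq_norm_sq]
    rw [e1, e2, e3, hν.inner, real_inner_self_eq_norm_sq] at h1
    convert h1 using 1
    ring
  · have hray0 : Tendsto (fun s : ℝ => s • F i) (𝓝 0) (𝓝 0) := by
      have : ContinuousAt (fun s : ℝ => s • F i) 0 := by fun_prop
      simpa [ContinuousAt] using this
    filter_upwards [hray0.eventually hnear] with s hs
    set y := s • F i
    set Y := b + s • sharp T (F i)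
    have h1 := gradient_sq_ge hg hν.mem hs.1 hs.2.2.2.1 (w y • Y)
    have h2 : fderiv ℝ (fun z => u (ν.symm z)) y = _ :=
      (ContDiffAt.hasFDerivAt_of_log (hs.2.2.1.of_le (by norm_num)) hs.2.1).fderiv
    rw [h2] at h1
    simp only [map_smul, smul_apply, smul_eq_mul] at h1
    have hwy : 0 < u (ν.symm y) := hs.2.1
    rw [div_pow, le_div_iff₀ (by positivity)]
    change (2 * fderiv ℝ v y Y - G y Y Y) * (w y) ^ 2 ≤ _
    refine le_trans (le_of_eq ?_) h1
    change _ = 2 * (w y * (w y * fderiv ℝ v y Y)) - w y * (w y * G y Y Y)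
    ring
  · rw [← hbf]; exact ht1
  · have e1 := hF.trace_comp hν.inner (fderiv ℝ (fderiv ℝ (fderiv ℝ v)) 0)
      (ContinuousLinearMap.apply ℝ ℝ b)
    have e2 := hF.trace_comp hν.inner (fderiv ℝ (fderiv ℝ G) 0)
      ((ContinuousLinearMap.apply ℝ ℝ b).comp (ContinuousLinearMap.apply ℝ (Euc n →L[ℝ] ℝ) b))
    simp only [ContinuousLinearMap.apply_apply, ContinuousLinearMap.comp_apply] at e1 e2
    rw [hbf] at ht2
    rw [hw0] at ht2
    -- The coefficient of the theorem arises as 1 + 2/(n - 1) = (n + 1)/(n - 1): one part from the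
    -- derivative of K(u)/u, the other from the trace of the Hessian.
    have e3 : deriv K (u x) - K (u x) / u x - 2 / (n - 1) * (K (u x) / u x) =
        deriv K (u x) - (n + 1) / (n - 1) * (K (u x) / u x) := by
      field_simp
      ring
    rw [e3] at ht2
    refine ht2.trans (le_of_eq ?_)
    simp only [Finset.sum_add_distrib, Finset.sum_sub_distrib, ← Finset.mul_sum, e1, e2]

end Barrier

/-! ### The inequalities at the maximum and the constants -/

section Cutoff

theorem HasTwoJet.cutoff {T : ℝ → ℝ} {ρ a b : ℝ} (h : HasTwoJet T ρ a b) (r : ℝ) :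
    HasTwoJet (fun s => 1 - 4 * (T s / r - 1) ^ 2) (1 - 4 * (ρ / r - 1) ^ 2)
      (-(8 / r * (ρ / r - 1) * a)) (-(8 / r ^ 2 * a ^ 2) - 8 / r * (ρ / r - 1) * b) := by
  obtain ⟨h0, T', h1, h2, h3⟩ := h
  refine ⟨by simp only [h0], fun s => -(8 / r * (T s / r - 1) * T' s), ?_, by simp only [h0, h2], ?_⟩
  · filter_upwards [h1] with s hs
    refine (((((hs.div_const r).sub_const 1).pow 2).const_mul 4).const_sub 1).congr_deriv ?_
    simp
    ring
  · refine ((((h1.self_of_nhds.div_const r).sub_const 1).const_mul (8 / r)).mul h3).neg.congr_deriv ?_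
    rw [h0, h2]
    ring

/-- The first and second order conditions at a local maximum of `z ^ 2 * φ`. -/
theorem HasTwoJet.of_localMax_sq_mul {z φ : ℝ → ℝ} {Z Z1 Z2 f p q : ℝ} (hz : HasTwoJet z Z Z1 Z2)
    (hφ : HasTwoJet φ f p q) (hZ : 0 < Z)
    (hmax : ∀ᶠ s in 𝓝 0, z s ^ 2 * φ s ≤ Z ^ 2 * f) :
    p * Z = -(2 * Z1 * f) ∧ Z ^ 2 * q ≤ f * (6 * Z1 ^ 2 - 2 * Z * Z2) := by
  have h1 := ((hz.mul hz).mul hφ).second_nonpos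
    (by filter_upwards [hmax] with s hs; rwa [← sq, ← sq])
  have h2 : p * Z = -(2 * Z1 * f) := by
    have h3 : Z * (p * Z + 2 * Z1 * f) = 0 := by linarith [h1.1]
    rcases mul_eq_zero.1 h3 with h | h
    · exact absurd h hZ.ne'
    · linarith
  refine ⟨h2, ?_⟩
  -- The first-order condition removes p from the mixed term 2(Z²)'p; together with (Z²)'' = 2Z1² +
  -- 2Z Z2 this leaves 6Z1² - 2Z Z2.
  have h4 : 2 * ((Z1 * Z + Z * Z1) * p) = -(8 * Z1 ^ 2 * f) := by
    linear_combination (4 * Z1) * h2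
  nlinarith [h1.2]

theorem le_add_of_sq_le {Y a m : ℝ} (hm : 0 ≤ m) (ha : 0 ≤ a) (h : Y ^ 2 ≤ a * Y + m ^ 2) :
    Y ≤ a + m := by
  by_contra! hlt
  nlinarith [mul_nonneg hm ha]

/-- The quadratic inequality for `Z * √f` at the maximum of `Z ^ 2 * f`. -/
theorem sq_le_of_max {n : ℕ} (hn : 2 ≤ n) {f Z H d D A B t : ℝ} {p q Z1 Z2 : Fin n → ℝ}
    (hf : 0 < f) (hZ : 0 < Z) (hZ' : Z ≤ 1) (hA : 0 ≤ A) (hB : 0 ≤ B)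
    (hp : ∀ i, p i * Z = -(2 * Z1 i * f))
    (hq : ∀ i, Z ^ 2 * q i ≤ f * (6 * Z1 i ^ 2 - 2 * Z * Z2 i))
    (ht : t ^ 2 * f ≤ (∑ i, p i ^ 2) / 4) (hd : (n - 1) * d ≤ D ^ 2)
    (hmain : f ^ 2 / (n - 1) - 2 * (n - 2) / (n - 1) * (t * f)
        + (-((n - 1) * H ^ 2) - d) * f ≤ (∑ i, q i) / 2)
    (hZ1 : ∑ i, Z1 i ^ 2 ≤ A ^ 2) (hZ2 : -B ≤ ∑ i, Z2 i) :
    (Z * √f) ^ 2 ≤ 2 * (n - 2) * A * (Z * √f)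
      + ((n - 1) ^ 2 * H ^ 2 + D ^ 2 + (n - 1) * (3 * A ^ 2 + B)) := by
  have hn2 : (0 : ℝ) ≤ n - 2 := by
    have : (2 : ℝ) ≤ n := by exact_mod_cast hn
    linarith
  have hn1 : (0 : ℝ) < n - 1 := by linarith
  have hsf : √f ^ 2 = f := Real.sq_sqrt hf.le
  have hsf0 : 0 < √f := Real.sqrt_pos.2 hf
  have h1 : (∑ i, p i ^ 2) * Z ^ 2 = 4 * f ^ 2 * ∑ i, Z1 i ^ 2 := by
    rw [Finset.sum_mul, Finset.mul_sum]
    refine Finset.sum_congr rfl fun i _ => ?_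
    rw [← mul_pow, hp]
    ring
  -- The bound on t by the gradient of f and the first-order condition p Z = -2 Z1 f absorb the
  -- mixed term.
  have h2 : Z * t ≤ A * √f := by
    refine le_of_sq_le_sq ?_ (by positivity)
    have h3 : (t ^ 2 * f) * Z ^ 2 ≤ f ^ 2 * A ^ 2 := by
      calc (t ^ 2 * f) * Z ^ 2 ≤ (∑ i, p i ^ 2) / 4 * Z ^ 2 := by gcongr
        _ = f ^ 2 * ∑ i, Z1 i ^ 2 := by linear_combination h1 / 4
        _ ≤ f ^ 2 * A ^ 2 := by gcongr
    have h4 : f * (Z * t) ^ 2 ≤ f * (A * √f) ^ 2 := by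
      rw [mul_pow A, hsf]
      linarith
    exact le_of_mul_le_mul_left h4 hf
  have h5 : Z ^ 2 * ∑ i, q i ≤ f * (6 * A ^ 2 + 2 * B) := by
    calc Z ^ 2 * ∑ i, q i = ∑ i, Z ^ 2 * q i := Finset.mul_sum _ _ _
      _ ≤ ∑ i, f * (6 * Z1 i ^ 2 - 2 * Z * Z2 i) := Finset.sum_le_sum fun i _ => hq i
      _ = f * (6 * ∑ i, Z1 i ^ 2 - 2 * Z * ∑ i, Z2 i) := by
        rw [← Finset.mul_sum, Finset.sum_sub_distrib, ← Finset.mul_sum, ← Finset.mul_sum]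
      _ ≤ f * (6 * A ^ 2 + 2 * B) := by
        refine mul_le_mul_of_nonneg_left ?_ hf.le
        nlinarith
  have h6 : f ^ 2 - 2 * (n - 2) * (t * f) - (n - 1) * ((n - 1) * H ^ 2 + d) * f
      ≤ (n - 1) * ((∑ i, q i) / 2) := by
    have h7 := mul_le_mul_of_nonneg_left hmain hn1.le
    refine le_trans (le_of_eq ?_) h7
    field_simp
    ring
  have h8 : Z ^ 2 * (f ^ 2 - 2 * (n - 2) * (t * f) - (n - 1) * ((n - 1) * H ^ 2 + d) * f)
      ≤ f * ((n - 1) * (3 * A ^ 2 + B)) := by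
    have h9 := mul_le_mul_of_nonneg_left h6 (sq_nonneg Z)
    have h10 := mul_le_mul_of_nonneg_left h5 hn1.le
    linarith
  have h11 : Z ^ 2 * (f - 2 * (n - 2) * t - (n - 1) * ((n - 1) * H ^ 2 + d))
      ≤ (n - 1) * (3 * A ^ 2 + B) := by
    refine le_of_mul_le_mul_left (le_trans (le_of_eq ?_) h8) hf
    ring
  have h12 : Z ^ 2 * ((n - 1) * ((n - 1) * H ^ 2 + d)) ≤ (n - 1) ^ 2 * H ^ 2 + D ^ 2 := by
    have h13 : (n - 1) * ((n - 1) * H ^ 2 + d) ≤ (n - 1) ^ 2 * H ^ 2 + D ^ 2 := by linarith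
    have h14 : Z ^ 2 ≤ 1 := pow_le_one₀ hZ.le hZ'
    have h15 : 0 ≤ (n - 1 : ℝ) ^ 2 * H ^ 2 + D ^ 2 := by positivity
    calc _ ≤ Z ^ 2 * ((n - 1) ^ 2 * H ^ 2 + D ^ 2) := by gcongr
      _ ≤ 1 * ((n - 1) ^ 2 * H ^ 2 + D ^ 2) := by gcongr
      _ = _ := one_mul _
  have h16 : (n - 2) * (Z * (Z * t)) ≤ (n - 2) * (Z * (A * √f)) := by gcongr
  rw [mul_pow, hsf]
  linarith

/-- The constants of the gradient estimate. -/
theorem le_of_sq_le_const {n : ℕ} (hn : 2 ≤ n) {Y H D r : ℝ} (hr : 0 < r) (hH : 0 ≤ H)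
    (hD : 0 ≤ D)
    (h : Y ^ 2 ≤ 2 * (n - 2) * (4 / r) * Y + ((n - 1) ^ 2 * H ^ 2 + D ^ 2
      + (n - 1) * (3 * (4 / r) ^ 2 + (8 / r ^ 2 + 4 / r * (2 * n / r + 2 * n * H))))) :
    Y ≤ (n - 1) * H + (8 * (n - 2) + √((n - 1) * (56 + 8 * n))) * r⁻¹
      + √(8 * n * (n - 1) * H) * (√r)⁻¹ + D := by
  have hn2 : (0 : ℝ) ≤ n - 2 := by
    have : (2 : ℝ) ≤ n := by exact_mod_cast hn
    linarith
  have hn1 : (0 : ℝ) < n - 1 := by linarith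
  have hn0 : (0 : ℝ) ≤ n := by linarith
  set c := √((n - 1) * (56 + 8 * n)) with hc_def
  set c' := √(8 * n * (n - 1) * H) with hc'_def
  have hc : c ^ 2 = (n - 1) * (56 + 8 * n) := Real.sq_sqrt (by positivity)
  have hc' : c' ^ 2 = 8 * n * (n - 1) * H := Real.sq_sqrt (by positivity)
  have hc0 : 0 ≤ c := Real.sqrt_nonneg _
  have hc0' : 0 ≤ c' := Real.sqrt_nonneg _
  have hr2 : (√r)⁻¹ ^ 2 = r⁻¹ := by rw [inv_pow, Real.sq_sqrt hr.le]
  have hs0 : 0 < (√r)⁻¹ := by positivity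
  -- All four terms are nonnegative, so m² dominates the sum of their squares. The constants are
  -- read off from 3·16 + 8 + 8n = 56 + 8n for r⁻² and from 8nH for r⁻¹, each times n - 1.
  set m := (n - 1) * H + c * r⁻¹ + c' * (√r)⁻¹ + D with hm_def
  have h1 : 0 ≤ (n - 1) * H := by positivity
  have h2 : 0 ≤ c * r⁻¹ := by positivity
  have h3 : 0 ≤ c' * (√r)⁻¹ := by positivity
  have hm0 : 0 ≤ m := by positivity
  have hm : (n - 1) ^ 2 * H ^ 2 + D ^ 2
      + (n - 1) * (3 * (4 / r) ^ 2 + (8 / r ^ 2 + 4 / r * (2 * n / r + 2 * n * H))) ≤ m ^ 2 := by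
    have h4 : ((n - 1) * H) ^ 2 + (c * r⁻¹) ^ 2 + (c' * (√r)⁻¹) ^ 2 + D ^ 2 ≤ m ^ 2 := by
      have e1 := mul_nonneg h1 h2
      have e2 := mul_nonneg h1 h3
      have e3 := mul_nonneg h1 hD
      have e4 := mul_nonneg h2 h3
      have e5 := mul_nonneg h2 hD
      have e6 := mul_nonneg h3 hD
      rw [hm_def]
      linarith
    refine le_trans (le_of_eq ?_) h4
    rw [mul_pow c, mul_pow c', hc, hc', hr2]
    field_simp
    ring
  have h5 := le_add_of_sq_le (Y := Y) (a := 2 * (n - 2) * (4 / r)) hm0 (by positivity)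
    (h.trans (by linarith))
  refine h5.trans (le_of_eq ?_)
  rw [hm_def]
  ring

end Cutoff

/-! ### The radial cutoff -/

section RadialCutoff

/-- The radial cutoff, equal to `1` on `[0, r]` and to `0` at `3 r / 2`. -/
def radialCutoff (r t : ℝ) : ℝ := 1 - 4 * (max (t / r - 1) 0) ^ 2

theorem continuous_radialCutoff (r : ℝ) : Continuous (radialCutoff r) := by
  unfold radialCutoff
  fun_prop

theorem radialCutoff_eq_one {r t : ℝ} (hr : 0 < r) (ht : t ≤ r) : radialCutoff r t = 1 := by
  have h1 : t / r - 1 ≤ 0 := by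
    have := (div_le_one hr).2 ht
    linarith
  simp [radialCutoff, max_eq_right h1]

theorem radialCutoff_eq {r t : ℝ} (hr : 0 < r) (ht : r ≤ t) :
    radialCutoff r t = 1 - 4 * (t / r - 1) ^ 2 := by
  have h1 : 0 ≤ t / r - 1 := by
    have := (one_le_div hr).2 ht
    linarith
  rw [radialCutoff, max_eq_left h1]

/-- The cutoff is nonincreasing, so an upper barrier for the distance becomes a lower barrier for
it. The polynomial form may replace the truncated one even for T < r, where it only makes the left
side smaller. -/
theorem le_radialCutoff {r t T : ℝ} (hr : 0 < r) (ht : t ≤ T) :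
    1 - 4 * (T / r - 1) ^ 2 ≤ radialCutoff r t := by
  have h1 : (max (t / r - 1) 0) ^ 2 ≤ (T / r - 1) ^ 2 := by
    rcases le_total (t / r - 1) 0 with h | h
    · rw [max_eq_right h]
      nlinarith [sq_nonneg (T / r - 1)]
    · rw [max_eq_left h]
      have h2 : t / r ≤ T / r := by gcongr
      exact pow_le_pow_left₀ h (by linarith) 2
  rw [radialCutoff]
  linarith

theorem radialCutoff_nonneg {r t : ℝ} (hr : 0 < r) (ht : t ≤ 3 * r / 2) :
    0 ≤ radialCutoff r t := by
  refine le_trans (le_of_eq ?_) (le_radialCutoff hr ht)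
  field_simp
  ring

theorem radialCutoff_le_one (r t : ℝ) : radialCutoff r t ≤ 1 := by
  rw [radialCutoff]
  nlinarith [sq_nonneg (max (t / r - 1) 0)]

end RadialCutoff

/-! ### The maximum principle and the gradient estimate -/

section Maximum

variable {n : ℕ} {M : Type*} [TopologicalSpace M] [T2Space M] [CompactSpace M]
  [ChartedSpace (EuclideanSpace ℝ (Fin n)) M]
  [IsManifold (𝓡 n) ∞ M] {g : BilinField n M} {S : Set M} {u : M → ℝ} {K : ℝ → ℝ}

/-- The estimate at a maximum point of the cut off function `(|∇ u| / u) ^ 2`. -/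
theorem estimate_at_max (hn : 2 ≤ n) (hg : IsUniformlyEuclidean g S) (hS : IsClosed S)
    (hemb : IsEmbeddedSubmanifold n S) {q : M} {r H D ρ f : ℝ} (hr : 0 < r) (hH : 0 ≤ H)
    (hsub : closedBall g S q (2 * r) ⊆ Sᶜ)
    (hric : ∀ x ∈ closedBall g S q (2 * r), RicciGeAt g (-((n - 1 : ℝ) * H ^ 2)) x) {x : M}
    (hx : dist g S q x = ENNReal.ofReal ρ) (hρ : ρ < 3 * r / 2)
    (hu : ContMDiffAt (𝓡 n) 𝓘(ℝ, ℝ) (3 : ℕ) u x) (hpos : 0 < u x)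
    (hK : DifferentiableAt ℝ K (u x)) (hlap : ∀ᶠ z in 𝓝 x, LaplacianEqAt g u (K (u z)) z)
    (hD : (n - 1) * |deriv K (u x) - (n + 1) / (n - 1) * (K (u x) / u x)| ≤ D ^ 2)
    (hf : f = (gradNorm g u x / u x) ^ 2) (hf0 : 0 < f)
    (hmax : ∀ᶠ z in 𝓝 x, radialCutoff r (dist g S q z).toReal ^ 2 * (gradNorm g u z / u z) ^ 2
      ≤ radialCutoff r ρ ^ 2 * f) :
    (radialCutoff r ρ * √f) ^ 2 ≤ 2 * (n - 2) * (4 / r) * (radialCutoff r ρ * √f)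
      + ((n - 1) ^ 2 * H ^ 2 + D ^ 2
      + (n - 1) * (3 * (4 / r) ^ 2 + (8 / r ^ 2 + 4 / r * (2 * n / r + 2 * n * H)))) := by
  have hn2 : (2 : ℝ) ≤ n := by exact_mod_cast hn
  have hn1 : (0 : ℝ) < n - 1 := by linarith
  have hx2 : x ∈ closedBall g S q (2 * r) := by
    change dist g S q x ≤ _
    rw [hx]
    exact ENNReal.ofReal_le_ofReal (by linarith)
  have hxS : x ∉ S := hsub hx2
  obtain ⟨ν, hν⟩ := exists_isNormalChart hg hS hxS
  have hray : ∀ v : Euc n, Tendsto (fun s : ℝ => ν.symm (s • v)) (𝓝 0) (𝓝 x) := by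
    intro v
    have h1 : Tendsto (fun s : ℝ => s • v) (𝓝 0) (𝓝 0) := by
      have : ContinuousAt (fun s : ℝ => s • v) 0 := by fun_prop
      simpa [ContinuousAt] using this
    have h2 := (ν.symm.continuousAt (x := (0 : Euc n)) hν.zero_mem).tendsto
    rw [hν.symm_zero] at h2
    exact h2.comp h1
  have hB0 : 0 ≤ 8 / r ^ 2 + 4 / r * (2 * n / r + 2 * n * H) := by positivity
  -- For ρ < r the cutoff is 1 near x, so no distance barrier is needed; this also covers ρ = 0.
  rcases lt_or_ge ρ r with hρr | hρr
  · rw [radialCutoff_eq_one hr hρr.le] at hmax ⊢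
    have hone : ∀ᶠ z in 𝓝 x, radialCutoff r (dist g S q z).toReal = 1 := by
      have h1 : dist g S q x < ENNReal.ofReal r := by
        rw [hx]; exact (ENNReal.ofReal_lt_ofReal_iff hr).2 hρr
      filter_upwards [mem_nhds_of_dist_lt hg hS hxS h1] with z hz
      exact radialCutoff_eq_one hr (ENNReal.toReal_le_of_le_ofReal hr.le hz.le)
    obtain ⟨φ, p, q', t, hjet, hle, ht, hmain⟩ := exists_gradient_barrier hn hg hS hxS hu hpos hK
      hlap (hric x hx2) hν (isOrthoFrame_stdVec hν.inner) hf hf0.ne'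
    have hpq : ∀ i, p i = 0 ∧ q' i ≤ 0 := by
      intro i
      refine (hjet i).second_nonpos ?_
      filter_upwards [hle i, (hray (stdVec i)).eventually hone,
        (hray (stdVec i)).eventually hmax] with s h1 h2 h3
      rw [h2] at h3
      linarith
    refine sq_le_of_max (p := p) (q := q') (Z1 := fun _ => 0) (Z2 := fun _ => 0) hn hf0 one_pos
      le_rfl (by positivity) hB0 (fun i => by rw [(hpq i).1]; simp)
      (fun i => by simpa using (hpq i).2) ht hD hmain ?_ ?_
    · simp only [ne_eq, OfNat.ofNat_ne_zero, not_false_eq_true, zero_pow, Finset.sum_const_zero]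
      positivity
    · rw [Finset.sum_const_zero]
      linarith
  -- This length balances the two terms of the comparison estimate: n/c = n/r + nH and (n - 1)H²c ≤
  -- nH. It also satisfies c ≤ r ≤ ρ.
  · set c : ℝ := r / (1 + H * r) with hc_def
    have hHr : 0 ≤ H * r := by positivity
    have hc : 0 < c := by positivity
    have hcr : c ≤ r := div_le_self hr.le (by linarith)
    obtain ⟨F, a, B, hF, ha, hBsum, hdist⟩ := exists_distance_barrier hg hS hemb
      (by positivity) hsub (by positivity) hric hx (by linarith) hc (hcr.trans hρr) hν
    obtain ⟨φ, p, q', t, hjet, hle, ht, hmain⟩ := exists_gradient_barrier hn hg hS hxS hu hpos hK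
      hlap (hric x hx2) hν hF hf hf0.ne'
    have hτ0 : 0 ≤ ρ / r - 1 := by
      have := (one_le_div hr).2 hρr
      linarith
    have hτ1 : ρ / r - 1 ≤ 1 / 2 := by
      rw [tsub_le_iff_right, div_le_iff₀ hr]
      linarith
    have hZ : radialCutoff r ρ = 1 - 4 * (ρ / r - 1) ^ 2 := radialCutoff_eq hr hρr
    have hτ2 : ρ / r - 1 < 1 / 2 := by
      rw [sub_lt_iff_lt_add, div_lt_iff₀ hr]
      linarith
    have hZ0 : 0 < radialCutoff r ρ := by
      rw [hZ]
      nlinarith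
    -- The slack η in the barrier is taken to be 1/r; over the frame it adds n/r, the same order as
    -- the terms already present.
    have hT : ∀ i, HasTwoJet (fun s => ρ + s * a i + s ^ 2 / 2 * (B i + 1 / r)) ρ (a i)
        (B i + 1 / r) := fun i => hasTwoJet_quadratic _ _ _
    have hz := fun i => (hT i).cutoff r
    rw [← hZ] at hz
    have hord := fun i => (hz i).of_localMax_sq_mul (hjet i) hZ0 (by
      have h0 : ContinuousAt
          (fun s => 1 - 4 * ((ρ + s * a i + s ^ 2 / 2 * (B i + 1 / r)) / r - 1) ^ 2) 0 := by
        fun_prop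
      have h1 : ∀ᶠ s : ℝ in 𝓝 0,
          0 < 1 - 4 * ((ρ + s * a i + s ^ 2 / 2 * (B i + 1 / r)) / r - 1) ^ 2 := by
        refine h0.eventually_const_lt ?_
        rw [(hz i).1]
        exact hZ0
      have h2 : ∀ᶠ s : ℝ in 𝓝 0, 0 < ρ + s * a i + s ^ 2 / 2 * (B i + 1 / r) := by
        have h3 : ContinuousAt (fun s : ℝ => ρ + s * a i + s ^ 2 / 2 * (B i + 1 / r)) 0 := by
          fun_prop
        refine h3.eventually_const_lt ?_
        rw [(hT i).1]
        linarith
      filter_upwards [hle i, hdist (1 / r) (by positivity), (hray (F i)).eventually hmax, h1, h2]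
        with s g1 g2 g3 g4 g5
      have g6 := ENNReal.toReal_le_of_le_ofReal g5.le (g2 i)
      have g7 := le_radialCutoff hr g6
      refine le_trans ?_ g3
      exact (mul_le_mul_of_nonneg_left g1 (sq_nonneg _)).trans
        (mul_le_mul_of_nonneg_right (pow_le_pow_left₀ g4.le g7 2) (sq_nonneg _)))
    have ha2 : ∑ i, a i ^ 2 ≤ 1 := by
      have h1 : ‖a‖ ^ 2 = ∑ i, a i ^ 2 := by
        rw [EuclideanSpace.norm_sq_eq]; simp
      rw [← h1]
      exact pow_le_one₀ (norm_nonneg _) ha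
    have hBs : ∑ i, (B i + 1 / r) ≤ 2 * n / r + 2 * n * H := by
      have h1 : (n : ℝ) / c = n / r + n * H := by
        rw [hc_def]
        field_simp
      have h2 : (n - 1) * H ^ 2 * c ≤ n * H := by
        have h3 : H * c ≤ 1 := by
          rw [hc_def, ← mul_div_assoc, div_le_one (by positivity)]
          linarith
        have h4 : (n - 1) * H * (H * c) ≤ (n - 1) * H * 1 := by gcongr
        nlinarith
      rw [Finset.sum_add_distrib, Finset.sum_const, Finset.card_univ, Fintype.card_fin,
        nsmul_eq_mul]
      have h5 : (n : ℝ) * (1 / r) = n / r := by ring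
      have h6 : 2 * (n : ℝ) / r = n / r + n / r := by ring
      rw [h5, h6]
      linarith
    refine sq_le_of_max hn hf0 hZ0 (radialCutoff_le_one _ _) (by positivity) hB0
      (fun i => (hord i).1) (fun i => (hord i).2) ht hD hmain ?_ ?_
    · have h1 : ∀ i, (-(8 / r * (ρ / r - 1) * a i)) ^ 2 = (8 / r * (ρ / r - 1)) ^ 2 * a i ^ 2 :=
        fun i => by ring
      simp only [h1, ← Finset.mul_sum]
      have h2 : 8 / r * (ρ / r - 1) ≤ 4 / r := by
        calc 8 / r * (ρ / r - 1) ≤ 8 / r * (1 / 2) := by gcongr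
          _ = 4 / r := by ring
      calc (8 / r * (ρ / r - 1)) ^ 2 * ∑ i, a i ^ 2 ≤ (4 / r) ^ 2 * 1 := by gcongr
        _ = (4 / r) ^ 2 := mul_one _
    · rw [Finset.sum_sub_distrib, Finset.sum_neg_distrib, ← Finset.mul_sum, ← Finset.mul_sum]
      have h2 : 8 / r * (ρ / r - 1) ≤ 4 / r := by
        calc 8 / r * (ρ / r - 1) ≤ 8 / r * (1 / 2) := by gcongr
          _ = 4 / r := by ring
      have h3 : 8 / r * (ρ / r - 1) * ∑ i, (B i + 1 / r) ≤ 4 / r * (2 * n / r + 2 * n * H) :=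
        (mul_le_mul_of_nonneg_left hBs (by positivity)).trans
          (mul_le_mul_of_nonneg_right h2 (by positivity))
      have h4 : 8 / r ^ 2 * ∑ i, a i ^ 2 ≤ 8 / r ^ 2 * 1 := by gcongr
      linarith

/-- The gradient estimate with a real bound `D`. -/
theorem gradient_estimate (hn : 2 ≤ n) (hg : IsUniformlyEuclidean g S) (hS : IsClosed S)
    (hemb : IsEmbeddedSubmanifold n S) {q : M} {r H D : ℝ} (hr : 0 < r) (hH : 0 ≤ H) (hD0 : 0 ≤ D)
    (hsub : closedBall g S q (2 * r) ⊆ Sᶜ)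
    (hric : ∀ x ∈ closedBall g S q (2 * r), RicciGeAt g (-((n - 1 : ℝ) * H ^ 2)) x)
    (hpos : ∀ x ∈ closedBall g S q (2 * r), 0 < u x)
    (hK : ∀ x ∈ closedBall g S q (2 * r), DifferentiableAt ℝ K (u x))
    (hu : ContMDiffOn (𝓡 n) 𝓘(ℝ, ℝ) 3 u (openBall g S q (2 * r)))
    (hlap : ∀ x ∈ openBall g S q (2 * r), LaplacianEqAt g u (K (u x)) x)
    (hD : ∀ x ∈ closedBall g S q (2 * r),
      (n - 1) * |deriv K (u x) - (n + 1) / (n - 1) * (K (u x) / u x)| ≤ D ^ 2)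
    {x : M} (hx : x ∈ closedBall g S q r) :
    gradNorm g u x / u x ≤ (n - 1) * H + (8 * (n - 2) + √((n - 1) * (56 + 8 * n))) * r⁻¹
      + √(8 * n * (n - 1) * H) * (√r)⁻¹ + D := by
  have hball : ∀ {z}, z ∈ closedBall g S q (3 * r / 2) → z ∈ openBall g S q (2 * r) ∧
      z ∈ closedBall g S q (2 * r) := by
    intro z hz
    refine ⟨?_, closedBall_mono (by linarith) hz⟩
    change dist g S q z < _
    exact lt_of_le_of_lt hz ((ENNReal.ofReal_lt_ofReal_iff (by linarith)).2 (by linarith))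
  have hnhds : ∀ {z}, z ∈ openBall g S q (2 * r) → openBall g S q (2 * r) ∈ 𝓝 z := by
    intro z hz
    have hz' : dist g S q z < ENNReal.ofReal (2 * r) := hz
    have hzS : z ∉ S := hsub (show z ∈ closedBall g S q (2 * r) from hz'.le)
    exact mem_nhds_of_dist_lt hg hS hzS hz
  have huat : ∀ {z}, z ∈ openBall g S q (2 * r) → ContMDiffAt (𝓡 n) 𝓘(ℝ, ℝ) (3 : ℕ) u z :=
    fun hz => hu.contMDiffAt (hnhds hz)
  set Φ : M → ℝ := fun z => radialCutoff r (dist g S q z).toReal ^ 2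
    * (gradNorm g u z / u z) ^ 2 with hΦ
  have hcompact : IsCompact (closedBall g S q (3 * r / 2)) :=
    (isClosed_closedBall hg hS hemb (by positivity)
      ((closedBall_mono (by linarith)).trans hsub)).isCompact
  have hcont : ContinuousOn Φ (closedBall g S q (3 * r / 2)) := by
    intro z hz
    have hz' := hball hz
    have hzS : z ∉ S := hsub hz'.2
    have hfin : dist g S q z ≠ ⊤ := ne_top_of_le_ne_top ENNReal.ofReal_ne_top hz
    have h1 : ContinuousAt (fun z => (dist g S q z).toReal) z :=
      (ENNReal.tendsto_toReal hfin).comp (continuousAt_dist hg hS q hzS hfin)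
    have h2 := continuousAt_gradNorm hg hS hzS ((huat hz'.1).of_le (by norm_num))
    have h3 : ContinuousAt u z := (huat hz'.1).continuousAt
    refine ContinuousAt.continuousWithinAt ?_
    exact (((continuous_radialCutoff r).continuousAt.comp h1).pow 2).mul
      ((h2.div h3 (hpos z hz'.2).ne').pow 2)
  have hx32 : x ∈ closedBall g S q (3 * r / 2) := closedBall_mono (by linarith) hx
  obtain ⟨x₁, hx₁, hmax⟩ := hcompact.exists_isMaxOn ⟨x, hx32⟩ hcont
  have hxr : (dist g S q x).toReal ≤ r := ENNReal.toReal_le_of_le_ofReal hr.le hx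
  have hΦx : Φ x = (gradNorm g u x / u x) ^ 2 := by
    simp only [hΦ, radialCutoff_eq_one hr hxr, one_pow, one_mul]
  have hnn : ∀ {z}, z ∈ closedBall g S q (2 * r) → 0 ≤ gradNorm g u z / u z := fun hz =>
    div_nonneg (Real.sqrt_nonneg _) (hpos _ hz).le
  have hx₁' := hball hx₁
  set ρ := (dist g S q x₁).toReal with hρ_def
  have hfin : dist g S q x₁ ≠ ⊤ := ne_top_of_le_ne_top ENNReal.ofReal_ne_top hx₁
  have hρ : dist g S q x₁ = ENNReal.ofReal ρ := (ENNReal.ofReal_toReal hfin).symm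
  have hρ32 : ρ ≤ 3 * r / 2 := ENNReal.toReal_le_of_le_ofReal (by positivity) hx₁
  have hζ : 0 ≤ radialCutoff r ρ := radialCutoff_nonneg hr hρ32
  set f := (gradNorm g u x₁ / u x₁) ^ 2 with hf
  have hsf : √f = gradNorm g u x₁ / u x₁ := Real.sqrt_sq (hnn hx₁'.2)
  have hle : gradNorm g u x / u x ≤ radialCutoff r ρ * √f := by
    have h1 : Φ x ≤ Φ x₁ := hmax hx32
    rw [hΦx] at h1
    refine le_of_sq_le_sq ?_ (by positivity)
    rw [mul_pow, hsf]
    exact h1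
  refine hle.trans (le_of_sq_le_const hn hr hH hD0 ?_)
  have hn2 : (0 : ℝ) ≤ n - 2 := by
    have : (2 : ℝ) ≤ n := by exact_mod_cast hn
    linarith
  have hn1 : (0 : ℝ) ≤ n - 1 := by linarith
  -- If the maximum is 0 the quadratic inequality is trivial. Otherwise f > 0 and the cutoff is
  -- positive, which puts the maximum point in the open ball of radius 3r/2, where it is a genuine
  -- local maximum.
  by_cases hzero : radialCutoff r ρ * √f = 0
  · rw [hzero]
    simp only [ne_eq, OfNat.ofNat_ne_zero, not_false_eq_true, zero_pow, mul_zero, zero_add]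
    positivity
  · have hf0 : 0 < f := by
      refine lt_of_le_of_ne (sq_nonneg _) fun h => hzero ?_
      rw [← h]; simp
    have hρlt : ρ < 3 * r / 2 := by
      refine lt_of_le_of_ne hρ32 fun h => hzero ?_
      rw [h, radialCutoff_eq hr (by linarith)]
      field_simp
      ring
    refine estimate_at_max hn hg hS hemb hr hH hsub hric hρ hρlt (huat hx₁'.1) (hpos _ hx₁'.2)
      (hK _ hx₁'.2) (Filter.eventually_of_mem (hnhds hx₁'.1) fun z hz => hlap z hz)
      (hD _ hx₁'.2) hf hf0 ?_
    have h1 : dist g S q x₁ < ENNReal.ofReal (3 * r / 2) := by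
      rw [hρ]
      exact (ENNReal.ofReal_lt_ofReal_iff (by positivity)).2 hρlt
    filter_upwards [mem_nhds_of_dist_lt hg hS (hsub hx₁'.2) h1] with z hz
    exact hmax (show z ∈ closedBall g S q (3 * r / 2) from le_of_lt hz)

end Maximum

end SingularMetric

end

theorem mainTheorem4 (n : ℕ) (hn : 2 ≤ n) :
    ∃ (C₁ : ℝ) (C₂ : ℝ → ℝ),
      ∀ (M : Type*) [TopologicalSpace M] [T2Space M] [CompactSpace M]
        [ChartedSpace (EuclideanSpace ℝ (Fin n)) M] [IsManifold (𝓡 n) ∞ M]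
        (S : Set M) (g : SingularMetric.BilinField n M)
        (H r : ℝ) (q : M) (K : ℝ → ℝ) (u : M → ℝ),
        IsClosed S → SingularMetric.IsEmbeddedSubmanifold n S →
        SingularMetric.IsUniformlyEuclidean g S →
        0 ≤ H → 0 < r →
        SingularMetric.closedBall g S q (2 * r) ⊆ Sᶜ →
        (∀ x ∈ SingularMetric.closedBall g S q (2 * r),
          SingularMetric.RicciGeAt g (-((n - 1 : ℝ) * H ^ 2)) x) →
        (∀ x ∈ SingularMetric.closedBall g S q (2 * r), 0 < u x) →
        (∀ x ∈ SingularMetric.closedBall g S q (2 * r), DifferentiableAt ℝ K (u x)) →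
        ContMDiffOn (𝓡 n) 𝓘(ℝ, ℝ) 3 u (SingularMetric.openBall g S q (2 * r)) →
        (∀ x ∈ SingularMetric.openBall g S q (2 * r),
          SingularMetric.LaplacianEqAt g u (K (u x)) x) →
        ∀ x ∈ SingularMetric.closedBall g S q r,
          ((SingularMetric.gradNorm g u x / u x : ℝ) : EReal) ≤
            max
              (⨆ y ∈ SingularMetric.closedBall g S q (2 * r),
                ((Real.sqrt (|K (u y)| / u y) : ℝ) : EReal))
              ((((n - 1 : ℝ) * H + C₁ * r⁻¹ + C₂ H * (Real.sqrt r)⁻¹ : ℝ) : EReal) +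
                ⨆ y ∈ SingularMetric.closedBall g S q (2 * r),
                  ((Real.sqrt ((n - 1 : ℝ) *
                    |deriv K (u y) - (n + 1 : ℝ) / (n - 1 : ℝ) * (K (u y) / u y)|) : ℝ)
                    : EReal)) := by
  refine ⟨8 * (n - 2) + √((n - 1) * (56 + 8 * n)), fun H => √(8 * n * (n - 1) * H), ?_⟩
  intro M _ _ _ _ _ S g H r q K u hS hemb hg hH hr hsub hric hpos hK hu hlap x hx
  -- The second entry of the maximum is always an upper bound.
  refine le_max_of_le_right ?_
  have hn1 : (0 : ℝ) ≤ n - 1 := by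
    have : (2 : ℝ) ≤ n := by exact_mod_cast hn
    linarith
  set s : EReal := ⨆ y ∈ SingularMetric.closedBall g S q (2 * r),
    ((Real.sqrt ((n - 1 : ℝ) *
      |deriv K (u y) - (n + 1 : ℝ) / (n - 1 : ℝ) * (K (u y) / u y)|) : ℝ) : EReal) with hs
  have hle : ∀ y ∈ SingularMetric.closedBall g S q (2 * r), ((Real.sqrt ((n - 1 : ℝ) *
      |deriv K (u y) - (n + 1 : ℝ) / (n - 1 : ℝ) * (K (u y) / u y)|) : ℝ) : EReal) ≤ s :=
    fun y hy => le_iSup₂ (f := fun y (_ : y ∈ SingularMetric.closedBall g S q (2 * r)) =>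
      ((Real.sqrt ((n - 1 : ℝ) *
        |deriv K (u y) - (n + 1 : ℝ) / (n - 1 : ℝ) * (K (u y) / u y)|) : ℝ) : EReal)) y hy
  have hx2 : x ∈ SingularMetric.closedBall g S q (2 * r) :=
    SingularMetric.closedBall_mono (by linarith) hx
  have hs0 : (0 : EReal) ≤ s :=
    le_trans (by exact_mod_cast Real.sqrt_nonneg _) (hle x hx2)
  -- If the supremum is infinite there is nothing to prove; otherwise it is a real number D, at
  -- least the value at x and hence nonnegative, and serves as the uniform bound.
  by_cases htop : s = ⊤
  · rw [htop, EReal.coe_add_top]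
    exact le_top
  have hbot : s ≠ ⊥ := fun h => by
    rw [h] at hs0
    exact absurd hs0 (by simp)
  obtain ⟨D, hD⟩ : ∃ D : ℝ, s = D := ⟨s.toReal, (EReal.coe_toReal htop hbot).symm⟩
  rw [hD] at hle hs0 ⊢
  rw [← EReal.coe_add, EReal.coe_le_coe_iff]
  have hD0 : 0 ≤ D := by exact_mod_cast hs0
  refine SingularMetric.gradient_estimate hn hg hS hemb hr hH hD0 hsub hric hpos hK hu hlap
    (fun y hy => ?_) hx
  have h1 := EReal.coe_le_coe_iff.1 (hle y hy)
  rw [Real.sqrt_le_left hD0] at h1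
  exact h1
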